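/- **Setting.** Let $\mathbb{N}_0^2\ni\mathbf n\mapsto|\mathbf n|\in[0,\infty)$ be additive with $|(1,0)|,|(0,1)|>0$, and let $\alpha>0$. Consider the variables $\mathsf z_k$ ($k\in\mathbb N_0$), $\mathsf z_{\mathbf n}$ ($\mathbf n\in\mathbb N_0^2\setminus\{\mathbf 0\}$), multi-indices $\gamma$ over these labels, monomials $\mathsf z^\gamma$, and the algebra $\mathbb R[[\mathsf z_k,\mathsf z_{\mathbf n}]]$ of formal power series $\pi=\sum_\gamma\pi_\gamma\mathsf z^\gamma$. Put $[\gamma]=\sum_k k\gamma(k)-\sum_{\mathbf n\ne\mathbf 0}\gamma(\mathbf n)$ and $|\gamma|=\alpha([\gamma]+1)+\sum_{\mathbf n\neq\mathbf 0}|\mathbf n|\gamma(\mathbf n)$. Let $\mathsf T^*$ be the space of $\pi$ with $\pi_\gamma=0$ unless $[\gamma]\ge0$ or $\gamma=e_{\mathbf n}$ for some $\mathbf n\neq\mathbf 0$, and let $\mathsf T$ be the direct sum over the same multi-indices, with basis $\mathsf z_\gamma$; then $\mathsf T^*$ is the algebraic dual of $\mathsf T$ through $\mathsf z^\gamma.\mathsf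 z_\beta=\delta^\gamma_\beta$. Let $\mathsf T_\kappa=\mathrm{span}\{\mathsf z_\gamma:|\gamma|=\kappa\}$. For polynomials $a\in\mathbb R[u]$ and $p\in\mathbb R[x_1,x_2]$ with $p(0)=0$, let $\mathsf z_k[a,p]$ and $\mathsf z_{\mathbf n}[a,p]$ be the coefficients of $u^k$ in $a$ and of $x^{\mathbf n}$ in $p$; for a power series $\pi$ let $\pi[a,p]=\sum_\gamma\pi_\gamma\mathsf z^\gamma[a,p]$ wherever this converges absolutely. Let $D^{(\mathbf 0)}=\sum_k(k+1)\mathsf z_{k+1}\partial_{\mathsf z_k}$, $D^{(\mathbf n)}=\partial_{\mathsf z_{\mathbf n}}$ for $\mathbf n\neq\mathbf 0$, and $\partial_i=\sum_{\mathbf n}(n_i+1)\mathsf z_{\mathbf n+\mathbf e_i}D^{(\mathbf n)}$, where $\mathbf e_1=(1,0)$, $\mathbf e_2=(0,1)$. A *parameter* is a pair of a shift $h\in\mathbb R^2$ and a tilt $\{\pi^{(\mathbf n)}\}_{\mathbf n\in\mathbb N_0^2}$ of power series with $\pi^{(\mathbf n)}_\gamma=0$ unless $[\gamma]\ge0$ and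 $|\gamma|>|\mathbf n|$. Its extended tilt is $\hat\pi^{(\mathbf n)}=\pi^{(\mathbf n)}+\sum_{\mathbf m>\mathbf n}\binom{\mathbf m}{\mathbf n}h^{\mathbf m-\mathbf n}\mathsf z_{\mathbf m}\in\mathsf T^*$, where $\mathbf m>\mathbf n$ means $\mathbf m\ge\mathbf n$ componentwise and $\mathbf m\ne\mathbf n$. The corresponding pull-back is the algebra morphism $\mathbb R[\mathsf z_k,\mathsf z_{\mathbf n}]\to\mathbb R[[\mathsf z_k,\mathsf z_{\mathbf n}]]$ with $\mathsf z_k\mapsto\sum_{l\ge0}\binom{k+l}{k}(\hat\pi^{(\mathbf 0)})^l\mathsf z_{k+l}$ and $\mathsf z_{\mathbf n}\mapsto\mathsf z_{\mathbf n}+\hat\pi^{(\mathbf n)}$, that is, the formal version of $(a,p)\mapsto\big(a(\cdot+\hat\pi^{(\mathbf 0)}[a,p]),\,p+\sum_{\mathbf n\neq\mathbf 0}\hat\pi^{(\mathbf n)}[a,p]x^{\mathbf n}\big)$. A *shift* is a parameter with all $\pi^{(\mathbf n)}=0$, a *tilt* is one with $h=0$. **Theorem.** (i) For every parameter, the pull-back,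 restricted to the polynomials in $\mathsf T^*$, extends to a linear automorphism $\Gamma^*$ of $\mathsf T^*$ that is the dual of an automorphism $\Gamma$ of $\mathsf T$; it is the only such extension that is the dual of an endomorphism of $\mathsf T$. For all polynomials $\pi\in\mathsf T^*$ and all $(a,p)$ such that all $\hat\pi^{(\mathbf n)}[a,p]$ converge absolutely and only finitely many are non-zero, $\Gamma^*\pi[a,p]=\pi\big[a(\cdot+\hat\pi^{(\mathbf 0)}[a,p]),p+\sum_{\mathbf n\neq\mathbf 0}\hat\pi^{(\mathbf n)}[a,p]x^{\mathbf n}\big]$; for a shift, $\Gamma^*\pi[a,p]=\pi[a(\cdot+p(h)),p(\cdot+h)-p(h)]$ for all $(a,p)$. If $\pi_1,\dots,\pi_k\in\mathsf T^*$ and $\pi_1\cdots\pi_k\in\mathsf T^*$, then $\Gamma^*(\pi_1\cdots\pi_k)=(\Gamma^*\pi_1)\cdots(\Gamma^*\pi_k)$. The $\Gamma^*$ of shifts and tilts generate a group $\mathsf G^*$, and (parameter) $\mapsto\Gamma^*$ is a bijection from the set of all parameters onto $\mathsf G^*$. If $\Gamma^*,\Gamma'^*\in\mathsf G^*$, then $\Gamma^*\Gamma'^*$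 has the shift $h+h'$ and the extended tilt $\hat\pi^{(\mathbf n)}+\Gamma^*\hat\pi'^{(\mathbf n)}$. On $\mathsf T^*$, with coefficientwise finite sums, $$\Gamma^*=\sum_{k\ge0}\frac1{k!}\sum_{\mathbf n_1,\dots,\mathbf n_k}\hat\pi^{(\mathbf n_1)}\cdots\hat\pi^{(\mathbf n_k)}D^{(\mathbf n_k)}\cdots D^{(\mathbf n_1)}.$$ (ii) The maps $\Gamma$ form a group $\mathsf G\subset\mathrm{End}(\mathsf T)$. Let $\mathsf A=\{\alpha k+|\mathbf n|:k\in\mathbb N_0,\mathbf n\in\mathbb N_0^2\}\setminus\{0\}$, or, if $|\cdot|$ is integer-valued, $\mathsf A=(\alpha\mathbb N_0+\mathbb N_0)\setminus\{0\}$. Then $(\mathsf A,\mathsf T,\mathsf G)$ is a regularity structure in the algebraic sense (no norms on the infinite-dimensional spaces $\mathsf T_\kappa$): $\mathsf A$ is bounded from below and has finite intersection with each $(-\infty,c]$, $\mathsf T=\bigoplus_{\kappa\in\mathsf A}\mathsf T_\kappa$, and $(\Gamma-\mathrm{id})\mathsf T_\kappa\subset\bigoplus_{\kappa'\in\mathsf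 A,\kappa'<\kappa}\mathsf T_{\kappa'}$ for all $\Gamma\in\mathsf G$, $\kappa\in\mathsf A$. (iii) The operators $\partial_1,\partial_2$ and $\mathsf z^\gamma D^{(\mathbf n)}$ with $[\gamma]\ge0$, $|\gamma|>|\mathbf n|$ map $\mathsf T^*$ into itself and are a basis of a Lie subalgebra $\mathsf L\subset\mathrm{End}(\mathsf T^*)$. Let $\tilde{\mathsf L}=\mathrm{span}\{\mathsf z^\gamma D^{(\mathbf n)}\}$, let $\mathrm U(\mathsf L)$ be the universal enveloping algebra, with its Hopf algebra structure (elements of $\mathsf L$ primitive) and its canonical morphism $\rho:\mathrm U(\mathsf L)\to\mathrm{End}(\mathsf T^*)$. There is a unique bilinear $\triangleleft:\mathsf L\times\tilde{\mathsf L}\to\tilde{\mathsf L}$ with $D\triangleleft\mathsf z^\gamma D^{(\mathbf n)}=(D\mathsf z^\gamma)D^{(\mathbf n)}$. It satisfies $[X,Y]=X\triangleleft Y-Y\triangleleft X$ for $X,Y\in\tilde{\mathsf L}$, $[D,D']\triangleleft X=D\triangleleft(D'\triangleleft X)-D'\triangleleft(D\triangleleft X)$ for $D,D'\in\mathsf L$,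 $X\in\tilde{\mathsf L}$ (so it is pre-Lie on $\tilde{\mathsf L}$), and $[\mathsf z^\gamma D^{(\mathbf n)},\partial_i]=n_i\mathsf z^\gamma D^{(\mathbf n-\mathbf e_i)}-\partial_i\triangleleft\mathsf z^\gamma D^{(\mathbf n)}$. There is a unique family of linear maps $\theta_X$ on $\mathrm U(\mathsf L)$, linear in $X\in\tilde{\mathsf L}$, with $\theta_X(1)=X$ and $\theta_X(Du)=D\,\theta_X(u)-\theta_{D\triangleleft X}(u)$ for $D\in\mathsf L$; these maps commute. For multi-indices $J$ over the pairs $(\gamma,\mathbf n)$ with $[\gamma]\ge0$, $|\gamma|>|\mathbf n|$, and $\mathbf m\in\mathbb N_0^2$, the elements $$D_{(J,\mathbf m)}=\frac1{J!\,\mathbf m!}\prod_{(\gamma,\mathbf n)}\theta_{\mathsf z^\gamma D^{(\mathbf n)}}^{J(\gamma,\mathbf n)}\big(\partial_1^{m_1}\partial_2^{m_2}\big)$$ form a basis of $\mathrm U(\mathsf L)$. Let $\mathsf T^+$ be the polynomial algebra in variables indexed by this basis of $\mathsf L$, with monomials $Z^{(J,\mathbf m)}$. The pairing $D_{(J',\mathbf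 m')}.Z^{(J,\mathbf m)}=\delta^{(J,\mathbf m)}_{(J',\mathbf m')}$ between $\mathrm U(\mathsf L)$ and $\mathsf T^+$ is non-degenerate, the product and unit of $\mathsf T^+$ are dual to the coproduct and counit of $\mathrm U(\mathsf L)$, and there are a coproduct $\Delta^+$, a counit $\varepsilon^+$ and an antipode $\mathcal S$ on $\mathsf T^+$, dual to the product, unit and antipode of $\mathrm U(\mathsf L)$, that make $\mathsf T^+$ a Hopf algebra. There is $\Delta:\mathsf T\to\mathsf T^+\otimes\mathsf T$, dual to the module, i.e. $(u\otimes\pi).\Delta\tau=((\rho u)\pi).\tau$, and $(\mathsf T,\Delta)$ is a left comodule over $\mathsf T^+$: $(\mathrm{id}\otimes\Delta)\Delta=(\Delta^+\otimes\mathrm{id})\Delta$, $(\varepsilon^+\otimes\mathrm{id})\Delta=\mathrm{id}$. The algebra morphisms $f:\mathsf T^+\to\mathbb R$ are in bijection with the parameters through $f(Z^{(J,\mathbf m)})=h^{\mathbf m}\prod_{(\gamma,\mathbf n)}(\pi^{(\mathbf n)}_\gamma)^{J(\gamma,\mathbf n)}$, and the element of $\mathsf G$ belonging to the parameter of $f$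 is $\Gamma_f=(f\otimes\mathrm{id})\Delta$. With $fg=(f\otimes g)\Delta^+$ one has $\Gamma_{\varepsilon^+}=\mathrm{id}$, $\Gamma_{fg}=\Gamma_g\Gamma_f$, $\Gamma_{f\mathcal S}=\Gamma_f^{-1}$. On $\mathsf T^*$, with coefficientwise finite sums, $\Gamma_f^*=\sum_{(J,\mathbf m)}f(Z^{(J,\mathbf m)})\,\rho D_{(J,\mathbf m)}$. Finally let $\mathcal J_{\mathbf n}:\mathsf T\to\mathsf T^+$, $\mathcal J_{\mathbf n}\mathsf z_\gamma=\mathbf n!\,Z^{(e_{(\gamma,\mathbf n)},\mathbf 0)}$ if $[\gamma]\ge0$ and $|\gamma|>|\mathbf n|$, and $\mathcal J_{\mathbf n}\mathsf z_\gamma=0$ otherwise. Then for all $\mathbf n$ and $\tau\in\mathsf T$, with a finite sum, $$\Delta^+\mathcal J_{\mathbf n}\tau=(\mathrm{id}\otimes\mathcal J_{\mathbf n})\Delta\tau+\sum_{\mathbf m}\mathcal J_{\mathbf m+\mathbf n}\tau\otimes\frac{Z^{(0,\mathbf m)}}{\mathbf m!},\qquad \Delta^+Z^{(0,\mathbf e_i)}=Z^{(0,\mathbf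 e_i)}\otimes1+1\otimes Z^{(0,\mathbf e_i)}.$$ -/

import Mathlib

open scoped TensorProduct

attribute [local instance 100] LieRing.ofAssociativeRing

namespace ShiftTilt

noncomputable section

/-! ### Multi-indices and formal power series -/

/-- `ℕ₀²`. -/
abbrev N2 : Type := Fin 2 →₀ ℕ

/-- The unit vectors `(1,0)` and `(0,1)` of `ℕ₀²`. -/
abbrev unitVec (i : Fin 2) : N2 := Finsupp.single i 1

/-- The factorial `n! = n₁! n₂!`. -/
def fact2 (n : N2) : ℕ := ∏ i, (n i).factorial

/-- The binomial coefficient `(n choose m) = (n₁ choose m₁) (n₂ choose m₂)`. -/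
def choose2 (n m : N2) : ℕ := ∏ i, (n i).choose (m i)

/-- The power `h^m = h₁^{m₁} h₂^{m₂}`. -/
def pow2 (h : Fin 2 → ℝ) (m : N2) : ℝ := ∏ i, h i ^ m i

/-- Labels of the variables: `Sum.inl k` is the label of `z_k`, `k ≥ 0`, and `Sum.inr n` the label
of `z_n`, `n ≠ 0`. -/
abbrev Var : Type := ℕ ⊕ {n : N2 // n ≠ 0}

/-- Multi-indices `γ`. -/
abbrev MIdx : Type := Var →₀ ℕ

/-- The algebra of formal power series `ℝ[[z_k, z_n]]`. -/
abbrev PS : Type := MvPowerSeries Var ℝ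

/-- The variable `z_n` for `n ≠ 0` (and, by convention, `0` for `n = 0`). -/
def zp (n : N2) : PS := if hn : n ≠ 0 then MvPowerSeries.X (Sum.inr ⟨n, hn⟩) else 0

/-- `[γ] = ∑_k k γ(k) - ∑_{n ≠ 0} γ(n)`. -/
def br (γ : MIdx) : ℤ :=
  γ.sum fun v e => match v with
    | Sum.inl k => (k : ℤ) * (e : ℤ)
    | Sum.inr _ => -(e : ℤ)

/-- The homogeneity `|γ| = α ([γ] + 1) + ∑_{n ≠ 0} |n| γ(n)`, where `w n = |n|`. -/
def homog (α : ℝ) (w : N2 →+ ℝ) (γ : MIdx) : ℝ :=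
  α * ((br γ : ℝ) + 1) + γ.sum fun v e => match v with
    | Sum.inl _ => 0
    | Sum.inr n => w n.1 * (e : ℝ)

/-- The multi-indices with `[γ] ≥ 0` or `γ = e_n` for some `n ≠ 0`. -/
def IsModelIdx (γ : MIdx) : Prop :=
  0 ≤ br γ ∨ ∃ n : {n : N2 // n ≠ 0}, γ = Finsupp.single (Sum.inr n) 1

/-- The space `T^* ⊂ ℝ[[z_k, z_n]]`. -/
def Tstar : Submodule ℝ PS where
  carrier := {F | ∀ γ, MvPowerSeries.coeff γ F ≠ 0 → IsModelIdx γ}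
  zero_mem' := by
    intro γ h
    simp at h
  add_mem' := by
    intro F G hF hG γ h
    by_cases h1 : MvPowerSeries.coeff γ F = 0
    · by_cases h2 : MvPowerSeries.coeff γ G = 0
      · simp [h1, h2] at h
      · exact hG γ h2
    · exact hF γ h1
  smul_mem' := by
    intro c F hF γ h
    refine hF γ fun h0 => h ?_
    simp [h0]

/-- The model space `T`, the direct sum over the multi-indices of `T^*`. -/
abbrev T : Type := {γ : MIdx // IsModelIdx γ} →₀ ℝ

/-- The basis vector `z_γ` of `T`. -/
abbrev zT (γ : {γ : MIdx // IsModelIdx γ}) : T := Finsupp.single γ 1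

/-- The canonical pairing between `T^*` and `T`, for which `z^γ . z_β = δ^γ_β`. -/
def toDual : Tstar →ₗ[ℝ] Module.Dual ℝ T where
  toFun F := Finsupp.lsum ℝ fun γ => MvPowerSeries.coeff γ.1 F.1 • (LinearMap.id : ℝ →ₗ[ℝ] ℝ)
  map_add' F G := by ext; simp
  map_smul' c F := by ext; simp

/-- `Ψs ∈ End(T^*)` is the dual of `Ψ ∈ End(T)`. -/
def IsDual (Ψs : Tstar →ₗ[ℝ] Tstar) (Ψ : T →ₗ[ℝ] T) : Prop :=
  ∀ (F : Tstar) (τ : T), toDual (Ψs F) τ = toDual F (Ψ τ)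

/-- `T_κ ⊂ T`, spanned by the `z_γ` with `|γ| = κ`. -/
def Tgraded (α : ℝ) (w : N2 →+ ℝ) (κ : ℝ) : Submodule ℝ T :=
  Finsupp.supported ℝ ℝ {γ | homog α w γ.1 = κ}

/-- A regularity structure in the algebraic sense: an index set that is bounded from below and
locally finite, a graded model space, and a group acting triangularly. -/
structure IsRegularityStructure (A : Set ℝ) {V : Type} [AddCommGroup V] [Module ℝ V]
    (Vgr : ℝ → Submodule ℝ V) (G : Subgroup (V ≃ₗ[ℝ] V)) : Prop where
  bddBelow : BddBelow A
  locallyFinite : ∀ c : ℝ, (A ∩ Set.Iic c).Finite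
  graded : DirectSum.IsInternal fun κ : A => Vgr κ
  triangular : ∀ Γ ∈ G, ∀ κ ∈ A, ∀ τ ∈ Vgr κ, Γ τ - τ ∈ ⨆ κ' ∈ A ∩ Set.Iio κ, Vgr κ'

/-! ### Formal sums -/

/-- The coefficientwise sum of a family of power series. -/
def formalSum {ι : Type} (F : ι → PS) : PS := fun γ => ∑ᶠ i, MvPowerSeries.coeff γ (F i)

/-- `S` is the coefficientwise sum of the family `F`, every coefficient being a finite sum. -/
def IsFormalSum {ι : Type} (F : ι → PS) (S : PS) : Prop :=
  ∀ γ : MIdx, {i | MvPowerSeries.coeff γ (F i) ≠ 0}.Finite ∧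
    MvPowerSeries.coeff γ S = ∑ᶠ i, MvPowerSeries.coeff γ (F i)

theorem coeff_formalSum {ι : Type} (F : ι → PS) (γ : MIdx) :
    MvPowerSeries.coeff γ (formalSum F) = ∑ᶠ i, MvPowerSeries.coeff γ (F i) := rfl

theorem formalSum_add {ι : Type} (F G : ι → PS)
    (hF : ∀ γ, {i | MvPowerSeries.coeff γ (F i) ≠ 0}.Finite)
    (hG : ∀ γ, {i | MvPowerSeries.coeff γ (G i) ≠ 0}.Finite) :
    formalSum (fun i => F i + G i) = formalSum F + formalSum G := by
  ext γ
  simp only [coeff_formalSum, map_add]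
  exact finsum_add_distrib (hF γ) (hG γ)

theorem formalSum_smul {ι : Type} (c : ℝ) (F : ι → PS) :
    formalSum (fun i => c • F i) = c • formalSum F := by
  ext γ
  simp only [coeff_formalSum, MvPowerSeries.coeff_smul]
  simpa only [smul_eq_mul] using (smul_finsum c fun i => MvPowerSeries.coeff γ (F i)).symm

theorem exists_of_finsum_ne_zero {ι : Type} {f : ι → ℝ} (h : ∑ᶠ i, f i ≠ 0) : ∃ i, f i ≠ 0 := by
  by_contra hf
  push Not at hf
  exact h (by simp [hf])

theorem exists_of_coeff_X_mul {v : Var} {F : PS} {β : MIdx}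
    (h : MvPowerSeries.coeff β (MvPowerSeries.X v * F) ≠ 0) :
    ∃ δ, β = δ + Finsupp.single v 1 ∧ MvPowerSeries.coeff δ F ≠ 0 := by
  classical
  rw [MvPowerSeries.X, MvPowerSeries.coeff_monomial_mul] at h
  split_ifs at h with hle
  · exact ⟨β - Finsupp.single v 1, (tsub_add_cancel_of_le hle).symm, by simpa using h⟩
  · exact absurd rfl h

theorem exists_of_coeff_zp_mul {n : N2} {F : PS} {β : MIdx}
    (h : MvPowerSeries.coeff β (zp n * F) ≠ 0) :
    ∃ (hn : n ≠ 0) (δ : MIdx), β = δ + Finsupp.single (Sum.inr ⟨n, hn⟩) 1 ∧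
      MvPowerSeries.coeff δ F ≠ 0 := by
  unfold zp at h
  split_ifs at h with hn
  · obtain ⟨δ, h1, h2⟩ := exists_of_coeff_X_mul h
    exact ⟨hn, δ, h1, h2⟩
  · simp at h

/-! ### The infinitesimal generators -/

theorem finite_D0 (F : PS) (γ : MIdx) : {k : ℕ | MvPowerSeries.coeff γ
    (((k : ℝ) + 1) • (MvPowerSeries.X (Sum.inl (k + 1)) *
      MvPowerSeries.pderiv ℝ (Sum.inl k) F)) ≠ 0}.Finite := by
  have hinj : Function.Injective fun k : ℕ => (Sum.inl (k + 1) : Var) := by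
    intro a b h
    simpa using h
  refine ((γ.support.finite_toSet).preimage hinj.injOn).subset ?_
  intro k hk
  have hk' : MvPowerSeries.coeff γ (MvPowerSeries.X (Sum.inl (k + 1)) *
      MvPowerSeries.pderiv ℝ (Sum.inl k) F) ≠ 0 := by
    intro h0
    apply hk
    rw [MvPowerSeries.coeff_smul, h0, mul_zero]
  obtain ⟨δ, rfl, -⟩ := exists_of_coeff_X_mul hk'
  simp

/-- `D^{(0)} = ∑_k (k+1) z_{k+1} ∂_{z_k}`. -/
def D0 : PS →ₗ[ℝ] PS where
  toFun F := formalSum fun k : ℕ =>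
    ((k : ℝ) + 1) • (MvPowerSeries.X (Sum.inl (k + 1)) * MvPowerSeries.pderiv ℝ (Sum.inl k) F)
  map_add' F G := by
    rw [← formalSum_add _ _ (finite_D0 F) (finite_D0 G)]
    simp [mul_add]
  map_smul' c F := by
    rw [RingHom.id_apply, ← formalSum_smul]
    congr 1
    funext k
    rw [Derivation.map_smul, mul_smul_comm, smul_comm]

/-- `D^{(n)}`, equal to `∂_{z_n}` for `n ≠ 0`. -/
def Dtilt (n : N2) : PS →ₗ[ℝ] PS :=
  if hn : n ≠ 0 then (MvPowerSeries.pderiv ℝ (Sum.inr ⟨n, hn⟩)).toLinearMap else D0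

theorem finite_shift (i : Fin 2) (F : PS) (γ : MIdx) : {n : N2 | MvPowerSeries.coeff γ
    (((n i : ℝ) + 1) • (zp (n + unitVec i) * Dtilt n F)) ≠ 0}.Finite := by
  classical
  let e : Var → N2 := fun v => match v with
    | Sum.inl _ => 0
    | Sum.inr m => m.1 - unitVec i
  refine (γ.support.image e).finite_toSet.subset ?_
  intro n hn
  have hn' : MvPowerSeries.coeff γ (zp (n + unitVec i) * Dtilt n F) ≠ 0 := by
    intro h0
    apply hn
    rw [MvPowerSeries.coeff_smul, h0, mul_zero]
  obtain ⟨h, δ, rfl, -⟩ := exists_of_coeff_zp_mul hn'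
  simp only [Finset.coe_image, Set.mem_image]
  exact ⟨Sum.inr ⟨n + unitVec i, h⟩, by simp, by simp [e]⟩

/-- `∂_i = ∑_n (n_i + 1) z_{n + e_i} D^{(n)}`. -/
def Dshift (i : Fin 2) : PS →ₗ[ℝ] PS where
  toFun F := formalSum fun n : N2 => ((n i : ℝ) + 1) • (zp (n + unitVec i) * Dtilt n F)
  map_add' F G := by
    rw [← formalSum_add _ _ (finite_shift i F) (finite_shift i G)]
    simp [mul_add]
  map_smul' c F := by
    rw [RingHom.id_apply, ← formalSum_smul]
    congr 1
    funext n
    rw [map_smul, mul_smul_comm, smul_comm]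

/-- The monomial `z^γ`. -/
abbrev zmon (γ : MIdx) : PS := MvPowerSeries.monomial γ 1

theorem br_add (γ δ : MIdx) : br (γ + δ) = br γ + br δ := by
  unfold br
  refine Finsupp.sum_add_index' ?_ ?_
  · rintro (k | n) <;> simp
  · rintro (k | n) a b <;> simp <;> ring

theorem br_single_inl (k : ℕ) : br (Finsupp.single (Sum.inl k) 1) = k := by
  unfold br
  rw [Finsupp.sum_single_index] <;> simp

theorem br_single_inr (n : {n : N2 // n ≠ 0}) : br (Finsupp.single (Sum.inr n) 1) = -1 := by
  unfold br
  rw [Finsupp.sum_single_index] <;> simp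

theorem exists_of_coeff_Dtilt {n : N2} {F : PS} {β : MIdx}
    (h : MvPowerSeries.coeff β (Dtilt n F) ≠ 0) :
    (∃ hn : n ≠ 0, MvPowerSeries.coeff (β + Finsupp.single (Sum.inr ⟨n, hn⟩) 1) F ≠ 0) ∨
    ∃ (k : ℕ) (δ : MIdx), β = δ + Finsupp.single (Sum.inl (k + 1)) 1 ∧
      MvPowerSeries.coeff (δ + Finsupp.single (Sum.inl k) 1) F ≠ 0 := by
  unfold Dtilt at h
  split_ifs at h with hn
  · left
    refine ⟨hn, fun h0 => h ?_⟩
    simp [MvPowerSeries.coeff_pderiv, h0]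
  · right
    have h' : ∑ᶠ k : ℕ, MvPowerSeries.coeff β (((k : ℝ) + 1) •
        (MvPowerSeries.X (Sum.inl (k + 1)) * MvPowerSeries.pderiv ℝ (Sum.inl k) F)) ≠ 0 := h
    obtain ⟨k, hk⟩ := exists_of_finsum_ne_zero h'
    have hk' : MvPowerSeries.coeff β (MvPowerSeries.X (Sum.inl (k + 1)) *
        MvPowerSeries.pderiv ℝ (Sum.inl k) F) ≠ 0 := by
      intro h0
      apply hk
      rw [MvPowerSeries.coeff_smul, h0, mul_zero]
    obtain ⟨δ, hδ, hd⟩ := exists_of_coeff_X_mul hk'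
    refine ⟨k, δ, hδ, fun h0 => hd ?_⟩
    simp [MvPowerSeries.coeff_pderiv, h0]

theorem br_nonneg_of_coeff_Dtilt {n : N2} {F : PS} (hF : F ∈ Tstar) {β : MIdx}
    (h : MvPowerSeries.coeff β (Dtilt n F) ≠ 0) : 0 ≤ br β := by
  have key : ∀ γ, MvPowerSeries.coeff γ F ≠ 0 → -1 ≤ br γ := by
    intro γ hγ
    rcases hF γ hγ with h1 | ⟨m, rfl⟩
    · omega
    · rw [br_single_inr]
  rcases exists_of_coeff_Dtilt h with ⟨hn, h1⟩ | ⟨k, δ, rfl, h1⟩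
  · have := key _ h1
    rw [br_add, br_single_inr] at this
    omega
  · have := key _ h1
    rw [br_add, br_single_inl] at this
    rw [br_add, br_single_inl]
    push_cast
    omega

theorem mul_Dtilt_mem {γ : MIdx} (hγ : 0 ≤ br γ) (n : N2) :
    ∀ F ∈ Tstar, (LinearMap.mulLeft ℝ (zmon γ) ∘ₗ Dtilt n) F ∈ Tstar := by
  classical
  intro F hF β hβ
  left
  simp only [LinearMap.comp_apply, LinearMap.mulLeft_apply, zmon,
    MvPowerSeries.coeff_monomial_mul, one_mul] at hβ
  split_ifs at hβ with hle
  · have h1 := br_nonneg_of_coeff_Dtilt hF hβ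
    have h2 := br_add γ (β - γ)
    rw [add_tsub_cancel_of_le hle] at h2
    omega
  · exact absurd rfl hβ

theorem Dshift_mem (i : Fin 2) : ∀ F ∈ Tstar, Dshift i F ∈ Tstar := by
  intro F hF β hβ
  have h' : ∑ᶠ n : N2, MvPowerSeries.coeff β (((n i : ℝ) + 1) •
      (zp (n + unitVec i) * Dtilt n F)) ≠ 0 := hβ
  obtain ⟨n, hn⟩ := exists_of_finsum_ne_zero h'
  have hn' : MvPowerSeries.coeff β (zp (n + unitVec i) * Dtilt n F) ≠ 0 := by
    intro h0
    apply hn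
    rw [MvPowerSeries.coeff_smul, h0, mul_zero]
  obtain ⟨h, δ, rfl, hδ⟩ := exists_of_coeff_zp_mul hn'
  rcases exists_of_coeff_Dtilt hδ with ⟨hn0, h1⟩ | ⟨k, ε, rfl, h1⟩
  · rcases hF _ h1 with h2 | ⟨m, hm⟩
    · left
      rw [br_add, br_single_inr] at h2 ⊢
      exact h2
    · right
      have hdeg := congrArg Finsupp.degree hm
      simp only [map_add, Finsupp.degree_single] at hdeg
      have hδ0 : δ = 0 := (Finsupp.degree_eq_zero_iff δ).1 (by omega)
      exact ⟨⟨n + unitVec i, h⟩, by rw [hδ0, zero_add]⟩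
  · left
    rcases hF _ h1 with h2 | ⟨m, hm⟩
    · rw [br_add, br_single_inl] at h2
      rw [br_add, br_add, br_single_inl, br_single_inr]
      push_cast
      omega
    · have := DFunLike.congr_fun hm (Sum.inl k)
      simp at this

/-- The index set of variable tilts: pairs `(γ, n)` with `[γ] ≥ 0` and `|γ| > |n|`. -/
abbrev TiltIdx (α : ℝ) (w : N2 →+ ℝ) : Type :=
  {q : MIdx × N2 // 0 ≤ br q.1 ∧ w q.2 < homog α w q.1}

/-- The index set of the Lie algebra `L`. -/
abbrev LIdx (α : ℝ) (w : N2 →+ ℝ) : Type := TiltIdx α w ⊕ Fin 2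

/-- The generators `z^γ D^{(n)}` and `∂_i` as endomorphisms of `T^*`. -/
def gen (α : ℝ) (w : N2 →+ ℝ) : LIdx α w → Module.End ℝ Tstar
  | Sum.inl q => (LinearMap.mulLeft ℝ (zmon q.1.1) ∘ₗ Dtilt q.1.2).restrict
      (mul_Dtilt_mem q.2.1 q.1.2)
  | Sum.inr i => (Dshift i).restrict (Dshift_mem i)

/-- The Lie algebra `L ⊂ End(T^*)` generated by the infinitesimal generators. -/
def L (α : ℝ) (w : N2 →+ ℝ) : LieSubalgebra ℝ (Module.End ℝ Tstar) :=
  LieSubalgebra.lieSpan ℝ (Module.End ℝ Tstar) (Set.range (gen α w))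

/-- The generators as elements of `L`. -/
def genL (α : ℝ) (w : N2 →+ ℝ) (q : LIdx α w) : L α w :=
  ⟨gen α w q, LieSubalgebra.subset_lieSpan ⟨q, rfl⟩⟩

/-- `L̃ ⊂ L`, the span of the `z^γ D^{(n)}`. -/
def Ltilde (α : ℝ) (w : N2 →+ ℝ) : Submodule ℝ (L α w) :=
  Submodule.span ℝ (Set.range fun q : TiltIdx α w => genL α w (Sum.inl q))

/-- The generators `z^γ D^{(n)}` as elements of `L̃`. -/
def genLt (α : ℝ) (w : N2 →+ ℝ) (q : TiltIdx α w) : Ltilde α w :=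
  ⟨genL α w (Sum.inl q), Submodule.subset_span ⟨q, rfl⟩⟩

/-- The monomial `z^γ` as an element of `T^*`, for `[γ] ≥ 0`. -/
def zmonT (γ : MIdx) (hγ : 0 ≤ br γ) : Tstar :=
  ⟨zmon γ, by
    classical
    intro β hβ
    left
    rw [MvPowerSeries.coeff_monomial] at hβ
    split_ifs at hβ with h
    · exact h ▸ hγ
    · exact absurd rfl hβ⟩

/-- The universal enveloping algebra `U(L)`. -/
abbrev U (α : ℝ) (w : N2 →+ ℝ) : Type := UniversalEnvelopingAlgebra ℝ (L α w)

/-- The inclusion of `L` into `U(L)`. -/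
def inU (α : ℝ) (w : N2 →+ ℝ) (D : L α w) : U α w := UniversalEnvelopingAlgebra.ι ℝ D

/-- The canonical projection `ρ : U(L) → End(T^*)`. -/
def rho (α : ℝ) (w : N2 →+ ℝ) : U α w →ₐ[ℝ] Module.End ℝ Tstar :=
  UniversalEnvelopingAlgebra.lift ℝ (L α w).incl

/-! ### The Hopf algebra `U(L)` -/

section Envelope

variable {K : Type} [LieRing K] [LieAlgebra ℝ K]

/-- The coproduct of the universal enveloping algebra, `D ↦ D ⊗ 1 + 1 ⊗ D` for `D ∈ L`. -/
def cop : UniversalEnvelopingAlgebra ℝ K →ₐ[ℝ]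
    UniversalEnvelopingAlgebra ℝ K ⊗[ℝ] UniversalEnvelopingAlgebra ℝ K :=
  UniversalEnvelopingAlgebra.lift ℝ
    { toFun := fun D => UniversalEnvelopingAlgebra.ι ℝ D ⊗ₜ[ℝ] 1 +
        1 ⊗ₜ[ℝ] UniversalEnvelopingAlgebra.ι ℝ D
      map_add' := by
        intro x y
        simp only [map_add, TensorProduct.add_tmul, TensorProduct.tmul_add]
        abel
      map_smul' := by
        intro c x
        simp only [map_smul, TensorProduct.smul_tmul', TensorProduct.tmul_smul, smul_add,
          RingHom.id_apply]
      map_lie' := by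
        intro x y
        simp only [LieHom.map_lie, LieRing.of_associative_ring_bracket, mul_add, add_mul,
          Algebra.TensorProduct.tmul_mul_tmul, one_mul, mul_one, TensorProduct.sub_tmul,
          TensorProduct.tmul_sub]
        abel }

/-- The counit of the universal enveloping algebra. -/
def counitU : UniversalEnvelopingAlgebra ℝ K →ₐ[ℝ] ℝ :=
  UniversalEnvelopingAlgebra.lift ℝ 0

/-- The antipode of the universal enveloping algebra: the anti-homomorphism with `D ↦ -D` for
`D ∈ L`. -/
def antipodeU : UniversalEnvelopingAlgebra ℝ K →ₗ[ℝ] UniversalEnvelopingAlgebra ℝ K :=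
  (MulOpposite.opLinearEquiv ℝ).symm.toLinearMap ∘ₗ
  (UniversalEnvelopingAlgebra.lift ℝ
    { toFun := fun D => MulOpposite.op (-UniversalEnvelopingAlgebra.ι ℝ D)
      map_add' := by
        intro x y
        simp only [map_add, neg_add, MulOpposite.op_add]
      map_smul' := by
        intro c x
        simp only [map_smul, ← smul_neg, MulOpposite.op_smul, RingHom.id_apply]
      map_lie' := by
        intro x y
        simp only [LieHom.map_lie, LieRing.of_associative_ring_bracket, ← MulOpposite.op_mul,
          ← MulOpposite.op_sub, neg_mul_neg, neg_sub] } :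
    UniversalEnvelopingAlgebra ℝ K →ₐ[ℝ] (UniversalEnvelopingAlgebra ℝ K)ᵐᵒᵖ).toLinearMap

end Envelope

/-- The Hopf algebra axioms for an algebra `H` with coproduct `Δ`, counit `ε` and antipode `S`; the
compatibility of product and coproduct is the multiplicativity of `Δ` and `ε`. -/
structure IsHopf {H : Type} [Ring H] [Algebra ℝ H] (Δ : H →ₐ[ℝ] H ⊗[ℝ] H) (ε : H →ₐ[ℝ] ℝ)
    (S : H →ₗ[ℝ] H) : Prop where
  coassoc : (TensorProduct.assoc ℝ H H H).toLinearMap ∘ₗ Δ.toLinearMap.rTensor H ∘ₗ Δ.toLinearMap =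
    Δ.toLinearMap.lTensor H ∘ₗ Δ.toLinearMap
  counit_left : ∀ x, TensorProduct.lid ℝ H (ε.toLinearMap.rTensor H (Δ x)) = x
  counit_right : ∀ x, TensorProduct.rid ℝ H (ε.toLinearMap.lTensor H (Δ x)) = x
  antipode_left : ∀ x, LinearMap.mul' ℝ H (S.rTensor H (Δ x)) = algebraMap ℝ H (ε x)
  antipode_right : ∀ x, LinearMap.mul' ℝ H (S.lTensor H (Δ x)) = algebraMap ℝ H (ε x)

/-- `(V, Δ)` is a left comodule over the coalgebra `(H, Δ⁺, ε)`. -/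
structure IsLeftComodule {H V : Type} [Ring H] [Algebra ℝ H] [AddCommGroup V] [Module ℝ V]
    (Δp : H →ₐ[ℝ] H ⊗[ℝ] H) (ε : H →ₐ[ℝ] ℝ) (Δ : V →ₗ[ℝ] H ⊗[ℝ] V) : Prop where
  coassoc : Δ.lTensor H ∘ₗ Δ =
    (TensorProduct.assoc ℝ H H V).toLinearMap ∘ₗ Δp.toLinearMap.rTensor V ∘ₗ Δ
  counit : ∀ τ, TensorProduct.lid ℝ V (ε.toLinearMap.rTensor V (Δ τ)) = τ

/-- The linear form `f ⊗ g` on a tensor product. -/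
def formTensor {V W : Type} [AddCommGroup V] [Module ℝ V] [AddCommGroup W] [Module ℝ W]
    (f : V →ₗ[ℝ] ℝ) (g : W →ₗ[ℝ] ℝ) : V ⊗[ℝ] W →ₗ[ℝ] ℝ :=
  LinearMap.mul' ℝ ℝ ∘ₗ TensorProduct.map f g

/-! ### The basis of `U(L)` and the space `T⁺` -/

/-- The space `T⁺`, the polynomial algebra in variables indexed by the index set of `L`. -/
abbrev Tplus (α : ℝ) (w : N2 →+ ℝ) : Type := MvPolynomial (LIdx α w) ℝ

/-- The basis element `Z^{(J,m)}` of `T⁺`. -/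
def Zb {α : ℝ} {w : N2 →+ ℝ} (J : TiltIdx α w →₀ ℕ) (m : N2) : Tplus α w :=
  MvPolynomial.monomial (Finsupp.sumElim J m) 1

/-- The partial pre-Lie product `L × L̃ → L̃`, determined by
`D ◁ z^γ D^{(n)} = (D z^γ) D^{(n)}`. -/
def IsPreLieProduct {α : ℝ} {w : N2 →+ ℝ}
    (tri : L α w →ₗ[ℝ] Ltilde α w →ₗ[ℝ] Ltilde α w) : Prop :=
  ∀ (D : L α w) (q : TiltIdx α w) (F : Tstar),
    (((tri D (genLt α w q) : L α w) : Module.End ℝ Tstar) F : PS) =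
      ((D : Module.End ℝ Tstar) (zmonT q.1.1 q.2.1) : PS) * Dtilt q.1.2 F

/-- The maps `U ↦ z^γ U D^{(n)}` of `U(L)`, written as a map that is linear in
`z^γ D^{(n)} ∈ L̃`: they send `1` to `z^γ D^{(n)}` and satisfy
`z^γ D U D^{(n)} = D z^γ U D^{(n)} - (D z^γ) U D^{(n)}` for `D ∈ L`. -/
structure IsGraft {α : ℝ} {w : N2 →+ ℝ} (tri : L α w →ₗ[ℝ] Ltilde α w →ₗ[ℝ] Ltilde α w)
    (graft : Ltilde α w →ₗ[ℝ] U α w →ₗ[ℝ] U α w) : Prop where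
  one : ∀ X, graft X 1 = inU α w X
  mul : ∀ X D u, graft X (inU α w D * u) = inU α w D * graft X u - graft (tri D X) u

/-- `Dbas J m = (J! m!)⁻¹ ∏ (z^γ)^{J(γ,n)} ∂₁^{m₁} ∂₂^{m₂} ∏ (D^{(n)})^{J(γ,n)}`, the maps
`U ↦ z^γ U D^{(n)}` being applied to `∂₁^{m₁} ∂₂^{m₂}` in any order `ℓ`. -/
def IsBasisFamily {α : ℝ} {w : N2 →+ ℝ} (graft : Ltilde α w →ₗ[ℝ] U α w →ₗ[ℝ] U α w)
    (Dbas : (TiltIdx α w →₀ ℕ) → N2 → U α w) : Prop :=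
  ∀ (ℓ : List (TiltIdx α w)) (J : TiltIdx α w →₀ ℕ) (m : N2),
    J = (ℓ.map fun q => Finsupp.single q 1).sum →
    Dbas J m = (((J.prod fun _ e => e.factorial) * fact2 m : ℕ) : ℝ)⁻¹ •
      ℓ.foldr (fun q u => graft (genLt α w q) u)
        (inU α w (genL α w (Sum.inr 0)) ^ m 0 * inU α w (genL α w (Sum.inr 1)) ^ m 1)

open Classical in
/-- The re-centering maps `𝒥_n : T → T⁺`: `z_γ ↦ n! Z^{(e_{(γ,n)}, 0)}` if `[γ] ≥ 0` and
`|γ| > |n|`, and `z_γ ↦ 0` otherwise. -/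
def Jmap (α : ℝ) (w : N2 →+ ℝ) (n : N2) : T →ₗ[ℝ] Tplus α w :=
  Finsupp.lsum ℝ fun γ => LinearMap.toSpanSingleton ℝ (Tplus α w)
    (if h : 0 ≤ br γ.1 ∧ w n < homog α w γ.1 then
      (fact2 n : ℝ) • Zb (Finsupp.single ⟨(γ.1, n), h⟩ 1) 0 else 0)

/-- The endomorphism `Γ_f = (f ⊗ id) Δ` of `T`. -/
def GammaOf {α : ℝ} {w : N2 →+ ℝ} (Δ : T →ₗ[ℝ] Tplus α w ⊗[ℝ] T) (f : Tplus α w →ₐ[ℝ] ℝ) :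
    T →ₗ[ℝ] T :=
  (TensorProduct.lid ℝ T).toLinearMap ∘ₗ f.toLinearMap.rTensor T ∘ₗ Δ

/-- The convolution product `f g = (f ⊗ g) Δ⁺` of multiplicative functionals on `T⁺`. -/
def conv {α : ℝ} {w : N2 →+ ℝ} (Δp : Tplus α w →ₐ[ℝ] Tplus α w ⊗[ℝ] Tplus α w)
    (f g : Tplus α w →ₐ[ℝ] ℝ) : Tplus α w →ₐ[ℝ] ℝ :=
  (Algebra.TensorProduct.lift f g fun _ _ => Commute.all _ _).comp Δp

/-! ### Shift and tilt parameters and their action -/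

/-- A shift `h ∈ ℝ²` together with an admissible tilt `{π^{(n)}}_n`. -/
structure Param (α : ℝ) (w : N2 →+ ℝ) where
  h : Fin 2 → ℝ
  tilt : N2 → PS
  adm : ∀ n γ, MvPowerSeries.coeff γ (tilt n) ≠ 0 → 0 ≤ br γ ∧ w n < homog α w γ

open Classical in
/-- The extended tilt: `π^{(n)} + ∑_{m > n} (m choose n) h^{m - n} z_m`. -/
def Param.etilt {α : ℝ} {w : N2 →+ ℝ} (g : Param α w) (n : N2) : PS :=
  g.tilt n + formalSum fun m : N2 =>
    if n < m then ((choose2 m n : ℝ) * pow2 g.h (m - n)) • zp m else 0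

/-- The map `(a, p) ↦ (a(· + π^{(0)}[a,p]), p + ∑_{n ≠ 0} π^{(n)}[a,p] x^n)`, with the extended tilt,
pulled back to polynomials in the coordinates of `(a, p)`: the algebra morphism
`ℝ[z_k, z_n] → ℝ[[z_k, z_n]]` sending `z_k` to the Taylor coefficient
`∑_l (k+l choose k) (π^{(0)})^l z_{k+l}` and `z_n` to `z_n + π^{(n)}`. -/
def Param.pullback {α : ℝ} {w : N2 →+ ℝ} (g : Param α w) : MvPolynomial Var ℝ →ₐ[ℝ] PS :=
  MvPolynomial.aeval fun v => match v with
    | Sum.inl k => formalSum fun l : ℕ =>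
        ((k + l).choose k : ℝ) • (g.etilt 0 ^ l * MvPowerSeries.X (Sum.inl (k + l)))
    | Sum.inr n => MvPowerSeries.X (Sum.inr n) + g.etilt n.1

/-- `Ψs ∈ End(T^*)` extends the pull-back from the polynomials in `T^*`. -/
def Extends {α : ℝ} {w : N2 →+ ℝ} (g : Param α w) (Ψs : Tstar →ₗ[ℝ] Tstar) : Prop :=
  ∀ (P : MvPolynomial Var ℝ) (hP : (P : PS) ∈ Tstar), (Ψs ⟨P, hP⟩ : PS) = g.pullback P

/-- The summand of the exponential formula that belongs to `n_1, …, n_k`: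
`(1/k!) π^{(n_1)} ⋯ π^{(n_k)} D^{(n_k)} ⋯ D^{(n_1)} F`. -/
def Param.expTerm {α : ℝ} {w : N2 →+ ℝ} (g : Param α w) (F : PS) (q : Σ k : ℕ, Fin k → N2) : PS :=
  ((q.1.factorial : ℝ)⁻¹) •
    ((∏ i, g.etilt (q.2 i)) * (List.ofFn q.2).foldl (fun G n => Dtilt n G) F)

/-- The multiplicative functional on `T⁺` with `f(Z^{(J,m)}) = h^m ∏ (π_γ^{(n)})^{J(γ,n)}`. -/
def Param.char {α : ℝ} {w : N2 →+ ℝ} (g : Param α w) : Tplus α w →ₐ[ℝ] ℝ :=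
  MvPolynomial.aeval fun v => match v with
    | Sum.inl q => MvPowerSeries.coeff q.1.1 (g.tilt q.1.2)
    | Sum.inr i => g.h i

/-! ### Functions on `(a,p)`-space -/

/-- The coordinates `z_k[a,p]`, `z_n[a,p]` of `(a, p)`, i.e. the Taylor coefficients at `0`. -/
def coords (a : Polynomial ℝ) (p : MvPolynomial (Fin 2) ℝ) : Var → ℝ
  | Sum.inl k => a.coeff k
  | Sum.inr n => p.coeff n.1

/-- The formal power series `F`, evaluated at `(a, p)`, converges (absolutely) to `v`. -/
def HasValue (F : PS) (a : Polynomial ℝ) (p : MvPolynomial (Fin 2) ℝ) (v : ℝ) : Prop :=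
  HasSum (fun γ : MIdx => MvPowerSeries.coeff γ F * γ.prod fun i e => coords a p i ^ e) v

/-- `a(· + c)`. -/
def translate (a : Polynomial ℝ) (c : ℝ) : Polynomial ℝ := a.comp (Polynomial.X + Polynomial.C c)

/-- `p(· + h)`. -/
def translate2 (p : MvPolynomial (Fin 2) ℝ) (h : Fin 2 → ℝ) : MvPolynomial (Fin 2) ℝ :=
  MvPolynomial.aeval (fun i => MvPolynomial.X i + MvPolynomial.C (h i)) p

/-- `∑_{n ≠ 0} v_n x^n`. -/
def tiltPoly (v : N2 →₀ ℝ) : MvPolynomial (Fin 2) ℝ :=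
  ∑ n ∈ v.support.erase 0, MvPolynomial.monomial n (v n)

end

end ShiftTilt

open ShiftTilt

/-! Every element of $\mathsf L$ is a formal vector field $\sum_n s_n D^{(n)}$, determined by its
coefficient family $s$ (its symbol). A derivation whose rows are finite is determined by its values
on the variables, so brackets are computed on symbols (`vf_bracket`). The span of the generators is
closed under brackets because the bracket of two generators is again a polynomial symbol
(`bracket_mem_LSym`, `L_toSubmodule`). The product $D\triangleleft X$ is the componentwise action of
$D$ on the symbol of $X$. The identity for $[D,D']\triangleleft X$ says exactly that $\varphi\mapsto
D\varphi(\cdot)-\varphi(D\triangleleft\cdot)$ represents $\mathsf L$ on $\mathrm{Hom}(\tilde{\mathsf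
L},\mathrm U(\mathsf L))$, and the maps $\theta_X$ are read off from this representation. The
central device is to view $\mathsf T^+$ as the polynomial functions on the space of parameters. The
extended tilt becomes a universal family `Ehat` with coefficients in $\mathsf T^+$, and
infinitesimal left multiplication in the group becomes a derivation $V_D$ of $\mathsf T^+$ with
$V_D\hat\pi^{(n)}=s_n+D\hat\pi^{(n)}$ (`VS_Ehat`). These derivations form an anti-representation of
$\mathsf L$ (`VS_bracket`), which extends to $\mathrm U(\mathsf L)$. The pairing is $\langle
u,Z\rangle=\varepsilon^+(V_uZ)$, evaluation at the trivial parameter. Under it $\theta_X$ is dual to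
the constant-coefficient derivative along $X$ (`BU_graft`), so the elements $D_{(J,m)}$ extract
Taylor coefficients at the origin (`BU_Dbas_Zb`). Linear independence and non-degeneracy follow from
this, without an appeal to the Poincaré–Birkhoff–Witt theorem; spanning is a reordering argument
(`graftSpan_eq_top`). The pull-back under the universal extended tilt satisfies the differential
equation $V_D(\text{pull-back of }P)=D(\text{pull-back of }P)$ (`dhat_upull`). Hence its matrix
entries in $\mathsf T^+$ pair with $u$ to give the matrix of $\rho(u)$ (`BU_cf`). These matrices are
triangular in $([\gamma],|\gamma|)$ and in a third quantity `qd`, with finite rows on the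
multi-indices of $\mathsf T^*$ (`finite_bounded`); they define $\Delta$, and their values at a
character define $\Gamma_f$ and $\Gamma_f^*$. Since the pairing separates points, also on tensor
products, the identities for $\Delta^+$, $\Delta$ and $\mathcal S$ are transported from $\mathrm
U(\mathsf L)$ and its module $\mathsf T^*$. The coproduct is read off from the cocycle rule
`BU_mul_Ehat`, and the antipode is obtained by recursion along the triangular order. Characters of
$\mathsf T^+$ are the parameters, so the group laws are the Hopf algebra axioms. The exponential
formula is the Taylor expansion in $t$ at $0$ of the pull-back under $t\hat\pi$, taken at $t=1$. -/

namespace ShiftTilt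

noncomputable section

/-! ### Row-finite operators and derivations on power series -/

open MvPowerSeries

/-! ### Operators on power series with finitely many entries per row -/

/-- Every coefficient of `op F` depends on finitely many coefficients of `F`. -/
def FinDep (op : PS →ₗ[ℝ] PS) : Prop :=
  ∀ β, ∃ S : Finset MIdx, ∀ F : PS, (∀ γ ∈ S, coeff γ F = 0) → coeff β (op F) = 0

theorem coeff_zmon [DecidableEq MIdx] (β γ : MIdx) : coeff β (zmon γ) = if β = γ then 1 else 0 := by
  classical
  rw [zmon, coeff_monomial]
  congr

/-- Subtracting from $F$ its finite part supported on $S$ leaves a series that the row $\beta$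
cannot see. Row-finite operators are thus given by matrices with finite rows, even though they act
on infinite series. -/
theorem FinDep.exists_sum {op : PS →ₗ[ℝ] PS} (h : FinDep op) (β : MIdx) :
    ∃ S : Finset MIdx, (∀ γ, γ ∉ S → coeff β (op (zmon γ)) = 0) ∧
      ∀ F : PS, coeff β (op F) = ∑ γ ∈ S, coeff β (op (zmon γ)) * coeff γ F := by
  classical
  obtain ⟨S, hS⟩ := h β
  refine ⟨S, fun γ hγ => hS _ fun δ hδ => ?_, fun F => ?_⟩
  · rw [coeff_zmon, if_neg]
    rintro rfl
    exact hγ hδ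
  · have h0 := hS (F - ∑ γ ∈ S, coeff γ F • zmon γ) fun δ hδ => by
      simp only [map_sub, map_sum, coeff_smul, coeff_zmon]
      simp [hδ]
    simp only [map_sub, map_sum, map_smul, sub_eq_zero] at h0
    rw [h0]
    exact Finset.sum_congr rfl fun _ _ => mul_comm _ _

theorem FinDep.comp {op op' : PS →ₗ[ℝ] PS} (h : FinDep op) (h' : FinDep op') :
    FinDep (op ∘ₗ op') := by
  classical
  intro β
  obtain ⟨S, hS⟩ := h β
  choose S' hS' using h'
  refine ⟨S.biUnion S', fun F hF => hS _ fun γ hγ => hS' γ _ fun δ hδ => hF δ ?_⟩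
  exact Finset.mem_biUnion.2 ⟨γ, hγ, hδ⟩

theorem FinDep.add {op op' : PS →ₗ[ℝ] PS} (h : FinDep op) (h' : FinDep op') :
    FinDep (op + op') := by
  classical
  intro β
  obtain ⟨S, hS⟩ := h β
  obtain ⟨S', hS'⟩ := h' β
  refine ⟨S ∪ S', fun F hF => ?_⟩
  rw [LinearMap.add_apply, map_add, hS _ fun γ hγ => hF γ (Finset.mem_union_left _ hγ),
    hS' _ fun γ hγ => hF γ (Finset.mem_union_right _ hγ), add_zero]

theorem FinDep.smul {op : PS →ₗ[ℝ] PS} (h : FinDep op) (c : ℝ) : FinDep (c • op) := by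
  intro β
  obtain ⟨S, hS⟩ := h β
  refine ⟨S, fun F hF => ?_⟩
  rw [LinearMap.smul_apply, coeff_smul, hS F hF, mul_zero]

theorem FinDep.sub {op op' : PS →ₗ[ℝ] PS} (h : FinDep op) (h' : FinDep op') :
    FinDep (op - op') := by
  rw [sub_eq_add_neg, ← neg_one_smul ℝ op']
  exact h.add (h'.smul _)

theorem FinDep.id : FinDep LinearMap.id := fun β => ⟨{β}, fun F hF => hF β (by simp)⟩

theorem FinDep.mulLeft (G : PS) : FinDep (LinearMap.mulLeft ℝ G) := by
  classical
  intro β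
  refine ⟨Finset.Iic β, fun F hF => ?_⟩
  rw [LinearMap.mulLeft_apply, coeff_mul]
  refine Finset.sum_eq_zero fun p hp => ?_
  rw [hF p.2, mul_zero]
  rw [Finset.HasAntidiagonal.mem_antidiagonal] at hp
  rw [Finset.mem_Iic, ← hp]
  exact le_add_self

theorem FinDep.pderiv (v : Var) : FinDep (MvPowerSeries.pderiv ℝ v).toLinearMap := by
  intro β
  refine ⟨{β + Finsupp.single v 1}, fun F hF => ?_⟩
  change coeff β (MvPowerSeries.pderiv ℝ v F) = 0
  rw [coeff_pderiv, hF _ (Finset.mem_singleton_self _), zero_mul]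

/-- Operators that are locally finite sums of row-finite operators are row-finite. -/
theorem FinDep.of_locally_sum {ι : Type} {op : PS →ₗ[ℝ] PS} (ops : ι → PS →ₗ[ℝ] PS)
    (h : ∀ i, FinDep (ops i))
    (hop : ∀ β, ∃ S : Finset ι, ∀ F, coeff β (op F) = ∑ i ∈ S, coeff β (ops i F)) :
    FinDep op := by
  classical
  intro β
  obtain ⟨S, hS⟩ := hop β
  choose R hR using fun i => h i β
  refine ⟨S.biUnion R, fun F hF => ?_⟩
  rw [hS]
  exact Finset.sum_eq_zero fun i hi => hR i F fun γ hγ =>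
    hF γ (Finset.mem_biUnion.2 ⟨i, hi, hγ⟩)

/-! ### The action on vector-valued coefficient families -/

section Act

variable {V W : Type} [AddCommGroup V] [Module ℝ V] [AddCommGroup W] [Module ℝ W]

/-- The extension of `op` to families of coefficients in a vector space `V`. -/
def act (op : PS →ₗ[ℝ] PS) (C : MIdx → V) : MIdx → V :=
  fun β => ∑ᶠ γ, coeff β (op (zmon γ)) • C γ

theorem act_eq_sum {op : PS →ₗ[ℝ] PS} {β : MIdx} {S : Finset MIdx}
    (hS : ∀ γ, γ ∉ S → coeff β (op (zmon γ)) = 0) (C : MIdx → V) :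
    act op C β = ∑ γ ∈ S, coeff β (op (zmon γ)) • C γ := by
  refine finsum_eq_sum_of_support_subset _ fun γ hγ => ?_
  by_contra hn
  exact hγ (by simp only [hS γ hn, zero_smul])

theorem map_act {op : PS →ₗ[ℝ] PS} (h : FinDep op) (φ : V →ₗ[ℝ] W) (C : MIdx → V) (β : MIdx) :
    φ (act op C β) = act op (fun γ => φ (C γ)) β := by
  obtain ⟨S, hS, -⟩ := h.exists_sum β
  simp only [act_eq_sum hS, map_sum, map_smul]

theorem act_real {op : PS →ₗ[ℝ] PS} (h : FinDep op) (F : PS) (β : MIdx) :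
    act op (fun γ => coeff γ F) β = coeff β (op F) := by
  obtain ⟨S, hS, h'⟩ := h.exists_sum β
  rw [act_eq_sum hS, h']
  simp only [smul_eq_mul]

/-- The power series with the coefficients `C`. -/
def series (C : MIdx → ℝ) : PS := C

@[simp] theorem coeff_series (C : MIdx → ℝ) (β : MIdx) : coeff β (series C) = C β := rfl

theorem dual_act {op : PS →ₗ[ℝ] PS} (h : FinDep op) (φ : V →ₗ[ℝ] ℝ) (C : MIdx → V) (β : MIdx) :
    φ (act op C β) = coeff β (op (series fun γ => φ (C γ))) := by
  rw [map_act h, ← act_real h]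
  rfl

theorem eq_of_dual {x y : V} (h : ∀ φ : V →ₗ[ℝ] ℝ, φ x = φ y) : x = y := by
  rw [← sub_eq_zero, ← Module.forall_dual_apply_eq_zero_iff ℝ]
  intro φ
  rw [map_sub, h, sub_self]

/-- Linear forms on $V$ separate points and commute with `act`, so the claim reduces to real
coefficients, where `act` is the operator itself. No sums have to be interchanged. -/
theorem act_comp {op op' : PS →ₗ[ℝ] PS} (h : FinDep op) (h' : FinDep op') (C : MIdx → V) :
    act (op ∘ₗ op') C = act op (act op' C) := by
  funext β
  refine eq_of_dual fun φ => ?_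
  rw [dual_act (h.comp h'), dual_act h, LinearMap.comp_apply]
  have : op' (series fun γ => φ (C γ)) = series fun γ => φ (act op' C γ) := by
    ext γ
    rw [coeff_series, dual_act h']
  rw [this]

theorem act_add {op op' : PS →ₗ[ℝ] PS} (h : FinDep op) (h' : FinDep op') (C : MIdx → V) :
    act (op + op') C = act op C + act op' C := by
  funext β
  refine eq_of_dual fun φ => ?_
  simp [dual_act (h.add h'), dual_act h, dual_act h']

theorem act_sub {op op' : PS →ₗ[ℝ] PS} (h : FinDep op) (h' : FinDep op') (C : MIdx → V) :
    act (op - op') C = act op C - act op' C := by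
  funext β
  refine eq_of_dual fun φ => ?_
  simp [dual_act (h.sub h'), dual_act h, dual_act h']

theorem act_smul {op : PS →ₗ[ℝ] PS} (h : FinDep op) (c : ℝ) (C : MIdx → V) :
    act (c • op) C = c • act op C := by
  funext β
  refine eq_of_dual fun φ => ?_
  simp [dual_act (h.smul c), dual_act h]

theorem act_map_add {op : PS →ₗ[ℝ] PS} (h : FinDep op) (C C' : MIdx → V) :
    act op (C + C') = act op C + act op C' := by
  funext β
  obtain ⟨S, hS, -⟩ := h.exists_sum β
  simp only [Pi.add_apply, act_eq_sum hS, smul_add, Finset.sum_add_distrib]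

theorem act_map_smul {op : PS →ₗ[ℝ] PS} (h : FinDep op) (c : ℝ) (C : MIdx → V) :
    act op (c • C) = c • act op C := by
  funext β
  obtain ⟨S, hS, -⟩ := h.exists_sum β
  simp only [Pi.smul_apply, act_eq_sum hS, Finset.smul_sum, smul_comm c]

end Act

/-! ### Derivations -/

/-- The Leibniz rule. -/
def IsDer (op : PS →ₗ[ℝ] PS) : Prop := ∀ F G, op (F * G) = F * op G + op F * G

theorem IsDer.one {op : PS →ₗ[ℝ] PS} (h : IsDer op) : op 1 = 0 := by
  have := h 1 1
  simpa using this

theorem IsDer.commutator {op op' : PS →ₗ[ℝ] PS} (h : IsDer op) (h' : IsDer op') :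
    IsDer (op ∘ₗ op' - op' ∘ₗ op) := by
  intro F G
  simp only [LinearMap.sub_apply, LinearMap.comp_apply, h F G, h' F G, map_add, h _ _, h' _ _]
  ring

theorem IsDer.sub {op op' : PS →ₗ[ℝ] PS} (h : IsDer op) (h' : IsDer op') : IsDer (op - op') := by
  intro F G
  simp only [LinearMap.sub_apply, h F G, h' F G]
  ring

/-- The Leibniz rule handles polynomials only; row-finiteness carries the conclusion to infinite
series, since each coefficient of the image is a finite combination of images of monomials. -/
theorem IsDer.eq_zero {op : PS →ₗ[ℝ] PS} (h : IsDer op) (hf : FinDep op)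
    (hX : ∀ v, op (X v) = 0) : op = 0 := by
  have key : ∀ P : MvPolynomial Var ℝ, op (P : PS) = 0 := by
    intro P
    induction P using MvPolynomial.induction_on with
    | C a =>
      rw [MvPolynomial.coe_C, ← mul_one (C a), ← MvPowerSeries.smul_eq_C_mul, map_smul, h.one,
        smul_zero]
    | add p q hp hq => rw [MvPolynomial.coe_add, map_add, hp, hq, add_zero]
    | mul_X p v hp => rw [MvPolynomial.coe_mul, MvPolynomial.coe_X, h, hp, hX, mul_zero, zero_mul,
        add_zero]
  ext F β
  obtain ⟨S, -, hS⟩ := hf.exists_sum β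
  rw [hS]
  refine Finset.sum_eq_zero fun γ _ => ?_
  have : op (zmon γ) = 0 := by
    rw [zmon, ← MvPolynomial.coe_monomial, key]
  rw [this, map_zero, zero_mul]

theorem IsDer.ext {op op' : PS →ₗ[ℝ] PS} (h : IsDer op) (h' : IsDer op') (hf : FinDep op)
    (hf' : FinDep op') (hX : ∀ v, op (X v) = op' (X v)) : op = op' :=
  sub_eq_zero.1 <| (h.sub h').eq_zero (hf.sub hf') fun v => by
    rw [LinearMap.sub_apply, hX, sub_self]

theorem IsDer.pderiv (v : Var) : IsDer (MvPowerSeries.pderiv ℝ v).toLinearMap := by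
  intro F G
  simp only [Derivation.coeFn_coe, Derivation.leibniz, smul_eq_mul]
  ring

theorem IsDer.mul {op : PS →ₗ[ℝ] PS} (h : IsDer op) (G : PS) :
    IsDer (LinearMap.mulLeft ℝ G ∘ₗ op) := by
  intro F F'
  simp only [LinearMap.comp_apply, LinearMap.mulLeft_apply, h F F']
  ring

/-- Locally finite sums of derivations are derivations. -/
theorem IsDer.of_locally_sum {ι : Type} {op : PS →ₗ[ℝ] PS} (ops : ι → PS →ₗ[ℝ] PS)
    (h : ∀ i, IsDer (ops i))
    (hop : ∀ β, ∃ S : Finset ι, ∀ β' ≤ β, ∀ F,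
      coeff β' (op F) = ∑ i ∈ S, coeff β' (ops i F)) : IsDer op := by
  classical
  intro F G
  ext β
  obtain ⟨S, hS⟩ := hop β
  rw [hS β le_rfl, map_add, coeff_mul, coeff_mul]
  simp only [h _ F G, map_add, Finset.sum_add_distrib, coeff_mul]
  congr 1
  · rw [Finset.sum_comm]
    refine Finset.sum_congr rfl fun p hp => ?_
    rw [Finset.HasAntidiagonal.mem_antidiagonal] at hp
    rw [hS p.2 (hp ▸ le_add_self), Finset.mul_sum]
  · rw [Finset.sum_comm]
    refine Finset.sum_congr rfl fun p hp => ?_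
    rw [Finset.HasAntidiagonal.mem_antidiagonal] at hp
    rw [hS p.1 (hp ▸ le_self_add), Finset.sum_mul]

/-! ### The operators `D^{(n)}` -/

/-- The summand `(k+1) z_{k+1} ∂_{z_k}` of `D^{(0)}`. -/
def D0term (k : ℕ) : PS →ₗ[ℝ] PS :=
  LinearMap.mulLeft ℝ (((k : ℝ) + 1) • X (Sum.inl (k + 1))) ∘ₗ
    (MvPowerSeries.pderiv ℝ (Sum.inl k)).toLinearMap

theorem D0_locally (β : MIdx) : ∃ S : Finset ℕ, ∀ β' ≤ β, ∀ F,
    coeff β' (D0 F) = ∑ k ∈ S, coeff β' (D0term k F) := by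
  classical
  -- The $k$-th summand is divisible by $z_{k+1}$, so only the $k$ with $z_{k+1}$ dividing $z^\beta$
  -- matter. The value $0$ at the labels `Sum.inr` merely enlarges the set.
  refine ⟨β.support.image fun v => match v with
    | Sum.inl k => k - 1
    | Sum.inr _ => 0, fun β' hβ F => ?_⟩
  have : coeff β' (D0 F) = ∑ᶠ k : ℕ, coeff β' (((k : ℝ) + 1) • (X (Sum.inl (k + 1)) *
      MvPowerSeries.pderiv ℝ (Sum.inl k) F)) := rfl
  rw [this]
  simp only [D0term, LinearMap.comp_apply, LinearMap.mulLeft_apply, smul_mul_assoc,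
    Derivation.coeFn_coe]
  refine finsum_eq_sum_of_support_subset _ fun k hk => ?_
  have hk' : coeff β' (X (Sum.inl (k + 1)) * MvPowerSeries.pderiv ℝ (Sum.inl k) F) ≠ 0 := by
    intro h0
    apply hk
    beta_reduce
    rw [coeff_smul, h0, mul_zero]
  obtain ⟨δ, rfl, -⟩ := exists_of_coeff_X_mul hk'
  simp only [Finset.coe_image, Set.mem_image]
  refine ⟨Sum.inl (k + 1), ?_, by simp⟩
  have := hβ (Sum.inl (k + 1))
  simp only [Finsupp.add_apply, Finsupp.single_eq_same] at this
  simp only [Finset.mem_coe, Finsupp.mem_support_iff]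
  omega

theorem FinDep.Dtilt (n : N2) : FinDep (Dtilt n) := by
  unfold ShiftTilt.Dtilt
  split_ifs
  · exact FinDep.pderiv _
  · refine FinDep.of_locally_sum D0term (fun k => (FinDep.mulLeft _).comp (FinDep.pderiv _))
      fun β => ?_
    obtain ⟨S, hS⟩ := D0_locally β
    exact ⟨S, hS β le_rfl⟩

theorem IsDer.Dtilt (n : N2) : IsDer (Dtilt n) := by
  unfold ShiftTilt.Dtilt
  split_ifs
  · exact IsDer.pderiv _
  · exact IsDer.of_locally_sum D0term (fun k => (IsDer.pderiv _).mul _) D0_locally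

theorem Dtilt_X_inl (n : N2) (k : ℕ) :
    Dtilt n (X (Sum.inl k)) = if n = 0 then ((k : ℝ) + 1) • X (Sum.inl (k + 1)) else 0 := by
  classical
  unfold Dtilt
  by_cases hn : n = 0
  · rw [dif_neg (by simpa using hn), if_pos hn]
    ext β
    have : coeff β (D0 (X (Sum.inl k))) = ∑ᶠ j : ℕ, coeff β (((j : ℝ) + 1) • (X (Sum.inl (j + 1)) *
        MvPowerSeries.pderiv ℝ (Sum.inl j) (X (Sum.inl k)))) := rfl
    rw [this, finsum_eq_single _ k]
    · simp
    · intro j hj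
      simp [Ne.symm hj]
  · rw [dif_pos hn, if_neg hn]
    simp

theorem Dtilt_X_inr (n : N2) (m : {n : N2 // n ≠ 0}) :
    Dtilt n (X (Sum.inr m)) = if n = m.1 then 1 else 0 := by
  classical
  unfold Dtilt
  by_cases hn : n = 0
  · rw [dif_neg (by simpa using hn), if_neg (fun h => m.2 (h.symm.trans hn))]
    ext β
    have : coeff β (D0 (X (Sum.inr m))) = ∑ᶠ j : ℕ, coeff β (((j : ℝ) + 1) • (X (Sum.inl (j + 1)) *
        MvPowerSeries.pderiv ℝ (Sum.inl j) (X (Sum.inr m)))) := rfl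
    rw [this]
    simp
  · rw [dif_pos hn]
    rcases eq_or_ne n m.1 with rfl | h
    · simp
    · have : m ≠ ⟨n, hn⟩ := fun h' => h (by rw [h'])
      simp [h, this]

end

end ShiftTilt

/-! ### Bookkeeping of homogeneities, and vector fields given by their symbols -/

namespace ShiftTilt

noncomputable section

open MvPowerSeries

/-! ### Homogeneities -/

section Homog

variable (α : ℝ) (w : N2 →+ ℝ)

/-- The $+1$ in $\alpha([\gamma]+1)$ makes the homogeneity affine rather than additive, which costs
one $\alpha$ per product. -/
theorem homog_add (γ δ : MIdx) : homog α w (γ + δ) = homog α w γ + homog α w δ - α := by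
  unfold homog
  rw [Finsupp.sum_add_index', br_add]
  · push_cast
    ring
  · rintro (k | n) <;> simp
  · rintro (k | n) a b <;> simp [mul_add]

theorem homog_single_inl (k : ℕ) : homog α w (Finsupp.single (Sum.inl k) 1) = α * (k + 1) := by
  unfold homog
  rw [br_single_inl, Finsupp.sum_single_index] <;> simp

theorem homog_single_inr (n : {n : N2 // n ≠ 0}) :
    homog α w (Finsupp.single (Sum.inr n) 1) = w n.1 := by
  unfold homog
  rw [br_single_inr, Finsupp.sum_single_index] <;> simp

theorem br_zero : br 0 = 0 := by
  unfold br
  simp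

theorem homog_zero : homog α w 0 = α := by
  unfold homog
  simp [br_zero]

theorem w_eq (n : N2) : w n = n 0 * w (unitVec 0) + n 1 * w (unitVec 1) := by
  have : n = n 0 • unitVec 0 + n 1 • unitVec 1 := by
    ext i
    fin_cases i <;> simp [unitVec]
  conv_lhs => rw [this]
  rw [map_add, map_nsmul, map_nsmul, nsmul_eq_mul, nsmul_eq_mul]

/-- The standing assumptions `α > 0` and `|(1,0)|, |(0,1)| > 0`. -/
class Pos : Prop where
  alpha_pos : 0 < α
  weight_pos : ∀ i, 0 < w (unitVec i)

variable [Pos α w]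

theorem alpha_pos (α : ℝ) (w : N2 →+ ℝ) [Pos α w] : 0 < α := Pos.alpha_pos (w := w)

theorem w_nonneg (α : ℝ) (w : N2 →+ ℝ) [Pos α w] (n : N2) : 0 ≤ w n := by
  have h := Pos.weight_pos α (w := w)
  rw [w_eq]
  have h0 := (h 0).le
  have h1 := (h 1).le
  positivity

theorem w_pos (α : ℝ) (w : N2 →+ ℝ) [Pos α w] {n : N2} (hn : n ≠ 0) : 0 < w n := by
  have h := Pos.weight_pos α (w := w)
  rw [w_eq]
  have h0 := h 0
  have h1 := h 1
  have : n 0 ≠ 0 ∨ n 1 ≠ 0 := by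
    by_contra hc
    push Not at hc
    apply hn
    ext i
    fin_cases i
    · exact hc.1
    · exact hc.2
  rcases this with h' | h'
  · have : (0 : ℝ) < n 0 := by exact_mod_cast Nat.pos_of_ne_zero h'
    positivity
  · have : (0 : ℝ) < n 1 := by exact_mod_cast Nat.pos_of_ne_zero h'
    positivity

theorem w_lt (α : ℝ) (w : N2 →+ ℝ) [Pos α w] {n m : N2} (h : n < m) : w n < w m := by
  obtain ⟨k, rfl⟩ := exists_add_of_le h.le
  have hk : k ≠ 0 := by
    rintro rfl
    simp at h
  rw [map_add]
  linarith [w_pos α w hk]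

theorem finite_w_lt (α : ℝ) (w : N2 →+ ℝ) [Pos α w] (c : ℝ) : {n : N2 | w n < c}.Finite := by
  have h := Pos.weight_pos α (w := w)
  let K : N2 := Finsupp.equivFunOnFinite.symm fun i => ⌈c / w (unitVec i)⌉₊
  refine (Set.finite_Iic K).subset fun n hn => ?_
  have hn : w n < c := hn
  rw [w_eq] at hn
  intro i
  change n i ≤ ⌈c / w (unitVec i)⌉₊
  have : (n i : ℝ) * w (unitVec i) ≤ c := by
    have h0 := mul_nonneg (Nat.cast_nonneg (α := ℝ) (n 0)) (h 0).le
    have h1 := mul_nonneg (Nat.cast_nonneg (α := ℝ) (n 1)) (h 1).le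
    fin_cases i
    · change (n 0 : ℝ) * w (unitVec 0) ≤ c
      linarith
    · change (n 1 : ℝ) * w (unitVec 1) ≤ c
      linarith
  have h2 : (n i : ℝ) ≤ c / w (unitVec i) := (le_div_iff₀ (h i)).2 this
  exact_mod_cast h2.trans (Nat.le_ceil _)

theorem finite_Nset (β : MIdx) : {n : N2 | ∃ γ ≤ β, w n < homog α w γ}.Finite := by
  have : {n : N2 | ∃ γ ≤ β, w n < homog α w γ} = ⋃ γ ∈ Set.Iic β, {n | w n < homog α w γ} := by
    ext n
    simp
  rw [this]
  exact (Set.finite_Iic β).biUnion fun γ _ => finite_w_lt α w _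

/-- The `n` with `|n| < |γ|` for some `γ ≤ β`. -/
def Nset (β : MIdx) : Finset N2 := (finite_Nset α w β).toFinset

theorem mem_Nset {β : MIdx} {n : N2} : n ∈ Nset α w β ↔ ∃ γ ≤ β, w n < homog α w γ := by
  simp [Nset]

end Homog

theorem IsModelIdx.neg_one_le {γ : MIdx} (h : IsModelIdx γ) : -1 ≤ br γ := by
  rcases h with h | ⟨n, rfl⟩
  · omega
  · rw [br_single_inr]

/-- The gain $\alpha$ cancels the loss in `homog_add`, so that $z^\delta D^{(n)}$ changes the
homogeneity by exactly $|\delta|-|n|$. This is why the condition $|\gamma|>|n|$ yields strict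
triangularity. -/
theorem exists_of_coeff_Dtilt_homog (α : ℝ) (w : N2 →+ ℝ) {n : N2} {F : PS} {β : MIdx}
    (h : coeff β (Dtilt n F) ≠ 0) :
    ∃ γ, coeff γ F ≠ 0 ∧ br β = br γ + 1 ∧ homog α w β = homog α w γ + α - w n := by
  unfold Dtilt at h
  split_ifs at h with hn
  · refine ⟨β + Finsupp.single (Sum.inr ⟨n, hn⟩) 1, fun h0 => h ?_, ?_, ?_⟩
    · simp [coeff_pderiv, h0]
    · rw [br_add, br_single_inr]
      ring
    · rw [homog_add, homog_single_inr]
      ring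
  · have h' : ∑ᶠ k : ℕ, coeff β (((k : ℝ) + 1) •
        (X (Sum.inl (k + 1)) * MvPowerSeries.pderiv ℝ (Sum.inl k) F)) ≠ 0 := h
    obtain ⟨k, hk⟩ := exists_of_finsum_ne_zero h'
    have hk' : coeff β (X (Sum.inl (k + 1)) * MvPowerSeries.pderiv ℝ (Sum.inl k) F) ≠ 0 := by
      intro h0
      apply hk
      rw [coeff_smul, h0, mul_zero]
    obtain ⟨δ, rfl, hd⟩ := exists_of_coeff_X_mul hk'
    have hn : n = 0 := by simpa using hn
    refine ⟨δ + Finsupp.single (Sum.inl k) 1, fun h0 => hd ?_, ?_, ?_⟩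
    · simp [coeff_pderiv, h0]
    · rw [br_add, br_add, br_single_inl, br_single_inl]
      push_cast
      ring
    · rw [homog_add, homog_add, homog_single_inl, homog_single_inl, hn, map_zero]
      push_cast
      ring

/-- The exceptional value $\beta=0$ comes from $\partial_{z_n}z_n=1$. Apart from it $[\cdot]$ is at
least $1$, which leaves room for a factor $z_m$ with $[e_m]=-1$ in front. -/
theorem coeff_Dtilt_of_mem_Tstar {n : N2} {F : PS} (hF : F ∈ Tstar) {β : MIdx}
    (h : coeff β (Dtilt n F) ≠ 0) : 1 ≤ br β ∨ β = 0 := by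
  rcases exists_of_coeff_Dtilt h with ⟨hn, h1⟩ | ⟨k, δ, rfl, h1⟩
  · rcases hF _ h1 with h2 | ⟨m, hm⟩
    · rw [br_add, br_single_inr] at h2
      left
      omega
    · right
      have hdeg := congrArg Finsupp.degree hm
      simp only [map_add, Finsupp.degree_single] at hdeg
      exact (Finsupp.degree_eq_zero_iff β).1 (by omega)
  · left
    rcases hF _ h1 with h2 | ⟨m, hm⟩
    · rw [br_add, br_single_inl] at h2
      rw [br_add, br_single_inl]
      push_cast
      omega
    · have := DFunLike.congr_fun hm (Sum.inl k)
      simp at this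

theorem exists_of_coeff_mul {F G : PS} {β : MIdx} (h : coeff β (F * G) ≠ 0) :
    ∃ γ δ, β = γ + δ ∧ coeff γ F ≠ 0 ∧ coeff δ G ≠ 0 := by
  classical
  rw [coeff_mul] at h
  obtain ⟨p, hp, h'⟩ := Finset.exists_ne_zero_of_sum_ne_zero h
  exact ⟨p.1, p.2, (Finset.HasAntidiagonal.mem_antidiagonal.1 hp).symm, left_ne_zero_of_mul h',
    right_ne_zero_of_mul h'⟩

/-! ### Vector fields `∑_n s_n D^{(n)}` -/

section VF

variable (α : ℝ) (w : N2 →+ ℝ)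

/-- The families `s` of elements of `T^*` such that `s_n` has homogeneities larger than `|n|`. -/
def TLs : Submodule ℝ (N2 → PS) where
  carrier := {s | ∀ n γ, coeff γ (s n) ≠ 0 → IsModelIdx γ ∧ w n < homog α w γ}
  zero_mem' := by
    intro n γ h
    simp at h
  add_mem' := by
    intro s t hs ht n γ h
    by_cases h1 : coeff γ (s n) = 0
    · by_cases h2 : coeff γ (t n) = 0
      · simp [h1, h2] at h
      · exact ht n γ h2
    · exact hs n γ h1
  smul_mem' := by
    intro c s hs n γ h
    refine hs n γ fun h0 => h ?_
    simp [h0]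

variable {α w}

theorem TLs_mem_Tstar (s : TLs α w) (n : N2) : s.1 n ∈ Tstar := fun γ h => (s.2 n γ h).1

variable [Pos α w]

theorem mem_Nset_of_coeff (s : TLs α w) {n : N2} {G : PS} {β β' : MIdx} (hβ : β' ≤ β)
    (h : coeff β' (s.1 n * G) ≠ 0) : n ∈ Nset α w β := by
  obtain ⟨γ, δ, rfl, h1, -⟩ := exists_of_coeff_mul h
  exact (mem_Nset α w).2 ⟨γ, le_self_add.trans hβ, (s.2 n γ h1).2⟩

theorem finite_vf (s : TLs α w) (F : PS) (β : MIdx) :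
    {n : N2 | coeff β (s.1 n * Dtilt n F) ≠ 0}.Finite :=
  (Nset α w β).finite_toSet.subset fun _ h => mem_Nset_of_coeff s le_rfl h

/-- The vector field `∑_n s_n D^{(n)}`. -/
def vf : TLs α w →ₗ[ℝ] PS →ₗ[ℝ] PS :=
  LinearMap.mk₂ ℝ (fun s F => formalSum fun n => s.1 n * Dtilt n F)
    (by
      intro s t F
      rw [← formalSum_add _ _ (finite_vf s F) (finite_vf t F)]
      simp [add_mul])
    (by
      intro c s F
      rw [← formalSum_smul]
      simp)
    (by
      intro s F G
      rw [← formalSum_add _ _ (finite_vf s F) (finite_vf s G)]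
      simp [mul_add])
    (by
      intro c s F
      rw [← formalSum_smul]
      simp)

theorem vf_apply (s : TLs α w) (F : PS) : vf s F = formalSum fun n => s.1 n * Dtilt n F := rfl

theorem coeff_vf (s : TLs α w) (F : PS) {β β' : MIdx} (hβ : β' ≤ β) :
    coeff β' (vf s F) = ∑ n ∈ Nset α w β, coeff β' (s.1 n * Dtilt n F) := by
  rw [vf_apply, coeff_formalSum]
  exact finsum_eq_sum_of_support_subset _ fun n h => mem_Nset_of_coeff s hβ h

theorem FinDep.vf (s : TLs α w) : FinDep (vf s) :=
  FinDep.of_locally_sum (fun n => LinearMap.mulLeft ℝ (s.1 n) ∘ₗ ShiftTilt.Dtilt n)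
    (fun n => (FinDep.mulLeft _).comp (FinDep.Dtilt n)) fun β => ⟨Nset α w β, fun F => by
      rw [coeff_vf s F le_rfl]
      rfl⟩

theorem IsDer.vf (s : TLs α w) : IsDer (vf s) :=
  IsDer.of_locally_sum (fun n => LinearMap.mulLeft ℝ (s.1 n) ∘ₗ ShiftTilt.Dtilt n)
    (fun n => (IsDer.Dtilt n).mul _) fun β => ⟨Nset α w β, fun β' hβ F => by
      rw [coeff_vf s F hβ]
      rfl⟩

theorem formalSum_single {ι : Type} (i : ι) (F : ι → PS) (h : ∀ j, j ≠ i → F j = 0) :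
    formalSum F = F i := by
  ext β
  rw [coeff_formalSum]
  exact finsum_eq_single _ i fun j hj => by rw [h j hj, map_zero]

theorem vf_X_inl (s : TLs α w) (k : ℕ) :
    vf s (X (Sum.inl k)) = s.1 0 * (((k : ℝ) + 1) • X (Sum.inl (k + 1))) := by
  rw [vf_apply, formalSum_single 0]
  · rw [Dtilt_X_inl, if_pos rfl]
  · intro n hn
    rw [Dtilt_X_inl, if_neg hn, mul_zero]

theorem vf_X_inr (s : TLs α w) (m : {n : N2 // n ≠ 0}) : vf s (X (Sum.inr m)) = s.1 m.1 := by
  rw [vf_apply, formalSum_single m.1]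
  · rw [Dtilt_X_inr, if_pos rfl, mul_one]
  · intro n hn
    rw [Dtilt_X_inr, if_neg hn, mul_zero]

/-- $D^{(n)}$ raises $[\cdot]$ by one, while a symbol lowers it by at most one; the homogeneity
grows by $|\delta|-|n|>0$. All later triangularity statements rest on this. -/
theorem exists_of_coeff_vf (s : TLs α w) {F : PS} {β : MIdx} (h : coeff β (vf s F) ≠ 0) :
    ∃ γ, coeff γ F ≠ 0 ∧ br γ ≤ br β ∧ homog α w γ < homog α w β := by
  rw [coeff_vf s F le_rfl] at h
  obtain ⟨n, -, h1⟩ := Finset.exists_ne_zero_of_sum_ne_zero h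
  obtain ⟨δ, β', rfl, h2, h3⟩ := exists_of_coeff_mul h1
  obtain ⟨γ, h4, h5, h6⟩ := exists_of_coeff_Dtilt_homog α w h3
  obtain ⟨h7, h8⟩ := s.2 n δ h2
  refine ⟨γ, h4, ?_, ?_⟩
  · rw [br_add]
    have := h7.neg_one_le
    omega
  · rw [homog_add]
    linarith

theorem vf_mem_Tstar (s : TLs α w) : ∀ F ∈ Tstar, vf s F ∈ Tstar := by
  intro F hF β h
  rw [coeff_vf s F le_rfl] at h
  obtain ⟨n, -, h1⟩ := Finset.exists_ne_zero_of_sum_ne_zero h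
  obtain ⟨δ, β', rfl, h2, h3⟩ := exists_of_coeff_mul h1
  obtain ⟨h7, -⟩ := s.2 n δ h2
  rcases coeff_Dtilt_of_mem_Tstar hF h3 with h4 | rfl
  · left
    rw [br_add]
    have := h7.neg_one_le
    omega
  · rwa [add_zero]

/-- The family `n ↦ (∑_m s_m D^{(m)}) t_n`. -/
def tl : TLs α w →ₗ[ℝ] TLs α w →ₗ[ℝ] TLs α w :=
  LinearMap.mk₂ ℝ (fun s t => ⟨fun n => vf s (t.1 n), fun n γ h => by
      refine ⟨vf_mem_Tstar s _ (TLs_mem_Tstar t n) γ h, ?_⟩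
      obtain ⟨δ, h1, -, h2⟩ := exists_of_coeff_vf s h
      exact (t.2 n δ h1).2.trans h2⟩)
    (by intros; ext; simp) (by intros; ext; simp) (by intros; ext; simp) (by intros; ext; simp)

@[simp] theorem tl_apply (s t : TLs α w) (n : N2) : (tl s t).1 n = vf s (t.1 n) := rfl

/-- Both sides are row-finite derivations, so the variables suffice. On $z_k$ the term
$s_0t_0z_{k+2}$ is symmetric and cancels; on $z_m$ the two sides agree by definition of `tl`. -/
theorem vf_bracket (s t : TLs α w) :
    vf (tl s t - tl t s) = vf s ∘ₗ vf t - vf t ∘ₗ vf s := by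
  refine IsDer.ext (IsDer.vf _) ((IsDer.vf s).commutator (IsDer.vf t)) (FinDep.vf _)
    (((FinDep.vf s).comp (FinDep.vf t)).sub ((FinDep.vf t).comp (FinDep.vf s))) ?_
  rintro (k | m)
  · simp only [LinearMap.sub_apply, LinearMap.comp_apply, vf_X_inl, IsDer.vf s _ _,
      IsDer.vf t _ _, map_smul, Submodule.coe_sub, Pi.sub_apply, tl_apply, mul_smul_comm]
    rw [← smul_sub, mul_left_comm (t.1 0) (s.1 0)]
    congr 1
    ring
  · simp only [vf_X_inr, LinearMap.sub_apply, LinearMap.comp_apply, Submodule.coe_sub,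
      Pi.sub_apply, tl_apply]

/-- Vector fields as endomorphisms of `T^*`. -/
def vfT : TLs α w →ₗ[ℝ] Module.End ℝ Tstar where
  toFun s := (vf s).restrict (vf_mem_Tstar s)
  map_add' s t := by ext; simp
  map_smul' c s := by ext; simp

@[simp] theorem coe_vfT (s : TLs α w) (F : Tstar) : (vfT s F : PS) = vf s F := rfl

theorem vfT_bracket (s t : TLs α w) : vfT (tl s t - tl t s) = ⁅vfT s, vfT t⁆ := by
  refine LinearMap.ext fun F => Subtype.ext ?_
  rw [coe_vfT, vf_bracket]
  rfl

theorem X_mem_Tstar (v : Var) : (X v : PS) ∈ Tstar := by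
  classical
  intro γ h
  rw [coeff_X] at h
  split_ifs at h with hγ
  · subst hγ
    rcases v with k | n
    · left
      rw [br_single_inl]
      omega
    · exact Or.inr ⟨n, rfl⟩
  · exact absurd rfl h

/-- The symbol is recovered from the values on variables: $s_m$ is the image of $z_m$ for $m\neq0$,
and $s_0z_1$ is the image of $z_0$, where $z_1$ can be cancelled in a domain. -/
theorem vfT_injective : Function.Injective (vfT : TLs α w →ₗ[ℝ] _) := by
  rw [injective_iff_map_eq_zero]
  intro s hs
  have key : ∀ v, vf s (X v) = 0 := by
    intro v
    have := LinearMap.congr_fun hs ⟨X v, X_mem_Tstar v⟩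
    exact congrArg Subtype.val this
  ext1
  funext n
  by_cases hn : n = 0
  · subst hn
    have h0 := key (Sum.inl 0)
    rw [vf_X_inl] at h0
    simp only [CharP.cast_eq_zero, zero_add, one_smul, mul_eq_zero] at h0
    refine h0.resolve_right fun h1 => ?_
    have := congrArg (coeff (Finsupp.single (Sum.inl 1) 1)) h1
    simp at this
  · rw [← vf_X_inr s ⟨n, hn⟩, key]
    rfl

end VF

end

end ShiftTilt

/-! ### The Lie algebra of generators and its partial pre-Lie product -/

namespace ShiftTilt

noncomputable section

open MvPowerSeries

/-! ### Symbols of the generators -/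

theorem span_range_span {ι M : Type} [AddCommGroup M] [Module ℝ M] (v : ι → M) :
    Submodule.span ℝ (Set.range fun i =>
      (⟨v i, Submodule.subset_span ⟨i, rfl⟩⟩ : Submodule.span ℝ (Set.range v))) = ⊤ := by
  rw [← Submodule.span_span_coe_preimage (R := ℝ) (s := Set.range v)]
  congr 1
  ext Y
  simp only [Set.mem_range, Set.mem_preimage]
  exact exists_congr fun q => Subtype.ext_iff

theorem span_genLt (α : ℝ) (w : N2 →+ ℝ) : Submodule.span ℝ (Set.range (genLt α w)) = ⊤ := span_range_span _

theorem Ltilde_ext {α : ℝ} {w : N2 →+ ℝ} {M : Type} [AddCommGroup M] [Module ℝ M] {f g : Ltilde α w →ₗ[ℝ] M}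
    (h : ∀ q, f (genLt α w q) = g (genLt α w q)) : f = g :=
  LinearMap.ext_on_range (span_genLt α w) h

section Symbols

variable {α : ℝ} {w : N2 →+ ℝ}

theorem add_unitVec_ne_zero (n : N2) (i : Fin 2) : n + unitVec i ≠ 0 := by
  intro h
  have := DFunLike.congr_fun h i
  simp [unitVec] at this

theorem zp_add_unitVec (n : N2) (i : Fin 2) :
    zp (n + unitVec i) = X (Sum.inr ⟨n + unitVec i, add_unitVec_ne_zero n i⟩) := by
  rw [zp, dif_pos (add_unitVec_ne_zero n i)]

theorem single_mem_TLs {n : N2} {P : PS}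
    (hP : ∀ γ, coeff γ P ≠ 0 → 0 ≤ br γ ∧ w n < homog α w γ) : Pi.single n P ∈ TLs α w := by
  classical
  intro m γ h
  by_cases hm : m = n
  · subst hm
    rw [Pi.single_eq_same] at h
    exact ⟨Or.inl (hP γ h).1, (hP γ h).2⟩
  · rw [Pi.single_eq_of_ne hm] at h
    simp at h

theorem adm_zmon (q : TiltIdx α w) (γ : MIdx) (h : coeff γ (zmon q.1.1) ≠ 0) :
    0 ≤ br γ ∧ w q.1.2 < homog α w γ := by
  classical
  rw [coeff_zmon] at h
  split_ifs at h with hγ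
  · subst hγ
    exact q.2
  · exact absurd rfl h

/-- The coordinates of a coefficient family with respect to the generators. -/
def coordS : LIdx α w → TLs α w →ₗ[ℝ] ℝ
  | Sum.inl q => coeff q.1.1 ∘ₗ LinearMap.proj q.1.2 ∘ₗ (TLs α w).subtype
  -- The generator $\partial_i$ is detected at $n=0$ by the coefficient of $z_{\mathbf e_i}$. No
  -- tilt generator contributes there, because $[e_{\mathbf e_i}]=-1$.
  | Sum.inr i => coeff (Finsupp.single (Sum.inr ⟨unitVec i, by simp [unitVec]⟩) 1) ∘ₗ
      LinearMap.proj 0 ∘ₗ (TLs α w).subtype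

theorem coordS_inl (q : TiltIdx α w) (s : TLs α w) :
    coordS (Sum.inl q) s = coeff q.1.1 (s.1 q.1.2) := rfl

theorem coordS_inr (i : Fin 2) (s : TLs α w) : coordS (Sum.inr i) s =
    coeff (Finsupp.single (Sum.inr ⟨unitVec i, by simp [unitVec]⟩) 1) (s.1 0) := rfl

variable [Pos α w]

theorem coeff_zp_ne_zero {n : N2} {γ : MIdx} (h : coeff γ (zp n) ≠ 0) :
    ∃ hn : n ≠ 0, γ = Finsupp.single (Sum.inr ⟨n, hn⟩) 1 := by
  classical
  unfold zp at h
  split_ifs at h with hn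
  · rw [coeff_X] at h
    split_ifs at h with hγ
    · exact ⟨hn, hγ⟩
    · exact absurd rfl h
  · simp at h

/-- The coefficient families of the generators. -/
def symb : LIdx α w → TLs α w
  | Sum.inl q => ⟨Pi.single q.1.2 (zmon q.1.1), single_mem_TLs (adm_zmon q)⟩
  | Sum.inr i => ⟨fun n => ((n i : ℝ) + 1) • zp (n + unitVec i), fun n γ h => by
      have h' : coeff γ (zp (n + unitVec i)) ≠ 0 := fun h0 => h (by simp [h0])
      obtain ⟨hn, rfl⟩ := coeff_zp_ne_zero h'
      refine ⟨Or.inr ⟨_, rfl⟩, ?_⟩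
      rw [homog_single_inr, map_add]
      linarith [Pos.weight_pos (α := α) (w := w) i]⟩

theorem symb_inl (q : TiltIdx α w) :
    (symb (Sum.inl q) : TLs α w).1 = Pi.single q.1.2 (zmon q.1.1) := rfl

theorem symb_inr (i : Fin 2) (n : N2) :
    (symb (Sum.inr i) : TLs α w).1 n = ((n i : ℝ) + 1) • zp (n + unitVec i) := rfl

theorem vf_single {n : N2} {P : PS} (h : Pi.single n P ∈ TLs α w) (F : PS) :
    vf ⟨Pi.single n P, h⟩ F = P * Dtilt n F := by
  classical
  rw [vf_apply, formalSum_single n]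
  · simp
  · intro m hm
    simp [Pi.single_eq_of_ne hm]

theorem gen_eq (q : LIdx α w) : gen α w q = vfT (symb q) := by
  refine LinearMap.ext fun F => Subtype.ext ?_
  rw [coe_vfT]
  rcases q with q | i
  · exact (vf_single _ _).symm
  · rw [vf_apply]
    change Dshift i F = _
    simp only [symb_inr, smul_mul_assoc]
    rfl

/-- The span of the coefficient families of the generators. -/
def LSym (α : ℝ) (w : N2 →+ ℝ) [Pos α w] : Submodule ℝ (TLs α w) := Submodule.span ℝ (Set.range symb)

/-- The span of the coefficient families of the tilt generators. -/
def LtSym (α : ℝ) (w : N2 →+ ℝ) [Pos α w] : Submodule ℝ (TLs α w) :=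
  Submodule.span ℝ (Set.range fun q : TiltIdx α w => symb (Sum.inl q))

theorem LtSym_le : LtSym α w ≤ LSym α w := by
  refine Submodule.span_mono ?_
  rintro _ ⟨q, rfl⟩
  exact ⟨_, rfl⟩

/-- The polynomials among the power series. -/
def polys : Subalgebra ℝ PS := (MvPolynomial.coeToMvPowerSeries.algHom (σ := Var) (R := ℝ) ℝ).range

theorem mem_polys {F : PS} : F ∈ polys ↔ ∃ P : MvPolynomial Var ℝ, (P : PS) = F := by
  simp only [polys, AlgHom.mem_range]
  refine exists_congr fun P => ?_
  rw [MvPolynomial.coeToMvPowerSeries.algHom_apply]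
  simp

theorem X_mem_polys (v : Var) : (X v : PS) ∈ polys := mem_polys.2 ⟨MvPolynomial.X v, by simp⟩

theorem zmon_mem_polys (γ : MIdx) : zmon γ ∈ polys :=
  mem_polys.2 ⟨MvPolynomial.monomial γ 1, by simp⟩

theorem symb_mem_polys (q : LIdx α w) (n : N2) : (symb q).1 n ∈ polys := by
  classical
  rcases q with q | i
  · rw [symb_inl]
    by_cases hn : n = q.1.2
    · subst hn
      rw [Pi.single_eq_same]
      exact zmon_mem_polys _
    · rw [Pi.single_eq_of_ne hn]
      exact zero_mem _
  · rw [symb_inr, zp_add_unitVec]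
    exact Subalgebra.smul_mem _ (X_mem_polys _) _

theorem LSym_mem_polys {s : TLs α w} (hs : s ∈ LSym α w) (n : N2) : s.1 n ∈ polys := by
  induction hs using Submodule.span_induction with
  | mem x h =>
    obtain ⟨q, rfl⟩ := h
    exact symb_mem_polys q n
  | zero => exact zero_mem _
  | add x y _ _ hx hy => exact add_mem hx hy
  | smul c x _ hx => exact Subalgebra.smul_mem _ hx c

theorem vf_mem_polys {s : TLs α w} (hs : s ∈ LSym α w) {F : PS} (hF : F ∈ polys) :
    vf s F ∈ polys := by
  obtain ⟨P, rfl⟩ := mem_polys.1 hF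
  clear hF
  induction P using MvPolynomial.induction_on with
  | C a =>
    rw [MvPolynomial.coe_C, ← mul_one (C a), ← MvPowerSeries.smul_eq_C_mul, map_smul,
      (IsDer.vf s).one, smul_zero]
    exact zero_mem _
  | add p q hp hq =>
    rw [MvPolynomial.coe_add, map_add]
    exact add_mem hp hq
  | mul_X p v hp =>
    rw [MvPolynomial.coe_mul, MvPolynomial.coe_X, IsDer.vf s]
    refine add_mem (mul_mem (mem_polys.2 ⟨p, rfl⟩) ?_) (mul_mem hp (X_mem_polys v))
    rcases v with k | m
    · rw [vf_X_inl]
      exact mul_mem (LSym_mem_polys hs 0) (Subalgebra.smul_mem _ (X_mem_polys _) _)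
    · rw [vf_X_inr]
      exact LSym_mem_polys hs _

/-- $\mathsf L$ consists of finite combinations of generators, whereas `TLs` allows infinite ones. A
symbol concentrated at one $n$ belongs to the span as soon as its component is an admissible
polynomial, and polynomiality is preserved by the action of $\mathsf L$. -/
theorem single_mem_LtSym {n : N2} {P : PS} (hP : P ∈ polys)
    (hadm : ∀ γ, coeff γ P ≠ 0 → 0 ≤ br γ ∧ w n < homog α w γ) {s : TLs α w}
    (hs : s.1 = Pi.single n P) : s ∈ LtSym α w := by
  classical
  obtain ⟨Q, rfl⟩ := mem_polys.1 hP
  have hadm' : ∀ γ ∈ Q.support, 0 ≤ br γ ∧ w n < homog α w γ := by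
    intro γ hγ
    refine hadm γ ?_
    rw [MvPolynomial.coeff_coe]
    exact MvPolynomial.mem_support_iff.1 hγ
  have : s = ∑ γ ∈ Q.support.attach, Q.coeff γ.1 •
      (symb (Sum.inl ⟨(γ.1, n), hadm' γ.1 γ.2⟩) : TLs α w) := by
    ext1
    rw [hs, Submodule.coe_sum]
    simp only [Submodule.coe_smul, symb_inl]
    rw [Finset.sum_attach Q.support fun γ => Q.coeff γ • (Pi.single n (zmon γ) : N2 → PS)]
    funext m
    rw [Finset.sum_apply]
    by_cases hm : m = n
    · subst hm
      simp only [Pi.smul_apply, Pi.single_eq_same]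
      ext δ
      simp only [MvPolynomial.coeff_coe, map_sum, coeff_smul, coeff_zmon]
      simp
    · simp [Pi.single_eq_of_ne hm]
  rw [this]
  exact Submodule.sum_mem _ fun γ _ => Submodule.smul_mem _ _ (Submodule.subset_span ⟨_, rfl⟩)

theorem adm_vf_zmon (s : TLs α w) (q : TiltIdx α w) (γ : MIdx)
    (h : coeff γ (vf s (zmon q.1.1)) ≠ 0) : 0 ≤ br γ ∧ w q.1.2 < homog α w γ := by
  obtain ⟨δ, h1, h2, h3⟩ := exists_of_coeff_vf s h
  obtain ⟨h4, h5⟩ := adm_zmon q δ h1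
  exact ⟨h4.trans h2, h5.trans h3⟩

theorem tl_symb_inl (s : TLs α w) (q : TiltIdx α w) :
    (tl s (symb (Sum.inl q))).1 = Pi.single q.1.2 (vf s (zmon q.1.1)) := by
  classical
  funext m
  rw [tl_apply, symb_inl]
  by_cases hm : m = q.1.2
  · subst hm
    simp
  · simp [Pi.single_eq_of_ne hm]

theorem tl_mem_LtSym {s t : TLs α w} (hs : s ∈ LSym α w) (ht : t ∈ LtSym α w) :
    tl s t ∈ LtSym α w := by
  induction ht using Submodule.span_induction with
  | mem x h =>
    obtain ⟨q, rfl⟩ := h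
    exact single_mem_LtSym (vf_mem_polys hs (zmon_mem_polys _)) (adm_vf_zmon s q) (tl_symb_inl s q)
  | zero =>
    rw [map_zero]
    exact zero_mem _
  | add x y _ _ hx hy =>
    rw [map_add]
    exact add_mem hx hy
  | smul c x _ hx =>
    rw [map_smul]
    exact Submodule.smul_mem _ c hx

/-- $z^\gamma D^{(n)}$ only sees the variable $z_n$ in the components $(m_i+1)z_{m+\mathbf e_i}$ of
$\partial_i$, hence $m=n-\mathbf e_i$. If $n_i=0$ the truncated difference is meaningless, but the
factor $n_i$ then vanishes. -/
theorem tl_symb_inl_inr (q : TiltIdx α w) (i : Fin 2) :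
    (tl (symb (Sum.inl q)) (symb (Sum.inr i))).1 =
      Pi.single (q.1.2 - unitVec i) ((q.1.2 i : ℝ) • zmon q.1.1) := by
  classical
  funext n
  rw [tl_apply, symb_inr, zp_add_unitVec, map_smul, vf_X_inr, symb_inl]
  by_cases hn : n + unitVec i = q.1.2
  · rw [← hn]
    simp
  · rw [Pi.single_eq_of_ne hn, smul_zero]
    by_cases hq : q.1.2 i = 0
    · simp [hq]
    · rw [Pi.single_eq_of_ne]
      rintro rfl
      apply hn
      refine tsub_add_cancel_of_le ?_
      rw [unitVec, Finsupp.single_le_iff]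
      omega

theorem w_tsub_le (α : ℝ) (w : N2 →+ ℝ) [Pos α w] (n m : N2) : w (n - m) ≤ w n := by
  have h : n - m ≤ n := tsub_le_self
  obtain ⟨k, hk⟩ := exists_add_of_le h
  conv_rhs => rw [hk, map_add]
  linarith [w_nonneg α w k]

theorem tl_symb_inl_inr_mem (q : TiltIdx α w) (i : Fin 2) :
    tl (symb (Sum.inl q)) (symb (Sum.inr i)) ∈ LtSym α w := by
  refine single_mem_LtSym (Subalgebra.smul_mem _ (zmon_mem_polys _) _) ?_ (tl_symb_inl_inr q i)
  intro γ h
  have h' : coeff γ (zmon q.1.1) ≠ 0 := fun h0 => h (by rw [coeff_smul, h0, mul_zero])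
  obtain ⟨h1, h2⟩ := adm_zmon q γ h'
  exact ⟨h1, (w_tsub_le α w _ _).trans_lt h2⟩

theorem tl_symb_inr_inr (i j : Fin 2) :
    (tl (symb (Sum.inr i)) (symb (Sum.inr j)) : TLs α w) =
      tl (symb (Sum.inr j)) (symb (Sum.inr i)) := by
  ext1
  funext n
  simp only [tl_apply, symb_inr, zp_add_unitVec, map_smul, vf_X_inr]
  simp only [← zp_add_unitVec]
  rw [smul_smul, smul_smul, add_right_comm]
  congr 1
  rcases eq_or_ne i j with rfl | h
  · rfl
  · simp [unitVec, h, h.symm, mul_comm]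

/-- By bilinearity it is enough to treat generators: a bracket involving a tilt generator is a
combination of tilt generators, and $\partial_1,\partial_2$ commute. -/
theorem bracket_mem_LSym {s t : TLs α w} (hs : s ∈ LSym α w) (ht : t ∈ LSym α w) :
    tl s t - tl t s ∈ LSym α w := by
  have hsym : ∀ q, symb q ∈ LSym α w := fun q => Submodule.subset_span ⟨q, rfl⟩
  have htsym : ∀ q, symb (Sum.inl q) ∈ LtSym α w := fun q => Submodule.subset_span ⟨q, rfl⟩
  induction hs, ht using Submodule.span_induction₂ with
  | mem_mem x y hx hy =>
    obtain ⟨q, rfl⟩ := hx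
    obtain ⟨q', rfl⟩ := hy
    rcases q with q | i <;> rcases q' with q' | j
    · exact LtSym_le (sub_mem (tl_mem_LtSym (hsym _) (htsym _)) (tl_mem_LtSym (hsym _) (htsym _)))
    · exact LtSym_le (sub_mem (tl_symb_inl_inr_mem _ _) (tl_mem_LtSym (hsym _) (htsym _)))
    · exact LtSym_le (sub_mem (tl_mem_LtSym (hsym _) (htsym _)) (tl_symb_inl_inr_mem _ _))
    · rw [tl_symb_inr_inr, sub_self]
      exact zero_mem _
  | zero_left y _ => simp
  | zero_right x _ => simp
  | add_left x y z _ _ _ hx hy =>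
    have : tl (x + y) z - tl z (x + y) = (tl x z - tl z x) + (tl y z - tl z y) := by
      simp only [map_add, LinearMap.add_apply]
      abel
    rw [this]
    exact add_mem hx hy
  | add_right x y z _ _ _ hx hy =>
    have : tl x (y + z) - tl (y + z) x = (tl x y - tl y x) + (tl x z - tl z x) := by
      simp only [map_add, LinearMap.add_apply]
      abel
    rw [this]
    exact add_mem hx hy
  | smul_left c x y _ _ h =>
    have : tl (c • x) y - tl y (c • x) = c • (tl x y - tl y x) := by
      simp only [map_smul, LinearMap.smul_apply, smul_sub]
    rw [this]
    exact Submodule.smul_mem _ c h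
  | smul_right c x y _ _ h =>
    have : tl x (c • y) - tl (c • y) x = c • (tl x y - tl y x) := by
      simp only [map_smul, LinearMap.smul_apply, smul_sub]
    rw [this]
    exact Submodule.smul_mem _ c h

/-! ### The Lie algebra `L` -/

theorem map_LSym : (LSym α w).map vfT = Submodule.span ℝ (Set.range (gen α w)) := by
  rw [LSym, Submodule.map_span, ← Set.range_comp]
  congr 2
  funext q
  exact (gen_eq q).symm

theorem L_toSubmodule : (L α w).toSubmodule = Submodule.span ℝ (Set.range (gen α w)) := by
  -- The plain span is already a Lie subalgebra containing the generators, so the Lie span cannot be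
  -- larger.
  let K : LieSubalgebra ℝ (Module.End ℝ Tstar) :=
    { (LSym α w).map vfT with
      lie_mem' := by
        rintro _ _ ⟨s, hs, rfl⟩ ⟨t, ht, rfl⟩
        exact ⟨_, bracket_mem_LSym hs ht, vfT_bracket s t⟩ }
  have hK : K.toSubmodule = (LSym α w).map vfT := rfl
  refine le_antisymm ?_ (Submodule.span_le.2 LieSubalgebra.subset_lieSpan)
  rw [← map_LSym, ← hK]
  have : L α w ≤ K := by
    refine LieSubalgebra.lieSpan_le.2 ?_
    rintro _ ⟨q, rfl⟩
    exact ⟨symb q, Submodule.subset_span ⟨q, rfl⟩, (gen_eq q).symm⟩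
  exact this

theorem vfT_mem_L {s : TLs α w} (hs : s ∈ LSym α w) : vfT s ∈ L α w := by
  change vfT s ∈ (L α w).toSubmodule
  rw [L_toSubmodule, ← map_LSym]
  exact ⟨s, hs, rfl⟩

/-- The identification of `L` with coefficient families. -/
def symEquiv (α : ℝ) (w : N2 →+ ℝ) [Pos α w] : LSym α w ≃ₗ[ℝ] L α w :=
  LinearEquiv.ofBijective
    ({ toFun := fun s => ⟨vfT s.1, vfT_mem_L s.2⟩
       map_add' := fun s t => Subtype.ext (by simp)
       map_smul' := fun c s => Subtype.ext (by simp) } : LSym α w →ₗ[ℝ] L α w)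
    ⟨fun s t h => Subtype.ext (vfT_injective (congrArg Subtype.val h)), fun D => by
      have hD : D.1 ∈ (L α w).toSubmodule := D.2
      rw [L_toSubmodule, ← map_LSym] at hD
      obtain ⟨s, hs, h⟩ := hD
      exact ⟨⟨s, hs⟩, Subtype.ext h⟩⟩

/-- The coefficient family of an element of `L`. -/
def sg : L α w →ₗ[ℝ] TLs α w := (LSym α w).subtype ∘ₗ (symEquiv α w).symm.toLinearMap

theorem sg_symEquiv (s : LSym α w) : sg (symEquiv α w s) = s.1 :=
  congrArg Subtype.val ((symEquiv α w).symm_apply_apply s)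

theorem sg_mem (D : L α w) : sg D ∈ LSym α w := ((symEquiv α w).symm D).2

theorem vfT_sg (D : L α w) : vfT (sg D) = D.1 :=
  congrArg Subtype.val ((symEquiv α w).apply_symm_apply D)

theorem coe_apply_eq_vf (D : L α w) (F : Tstar) : ((D : Module.End ℝ Tstar) F : PS) = vf (sg D) F := by
  rw [← coe_vfT, vfT_sg]

theorem sg_injective : Function.Injective (sg : L α w →ₗ[ℝ] TLs α w) :=
  Subtype.val_injective.comp (symEquiv α w).symm.injective

theorem sg_eq_of_vfT {D : L α w} {s : TLs α w} (h : vfT s = D.1) : sg D = s :=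
  vfT_injective ((vfT_sg D).trans h.symm)

theorem sg_genL (q : LIdx α w) : sg (genL α w q) = symb q := sg_eq_of_vfT (gen_eq q).symm

theorem sg_lie (D D' : L α w) : sg ⁅D, D'⁆ = tl (sg D) (sg D') - tl (sg D') (sg D) := by
  refine sg_eq_of_vfT ?_
  rw [vfT_bracket, vfT_sg, vfT_sg]
  rfl

theorem map_sg_Ltilde : (Ltilde α w).map sg = LtSym α w := by
  rw [Ltilde, Submodule.map_span, ← Set.range_comp, LtSym]
  congr 2
  funext q
  exact sg_genL _

theorem sg_mem_LtSym_iff {D : L α w} : sg D ∈ LtSym α w ↔ D ∈ Ltilde α w := by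
  rw [← map_sg_Ltilde]
  constructor
  · rintro ⟨D', h, h'⟩
    rwa [← sg_injective h']
  · exact fun h => ⟨D, h, rfl⟩

theorem coordS_symb [DecidableEq (LIdx α w)] (q q' : LIdx α w) :
    coordS q (symb q') = if q = q' then 1 else 0 := by
  classical
  rcases q with q | i <;> rcases q' with q' | j
  · rw [coordS_inl, symb_inl]
    by_cases h : q.1.2 = q'.1.2
    · rw [h, Pi.single_eq_same, coeff_zmon]
      refine if_congr ?_ rfl rfl
      rw [Sum.inl.injEq, Subtype.ext_iff, Prod.ext_iff]
      exact ⟨fun h1 => ⟨h1, h⟩, fun h1 => h1.1⟩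
    · rw [Pi.single_eq_of_ne h, if_neg]
      · simp
      · rintro ⟨⟩
        exact h rfl
  · rw [coordS_inl, symb_inr, if_neg (by simp)]
    by_contra h
    rw [coeff_smul] at h
    obtain ⟨hn, h1⟩ := coeff_zp_ne_zero (right_ne_zero_of_mul h)
    have := q.2.1
    rw [h1, br_single_inr] at this
    omega
  · rw [coordS_inr, symb_inl, if_neg (by simp)]
    by_contra h
    by_cases h0 : 0 = q'.1.2
    · rw [← h0, Pi.single_eq_same] at h
      have := (adm_zmon q' _ h).1
      rw [br_single_inr] at this
      omega
    · rw [Pi.single_eq_of_ne h0] at h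
      simp at h
  · rw [coordS_inr, symb_inr, coeff_smul, zp_add_unitVec, coeff_X]
    simp only [Finsupp.coe_zero, Pi.zero_apply, CharP.cast_eq_zero, zero_add, one_mul]
    refine if_congr ?_ rfl rfl
    constructor
    · intro h
      have := Finsupp.single_left_injective one_ne_zero h
      simp only [Sum.inr.injEq, Subtype.mk.injEq] at this
      rw [Finsupp.single_left_injective one_ne_zero this]
    · intro h
      rw [Sum.inr.inj h]

theorem linearIndependent_symb : LinearIndependent ℝ (symb : LIdx α w → TLs α w) := by
  classical
  rw [linearIndependent_iff]
  intro l hl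
  ext q
  have := congrArg (coordS q) hl
  rw [map_zero, Finsupp.linearCombination_apply, Finsupp.sum, map_sum] at this
  simp only [map_smul, coordS_symb, smul_eq_mul, mul_ite, mul_one, mul_zero] at this
  simpa using this

theorem linearIndependent_gen : LinearIndependent ℝ (gen α w) := by
  have key : ∀ l : LIdx α w →₀ ℝ,
      Finsupp.linearCombination ℝ (gen α w) l = vfT (Finsupp.linearCombination ℝ symb l) := by
    intro l
    rw [Finsupp.linearCombination_apply, Finsupp.linearCombination_apply,
      Finsupp.sum, Finsupp.sum, map_sum]
    exact Finset.sum_congr rfl fun q _ => by rw [map_smul, gen_eq]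
  intro l l' h
  rw [key, key] at h
  exact linearIndependent_symb (vfT_injective h)

/-! ### The partial pre-Lie product -/

/-- The element `D ◁ X` of `L̃`. -/
def triFun (D : L α w) (Y : Ltilde α w) : Ltilde α w :=
  ⟨symEquiv α w ⟨tl (sg D) (sg Y), LtSym_le (tl_mem_LtSym (sg_mem D) (sg_mem_LtSym_iff.2 Y.2))⟩, by
    rw [← sg_mem_LtSym_iff, sg_symEquiv]
    exact tl_mem_LtSym (sg_mem D) (sg_mem_LtSym_iff.2 Y.2)⟩

theorem sg_triFun (D : L α w) (Y : Ltilde α w) : sg (triFun D Y : L α w) = tl (sg D) (sg Y) := by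
  unfold triFun
  exact sg_symEquiv _

/-- The pre-Lie product `◁`. -/
def triL : L α w →ₗ[ℝ] Ltilde α w →ₗ[ℝ] Ltilde α w :=
  LinearMap.mk₂ ℝ triFun
    (by
      intros
      refine Subtype.ext (sg_injective ?_)
      simp only [Submodule.coe_add, map_add, sg_triFun, LinearMap.add_apply])
    (by
      intros
      refine Subtype.ext (sg_injective ?_)
      simp only [Submodule.coe_smul, map_smul, sg_triFun, LinearMap.smul_apply])
    (by
      intros
      refine Subtype.ext (sg_injective ?_)
      simp only [Submodule.coe_add, map_add, sg_triFun])
    (by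
      intros
      refine Subtype.ext (sg_injective ?_)
      simp only [Submodule.coe_smul, map_smul, sg_triFun])

theorem sg_tri (D : L α w) (Y : Ltilde α w) : sg (triL D Y : L α w) = tl (sg D) (sg Y) :=
  sg_triFun D Y

theorem sg_genLt (q : TiltIdx α w) : sg (genLt α w q : L α w) = symb (Sum.inl q) := sg_genL _

theorem isPreLieProduct_triL : IsPreLieProduct (triL : L α w →ₗ[ℝ] _) := by
  intro D q F
  rw [coe_apply_eq_vf, sg_tri, sg_genLt, coe_apply_eq_vf]
  have := tl_symb_inl (sg D) q
  have h : (⟨Pi.single q.1.2 (vf (sg D) (zmon q.1.1)), this ▸ (tl _ _).2⟩ : TLs α w) =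
      tl (sg D) (symb (Sum.inl q)) := Subtype.ext this.symm
  rw [← h, vf_single]
  rfl

theorem span_genL : Submodule.span ℝ (Set.range (genL α w)) = ⊤ := by
  rw [eq_top_iff]
  intro D _
  have h : sg D ∈ LSym α w := sg_mem D
  have h' : LSym α w = (Submodule.span ℝ (Set.range (genL α w))).map sg := by
    rw [LSym, Submodule.map_span, ← Set.range_comp]
    congr 2
    funext q
    exact (sg_genL q).symm
  rw [h'] at h
  obtain ⟨D', h1, h2⟩ := h
  rwa [← sg_injective h2]

theorem triL_unique {tri : L α w →ₗ[ℝ] Ltilde α w →ₗ[ℝ] Ltilde α w} (h : IsPreLieProduct tri) :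
    tri = triL := by
  refine LinearMap.ext fun D => Ltilde_ext fun q => ?_
  refine Subtype.ext (Subtype.ext (LinearMap.ext fun F => Subtype.ext ?_))
  rw [h D q F, isPreLieProduct_triL D q F]

theorem lie_eq_triL (Y Z : Ltilde α w) :
    ⁅(Y : L α w), (Z : L α w)⁆ = (triL Y Z : L α w) - (triL Z Y : L α w) := by
  refine sg_injective ?_
  rw [sg_lie, map_sub, sg_tri, sg_tri]

/-- On symbols $D\triangleleft$ is the componentwise action of the vector field $D$, so this is the
representation property of `vf`. -/
theorem triL_lie (D D' : L α w) (Y : Ltilde α w) :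
    triL ⁅D, D'⁆ Y = triL D (triL D' Y) - triL D' (triL D Y) := by
  refine Subtype.ext (sg_injective (Subtype.ext (funext fun n => ?_)))
  rw [Submodule.coe_sub, map_sub]
  simp only [sg_tri, sg_lie, Submodule.coe_sub, Pi.sub_apply, tl_apply, vf_bracket,
    LinearMap.sub_apply, LinearMap.comp_apply]

theorem lie_inl_inr_apply (q : TiltIdx α w) (i : Fin 2) (F : Tstar) :
    (((⁅genL α w (Sum.inl q), genL α w (Sum.inr i)⁆ : L α w) : Module.End ℝ Tstar) F : PS) =
      (q.1.2 i : ℝ) • (zmon q.1.1 * Dtilt (q.1.2 - unitVec i) (F : PS)) -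
      (((triL (genL α w (Sum.inr i)) (genLt α w q) : L α w) : Module.End ℝ Tstar) F : PS) := by
  rw [coe_apply_eq_vf, coe_apply_eq_vf, sg_lie, sg_tri, map_sub, LinearMap.sub_apply, sg_genLt,
    sg_genL, sg_genL]
  congr 1
  have h := tl_symb_inl_inr q i
  have h' : (⟨_, h ▸ (tl _ _).2⟩ : TLs α w) = tl (symb (Sum.inl q)) (symb (Sum.inr i)) :=
    Subtype.ext h.symm
  rw [← h', vf_single, smul_mul_assoc]

end Symbols

end

end ShiftTilt

/-! ### Generalities on universal enveloping algebras -/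

namespace ShiftTilt

noncomputable section

/-! ### Enveloping algebras -/

section Envelope

variable {K : Type} [LieRing K] [LieAlgebra ℝ K]

local notation "UK" => UniversalEnvelopingAlgebra ℝ K
local notation "ιK" => UniversalEnvelopingAlgebra.ι ℝ (L := K)

/-- The elements whose left multiplication preserves $P$ form a subalgebra containing the Lie
algebra. By the universal property the inclusion of this subalgebra has a right inverse, so it is
everything; it is then applied to $1$. -/
theorem envelope_induction {P : UK → Prop} (one : P 1)
    (mul : ∀ D u, P u → P (ιK D * u)) (add : ∀ u v, P u → P v → P (u + v))
    (smul : ∀ (c : ℝ) u, P u → P (c • u)) (u : UK) : P u := by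
  let N : Submodule ℝ UK :=
    { carrier := {u | P u}
      zero_mem' := by simpa using smul 0 1 one
      add_mem' := fun {u v} hu hv => add u v hu hv
      smul_mem' := fun c u hu => smul c u hu }
  let S : Subalgebra ℝ UK :=
    { carrier := {a | ∀ u ∈ N, a * u ∈ N}
      mul_mem' := by
        intro a b ha hb u hu
        rw [mul_assoc]
        exact ha _ (hb u hu)
      add_mem' := by
        intro a b ha hb u hu
        rw [add_mul]
        exact add_mem (ha u hu) (hb u hu)
      algebraMap_mem' := by
        intro c u hu
        rw [← Algebra.smul_def]
        exact N.smul_mem c hu }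
  let f : K →ₗ⁅ℝ⁆ S :=
    { toFun := fun D => ⟨ιK D, fun u hu => mul D u hu⟩
      map_add' := fun x y => Subtype.ext (by simp)
      map_smul' := fun c x => Subtype.ext (by simp)
      map_lie' := fun {x y} => Subtype.ext (LieHom.map_lie ιK x y) }
  have h : S.val.comp (UniversalEnvelopingAlgebra.lift ℝ f) = AlgHom.id ℝ UK := by
    refine UniversalEnvelopingAlgebra.hom_ext ℝ (LieHom.ext fun D => ?_)
    change S.val (UniversalEnvelopingAlgebra.lift ℝ f (ιK D)) = ιK D
    rw [UniversalEnvelopingAlgebra.lift_ι_apply]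
    rfl
  have h2 : u ∈ S := by
    have := AlgHom.congr_fun h u
    rw [AlgHom.id_apply] at this
    rw [← this]
    exact (UniversalEnvelopingAlgebra.lift ℝ f u).2
  have h3 := h2 1 one
  rwa [mul_one] at h3

theorem cop_ι (D : K) : cop (ιK D) = ιK D ⊗ₜ[ℝ] 1 + 1 ⊗ₜ[ℝ] ιK D :=
  UniversalEnvelopingAlgebra.lift_ι_apply ℝ _ D

theorem counitU_ι (D : K) : counitU (ιK D) = 0 :=
  UniversalEnvelopingAlgebra.lift_ι_apply ℝ _ D

theorem antipodeU_ι (D : K) : antipodeU (ιK D) = -ιK D :=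
  congrArg MulOpposite.unop (UniversalEnvelopingAlgebra.lift_ι_apply ℝ _ D)

theorem antipodeU_mul (u v : UK) : antipodeU (u * v) = antipodeU v * antipodeU u := by
  simp [antipodeU]

theorem antipodeU_one : antipodeU (1 : UK) = 1 := by
  simp [antipodeU]

theorem counitU_ι_mul (D : K) (u : UK) : counitU (ιK D * u) = 0 := by
  rw [map_mul, counitU_ι, zero_mul]

/-- Both sides are algebra morphisms, hence it is enough to compare them on primitive elements. The
counit laws are treated in the same way. -/
theorem cop_coassoc : (TensorProduct.assoc ℝ UK UK UK).toLinearMap ∘ₗ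
    (cop (K := K)).toLinearMap.rTensor UK ∘ₗ (cop (K := K)).toLinearMap =
    (cop (K := K)).toLinearMap.lTensor UK ∘ₗ (cop (K := K)).toLinearMap := by
  have h : ((Algebra.TensorProduct.assoc ℝ ℝ ℝ UK UK UK).toAlgHom.comp
      ((Algebra.TensorProduct.map (cop (K := K)) (AlgHom.id ℝ UK)).comp cop)) =
      (Algebra.TensorProduct.map (AlgHom.id ℝ UK) (cop (K := K))).comp cop := by
    refine UniversalEnvelopingAlgebra.hom_ext ℝ (LieHom.ext fun D => ?_)
    change Algebra.TensorProduct.assoc ℝ ℝ ℝ UK UK UK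
      (Algebra.TensorProduct.map cop (AlgHom.id ℝ UK) (cop (ιK D))) =
      Algebra.TensorProduct.map (AlgHom.id ℝ UK) cop (cop (ιK D))
    simp only [cop_ι, map_add, Algebra.TensorProduct.map_tmul, AlgHom.id_apply, map_one,
      TensorProduct.add_tmul, TensorProduct.tmul_add, Algebra.TensorProduct.assoc_tmul,
      Algebra.TensorProduct.one_def]
    abel
  exact congrArg AlgHom.toLinearMap h

theorem cop_counit_left (x : UK) :
    TensorProduct.lid ℝ UK ((counitU (K := K)).toLinearMap.rTensor UK (cop x)) = x := by
  have h : (Algebra.TensorProduct.lid ℝ UK).toAlgHom.comp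
      ((Algebra.TensorProduct.map (counitU (K := K)) (AlgHom.id ℝ UK)).comp cop) = AlgHom.id ℝ UK := by
    refine UniversalEnvelopingAlgebra.hom_ext ℝ (LieHom.ext fun D => ?_)
    change Algebra.TensorProduct.lid ℝ UK
      (Algebra.TensorProduct.map counitU (AlgHom.id ℝ UK) (cop (ιK D))) = ιK D
    simp [cop_ι, counitU_ι, -UniversalEnvelopingAlgebra.ι_apply]
  exact AlgHom.congr_fun h x

theorem cop_counit_right (x : UK) :
    TensorProduct.rid ℝ UK ((counitU (K := K)).toLinearMap.lTensor UK (cop x)) = x := by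
  have h : (Algebra.TensorProduct.rid ℝ ℝ UK).toAlgHom.comp
      ((Algebra.TensorProduct.map (AlgHom.id ℝ UK) (counitU (K := K))).comp cop) = AlgHom.id ℝ UK := by
    refine UniversalEnvelopingAlgebra.hom_ext ℝ (LieHom.ext fun D => ?_)
    change Algebra.TensorProduct.rid ℝ ℝ UK
      (Algebra.TensorProduct.map (AlgHom.id ℝ UK) counitU (cop (ιK D))) = ιK D
    simp [cop_ι, counitU_ι, -UniversalEnvelopingAlgebra.ι_apply]
  exact AlgHom.congr_fun h x

/-- For $Du$ the contributions of $D\otimes1$ and $1\otimes D$ are $-S(a)Db$ and $S(a)Db$ and cancel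
for each tensor separately. -/
theorem antipodeU_left (x : UK) :
    LinearMap.mul' ℝ UK (antipodeU.rTensor UK (cop x)) = algebraMap ℝ UK (counitU x) := by
  induction x using envelope_induction with
  | one => simp [Algebra.TensorProduct.one_def, antipodeU_one]
  | mul D u _ =>
    rw [map_mul, cop_ι, counitU_ι_mul, map_zero]
    induction cop u using TensorProduct.induction_on with
    | zero => simp
    | tmul a b =>
      simp [add_mul, antipodeU_mul, antipodeU_ι, mul_assoc, -UniversalEnvelopingAlgebra.ι_apply]
    | add s t hs ht => rw [mul_add, map_add, map_add, hs, ht, add_zero]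
  | add u v hu hv => rw [map_add, map_add, map_add, hu, hv, map_add, map_add]
  | smul c u hu => rw [map_smul, map_smul, map_smul, hu, map_smul, smul_eq_mul, map_mul,
      Algebra.smul_def]

/-- Unlike in `antipodeU_left`, the contributions for $Du$ form a commutator of $D$ with the value
at $u$. It vanishes because that value is a scalar by induction. -/
theorem antipodeU_right (x : UK) :
    LinearMap.mul' ℝ UK (antipodeU.lTensor UK (cop x)) = algebraMap ℝ UK (counitU x) := by
  induction x using envelope_induction with
  | one => simp [Algebra.TensorProduct.one_def, antipodeU_one]
  | mul D u hu =>
    have key : ∀ t, LinearMap.mul' ℝ UK (antipodeU.lTensor UK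
        ((ιK D ⊗ₜ[ℝ] 1 + 1 ⊗ₜ[ℝ] ιK D) * t)) =
        ιK D * LinearMap.mul' ℝ UK (antipodeU.lTensor UK t) -
        LinearMap.mul' ℝ UK (antipodeU.lTensor UK t) * ιK D := by
      intro t
      induction t using TensorProduct.induction_on with
      | zero => simp
      | tmul a b => simp [add_mul, antipodeU_mul, antipodeU_ι, mul_assoc, sub_eq_add_neg,
          -UniversalEnvelopingAlgebra.ι_apply]
      | add s t hs ht =>
        rw [mul_add, map_add, map_add, hs, ht, map_add, map_add, mul_add, add_mul]
        abel
    rw [map_mul, cop_ι, counitU_ι_mul, map_zero, key, hu, Algebra.commutes, sub_self]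
  | add u v hu hv => rw [map_add, map_add, map_add, hu, hv, map_add, map_add]
  | smul c u hu => rw [map_smul, map_smul, map_smul, hu, map_smul, smul_eq_mul, map_mul,
      Algebra.smul_def]

theorem isHopf_envelope : IsHopf (cop (K := K)) counitU antipodeU where
  coassoc := cop_coassoc
  counit_left := cop_counit_left
  counit_right := cop_counit_right
  antipode_left := antipodeU_left
  antipode_right := antipodeU_right

/-- The antipode of a cocommutative Hopf algebra is a coalgebra morphism. -/
theorem cop_antipodeU (u : UK) :
    cop (antipodeU u) = TensorProduct.map antipodeU antipodeU (cop u) := by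
  induction u using envelope_induction with
  | one => simp [Algebra.TensorProduct.one_def, antipodeU_one]
  | mul D u hu =>
    rw [antipodeU_mul, map_mul, hu, antipodeU_ι, map_neg, map_mul, cop_ι]
    induction cop u using TensorProduct.induction_on with
    | zero => simp
    | tmul a b =>
      simp only [TensorProduct.map_tmul, mul_neg, mul_add, add_mul, map_add,
        Algebra.TensorProduct.tmul_mul_tmul, antipodeU_mul, antipodeU_ι, one_mul, mul_one,
        TensorProduct.neg_tmul, TensorProduct.tmul_neg, neg_add]
    | add s t hs ht => rw [mul_add, map_add, map_add, add_mul, hs, ht]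
  | add u v hu hv => simp only [map_add, hu, hv]
  | smul c u hu => simp only [map_smul, hu]

/-- The Leibniz rule for the action of the enveloping algebra generated by derivations. -/
theorem leibniz_cop {A : Type} [CommRing A] [Algebra ℝ A] (R : UK →ₐ[ℝ] Module.End ℝ A)
    (hR : ∀ D a b, R (ιK D) (a * b) = a * R (ιK D) b + R (ιK D) a * b) (u : UK) (a b : A) :
    R u (a * b) = LinearMap.mul' ℝ A (TensorProduct.map (R.toLinearMap.flip a)
      (R.toLinearMap.flip b) (cop u)) := by
  induction u using envelope_induction with
  | one => simp [Algebra.TensorProduct.one_def]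
  | mul D u hu =>
    rw [map_mul R, Module.End.mul_apply, hu, map_mul cop, cop_ι]
    induction cop u using TensorProduct.induction_on with
    | zero => simp
    | tmul x y =>
      simp only [TensorProduct.map_tmul, LinearMap.mul'_apply, LinearMap.flip_apply,
        AlgHom.toLinearMap_apply, hR, add_mul, map_add, Algebra.TensorProduct.tmul_mul_tmul,
        one_mul, map_mul, Module.End.mul_apply]
      ring
    | add s t hs ht => rw [mul_add, map_add, map_add, map_add, map_add, map_add, hs, ht]
  | add u v hu hv => simp only [map_add, LinearMap.add_apply, hu, hv]
  | smul c u hu => simp only [map_smul, LinearMap.smul_apply, hu]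

/-- The Leibniz rule for a right action of the enveloping algebra generated by derivations. -/
theorem leibniz_cop_op {A : Type} [CommRing A] [Algebra ℝ A] (R : UK →ₗ[ℝ] Module.End ℝ A)
    (h1 : R 1 = 1) (hm : ∀ D u, R (ιK D * u) = R u * R (ιK D))
    (hR : ∀ D a b, R (ιK D) (a * b) = a * R (ιK D) b + R (ιK D) a * b) (u : UK) (a b : A) :
    R u (a * b) = LinearMap.mul' ℝ A (TensorProduct.map (R.flip a) (R.flip b) (cop u)) := by
  induction u using envelope_induction generalizing a b with
  | one => simp [Algebra.TensorProduct.one_def, h1]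
  | mul D u hu =>
    rw [hm, Module.End.mul_apply, hR, map_add, hu, hu, map_mul cop, cop_ι]
    induction cop u using TensorProduct.induction_on with
    | zero => simp
    | tmul x y =>
      simp only [TensorProduct.map_tmul, LinearMap.mul'_apply, LinearMap.flip_apply,
        add_mul, map_add, Algebra.TensorProduct.tmul_mul_tmul,
        one_mul, hm, Module.End.mul_apply]
      ring
    | add s t hs ht =>
      rw [mul_add]
      simp only [map_add] at hs ht ⊢
      rw [← hs, ← ht]
      ring
  | add u v hu hv => simp only [map_add, LinearMap.add_apply, hu, hv]
  | smul c u hu => simp only [map_smul, LinearMap.smul_apply, hu]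

end Envelope

end

end ShiftTilt

/-! ### Grafting maps, a spanning family of the enveloping algebra, and its action on power series
-/

namespace ShiftTilt

noncomputable section

/-! ### The grafting maps -/

section GraftGeneral

variable {K M : Type} [LieRing K] [LieAlgebra ℝ K] [AddCommGroup M] [Module ℝ M]
  (tri : K →ₗ[ℝ] M →ₗ[ℝ] M) (jK : M →ₗ[ℝ] K)

local notation "UK" => UniversalEnvelopingAlgebra ℝ K
local notation "ιK" => UniversalEnvelopingAlgebra.ι ℝ (L := K)

theorem ι_lie (D D' : K) : ιK ⁅D, D'⁆ = ιK D * ιK D' - ιK D' * ιK D := LieHom.map_lie ιK D D'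

/-- The action `(D φ)(X) = D φ(X) - φ(D ◁ X)` of a Lie algebra on linear maps from a module to the
enveloping algebra. -/
def graftRep (htri : ∀ D D' Y, tri ⁅D, D'⁆ Y = tri D (tri D' Y) - tri D' (tri D Y)) :
    K →ₗ⁅ℝ⁆ Module.End ℝ (M →ₗ[ℝ] UK) where
  toFun D :=
    { toFun := fun φ => LinearMap.mulLeft ℝ (ιK D) ∘ₗ φ - φ ∘ₗ tri D
      map_add' := fun φ ψ => by
        ext Y
        simp only [LinearMap.sub_apply, LinearMap.comp_apply, LinearMap.add_apply,
          LinearMap.mulLeft_apply, mul_add]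
        abel
      map_smul' := fun c φ => by
        ext Y
        simp only [LinearMap.sub_apply, LinearMap.comp_apply, LinearMap.smul_apply,
          LinearMap.mulLeft_apply, mul_smul_comm, RingHom.id_apply, smul_sub] }
  map_add' D D' := by
    refine LinearMap.ext fun φ => LinearMap.ext fun Y => ?_
    change ιK (D + D') * φ Y - φ (tri (D + D') Y) =
      (ιK D * φ Y - φ (tri D Y)) + (ιK D' * φ Y - φ (tri D' Y))
    rw [map_add ιK, map_add tri, LinearMap.add_apply, map_add, add_mul]
    abel
  map_smul' c D := by
    refine LinearMap.ext fun φ => LinearMap.ext fun Y => ?_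
    change ιK (c • D) * φ Y - φ (tri (c • D) Y) = c • (ιK D * φ Y - φ (tri D Y))
    rw [map_smul ιK, map_smul tri, LinearMap.smul_apply, map_smul, smul_mul_assoc, smul_sub]
  map_lie' := by
    intro D D'
    refine LinearMap.ext fun φ => LinearMap.ext fun Y => ?_
    change ιK ⁅D, D'⁆ * φ Y - φ (tri ⁅D, D'⁆ Y) =
      (ιK D * (ιK D' * φ Y - φ (tri D' Y)) - (ιK D' * φ (tri D Y) - φ (tri D' (tri D Y)))) -
      (ιK D' * (ιK D * φ Y - φ (tri D Y)) - (ιK D * φ (tri D' Y) - φ (tri D (tri D' Y))))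
    rw [htri, map_sub φ, ι_lie]
    simp only [mul_sub, sub_mul, mul_assoc]
    abel

variable {tri} (htri : ∀ D D' Y, tri ⁅D, D'⁆ Y = tri D (tri D' Y) - tri D' (tri D Y))

/-- The maps `θ_X`. -/
def graftMap : M →ₗ[ℝ] UK →ₗ[ℝ] UK :=
  -- Let $u$ act on $\mathrm{Hom}(M,\mathrm U)$ through `graftRep` and apply the result to the
  -- inclusion. The actions of $1$ and of $Du$ are then the two defining properties of $\theta_X$.
  LinearMap.flip ((LinearMap.applyₗ ((ιK : K →ₗ[ℝ] UK) ∘ₗ jK)) ∘ₗ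
    (UniversalEnvelopingAlgebra.lift ℝ (graftRep tri htri)).toLinearMap)

theorem graftMap_one (Y : M) : graftMap jK htri Y 1 = ιK (jK Y) := by
  change UniversalEnvelopingAlgebra.lift ℝ (graftRep tri htri) 1 _ Y = _
  rw [map_one]
  rfl

theorem graftMap_mul (Y : M) (D : K) (u : UK) : graftMap jK htri Y (ιK D * u) =
    ιK D * graftMap jK htri Y u - graftMap jK htri (tri D Y) u := by
  change UniversalEnvelopingAlgebra.lift ℝ (graftRep tri htri) (ιK D * u) _ Y = _
  rw [map_mul, UniversalEnvelopingAlgebra.lift_ι_apply]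
  rfl

/-- At $u=1$ commutation amounts to $[X,Y]=X\triangleleft Y-Y\triangleleft X$. The rule for
$\theta_X(Du)$ propagates it, provided that all pairs $X,Y$ are treated simultaneously. -/
theorem graftMap_comm (hj : ∀ Y Z, ⁅jK Y, jK Z⁆ = jK (tri (jK Y) Z) - jK (tri (jK Z) Y))
    (Y Z : M) (u : UK) : graftMap jK htri Y (graftMap jK htri Z u) =
      graftMap jK htri Z (graftMap jK htri Y u) := by
  induction u using envelope_induction generalizing Y Z with
  | one =>
    have h : ∀ Y Z, graftMap jK htri Y (graftMap jK htri Z 1) =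
        ιK (jK Z) * ιK (jK Y) - ιK (jK (tri (jK Z) Y)) := by
      intro Y Z
      rw [graftMap_one, ← mul_one (ιK (jK Z)), graftMap_mul, graftMap_one, graftMap_one, mul_one]
    rw [h, h, sub_eq_sub_iff_sub_eq_sub, ← ι_lie, hj, map_sub]
  | mul D u hu =>
    rw [graftMap_mul, graftMap_mul, map_sub, map_sub, graftMap_mul, graftMap_mul, hu,
      hu (tri D Y), hu Y (tri D Z)]
    abel
  | add u v hu hv => simp only [map_add, hu Y Z, hv Y Z]
  | smul c u hu => simp only [map_smul, hu Y Z]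

end GraftGeneral

section InU

variable {α : ℝ} {w : N2 →+ ℝ}

theorem inU_induction {P : U α w → Prop} (one : P 1)
    (mul : ∀ D u, P u → P (inU α w D * u)) (add : ∀ u v, P u → P v → P (u + v))
    (smul : ∀ (c : ℝ) u, P u → P (c • u)) (u : U α w) : P u :=
  envelope_induction one mul add smul u

/-- The inclusion of `L` into `U(L)` as a linear map. -/
def inUL (α : ℝ) (w : N2 →+ ℝ) : L α w →ₗ[ℝ] U α w :=
  (UniversalEnvelopingAlgebra.ι ℝ : L α w →ₗ⁅ℝ⁆ U α w).toLinearMap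

theorem inU_lie (D D' : L α w) :
    inU α w ⁅D, D'⁆ = inU α w D * inU α w D' - inU α w D' * inU α w D :=
  LieHom.map_lie (UniversalEnvelopingAlgebra.ι ℝ) D D'

end InU

section Graft

variable {α : ℝ} {w : N2 →+ ℝ} [Pos α w]

/-- The maps `θ_X` on `U(L)`. -/
def graft : Ltilde α w →ₗ[ℝ] U α w →ₗ[ℝ] U α w := graftMap (Ltilde α w).subtype triL_lie

theorem graft_one (Y : Ltilde α w) : graft Y 1 = inU α w Y := graftMap_one _ _ Y

theorem graft_mul (Y : Ltilde α w) (D : L α w) (u : U α w) :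
    graft Y (inU α w D * u) = inU α w D * graft Y u - graft (triL D Y) u := graftMap_mul _ _ Y D u

theorem isGraft_graft : IsGraft (triL : L α w →ₗ[ℝ] _) graft := ⟨graft_one, graft_mul⟩

theorem mul_graft (Y : Ltilde α w) (D : L α w) (u : U α w) :
    inU α w D * graft Y u = graft Y (inU α w D * u) + graft (triL D Y) u := by
  rw [graft_mul, sub_add_cancel]

theorem graft_unique {graft' : Ltilde α w →ₗ[ℝ] U α w →ₗ[ℝ] U α w} (h : IsGraft triL graft') :
    graft' = graft := by
  suffices ∀ u Y, graft' Y u = graft Y u from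
    LinearMap.ext fun Y => LinearMap.ext fun u => this u Y
  intro u
  induction u using inU_induction with
  | one => exact fun Y => (h.one Y).trans (graft_one Y).symm
  | mul D u hu =>
    intro Y
    rw [h.mul, graft_mul, hu, hu]
  | add u v hu hv =>
    intro Y
    rw [map_add, map_add, hu, hv]
  | smul c u hu =>
    intro Y
    rw [map_smul, map_smul, hu]

theorem graft_comm (Y Z : Ltilde α w) (u : U α w) :
    graft Y (graft Z u) = graft Z (graft Y u) :=
  graftMap_comm _ _ lie_eq_triL Y Z u

/-- This allows folding the grafts over a multiset, so that products indexed by $J$ require no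
choice of order. -/
instance : LeftCommutative fun (q : TiltIdx α w) (u : U α w) => graft (genLt α w q) u :=
  ⟨fun _ _ _ => graft_comm _ _ _⟩

/-- The element `∂₁^{m₁} ∂₂^{m₂}` of `U(L)`. -/
def shiftPow (α : ℝ) (w : N2 →+ ℝ) (m : N2) : U α w :=
  inU α w (genL α w (Sum.inr 0)) ^ m 0 * inU α w (genL α w (Sum.inr 1)) ^ m 1

/-- The elements `∏ θ_{z^γ D^{(n)}}^{J(γ,n)} (∂₁^{m₁} ∂₂^{m₂})`. -/
def graftMon (J : TiltIdx α w →₀ ℕ) (m : N2) : U α w :=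
  (Finsupp.toMultiset J).foldr (fun q u => graft (genLt α w q) u) (shiftPow α w m)

/-- The normalized elements `D_{(J,m)}`. -/
def Dbas (J : TiltIdx α w →₀ ℕ) (m : N2) : U α w :=
  (((J.prod fun _ e => e.factorial) * fact2 m : ℕ) : ℝ)⁻¹ • graftMon J m

theorem finsupp_induction {ι : Type} {P : (ι →₀ ℕ) → Prop} (zero : P 0)
    (add_single : ∀ J i, P J → P (J + Finsupp.single i 1)) (J : ι →₀ ℕ) : P J := by
  classical
  obtain ⟨s, rfl⟩ : ∃ s : Multiset ι, J = Multiset.toFinsupp s := ⟨Finsupp.toMultiset J, by simp⟩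
  induction s using Multiset.induction_on with
  | empty => simpa using zero
  | cons a s ih =>
    have : Multiset.toFinsupp (a ::ₘ s) = Multiset.toFinsupp s + Finsupp.single a 1 := by
      rw [← Multiset.singleton_add, map_add, Multiset.toFinsupp_singleton, add_comm]
    rw [this]
    exact add_single _ _ ih

theorem toMultiset_sum_single {ι : Type} (ℓ : List ι) :
    Finsupp.toMultiset (ℓ.map fun q => Finsupp.single q 1).sum = (ℓ : Multiset ι) := by
  induction ℓ with
  | nil => simp
  | cons q ℓ ih =>
    rw [List.map_cons, List.sum_cons, map_add, ih, Finsupp.toMultiset_single, one_smul]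
    rfl

theorem isBasisFamily_Dbas : IsBasisFamily (graft : Ltilde α w →ₗ[ℝ] _) Dbas := by
  rintro ℓ J m rfl
  unfold Dbas graftMon
  rw [toMultiset_sum_single]
  rfl

theorem graftMon_add_single (q : TiltIdx α w) (J : TiltIdx α w →₀ ℕ) (m : N2) :
    graftMon (J + Finsupp.single q 1) m = graft (genLt α w q) (graftMon J m) := by
  unfold graftMon
  rw [map_add, Finsupp.toMultiset_single, one_smul, add_comm, Multiset.singleton_add,
    Multiset.foldr_cons]

theorem graftMon_zero (m : N2) : graftMon (0 : TiltIdx α w →₀ ℕ) m = shiftPow α w m := by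
  unfold graftMon
  rw [map_zero, Multiset.foldr_zero]

/-! ### The basis elements span -/

/-- The span of the elements `∏ θ_{z^γ D^{(n)}}^{J(γ,n)} (∂₁^{m₁} ∂₂^{m₂})`. -/
def graftSpan (α : ℝ) (w : N2 →+ ℝ) [Pos α w] : Submodule ℝ (U α w) :=
  Submodule.span ℝ (Set.range fun M : (TiltIdx α w →₀ ℕ) × N2 => graftMon M.1 M.2)

theorem graft_mem_graftSpan (Y : Ltilde α w) {u : U α w} (hu : u ∈ graftSpan α w) :
    graft Y u ∈ graftSpan α w := by
  have hY : Y ∈ Submodule.span ℝ (Set.range (genLt α w)) := by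
    rw [span_genLt]
    trivial
  induction hY using Submodule.span_induction with
  | mem Z hZ =>
    obtain ⟨q, rfl⟩ := hZ
    induction hu using Submodule.span_induction with
    | mem v hv =>
      obtain ⟨M, rfl⟩ := hv
      refine Submodule.subset_span ⟨(M.1 + Finsupp.single q 1, M.2), ?_⟩
      exact graftMon_add_single q M.1 M.2
    | zero =>
      rw [map_zero]
      exact zero_mem _
    | add x y _ _ hx hy =>
      rw [map_add]
      exact add_mem hx hy
    | smul c x _ hx =>
      rw [map_smul]
      exact Submodule.smul_mem _ c hx
  | zero =>
    rw [map_zero]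
    exact zero_mem _
  | add x y _ _ hx hy =>
    rw [map_add]
    exact add_mem hx hy
  | smul c x _ hx =>
    rw [map_smul]
    exact Submodule.smul_mem _ c hx

/-- By $D\theta_X(u)=\theta_X(Du)+\theta_{D\triangleleft X}(u)$ the factor $D$ moves inwards through
all grafts, until it meets $\partial_1^{m_1}\partial_2^{m_2}$. -/
theorem mul_mem_graftSpan {D : L α w} (hD : ∀ m, inU α w D * shiftPow α w m ∈ graftSpan α w)
    {u : U α w} (hu : u ∈ graftSpan α w) : inU α w D * u ∈ graftSpan α w := by
  induction hu using Submodule.span_induction with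
  | mem v hv =>
    obtain ⟨⟨J, m⟩, rfl⟩ := hv
    change inU α w D * graftMon J m ∈ graftSpan α w
    induction J using finsupp_induction with
    | zero =>
      rw [graftMon_zero]
      exact hD m
    | add_single J q ih =>
      rw [graftMon_add_single, mul_graft]
      exact add_mem (graft_mem_graftSpan _ ih)
        (graft_mem_graftSpan _ (Submodule.subset_span ⟨(J, m), rfl⟩))
  | zero =>
    rw [mul_zero]
    exact zero_mem _
  | add x y _ _ hx hy =>
    rw [mul_add]
    exact add_mem hx hy
  | smul c x _ hx =>
    rw [mul_smul_comm]
    exact Submodule.smul_mem _ c hx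

theorem shiftPow_mul (i : Fin 2) (m : N2) :
    inU α w (genL α w (Sum.inr i)) * shiftPow α w m = shiftPow α w (m + unitVec i) := by
  have hc : Commute (inU α w (genL α w (Sum.inr 1))) (inU α w (genL α w (Sum.inr 0))) := by
    rw [commute_iff_lie_eq]
    have : ⁅genL α w (Sum.inr 1), genL α w (Sum.inr 0)⁆ = 0 := by
      refine sg_injective ?_
      rw [sg_lie, sg_genL, sg_genL, tl_symb_inr_inr, sub_self, map_zero]
    change inU α w _ * inU α w _ - inU α w _ * inU α w _ = 0
    rw [← inU_lie, this]
    exact map_zero (inUL α w)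
  unfold shiftPow
  fin_cases i
  · simp [unitVec, pow_succ', mul_assoc]
  · change inU α w (genL α w (Sum.inr 1)) * _ = _
    rw [← mul_assoc, (hc.pow_right _).eq, mul_assoc, ← pow_succ']
    simp [unitVec]

theorem shiftPow_zero : shiftPow α w 0 = 1 := by
  simp [shiftPow]

theorem lie_inr_mem_Ltilde (Y : Ltilde α w) (i : Fin 2) :
    ⁅(Y : L α w), genL α w (Sum.inr i)⁆ ∈ Ltilde α w := by
  rw [← sg_mem_LtSym_iff, sg_lie, sg_genL]
  have hY := sg_mem_LtSym_iff.2 Y.2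
  refine sub_mem ?_ (tl_mem_LtSym (Submodule.subset_span ⟨_, rfl⟩) hY)
  generalize sg (Y : L α w) = s at hY ⊢
  induction hY using Submodule.span_induction with
  | mem x h =>
    obtain ⟨q, rfl⟩ := h
    exact tl_symb_inl_inr_mem q i
  | zero =>
    rw [map_zero, LinearMap.zero_apply]
    exact zero_mem _
  | add x y _ _ hx hy =>
    rw [map_add, LinearMap.add_apply]
    exact add_mem hx hy
  | smul c x _ hx =>
    rw [map_smul, LinearMap.smul_apply]
    exact Submodule.smul_mem _ c hx

theorem inr_mul_mem_graftSpan (i : Fin 2) {u : U α w} (hu : u ∈ graftSpan α w) :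
    inU α w (genL α w (Sum.inr i)) * u ∈ graftSpan α w := by
  refine mul_mem_graftSpan (fun m => ?_) hu
  rw [shiftPow_mul]
  exact Submodule.subset_span ⟨(0, m + unitVec i), graftMon_zero _⟩

theorem tilt_mul_shiftPow_mem (Y : Ltilde α w) (m : N2) :
    inU α w (Y : L α w) * shiftPow α w m ∈ graftSpan α w := by
  induction m using finsupp_induction generalizing Y with
  | zero =>
    rw [shiftPow_zero, mul_one, ← graft_one]
    refine graft_mem_graftSpan _ (Submodule.subset_span ⟨(0, 0), ?_⟩)
    exact (graftMon_zero _).trans shiftPow_zero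
  | add_single m i ih =>
    -- The reordering $Y\partial_i=[Y,\partial_i]+\partial_iY$, where the bracket lies in
    -- $\tilde{\mathsf L}$ again. The induction therefore has to be uniform in $Y$.
    rw [← shiftPow_mul, ← mul_assoc, ← sub_add_cancel (inU α w (Y : L α w) * _)
      (inU α w (genL α w (Sum.inr i)) * inU α w (Y : L α w)), ← inU_lie, add_mul, mul_assoc]
    exact add_mem (ih ⟨_, lie_inr_mem_Ltilde Y i⟩) (inr_mul_mem_graftSpan i (ih Y))

theorem graftSpan_eq_top : graftSpan α w = ⊤ := by
  refine Submodule.eq_top_iff'.2 fun u => ?_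
  induction u using inU_induction with
  | one => exact Submodule.subset_span ⟨(0, 0), (graftMon_zero _).trans shiftPow_zero⟩
  | mul D u hu =>
    have hD : D ∈ Submodule.span ℝ (Set.range (genL α w)) := by
      rw [span_genL]
      trivial
    change inUL α w D * u ∈ _
    induction hD using Submodule.span_induction with
    | mem x h =>
      obtain ⟨q | i, rfl⟩ := h
      · exact mul_mem_graftSpan (tilt_mul_shiftPow_mem (genLt α w q)) hu
      · exact inr_mul_mem_graftSpan i hu
    | zero =>
      rw [map_zero, zero_mul]
      exact zero_mem _
    | add x y _ _ hx hy =>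
      rw [map_add, add_mul]
      exact add_mem hx hy
    | smul c x _ hx =>
      rw [map_smul, smul_mul_assoc]
      exact Submodule.smul_mem _ c hx
  | add u v hu hv => exact add_mem hu hv
  | smul c u hu => exact Submodule.smul_mem _ c hu

theorem factorials_ne_zero (J : TiltIdx α w →₀ ℕ) (m : N2) :
    (((J.prod fun _ e => e.factorial) * fact2 m : ℕ) : ℝ) ≠ 0 := by
  rw [Nat.cast_ne_zero, fact2, Finsupp.prod]
  exact mul_ne_zero (Finset.prod_ne_zero_iff.2 fun _ _ => Nat.factorial_ne_zero _)
    (Finset.prod_ne_zero_iff.2 fun _ _ => Nat.factorial_ne_zero _)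

theorem span_Dbas :
    Submodule.span ℝ (Set.range fun M : (TiltIdx α w →₀ ℕ) × N2 => Dbas M.1 M.2) = ⊤ := by
  rw [eq_top_iff, ← graftSpan_eq_top, graftSpan, Submodule.span_le]
  rintro _ ⟨M, rfl⟩
  have : graftMon M.1 M.2 = (((M.1.prod fun _ e => e.factorial) * fact2 M.2 : ℕ) : ℝ) •
      Dbas M.1 M.2 := by
    rw [Dbas, smul_inv_smul₀ (factorials_ne_zero _ _)]
  rw [SetLike.mem_coe]
  change graftMon M.1 M.2 ∈ _
  rw [this]
  exact Submodule.smul_mem _ _ (Submodule.subset_span ⟨M, rfl⟩)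

/-! ### The action of `U(L)` on all power series -/

/-- The Lie algebra `L` acting on all power series. -/
def extL (α : ℝ) (w : N2 →+ ℝ) [Pos α w] : L α w →ₗ⁅ℝ⁆ Module.End ℝ PS :=
  { (vf ∘ₗ sg : L α w →ₗ[ℝ] PS →ₗ[ℝ] PS) with
    map_lie' := by
      intro D D'
      change vf (sg ⁅D, D'⁆) = _
      rw [sg_lie, vf_bracket]
      rfl }

/-- The extension of `ρ` to all power series. -/
def rhoh (α : ℝ) (w : N2 →+ ℝ) [Pos α w] : U α w →ₐ[ℝ] Module.End ℝ PS :=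
  UniversalEnvelopingAlgebra.lift ℝ (extL α w)

theorem rhoh_inU (D : L α w) : rhoh α w (inU α w D) = vf (sg D) :=
  UniversalEnvelopingAlgebra.lift_ι_apply ℝ _ D

theorem rhoh_inU_mul (D : L α w) (u : U α w) (F : PS) :
    rhoh α w (inU α w D * u) F = vf (sg D) (rhoh α w u F) := by
  rw [map_mul, rhoh_inU]
  rfl

theorem rho_inU_mul (D : L α w) (u : U α w) (F : Tstar) :
    (rho α w (inU α w D * u) F : PS) = vf (sg D) (rho α w u F : PS) := by
  rw [map_mul, ← coe_apply_eq_vf]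
  have : rho α w (inU α w D) = D.1 := UniversalEnvelopingAlgebra.lift_ι_apply ℝ _ D
  rw [this]
  rfl

theorem coe_rho (u : U α w) (F : Tstar) : (rho α w u F : PS) = rhoh α w u F := by
  induction u using inU_induction with
  | one =>
    rw [map_one, map_one]
    rfl
  | mul D u hu => rw [rho_inU_mul, rhoh_inU_mul, hu]
  | add u v hu hv =>
    rw [map_add, map_add, LinearMap.add_apply, LinearMap.add_apply, Submodule.coe_add, hu, hv]
  | smul c u hu =>
    rw [map_smul, map_smul, LinearMap.smul_apply, LinearMap.smul_apply, Submodule.coe_smul, hu]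

theorem FinDep.rhoh (u : U α w) : FinDep (rhoh α w u) := by
  induction u using inU_induction with
  | one =>
    rw [map_one]
    exact FinDep.id
  | mul D u hu =>
    rw [map_mul, rhoh_inU]
    exact (FinDep.vf _).comp hu
  | add u v hu hv =>
    rw [map_add]
    exact hu.add hv
  | smul c u hu =>
    rw [map_smul]
    exact hu.smul c

/-- The reason for leaving $\mathsf T^*$: it is not closed under products (for instance
$[e_n+e_m]=-2$), so the Leibniz rule needs the action on the full algebra of power series. -/
theorem rhoh_mul (u : U α w) (F G : PS) : rhoh α w u (F * G) =
    LinearMap.mul' ℝ PS (TensorProduct.map ((rhoh α w).toLinearMap.flip F)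
      ((rhoh α w).toLinearMap.flip G) (cop u)) := by
  refine leibniz_cop (rhoh α w) (fun D F G => ?_) u F G
  change rhoh α w (inU α w D) (F * G) = F * rhoh α w (inU α w D) G + rhoh α w (inU α w D) F * G
  rw [rhoh_inU]
  exact IsDer.vf (sg D) F G

end Graft

end

end ShiftTilt

/-! ### The universal extended tilt and the vector fields on parameter space -/

namespace ShiftTilt

noncomputable section

open MvPowerSeries (coeff X coeff_X coeff_smul)

/-! ### Anti-representations of the enveloping algebra -/

section OpRep

variable {K A : Type} [LieRing K] [LieAlgebra ℝ K] [AddCommGroup A] [Module ℝ A]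
  (φ : K →ₗ[ℝ] Module.End ℝ A)

local notation "UK" => UniversalEnvelopingAlgebra ℝ K
local notation "ιK" => UniversalEnvelopingAlgebra.ι ℝ (L := K)

/-- The extension of a Lie algebra anti-representation to the enveloping algebra. -/
def opRep (hφ : ∀ D D', φ ⁅D, D'⁆ = φ D' * φ D - φ D * φ D') : UK →ₗ[ℝ] Module.End ℝ A :=
  (MulOpposite.opLinearEquiv ℝ).symm.toLinearMap ∘ₗ
  (UniversalEnvelopingAlgebra.lift ℝ
    { (MulOpposite.opLinearEquiv ℝ).toLinearMap ∘ₗ φ with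
      map_lie' := by
        intro D D'
        change MulOpposite.op (φ ⁅D, D'⁆) = _
        rw [hφ, MulOpposite.op_sub, MulOpposite.op_mul, MulOpposite.op_mul]
        rfl } : UK →ₐ[ℝ] (Module.End ℝ A)ᵐᵒᵖ).toLinearMap

variable {φ} (hφ : ∀ D D', φ ⁅D, D'⁆ = φ D' * φ D - φ D * φ D')

theorem opRep_one : opRep φ hφ 1 = 1 := by
  change MulOpposite.unop (UniversalEnvelopingAlgebra.lift ℝ _ 1) = 1
  rw [map_one]
  rfl

theorem opRep_mul (u v : UK) : opRep φ hφ (u * v) = opRep φ hφ v * opRep φ hφ u := by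
  change MulOpposite.unop (UniversalEnvelopingAlgebra.lift ℝ _ (u * v)) = _
  rw [map_mul]
  rfl

theorem opRep_ι (D : K) : opRep φ hφ (ιK D) = φ D := by
  change MulOpposite.unop (UniversalEnvelopingAlgebra.lift ℝ _ (ιK D)) = _
  rw [UniversalEnvelopingAlgebra.lift_ι_apply]
  rfl

end OpRep

/-! ### The universal extended tilt -/

section Universal

variable {α : ℝ} {w : N2 →+ ℝ}

/-- The multi-index `e_m`. -/
abbrev eIdx (m : {n : N2 // n ≠ 0}) : MIdx := Finsupp.single (Sum.inr m) 1

theorem eIdx_injective : Function.Injective eIdx := by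
  intro m m' h
  have := (Finsupp.single_eq_single_iff _ _ _ _).1 h
  simpa using this

theorem unitVec_ne_zero (i : Fin 2) : unitVec i ≠ 0 := by simp [unitVec]

/-- The monomial `h^k` of `T⁺`. -/
def hmon (α : ℝ) (w : N2 →+ ℝ) (k : N2) : Tplus α w := ∏ i, MvPolynomial.X (Sum.inr i) ^ k i

/-- `(m choose n) h^{m-n}`, an element of `T⁺`. -/
def hbin (α : ℝ) (w : N2 →+ ℝ) (m n : N2) : Tplus α w := (choose2 m n : ℝ) • hmon α w (m - n)

open Classical in
/-- The universal extended tilt, a family of power series with coefficients in `T⁺`. -/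
def Ehat (α : ℝ) (w : N2 →+ ℝ) (n : N2) (γ : MIdx) : Tplus α w :=
  if h : 0 ≤ br γ ∧ w n < homog α w γ then MvPolynomial.X (Sum.inl ⟨(γ, n), h⟩)
  else if h : ∃ m : {n : N2 // n ≠ 0}, γ = eIdx m then
    (if n = h.choose.1 then 0 else hbin α w h.choose.1 n)
  else 0

theorem Ehat_adm (q : TiltIdx α w) : Ehat α w q.1.2 q.1.1 = MvPolynomial.X (Sum.inl q) := by
  rw [Ehat, dif_pos q.2]

theorem Ehat_eIdx (n : N2) (m : {n : N2 // n ≠ 0}) :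
    Ehat α w n (eIdx m) = if n = m.1 then 0 else hbin α w m.1 n := by
  have hb : ¬ (0 ≤ br (eIdx m) ∧ w n < homog α w (eIdx m)) := by
    rw [br_single_inr]
    omega
  have he : ∃ m' : {n : N2 // n ≠ 0}, eIdx m = eIdx m' := ⟨m, rfl⟩
  rw [Ehat, dif_neg hb, dif_pos he, ← eIdx_injective he.choose_spec]

theorem choose2_eq_zero {m n : N2} (h : ¬ n ≤ m) : choose2 m n = 0 := by
  have : ∃ i, ¬ n i ≤ m i := by
    by_contra hc
    push Not at hc
    exact h hc
  obtain ⟨i, hi⟩ := this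
  exact Finset.prod_eq_zero (Finset.mem_univ i) (Nat.choose_eq_zero_of_lt (not_le.1 hi))

theorem choose2_self (n : N2) : choose2 n n = 1 := by simp [choose2]

theorem choose2_zero_right (n : N2) : choose2 n 0 = 1 := by simp [choose2]

theorem hmon_zero : hmon α w 0 = 1 := by simp [hmon]

theorem hmon_unitVec (i : Fin 2) : hmon α w (unitVec i) = MvPolynomial.X (Sum.inr i) := by
  rw [hmon, Finset.prod_eq_single i]
  · simp [unitVec]
  · intro j _ hj
    simp [unitVec, hj.symm]
  · simp

theorem Ehat_unitVec (i : Fin 2) :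
    Ehat α w 0 (eIdx ⟨unitVec i, unitVec_ne_zero i⟩) = MvPolynomial.X (Sum.inr i) := by
  rw [Ehat_eIdx, if_neg (unitVec_ne_zero i).symm, hbin, choose2_zero_right, tsub_zero,
    hmon_unitVec, Nat.cast_one, one_smul]

/-- The position of a variable of `T⁺` in the universal extended tilt. -/
def posIdx : LIdx α w → N2 × MIdx
  | Sum.inl q => (q.1.2, q.1.1)
  | Sum.inr i => (0, eIdx ⟨unitVec i, unitVec_ne_zero i⟩)

/-- All variables of $\mathsf T^+$ occur among the entries of the extended tilt, so derivations and
morphisms of $\mathsf T^+$ are determined by their effect on `Ehat`. -/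
theorem Ehat_posIdx (q : LIdx α w) :
    Ehat α w (posIdx q).1 (posIdx q).2 = MvPolynomial.X q := by
  rcases q with q | i
  · exact Ehat_adm q
  · exact Ehat_unitVec i

theorem Ehat_eq_zero_of_not_model {n : N2} {γ : MIdx} (h : ¬ IsModelIdx γ) :
    Ehat α w n γ = 0 := by
  rw [Ehat, dif_neg fun h' => h (Or.inl h'.1), dif_neg fun h' => h (Or.inr h')]

variable [Pos α w]

theorem of_Ehat_ne_zero {n : N2} {γ : MIdx} (h : Ehat α w n γ ≠ 0) :
    IsModelIdx γ ∧ w n < homog α w γ := by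
  by_cases hm : IsModelIdx γ
  · refine ⟨hm, ?_⟩
    rcases hm with hb | ⟨m, rfl⟩
    · by_contra hw
      refine h ?_
      rw [Ehat, dif_neg fun h' => hw h'.2, dif_neg]
      rintro ⟨m, rfl⟩
      rw [br_single_inr] at hb
      omega
    · change Ehat α w n (eIdx m) ≠ 0 at h
      rw [Ehat_eIdx] at h
      rw [homog_single_inr]
      split_ifs at h with hn
      · exact absurd rfl h
      · refine w_lt α w (lt_of_le_of_ne ?_ hn)
        by_contra hle
        refine h ?_
        rw [hbin, choose2_eq_zero hle, Nat.cast_zero, zero_smul]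
  · exact absurd (Ehat_eq_zero_of_not_model hm) h

/-! ### The vector fields `V_D` on `T⁺` -/

/-- The prescribed derivative `s_n + (∑_m s_m D^{(m)}) π^{(n)}` of the universal extended tilt. -/
def vdot (s : TLs α w) (n : N2) (γ : MIdx) : Tplus α w :=
  MvPolynomial.C (coeff γ (s.1 n)) + act (vf s) (Ehat α w n) γ

/-- `vdot` as a linear map. -/
def vdotL (n : N2) (γ : MIdx) : TLs α w →ₗ[ℝ] Tplus α w where
  toFun s := vdot s n γ
  map_add' s t := by
    simp only [vdot, map_add, act_add (FinDep.vf s) (FinDep.vf t), Submodule.coe_add, Pi.add_apply]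
    abel
  map_smul' c s := by
    simp only [vdot, map_smul, act_smul (FinDep.vf s), Submodule.coe_smul, Pi.smul_apply,
      RingHom.id_apply, smul_add, MvPolynomial.C_eq_smul_one, smul_eq_mul, mul_smul]

/-- The derivation of `T⁺` belonging to a coefficient family. -/
def VS : TLs α w →ₗ[ℝ] Derivation ℝ (Tplus α w) (Tplus α w) :=
  (MvPolynomial.mkDerivationEquiv ℝ).toLinearMap ∘ₗ LinearMap.pi fun q => vdotL (posIdx q).1 (posIdx q).2

theorem VS_X (s : TLs α w) (q : LIdx α w) :
    VS s (MvPolynomial.X q) = vdot s (posIdx q).1 (posIdx q).2 :=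
  MvPolynomial.mkDerivation_X ℝ _ q

theorem act_ne_zero {V : Type} [AddCommGroup V] [Module ℝ V] {op : PS →ₗ[ℝ] PS} {C : MIdx → V}
    {β : MIdx} (h : act op C β ≠ 0) : ∃ γ, coeff β (op (zmon γ)) ≠ 0 ∧ C γ ≠ 0 := by
  by_contra hc
  push Not at hc
  refine h ?_
  have : ∀ γ, coeff β (op (zmon γ)) • C γ = 0 := by
    intro γ
    by_cases h0 : coeff β (op (zmon γ)) = 0
    · rw [h0, zero_smul]
    · rw [hc γ h0, smul_zero]
  simp only [act, this, finsum_zero]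

theorem zmon_mem_Tstar {γ : MIdx} (h : IsModelIdx γ) : zmon γ ∈ Tstar := by
  classical
  intro β hβ
  rw [coeff_zmon] at hβ
  split_ifs at hβ with h'
  · exact h' ▸ h
  · exact absurd rfl hβ

theorem exists_of_coeff_vf_zmon (s : TLs α w) {γ β : MIdx} (h : coeff β (vf s (zmon γ)) ≠ 0) :
    br γ ≤ br β ∧ homog α w γ < homog α w β := by
  classical
  obtain ⟨δ, h1, h2⟩ := exists_of_coeff_vf s h
  rw [coeff_zmon] at h1
  split_ifs at h1 with h'
  · exact h' ▸ h2
  · exact absurd rfl h1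

theorem of_vdot_ne_zero {s : TLs α w} {n : N2} {γ : MIdx} (h : vdot s n γ ≠ 0) :
    IsModelIdx γ ∧ w n < homog α w γ := by
  by_cases h0 : coeff γ (s.1 n) = 0
  · rw [vdot, h0, map_zero, zero_add] at h
    obtain ⟨δ, h1, h2⟩ := act_ne_zero h
    obtain ⟨h3, h4⟩ := of_Ehat_ne_zero h2
    exact ⟨vf_mem_Tstar s _ (zmon_mem_Tstar h3) γ h1,
      h4.trans (exists_of_coeff_vf_zmon s h1).2⟩
  · exact s.2 n γ h0

theorem zmon_eIdx (m : {n : N2 // n ≠ 0}) : zmon (eIdx m) = X (Sum.inr m) := rfl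

/-- A vector field does not lower $[\cdot]$ and $[e_m]=-1$, so among the multi-indices carrying
`Ehat` only the $e_l$ contribute to the coefficient at $e_m$. -/
theorem act_vf_eIdx (s : TLs α w) (n : N2) (m : {n : N2 // n ≠ 0}) :
    act (vf s) (Ehat α w n) (eIdx m) =
      ∑ᶠ l : {n : N2 // n ≠ 0}, coeff (eIdx m) (s.1 l.1) • Ehat α w n (eIdx l) := by
  unfold act
  have h1 : ∀ γ, γ ∉ Set.range eIdx →
      coeff (eIdx m) (vf s (zmon γ)) • Ehat α w n γ = 0 := by
    intro γ hγ
    by_contra hc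
    obtain ⟨h2, h3⟩ := of_Ehat_ne_zero (right_ne_zero_of_smul hc)
    have h4 := (exists_of_coeff_vf_zmon s (left_ne_zero_of_smul hc)).1
    rw [br_single_inr] at h4
    rcases h2 with h2 | ⟨l, rfl⟩
    · omega
    · exact hγ ⟨l, rfl⟩
  have h2 : ∀ l : {n : N2 // n ≠ 0}, coeff (eIdx m) (s.1 l.1) • Ehat α w n (eIdx l) =
      coeff (eIdx m) (vf s (zmon (eIdx l))) • Ehat α w n (eIdx l) := by
    intro l
    rw [zmon_eIdx, vf_X_inr]
  rw [finsum_congr h2, ← finsum_mem_range eIdx_injective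
    (f := fun γ => coeff (eIdx m) (vf s (zmon γ)) • Ehat α w n γ), ← finsum_mem_univ]
  refine finsum_mem_inter_support_eq _ _ _ ?_
  ext γ
  simp only [Set.mem_inter_iff, Set.mem_univ, true_and, iff_and_self, Function.mem_support]
  exact fun h => by_contra fun h' => h (h1 γ h')

theorem coeff_eIdx_zmon {γ : MIdx} (hγ : 0 ≤ br γ) (m : {n : N2 // n ≠ 0}) :
    coeff (eIdx m) (zmon γ) = 0 := by
  classical
  rw [coeff_zmon, if_neg]
  rintro rfl
  rw [br_single_inr] at hγ
  omega

theorem coeff_eIdx_symb_inl (q : TiltIdx α w) (n : N2) (m : {n : N2 // n ≠ 0}) :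
    coeff (eIdx m) ((symb (Sum.inl q) : TLs α w).1 n) = 0 := by
  rw [symb_inl]
  by_cases hn : n = q.1.2
  · subst hn
    rw [Pi.single_eq_same, coeff_eIdx_zmon q.2.1]
  · rw [Pi.single_eq_of_ne hn, map_zero]

theorem vdot_symb_inl_eIdx (q : TiltIdx α w) (n : N2) (m : {n : N2 // n ≠ 0}) :
    vdot (symb (Sum.inl q)) n (eIdx m) = 0 := by
  rw [vdot, act_vf_eIdx]
  simp only [coeff_eIdx_symb_inl, zero_smul, finsum_zero, map_zero, zero_add]

theorem coeff_eIdx_zp (l : N2) (m : {n : N2 // n ≠ 0}) :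
    coeff (eIdx m) (zp l) = if l = m.1 then 1 else 0 := by
  classical
  by_cases hl : l = 0
  · rw [zp, dif_neg (by simpa using hl), map_zero, if_neg]
    rintro rfl
    exact m.2 hl
  · rw [zp, dif_pos hl, coeff_X]
    refine if_congr ?_ rfl rfl
    rw [eIdx_injective.eq_iff (a := m) (b := ⟨l, hl⟩), Subtype.ext_iff]
    exact eq_comm

/-- The right-hand side is the derivative of $\binom mn h^{m-n}$ in $h_i$, so $\partial_i$ acts on
the shift entries as $\partial/\partial h_i$. Only $l=m-\mathbf e_i$ contributes to the sum. The
diagonal case $n=l$, where the extended tilt has entry $0$ in place of $1$, is supplied by the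
symbol $s_n$ itself. -/
theorem vdot_symb_inr_eIdx (i : Fin 2) (n : N2) (m : {n : N2 // n ≠ 0}) :
    vdot (symb (Sum.inr i) : TLs α w) n (eIdx m) = (m.1 i : ℝ) • hbin α w (m.1 - unitVec i) n := by
  rw [vdot, act_vf_eIdx]
  simp only [symb_inr, coeff_smul, coeff_eIdx_zp]
  by_cases hm : m.1 i = 0
  · have : ∀ l : N2, l + unitVec i ≠ m.1 := by
      rintro l h
      rw [← h] at hm
      simp [unitVec] at hm
    simp [this, hm]
  · obtain ⟨l, hl⟩ : ∃ l, l + unitVec i = m.1 := by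
      refine ⟨m.1 - unitVec i, tsub_add_cancel_of_le ?_⟩
      rw [unitVec, Finsupp.single_le_iff]
      omega
    have hmi : ((l i : ℝ) + 1) = m.1 i := by
      rw [← hl]
      simp [unitVec]
    rw [← hl, add_tsub_cancel_right]
    simp only [add_left_inj]
    rw [hl, ← hmi]
    by_cases hl0 : l = 0
    · subst hl0
      have : ∀ l' : {n : N2 // n ≠ 0}, l'.1 ≠ 0 := fun l' => l'.2
      simp only [this, if_false, mul_zero, zero_smul, finsum_zero, add_zero]
      by_cases hn : n = 0
      · subst hn
        simp [hbin, choose2_self, hmon_zero]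
      · rw [if_neg hn, hbin, choose2_eq_zero]
        · simp
        · simpa using hn
    · rw [finsum_eq_single _ ⟨l, hl0⟩]
      · rw [if_pos rfl, mul_one, Ehat_eIdx]
        by_cases hn : n = l
        · subst hn
          simp [hbin, choose2_self, hmon_zero, MvPolynomial.smul_eq_C_mul]
        · simp [hn]
      · intro l' hl'
        rw [if_neg fun h => hl' (Subtype.ext h), mul_zero, zero_smul]

end Universal

end

end ShiftTilt

/-! ### The pairing and the dual bases -/

namespace ShiftTilt

noncomputable section

open MvPowerSeries (coeff coeff_smul)

/-! ### Derivations of `T⁺` -/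

section Tplus

variable {α : ℝ} {w : N2 →+ ℝ}

theorem derivation_hmon_eq_zero {d : Derivation ℝ (Tplus α w) (Tplus α w)}
    (h : ∀ j, d (MvPolynomial.X (Sum.inr j)) = 0) (k : N2) : d (hmon α w k) = 0 := by
  rw [hmon, Fin.prod_univ_two, Derivation.leibniz, Derivation.leibniz_pow, Derivation.leibniz_pow,
    h, h]
  simp

theorem derivation_hmon {d : Derivation ℝ (Tplus α w) (Tplus α w)} {i : Fin 2}
    (h : ∀ j, d (MvPolynomial.X (Sum.inr j)) = if j = i then 1 else 0) (k : N2) :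
    d (hmon α w k) = (k i : ℝ) • hmon α w (k - unitVec i) := by
  rw [hmon, Fin.prod_univ_two, Derivation.leibniz, Derivation.leibniz_pow, Derivation.leibniz_pow,
    h, h, hmon, Fin.prod_univ_two]
  fin_cases i
  · simp [unitVec, MvPolynomial.smul_eq_C_mul]
    ring
  · simp [unitVec, MvPolynomial.smul_eq_C_mul]
    ring

theorem choose2_mul_sub (m n : N2) (i : Fin 2) :
    choose2 m n * (m - n) i = m i * choose2 (m - unitVec i) n := by
  have key : ∀ a b : ℕ, a.choose b * (a - b) = a * (a - 1).choose b := by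
    intro a b
    rcases a with _ | a
    · simp
    · rw [Nat.add_sub_cancel, ← Nat.choose_mul_succ_eq, mul_comm]
  unfold choose2
  rw [Fin.prod_univ_two, Fin.prod_univ_two]
  fin_cases i
  · have := key (m 0) (n 0)
    simp [unitVec]
    linear_combination (m 1).choose (n 1) * this
  · have := key (m 1) (n 1)
    simp [unitVec]
    linear_combination (m 0).choose (n 0) * this

theorem derivation_hbin {d : Derivation ℝ (Tplus α w) (Tplus α w)} {i : Fin 2}
    (h : ∀ j, d (MvPolynomial.X (Sum.inr j)) = if j = i then 1 else 0) (m n : N2) :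
    d (hbin α w m n) = (m i : ℝ) • hbin α w (m - unitVec i) n := by
  rw [hbin, Derivation.map_smul, derivation_hmon h, hbin, smul_smul, smul_smul, ← Nat.cast_mul,
    ← Nat.cast_mul, choose2_mul_sub, tsub_right_comm]

theorem hbin_self (m : N2) : hbin α w m m = 1 := by
  rw [hbin, choose2_self, tsub_self, hmon_zero, Nat.cast_one, one_smul]

theorem act_C {op : PS →ₗ[ℝ] PS} (h : FinDep op) (F : PS) (β : MIdx) :
    act op (fun γ => (MvPolynomial.C (coeff γ F) : Tplus α w)) β =
      MvPolynomial.C (coeff β (op F)) := by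
  rw [← act_real h F β]
  exact (map_act h (Algebra.linearMap ℝ (Tplus α w)) _ β).symm

theorem derivation_ext_Ehat {d d' : Derivation ℝ (Tplus α w) (Tplus α w)}
    (h : ∀ n γ, d (Ehat α w n γ) = d' (Ehat α w n γ)) : d = d' := by
  refine MvPolynomial.derivation_ext fun q => ?_
  rw [← Ehat_posIdx, h]

/-- The counit of `T⁺`. -/
def epsP (α : ℝ) (w : N2 →+ ℝ) : Tplus α w →ₐ[ℝ] ℝ := MvPolynomial.aeval fun _ => 0

theorem epsP_X (q : LIdx α w) : epsP α w (MvPolynomial.X q) = 0 := MvPolynomial.aeval_X _ _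

theorem epsP_C (c : ℝ) : epsP α w (MvPolynomial.C c) = c := MvPolynomial.aeval_C _ _

theorem epsP_derivation_ext {d d' : Derivation ℝ (Tplus α w) (Tplus α w)}
    (h : ∀ q, epsP α w (d (MvPolynomial.X q)) = epsP α w (d' (MvPolynomial.X q)))
    (Z : Tplus α w) : epsP α w (d Z) = epsP α w (d' Z) := by
  induction Z using MvPolynomial.induction_on with
  | C a => rw [MvPolynomial.derivation_C, MvPolynomial.derivation_C]
  | add p q hp hq => rw [map_add, map_add, map_add, map_add, hp, hq]
  | mul_X p q hp =>
    rw [Derivation.leibniz, Derivation.leibniz, map_add, map_add, smul_eq_mul, smul_eq_mul,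
      smul_eq_mul, smul_eq_mul, map_mul, map_mul, map_mul, map_mul, hp, h]

/-- The algebra morphism of `T⁺` that removes the tilt variables. -/
def killTilt (α : ℝ) (w : N2 →+ ℝ) : Tplus α w →ₐ[ℝ] Tplus α w :=
  MvPolynomial.aeval fun q => match q with
    | Sum.inl _ => 0
    | Sum.inr i => MvPolynomial.X (Sum.inr i)

theorem killTilt_inl (q : TiltIdx α w) : killTilt α w (MvPolynomial.X (Sum.inl q)) = 0 :=
  MvPolynomial.aeval_X _ _

theorem killTilt_inr (i : Fin 2) :
    killTilt α w (MvPolynomial.X (Sum.inr i)) = MvPolynomial.X (Sum.inr i) :=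
  MvPolynomial.aeval_X _ _

theorem Zb_eq (J : TiltIdx α w →₀ ℕ) (m : N2) :
    Zb J m = (J.prod fun q e => (MvPolynomial.X (Sum.inl q) : Tplus α w) ^ e) * hmon α w m := by
  rw [Zb, MvPolynomial.monomial_eq, map_one, one_mul, Finsupp.prod_sumElim, hmon,
    Finsupp.prod_fintype m _ (by simp)]
  simp only [Function.comp_def]

theorem pderiv_Zb (q : TiltIdx α w) (J : TiltIdx α w →₀ ℕ) (m : N2) :
    MvPolynomial.pderiv (Sum.inl q) (Zb J m) = (J q : ℝ) • Zb (J - Finsupp.single q 1) m := by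
  rw [Zb, MvPolynomial.pderiv_monomial, Zb, MvPolynomial.smul_monomial]
  have h : Finsupp.sumElim J m - Finsupp.single (Sum.inl q) 1 =
      Finsupp.sumElim (J - Finsupp.single q 1) m := by
    ext x
    rcases x with x | x
    · classical
      simp [Finsupp.single_apply]
    · simp
  rw [h]
  simp

end Tplus

section Pairing

variable {α : ℝ} {w : N2 →+ ℝ} [Pos α w]

theorem VS_symb_inl_X (q : TiltIdx α w) (j : Fin 2) :
    VS (symb (Sum.inl q) : TLs α w) (MvPolynomial.X (Sum.inr j)) = 0 := by
  rw [VS_X]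
  exact vdot_symb_inl_eIdx q _ _

theorem VS_symb_inr_X (i j : Fin 2) :
    VS (symb (Sum.inr i) : TLs α w) (MvPolynomial.X (Sum.inr j)) = if j = i then 1 else 0 := by
  rw [VS_X]
  refine (vdot_symb_inr_eIdx i _ _).trans ?_
  rw [posIdx]
  split_ifs with h
  · subst h
    rw [tsub_self, hbin_self]
    simp [unitVec]
  · simp [unitVec, h]

/-- `VS` prescribes this only on the variables. The shift entries $\binom mn h^{m-n}$ are
polynomials in $h$, so for them it is a consistency condition. It is checked on the generators,
hence the restriction to their span. -/
theorem VS_Ehat {s : TLs α w} (hs : s ∈ LSym α w) (n : N2) (γ : MIdx) :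
    VS s (Ehat α w n γ) = vdot s n γ := by
  by_cases hm : IsModelIdx γ ∧ w n < homog α w γ
  · rcases hm with ⟨hb | ⟨m, rfl⟩, hw⟩
    · have := VS_X s (Sum.inl ⟨(γ, n), hb, hw⟩)
      rwa [← Ehat_adm] at this
    · change VS s (Ehat α w n (eIdx m)) = vdotL n (eIdx m) s
      induction hs using Submodule.span_induction with
      | mem x h =>
        obtain ⟨q | i, rfl⟩ := h
        · rw [Ehat_eIdx]
          change _ = vdot _ _ _
          rw [vdot_symb_inl_eIdx]
          split_ifs
          · rw [map_zero]
          · rw [hbin, Derivation.map_smul, derivation_hmon_eq_zero (VS_symb_inl_X q), smul_zero]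
        · change _ = vdot _ _ _
          rw [Ehat_eIdx, vdot_symb_inr_eIdx, ← derivation_hbin (VS_symb_inr_X i)]
          split_ifs with hn
          · rw [hn, hbin_self, map_zero, Derivation.map_one_eq_zero]
          · rfl
      | zero => rw [map_zero, map_zero, Derivation.zero_apply]
      | add x y _ _ hx hy => rw [map_add, map_add, Derivation.add_apply, hx, hy]
      | smul c x _ hx => rw [map_smul, map_smul, Derivation.smul_apply, hx]
  · have h1 : vdot s n γ = 0 := by_contra fun h => hm (of_vdot_ne_zero h)
    have h2 : Ehat α w n γ = 0 := by_contra fun h => hm (of_Ehat_ne_zero h)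
    rw [h1, h2, map_zero]

/-- The derivation of $t$ acts on coefficients and commutes with the operator of $s$, so the
operators compose in the order opposite to the derivations. This is the source of the
anti-representation. -/
theorem VS_VS_Ehat {s t : TLs α w} (hs : s ∈ LSym α w) (ht : t ∈ LSym α w) (n : N2) (γ : MIdx) :
    VS t (VS s (Ehat α w n γ)) =
      MvPolynomial.C (coeff γ (vf s (t.1 n))) + act (vf s ∘ₗ vf t) (Ehat α w n) γ := by
  rw [VS_Ehat hs, vdot, map_add, MvPolynomial.derivation_C, zero_add]
  have h := map_act (FinDep.vf s) (VS t : Tplus α w →ₗ[ℝ] Tplus α w) (Ehat α w n) γ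
  rw [Derivation.coeFn_coe] at h
  rw [h]
  have h2 : (fun δ => VS t (Ehat α w n δ)) =
      (fun δ => MvPolynomial.C (coeff δ (t.1 n))) + act (vf t) (Ehat α w n) := by
    funext δ
    rw [VS_Ehat ht]
    rfl
  rw [h2, act_map_add (FinDep.vf s), Pi.add_apply, act_C (FinDep.vf s),
    act_comp (FinDep.vf s) (FinDep.vf t)]

theorem VS_bracket {s t : TLs α w} (hs : s ∈ LSym α w) (ht : t ∈ LSym α w) :
    VS (tl s t - tl t s) = ⁅VS t, VS s⁆ := by
  refine derivation_ext_Ehat fun n γ => ?_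
  rw [VS_Ehat (bracket_mem_LSym hs ht), Derivation.commutator_apply, VS_VS_Ehat hs ht,
    VS_VS_Ehat ht hs, vdot, vf_bracket, act_sub ((FinDep.vf s).comp (FinDep.vf t))
      ((FinDep.vf t).comp (FinDep.vf s))]
  simp only [Submodule.coe_sub, Pi.sub_apply, tl_apply, map_sub]
  abel

/-- The vector fields `V_D`, `D ∈ L`, on `T⁺`. -/
def VD : L α w →ₗ[ℝ] Module.End ℝ (Tplus α w) where
  toFun D := (VS (sg D) : Tplus α w →ₗ[ℝ] Tplus α w)
  map_add' D D' := by
    refine LinearMap.ext fun Z => ?_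
    simp
  map_smul' c D := by
    refine LinearMap.ext fun Z => ?_
    simp

theorem VD_apply (D : L α w) (Z : Tplus α w) : VD D Z = VS (sg D) Z := rfl

theorem VD_lie (D D' : L α w) : VD ⁅D, D'⁆ = VD D' * VD D - VD D * VD D' := by
  refine LinearMap.ext fun Z => ?_
  rw [VD_apply, sg_lie, VS_bracket (sg_mem D) (sg_mem D'), Derivation.commutator_apply]
  rfl

/-- The anti-representation of `U(L)` on `T⁺`. -/
def VU : U α w →ₗ[ℝ] Module.End ℝ (Tplus α w) := opRep VD VD_lie

theorem VU_one : VU (1 : U α w) = 1 := opRep_one _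

theorem VU_mul (u v : U α w) : VU (u * v) = VU v * VU u := opRep_mul _ _ _

theorem VU_inU (D : L α w) : VU (inU α w D) = VD D := opRep_ι _ _

/-- The counit is the trivial parameter. As the diagonal is excluded, each remaining shift entry has
positive degree in $h$. -/
theorem epsP_Ehat (n : N2) (γ : MIdx) : epsP α w (Ehat α w n γ) = 0 := by
  by_cases hm : IsModelIdx γ ∧ w n < homog α w γ
  · rcases hm with ⟨hb | ⟨m, rfl⟩, hw⟩
    · have := Ehat_adm (α := α) (w := w) ⟨(γ, n), hb, hw⟩
      rw [this, epsP_X]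
    · change epsP α w (Ehat α w n (eIdx m)) = 0
      rw [homog_single_inr] at hw
      rw [Ehat_eIdx]
      split_ifs with hn
      · rw [map_zero]
      · by_cases hle : n ≤ m.1
        · have : ∃ i, (m.1 - n) i ≠ 0 := by
            by_contra hc
            push Not at hc
            exact hn (le_antisymm hle (tsub_eq_zero_iff_le.1 (Finsupp.ext hc)))
          obtain ⟨i, hi⟩ := this
          rw [hbin, map_smul, hmon, map_prod, Finset.prod_eq_zero (Finset.mem_univ i), smul_zero]
          rw [map_pow, epsP_X, zero_pow hi]
        · rw [hbin, choose2_eq_zero hle, Nat.cast_zero, zero_smul, map_zero]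
  · have h2 : Ehat α w n γ = 0 := by_contra fun h => hm (of_Ehat_ne_zero h)
    rw [h2, map_zero]

/-- The pairing between `U(L)` and `T⁺`. -/
def BU : U α w →ₗ[ℝ] Tplus α w →ₗ[ℝ] ℝ := VU.compr₂ (epsP α w).toLinearMap

theorem BU_apply (u : U α w) (Z : Tplus α w) : BU u Z = epsP α w (VU u Z) := rfl

theorem BU_one (Z : Tplus α w) : BU 1 Z = epsP α w Z := by
  rw [BU_apply, VU_one]
  rfl

theorem BU_mul (u v : U α w) (Z : Tplus α w) : BU (u * v) Z = BU v (VU u Z) := by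
  rw [BU_apply, VU_mul]
  rfl

theorem BU_inU_mul (D : L α w) (v : U α w) (Z : Tplus α w) :
    BU (inU α w D * v) Z = BU v (VS (sg D) Z) := by
  rw [BU_mul, VU_inU, VD_apply]

theorem VU_mul_apply (u : U α w) (Z Z' : Tplus α w) : VU u (Z * Z') =
    LinearMap.mul' ℝ (Tplus α w) (TensorProduct.map (VU.flip Z) (VU.flip Z') (cop u)) := by
  refine leibniz_cop_op VU VU_one (fun D u => ?_) (fun D a b => ?_) u Z Z'
  · exact VU_mul _ _
  · change VU (inU α w D) (a * b) = a * VU (inU α w D) b + VU (inU α w D) a * b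
    rw [VU_inU]
    simp only [VD_apply, Derivation.leibniz, smul_eq_mul]
    ring

/-- Elements of $\mathsf L$ act as derivations, so $V_u$ satisfies the Leibniz rule given by the
coproduct; evaluation at the trivial parameter is multiplicative. -/
theorem BU_mul_apply (u : U α w) (Z Z' : Tplus α w) :
    BU u (Z * Z') = formTensor (BU.flip Z) (BU.flip Z') (cop u) := by
  rw [BU_apply, VU_mul_apply]
  induction cop u using TensorProduct.induction_on with
  | zero => simp
  | tmul x y =>
    simp only [formTensor, TensorProduct.map_tmul, LinearMap.mul'_apply, LinearMap.comp_apply,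
      LinearMap.flip_apply, map_mul, BU_apply]
  | add x y hx hy => simp only [map_add, hx, hy]

theorem BU_apply_one (u : U α w) : BU u 1 = counitU u := by
  induction u using inU_induction with
  | one => rw [BU_one, map_one, map_one]
  | mul D u hu =>
    rw [BU_inU_mul, Derivation.map_one_eq_zero, map_zero]
    exact (counitU_ι_mul D u).symm
  | add u v hu hv => rw [map_add, LinearMap.add_apply, hu, hv, map_add]
  | smul c u hu => rw [map_smul, LinearMap.smul_apply, hu, map_smul]

/-! ### The pairing of the grafted elements -/

/-- The derivation of `T⁺` in the direction of an element of `L̃`. -/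
def dirD : Ltilde α w →ₗ[ℝ] Derivation ℝ (Tplus α w) (Tplus α w) :=
  (MvPolynomial.mkDerivationEquiv ℝ).toLinearMap ∘ₗ LinearMap.pi fun q =>
    Algebra.linearMap ℝ (Tplus α w) ∘ₗ coordS q ∘ₗ sg ∘ₗ (Ltilde α w).subtype

theorem dirD_X (Y : Ltilde α w) (q : LIdx α w) : dirD Y (MvPolynomial.X q) =
    MvPolynomial.C (coordS q (sg (Y : L α w))) :=
  MvPolynomial.mkDerivation_X ℝ _ q

theorem coeff_eIdx_sg (Y : Ltilde α w) (n : N2) (m : {n : N2 // n ≠ 0}) :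
    coeff (eIdx m) ((sg (Y : L α w)).1 n) = 0 := by
  have hY := sg_mem_LtSym_iff.2 Y.2
  generalize sg (Y : L α w) = s at hY ⊢
  induction hY using Submodule.span_induction with
  | mem x h =>
    obtain ⟨q, rfl⟩ := h
    exact coeff_eIdx_symb_inl q n m
  | zero => simp
  | add x y _ _ hx hy => simp [hx, hy]
  | smul c x _ hx => simp [hx]

theorem dirD_Ehat (Y : Ltilde α w) (n : N2) (γ : MIdx) :
    dirD Y (Ehat α w n γ) = MvPolynomial.C (coeff γ ((sg (Y : L α w)).1 n)) := by
  by_cases hm : IsModelIdx γ ∧ w n < homog α w γ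
  · rcases hm with ⟨hb | ⟨m, rfl⟩, hw⟩
    · have := dirD_X Y (Sum.inl ⟨(γ, n), hb, hw⟩)
      rwa [← Ehat_adm] at this
    · have h0 : ∀ j, dirD Y (MvPolynomial.X (Sum.inr j)) = 0 := by
        intro j
        rw [dirD_X, coordS_inr, coeff_eIdx_sg, map_zero]
      change dirD Y (Ehat α w n (eIdx m)) = _
      rw [Ehat_eIdx, coeff_eIdx_sg, map_zero]
      split_ifs
      · rw [map_zero]
      · rw [hbin, Derivation.map_smul, derivation_hmon_eq_zero h0, smul_zero]
  · have h1 : coeff γ ((sg (Y : L α w)).1 n) = 0 := by_contra fun h => hm ((sg (Y : L α w)).2 n γ h)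
    have h2 : Ehat α w n γ = 0 := by_contra fun h => hm (of_Ehat_ne_zero h)
    rw [h1, h2, map_zero, map_zero]

/-- $V_D\hat\pi^{(n)}=s_n+D\hat\pi^{(n)}$ is affine in the extended tilt; differentiating it along
the constant direction $X$ gives $D$ applied to the symbol of $X$. -/
theorem dirD_triL (Y : Ltilde α w) (D : L α w) : dirD (triL D Y) = ⁅dirD Y, VS (sg D)⁆ := by
  refine derivation_ext_Ehat fun n γ => ?_
  rw [Derivation.commutator_apply, dirD_Ehat, dirD_Ehat, MvPolynomial.derivation_C, sub_zero,
    sg_tri, VS_Ehat (sg_mem D), vdot, map_add, MvPolynomial.derivation_C, zero_add, tl_apply]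
  have h := map_act (FinDep.vf (sg D)) (dirD Y : Tplus α w →ₗ[ℝ] Tplus α w) (Ehat α w n) γ
  rw [Derivation.coeFn_coe] at h
  rw [h]
  simp only [dirD_Ehat]
  rw [act_C (FinDep.vf _)]

theorem epsP_vdot (s : TLs α w) (n : N2) (γ : MIdx) :
    epsP α w (vdot s n γ) = coeff γ (s.1 n) := by
  rw [vdot, map_add, epsP_C]
  have h := dual_act (FinDep.vf s) (epsP α w).toLinearMap (Ehat α w n) γ
  rw [AlgHom.toLinearMap_apply] at h
  have h0 : (series fun γ => (epsP α w).toLinearMap (Ehat α w n γ)) = 0 := by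
    ext δ
    rw [coeff_series, AlgHom.toLinearMap_apply, epsP_Ehat, map_zero]
  rw [h, h0, map_zero, map_zero, add_zero]

/-- Grafting is dual to a constant-coefficient derivative. At $u=1$ this holds because $V_X$ and the
derivative along $X$ agree at the origin. For $Du$ the correction $\theta_{D\triangleleft X}$ is the
commutator in `dirD_triL`. -/
theorem BU_graft (Y : Ltilde α w) (u : U α w) (Z : Tplus α w) :
    BU (graft Y u) Z = BU u (dirD Y Z) := by
  induction u using inU_induction generalizing Y Z with
  | one =>
    rw [graft_one, BU_one, ← mul_one (inU α w _), BU_inU_mul, BU_one]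
    refine epsP_derivation_ext (fun q => ?_) Z
    rw [VS_X, epsP_vdot, dirD_X, epsP_C]
    rcases q with q | i <;> rfl
  | mul D u hu =>
    rw [graft_mul, map_sub, LinearMap.sub_apply, BU_inU_mul, BU_inU_mul, hu, hu, dirD_triL,
      Derivation.commutator_apply, map_sub, sub_sub_cancel]
  | add u v hu hv => simp only [map_add, LinearMap.add_apply, hu, hv]
  | smul c u hu => simp only [map_smul, LinearMap.smul_apply, hu]

/-- The vector field of $\partial_i$ is tangent to the set of pure shifts: without tilt only the
$z_m$ remain in the extended tilt, and $\partial_i$ maps these to multiples of $z_{m+\mathbf e_i}$.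
Pairings with $\partial_1^{m_1}\partial_2^{m_2}$ therefore see the shift variables only. -/
theorem killTilt_vdot (i : Fin 2) (q : TiltIdx α w) :
    killTilt α w (vdot (symb (Sum.inr i)) q.1.2 q.1.1) = 0 := by
  have h0 : ∀ n, coeff q.1.1 ((symb (Sum.inr i) : TLs α w).1 n) = 0 := by
    intro n
    by_contra h
    rw [symb_inr, coeff_smul] at h
    obtain ⟨hn, hq⟩ := coeff_zp_ne_zero (right_ne_zero_of_mul h)
    have := q.2.1
    rw [hq, br_single_inr] at this
    omega
  rw [vdot, h0, map_zero, zero_add]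
  have h := map_act (FinDep.vf (symb (Sum.inr i) : TLs α w)) (killTilt α w).toLinearMap (Ehat α w q.1.2) q.1.1
  rw [AlgHom.toLinearMap_apply] at h
  rw [h]
  by_contra hc
  obtain ⟨γ, h1, h2⟩ := act_ne_zero hc
  rw [AlgHom.toLinearMap_apply] at h2
  have h3 : Ehat α w q.1.2 γ ≠ 0 := fun h => h2 (by rw [h, map_zero])
  rcases of_Ehat_ne_zero h3 with ⟨hb | ⟨m, rfl⟩, hw⟩
  · have := Ehat_adm (α := α) (w := w) ⟨(γ, q.1.2), hb, hw⟩
    exact h2 (by rw [this, killTilt_inl])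
  · rw [zmon_eIdx, vf_X_inr, h0] at h1
    exact h1 rfl

theorem VS_killTilt (i : Fin 2) (Z : Tplus α w) :
    VS (symb (Sum.inr i)) (killTilt α w Z) = killTilt α w (VS (symb (Sum.inr i)) Z) := by
  induction Z using MvPolynomial.induction_on with
  | C a => rw [MvPolynomial.derivation_C, killTilt, MvPolynomial.aeval_C, map_zero,
      MvPolynomial.algebraMap_eq, MvPolynomial.derivation_C]
  | add p q hp hq => simp only [map_add, hp, hq]
  | mul_X p q hp =>
    rw [map_mul, Derivation.leibniz, Derivation.leibniz, map_add, smul_eq_mul, smul_eq_mul,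
      smul_eq_mul, smul_eq_mul, map_mul, map_mul, hp]
    congr 2
    rcases q with q | j
    · rw [killTilt_inl, map_zero, VS_X]
      exact (killTilt_vdot i q).symm
    · rw [killTilt_inr, VS_symb_inr_X]
      split_ifs <;> simp

theorem BU_shiftPow_killTilt (m : N2) (Z : Tplus α w) :
    BU (shiftPow α w m) (killTilt α w Z) = BU (shiftPow α w m) Z := by
  induction m using finsupp_induction generalizing Z with
  | zero =>
    rw [shiftPow_zero, BU_one, BU_one]
    induction Z using MvPolynomial.induction_on with
    | C a => rw [killTilt, MvPolynomial.aeval_C, MvPolynomial.algebraMap_eq]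
    | add p q hp hq => simp only [map_add, hp, hq]
    | mul_X p q hp =>
      rw [map_mul, map_mul, map_mul, epsP_X]
      rcases q with q | j
      · rw [killTilt_inl, map_zero, mul_zero, mul_zero]
      · rw [killTilt_inr, epsP_X, mul_zero, mul_zero]
  | add_single m i ih =>
    rw [← shiftPow_mul, BU_inU_mul, BU_inU_mul, sg_genL, VS_killTilt, ih]

theorem Zb_zero (m : N2) : Zb (0 : TiltIdx α w →₀ ℕ) m = hmon α w m := by
  rw [Zb_eq, Finsupp.prod_zero_index, one_mul]

theorem fact2_add_unitVec (m : N2) (i : Fin 2) :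
    fact2 (m + unitVec i) = (m i + 1) * fact2 m := by
  unfold fact2
  rw [Fin.prod_univ_two, Fin.prod_univ_two]
  fin_cases i
  · simp [unitVec, Nat.factorial_succ]
    ring
  · simp [unitVec, Nat.factorial_succ]
    ring

open Classical in
theorem BU_shiftPow_hmon (m m' : N2) :
    BU (shiftPow α w m) (hmon α w m') = if m = m' then (fact2 m : ℝ) else 0 := by
  induction m using finsupp_induction generalizing m' with
  | zero =>
    rw [shiftPow_zero, BU_one]
    split_ifs with h
    · rw [← h, hmon_zero, map_one]
      simp [fact2]
    · have : ∃ i, m' i ≠ 0 := by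
        by_contra hc
        push Not at hc
        exact h (Finsupp.ext fun i => (hc i).symm)
      obtain ⟨i, hi⟩ := this
      rw [hmon, map_prod, Finset.prod_eq_zero (Finset.mem_univ i)]
      rw [map_pow, epsP_X, zero_pow hi]
  | add_single m i ih =>
    rw [← shiftPow_mul, BU_inU_mul, sg_genL, derivation_hmon (VS_symb_inr_X i), map_smul, ih,
      fact2_add_unitVec]
    by_cases hi : m' i = 0
    · rw [hi, Nat.cast_zero, zero_smul, if_neg]
      rintro rfl
      simp at hi
    · have hle : unitVec i ≤ m' := by
        rw [unitVec, Finsupp.single_le_iff]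
        omega
      have hiff : m = m' - unitVec i ↔ m + unitVec i = m' := (eq_tsub_iff_add_eq_of_le hle)
      by_cases h : m + unitVec i = m'
      · rw [if_pos h, if_pos (hiff.2 h), ← h]
        simp [unitVec]
      · rw [if_neg h, if_neg (fun h' => h (hiff.1 h')), smul_zero]

open Classical in
theorem BU_shiftPow_Zb (m : N2) (J' : TiltIdx α w →₀ ℕ) (m' : N2) :
    BU (shiftPow α w m) (Zb J' m') = if 0 = J' ∧ m = m' then (fact2 m : ℝ) else 0 := by
  by_cases hJ : 0 = J'
  · subst hJ
    simp only [true_and]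
    rw [Zb_zero, BU_shiftPow_hmon]
  · rw [if_neg (fun h => hJ h.1), ← BU_shiftPow_killTilt, Zb_eq, map_mul]
    have : ∃ q, J' q ≠ 0 := by
      by_contra hc
      push Not at hc
      exact hJ (Finsupp.ext fun q => (hc q).symm)
    obtain ⟨q, hq⟩ := this
    rw [Finsupp.prod, map_prod, Finset.prod_eq_zero (Finsupp.mem_support_iff.2 hq), zero_mul,
      map_zero]
    rw [map_pow, killTilt_inl, zero_pow hq]

theorem dirD_genLt (q : TiltIdx α w) :
    dirD (genLt α w q) = MvPolynomial.pderiv (Sum.inl q) := by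
  classical
  refine MvPolynomial.derivation_ext fun q' => ?_
  rw [dirD_X, sg_genLt, coordS_symb, MvPolynomial.pderiv_X, Pi.single_apply]
  split_ifs <;> simp

-- By `BU_graft` each graft differentiates in one tilt variable and the remaining shift part in $h$,
-- so the pairing is a Taylor derivative at the origin of a monomial. The factorials are the ones
-- removed in `Dbas`.
open Classical in
theorem BU_graftMon_Zb (J : TiltIdx α w →₀ ℕ) (m : N2) (J' : TiltIdx α w →₀ ℕ) (m' : N2) :
    BU (graftMon J m) (Zb J' m') = if J = J' ∧ m = m' then
      (((J.prod fun _ e => e.factorial) * fact2 m : ℕ) : ℝ) else 0 := by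
  induction J using finsupp_induction generalizing J' with
  | zero => rw [graftMon_zero, BU_shiftPow_Zb, Finsupp.prod_zero_index, one_mul]
  | add_single J q ih =>
    rw [graftMon_add_single, BU_graft, dirD_genLt, pderiv_Zb, map_smul, ih]
    by_cases hi : J' q = 0
    · rw [hi, Nat.cast_zero, zero_smul, if_neg]
      rintro ⟨rfl, -⟩
      simp at hi
    · have hle : Finsupp.single q 1 ≤ J' := by
        rw [Finsupp.single_le_iff]
        omega
      have hiff : J = J' - Finsupp.single q 1 ↔ J + Finsupp.single q 1 = J' :=
        eq_tsub_iff_add_eq_of_le hle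
      by_cases h : J + Finsupp.single q 1 = J' ∧ m = m'
      · rw [if_pos h, if_pos ⟨hiff.2 h.1, h.2⟩, ← h.1]
        have hf : ((J + Finsupp.single q 1).prod fun _ e => e.factorial) =
            (J q + 1) * J.prod fun _ e => e.factorial := by
          have e1 := Finsupp.prod_of_support_subset J (s := insert q J.support) (Finset.subset_insert _ _)
            (fun _ e => e.factorial) (by simp)
          have e2 := Finsupp.prod_of_support_subset (J + Finsupp.single q 1)
            (s := insert q J.support) (by
              intro x hx
              rw [Finsupp.mem_support_iff, Finsupp.add_apply] at hx
              rw [Finset.mem_insert, Finsupp.mem_support_iff]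
              by_contra hc
              push Not at hc
              simp [hc.2, Ne.symm hc.1] at hx)
            (fun _ e => e.factorial) (by simp)
          rw [e1, e2, ← Finset.mul_prod_erase _ _ (Finset.mem_insert_self q _),
            ← Finset.mul_prod_erase _ _ (Finset.mem_insert_self q _), ← mul_assoc]
          congr 1
          · simp [Nat.factorial_succ]
          · refine Finset.prod_congr rfl fun x hx => ?_
            rw [Finsupp.add_apply, Finsupp.single_apply, if_neg (Finset.ne_of_mem_erase hx).symm,
              add_zero]
        rw [hf]
        simp
        ring
      · rw [if_neg h, if_neg (fun h' => h ⟨hiff.1 h'.1, h'.2⟩), smul_zero]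

open Classical in
theorem BU_Dbas_Zb (J : TiltIdx α w →₀ ℕ) (m : N2) (J' : TiltIdx α w →₀ ℕ) (m' : N2) :
    BU (Dbas J m) (Zb J' m') = if J = J' ∧ m = m' then 1 else 0 := by
  rw [Dbas, map_smul, LinearMap.smul_apply, BU_graftMon_Zb, smul_eq_mul]
  split_ifs
  · exact inv_mul_cancel₀ (factorials_ne_zero J m)
  · rw [mul_zero]

theorem linearIndependent_Dbas :
    LinearIndependent ℝ (fun M : (TiltIdx α w →₀ ℕ) × N2 => (Dbas M.1 M.2 : U α w)) := by
  classical
  rw [linearIndependent_iff]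
  intro l hl
  ext M
  have := congrArg (BU.flip (Zb M.1 M.2)) hl
  rw [map_zero, Finsupp.linearCombination_apply, Finsupp.sum, map_sum] at this
  simp only [map_smul, LinearMap.flip_apply, BU_Dbas_Zb, smul_eq_mul, mul_ite, mul_one,
    mul_zero, ← Prod.ext_iff, Finset.sum_ite_eq', Finsupp.mem_support_iff] at this
  simpa using this

theorem BU_Dbas_apply (J : TiltIdx α w →₀ ℕ) (m : N2) (Z : Tplus α w) :
    BU (Dbas J m) Z = MvPolynomial.coeff (Finsupp.sumElim J m) Z := by
  classical
  induction Z using MvPolynomial.induction_on' with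
  | monomial k c =>
    obtain ⟨⟨J', m'⟩, rfl⟩ := Finsupp.sumFinsuppEquivProdFinsupp.symm.surjective k
    have : (MvPolynomial.monomial (Finsupp.sumFinsuppEquivProdFinsupp.symm (J', m')) c :
        Tplus α w) = c • Zb J' m' := by
      rw [Zb, MvPolynomial.smul_monomial, smul_eq_mul, mul_one]
      rfl
    rw [this, map_smul, BU_Dbas_Zb, MvPolynomial.coeff_smul, Zb, MvPolynomial.coeff_monomial]
    congr 1
    refine if_congr ?_ rfl rfl
    have hinj := Finsupp.sumFinsuppEquivProdFinsupp.symm.injective.eq_iff (a := (J', m'))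
      (b := (J, m))
    change Finsupp.sumElim J' m' = Finsupp.sumElim J m ↔ _ at hinj
    rw [hinj, Prod.mk.injEq, eq_comm, @eq_comm _ m]
  | add p q hp hq => rw [map_add, MvPolynomial.coeff_add, hp, hq]

/-- Pairing with the basis elements reads off the coefficients of a polynomial. Identities in
$\mathsf T^+$ can thus be verified after pairing with $\mathrm U(\mathsf L)$. -/
theorem BU_ext_right {Z Z' : Tplus α w} (h : ∀ u : U α w, BU u Z = BU u Z') : Z = Z' := by
  ext k
  obtain ⟨⟨J, m⟩, rfl⟩ := Finsupp.sumFinsuppEquivProdFinsupp.symm.surjective k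
  have := h (Dbas J m)
  rwa [BU_Dbas_apply, BU_Dbas_apply] at this

theorem BU_ext_left {u : U α w} (h : ∀ Z : Tplus α w, BU u Z = 0) : u = 0 := by
  classical
  have hu : u ∈ Submodule.span ℝ
      (Set.range fun M : (TiltIdx α w →₀ ℕ) × N2 => (Dbas M.1 M.2 : U α w)) := by
    rw [span_Dbas]
    trivial
  rw [Finsupp.mem_span_range_iff_exists_finsupp] at hu
  obtain ⟨c, rfl⟩ := hu
  have : c = 0 := by
    ext M
    have := h (Zb M.1 M.2)
    rw [Finsupp.sum, map_sum, LinearMap.sum_apply] at this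
    simp only [map_smul, LinearMap.smul_apply, BU_Dbas_Zb, smul_eq_mul, mul_ite, mul_one,
      mul_zero, ← Prod.ext_iff, Finset.sum_ite_eq', Finsupp.mem_support_iff] at this
    simpa using this
  rw [this, Finsupp.sum_zero_index]

theorem nondegenerate_BU : (BU : U α w →ₗ[ℝ] Tplus α w →ₗ[ℝ] ℝ).Nondegenerate := by
  refine ⟨fun u h => BU_ext_left h, fun Z h => BU_ext_right fun u => ?_⟩
  rw [h u, map_zero]

end Pairing

end

end ShiftTilt

/-! ### The universal pull-back and its differential equation -/

namespace ShiftTilt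

noncomputable section

open MvPowerSeries (coeff X)

/-! ### The pull-back with coefficients in a commutative algebra -/

section Pullback

variable {R R' : Type} [CommRing R] [Algebra ℝ R] [CommRing R'] [Algebra ℝ R']

theorem coeff_rsmul (c : ℝ) (F : MvPowerSeries Var R) (β : MIdx) :
    coeff β (c • F) = c • coeff β F := rfl

/-- The Taylor series `∑_l (k+l choose k) E^l z_{k+l}`. -/
def taylor (E : MvPowerSeries Var R) (k : ℕ) : MvPowerSeries Var R := fun β =>
  ∑ᶠ l : ℕ, coeff β (((k + l).choose k : ℝ) • (E ^ l * X (Sum.inl (k + l))))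

theorem coeff_mul_X_eq_zero {β : MIdx} {v : Var} (h : β v = 0) (F : MvPowerSeries Var R) :
    coeff β (F * X v) = 0 := by
  classical
  rw [X, MvPowerSeries.coeff_mul_monomial, if_neg]
  rw [Finsupp.single_le_iff]
  omega

theorem coeff_taylor (E : MvPowerSeries Var R) (k : ℕ) {β : MIdx} {N : ℕ}
    (hN : ∀ j, N ≤ j → β (Sum.inl j) = 0) : coeff β (taylor E k) =
      ∑ l ∈ Finset.range N, coeff β (((k + l).choose k : ℝ) • (E ^ l * X (Sum.inl (k + l)))) := by
  refine finsum_eq_sum_of_support_subset _ fun l hl => ?_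
  by_contra hc
  rw [Finset.coe_range, Set.mem_Iio, not_lt] at hc
  refine hl ?_
  beta_reduce
  rw [coeff_rsmul, coeff_mul_X_eq_zero (hN _ (by omega)), smul_zero]

theorem exists_bound (S : Finset MIdx) : ∃ N : ℕ, ∀ β ∈ S, ∀ j, N ≤ j → β (Sum.inl j) = 0 := by
  classical
  induction S using Finset.induction_on with
  | empty => exact ⟨0, by simp⟩
  | insert β S _ ih =>
    obtain ⟨N, hN⟩ := ih
    let f : Var → ℕ := fun v => match v with
      | Sum.inl k => k + 1
      | Sum.inr _ => 0
    refine ⟨max N (β.support.sup f), fun γ hγ j hj => ?_⟩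
    rcases Finset.mem_insert.1 hγ with rfl | hγ
    · by_contra hc
      have := Finset.le_sup (f := f) (Finsupp.mem_support_iff.2 hc)
      have h1 : f (Sum.inl j) = j + 1 := rfl
      omega
    · exact hN γ hγ j (le_trans (le_max_left _ _) hj)

/-- The pull-back under `(a,p) ↦ (a(· + E_0), p + ∑_{n ≠ 0} E_n x^n)` on polynomials. -/
def gpull (E : N2 → MvPowerSeries Var R) : MvPolynomial Var ℝ →ₐ[ℝ] MvPowerSeries Var R :=
  MvPolynomial.aeval fun v => match v with
    | Sum.inl k => taylor (E 0) k
    | Sum.inr n => X (Sum.inr n) + E n.1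

theorem gpull_inl (E : N2 → MvPowerSeries Var R) (k : ℕ) :
    gpull E (MvPolynomial.X (Sum.inl k)) = taylor (E 0) k := MvPolynomial.aeval_X _ _

theorem gpull_inr (E : N2 → MvPowerSeries Var R) (n : {n : N2 // n ≠ 0}) :
    gpull E (MvPolynomial.X (Sum.inr n)) = X (Sum.inr n) + E n.1 := MvPolynomial.aeval_X _ _

/-- Coefficientwise application of an algebra morphism. -/
def mapA (φ : R →ₐ[ℝ] R') : MvPowerSeries Var R →ₐ[ℝ] MvPowerSeries Var R' :=
  { MvPowerSeries.map (σ := Var) (φ : R →+* R') with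
    commutes' := fun c => by
      classical
      ext β
      simp [MvPowerSeries.algebraMap_apply, MvPowerSeries.coeff_C] }

theorem coeff_mapA (φ : R →ₐ[ℝ] R') (F : MvPowerSeries Var R) (β : MIdx) :
    coeff β (mapA φ F) = φ (coeff β F) := rfl

theorem mapA_X (φ : R →ₐ[ℝ] R') (v : Var) : mapA φ (X v) = X v := MvPowerSeries.map_X _ _

theorem mapA_taylor (φ : R →ₐ[ℝ] R') (E : MvPowerSeries Var R) (k : ℕ) :
    mapA φ (taylor E k) = taylor (mapA φ E) k := by
  ext β
  obtain ⟨N, hN⟩ := exists_bound {β}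
  have hN := hN β (Finset.mem_singleton_self _)
  rw [coeff_mapA, coeff_taylor E k hN, coeff_taylor _ k hN, map_sum]
  refine Finset.sum_congr rfl fun l _ => ?_
  rw [← coeff_mapA, map_smul, map_mul, map_pow, mapA_X]

theorem mapA_gpull (φ : R →ₐ[ℝ] R') (E : N2 → MvPowerSeries Var R) (P : MvPolynomial Var ℝ) :
    mapA φ (gpull E P) = gpull (fun n => mapA φ (E n)) P := by
  have : (mapA φ).comp (gpull E) = gpull fun n => mapA φ (E n) := by
    refine MvPolynomial.algHom_ext fun v => ?_
    rw [AlgHom.comp_apply]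
    rcases v with k | n
    · rw [gpull_inl, gpull_inl, mapA_taylor]
    · rw [gpull_inr, gpull_inr, map_add, mapA_X]
  exact DFunLike.congr_fun this P

theorem taylor_zero (k : ℕ) : taylor (0 : MvPowerSeries Var R) k = X (Sum.inl k) := by
  ext β
  change (∑ᶠ l : ℕ, _) = _
  rw [finsum_eq_single _ 0]
  · simp
  · intro l hl
    rw [zero_pow hl, zero_mul, smul_zero, map_zero]

theorem gpull_zero (P : MvPolynomial Var ℝ) : gpull (R := ℝ) 0 P = P := by
  have : gpull (R := ℝ) 0 = MvPolynomial.coeToMvPowerSeries.algHom ℝ := by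
    refine MvPolynomial.algHom_ext fun v => ?_
    rw [MvPolynomial.coeToMvPowerSeries.algHom_apply]
    rcases v with k | n
    · rw [gpull_inl, Pi.zero_apply, taylor_zero]
      simp
    · rw [gpull_inr]
      simp
  rw [this, MvPolynomial.coeToMvPowerSeries.algHom_apply]
  simp

/-- Coefficientwise application of a derivation. -/
def dhatL (d : Derivation ℝ R R) : MvPowerSeries Var R →ₗ[ℝ] MvPowerSeries Var R where
  toFun F β := d (coeff β F)
  map_add' F G := by
    ext β
    change d (coeff β (F + G)) = d (coeff β F) + d (coeff β G)
    rw [map_add, map_add]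
  map_smul' c F := by
    ext β
    change d (coeff β (c • F)) = c • d (coeff β F)
    rw [coeff_rsmul, Derivation.map_smul]

/-- Coefficientwise application of a derivation, a derivation of the power series. -/
def dhat (d : Derivation ℝ R R) :
    Derivation ℝ (MvPowerSeries Var R) (MvPowerSeries Var R) :=
  Derivation.mk' (dhatL d)
    (fun F G => by
      classical
      ext β
      change d (coeff β (F * G)) = coeff β (F * dhatL d G + G * dhatL d F)
      rw [mul_comm G, map_add, MvPowerSeries.coeff_mul, MvPowerSeries.coeff_mul,
        MvPowerSeries.coeff_mul, map_sum, ← Finset.sum_add_distrib]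
      refine Finset.sum_congr rfl fun p _ => ?_
      rw [Derivation.leibniz, smul_eq_mul, smul_eq_mul, mul_comm (coeff p.2 G)]
      rfl)

theorem coeff_dhat (d : Derivation ℝ R R) (F : MvPowerSeries Var R) (β : MIdx) :
    coeff β (dhat d F) = d (coeff β F) := rfl

theorem dhat_X (d : Derivation ℝ R R) (v : Var) : dhat d (X v) = 0 := by
  classical
  ext β
  rw [coeff_dhat, MvPowerSeries.coeff_X, map_zero]
  split_ifs <;> simp

/-- Derivations that agree on the images of the variables agree on the image of the pull-back. -/
theorem derivation_gpull_ext {d d' : Derivation ℝ (MvPowerSeries Var R) (MvPowerSeries Var R)}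
    {E : N2 → MvPowerSeries Var R}
    (h : ∀ v, d (gpull E (MvPolynomial.X v)) = d' (gpull E (MvPolynomial.X v)))
    (P : MvPolynomial Var ℝ) : d (gpull E P) = d' (gpull E P) := by
  induction P using MvPolynomial.induction_on with
  | C a =>
    rw [← MvPolynomial.algebraMap_eq, AlgHom.commutes, Derivation.map_algebraMap,
      Derivation.map_algebraMap]
  | add p q hp hq => simp only [map_add, hp, hq]
  | mul_X p v hp => rw [map_mul, Derivation.leibniz, Derivation.leibniz, hp, h]

end Pullback

/-! ### The universal pull-back and the action of `U(L)` -/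

section UniversalPullback

variable {α : ℝ} {w : N2 →+ ℝ}

/-- Power series with coefficients in `T⁺`. -/
abbrev PSplus (α : ℝ) (w : N2 →+ ℝ) : Type := MvPowerSeries Var (Tplus α w)

/-- The universal extended tilt as a family of power series. -/
def Eser (α : ℝ) (w : N2 →+ ℝ) (n : N2) : PSplus α w := fun γ => Ehat α w n γ

theorem coeff_Eser (n : N2) (γ : MIdx) : coeff γ (Eser α w n) = Ehat α w n γ := rfl

/-- A real polynomial is determined by its values, also in infinitely many variables. This reduces
product rules for coefficients in $\mathsf T^+$ to real coefficients. -/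
theorem Tplus_ext {Z Z' : Tplus α w} (h : ∀ χ : Tplus α w →ₐ[ℝ] ℝ, χ Z = χ Z') : Z = Z' :=
  MvPolynomial.funext fun x => h (MvPolynomial.aeval x)

theorem PSplus_ext {F G : PSplus α w} (h : ∀ χ : Tplus α w →ₐ[ℝ] ℝ, mapA χ F = mapA χ G) :
    F = G := by
  ext1 β
  refine Tplus_ext fun χ => ?_
  rw [← coeff_mapA, h, coeff_mapA]

/-- Row-finite derivations act on power series with coefficients in `T⁺`. -/
def ahatL {op : PS →ₗ[ℝ] PS} (hf : FinDep op) : PSplus α w →ₗ[ℝ] PSplus α w where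
  toFun F := act op fun γ => coeff γ F
  map_add' _ _ := act_map_add hf _ _
  map_smul' c _ := act_map_smul hf c _

theorem mapA_ahatL {op : PS →ₗ[ℝ] PS} (hf : FinDep op) (χ : Tplus α w →ₐ[ℝ] ℝ) (F : PSplus α w) :
    mapA χ (ahatL hf F) = op (mapA χ F) := by
  ext β
  exact dual_act hf χ.toLinearMap _ β

/-- Row-finite derivations act as derivations on power series with coefficients in `T⁺`. -/
def ahat {op : PS →ₗ[ℝ] PS} (hf : FinDep op) (hd : IsDer op) :
    Derivation ℝ (PSplus α w) (PSplus α w) :=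
  Derivation.mk' (ahatL hf)
    (fun F G => by
      refine PSplus_ext fun χ => ?_
      rw [map_add (mapA χ), smul_eq_mul, smul_eq_mul, map_mul (mapA χ), map_mul (mapA χ),
        mapA_ahatL, mapA_ahatL, mapA_ahatL, map_mul (mapA χ), hd, mul_comm (mapA χ G)])

theorem coeff_ahat {op : PS →ₗ[ℝ] PS} (hf : FinDep op) (hd : IsDer op) (F : PSplus α w)
    (β : MIdx) : coeff β (ahat hf hd F) = act op (fun γ => coeff γ F) β := rfl

/-- Real power series as power series with coefficients in `T⁺`. -/
def incPS (α : ℝ) (w : N2 →+ ℝ) : PS →ₐ[ℝ] PSplus α w := mapA (Algebra.ofId ℝ (Tplus α w))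

theorem ahat_incPS {op : PS →ₗ[ℝ] PS} (hf : FinDep op) (hd : IsDer op) (F : PS) :
    ahat hf hd (incPS α w F) = incPS α w (op F) := by
  ext1 β
  exact act_C hf F β

theorem incPS_X (v : Var) : incPS α w (X v) = X v := mapA_X _ _

theorem coeff_ahat_taylor {op : PS →ₗ[ℝ] PS} (hf : FinDep op) (hd : IsDer op) (F : PSplus α w)
    (k : ℕ) (β : MIdx) : ∃ N : ℕ, (∀ j, N ≤ j → β (Sum.inl j) = 0) ∧
      coeff β (ahat hf hd (taylor F k)) = ∑ l ∈ Finset.range N,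
        coeff β (ahat hf hd (((k + l).choose k : ℝ) • (F ^ l * X (Sum.inl (k + l))))) := by
  classical
  obtain ⟨S, hS, -⟩ := hf.exists_sum β
  -- One truncation length serves $\beta$ and every $\gamma$ in row $\beta$ of the operator, so the
  -- two finite sums can be exchanged.
  obtain ⟨N, hN⟩ := exists_bound (insert β S)
  refine ⟨N, hN β (Finset.mem_insert_self _ _), ?_⟩
  simp only [coeff_ahat, act_eq_sum hS]
  rw [Finset.sum_comm]
  refine Finset.sum_congr rfl fun γ hγ => ?_
  rw [coeff_taylor F k (hN γ (Finset.mem_insert_of_mem hγ)), Finset.smul_sum]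

variable [Pos α w]

theorem choose_mul_succ (k l : ℕ) :
    ((k + (l + 1)).choose k : ℝ) * ((l : ℝ) + 1) = (k + l).choose k * ((k : ℝ) + l + 1) := by
  have h := Nat.choose_mul_succ_eq (k + l) k
  have h1 : k + l + 1 - k = l + 1 := by omega
  rw [h1] at h
  rw [← add_assoc]
  exact_mod_cast h.symm

/-- The universal pull-back. -/
def upull (α : ℝ) (w : N2 →+ ℝ) : MvPolynomial Var ℝ →ₐ[ℝ] PSplus α w := gpull (Eser α w)

theorem dhat_Eser {s : TLs α w} (hs : s ∈ LSym α w) (n : N2) :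
    dhat (VS s) (Eser α w n) = incPS α w (s.1 n) + ahat (FinDep.vf s) (IsDer.vf s) (Eser α w n) := by
  ext1 β
  exact VS_Ehat hs n β

/-- The terms $E^ld'x$ left over at stage $l$ match the terms with $\sigma$ at stage $l+1$, by
$\binom{k+l+1}{k}(l+1)=\binom{k+l}{k}(k+l+1)$. Hence the differences telescope when summed over the
Taylor series. -/
theorem derivation_taylor_term {A : Type} [CommRing A] [Algebra ℝ A] {d d' : Derivation ℝ A A}
    {E σ x x' : A} {k l : ℕ} (hE : d E = σ + d' E) (hx : d x = 0)
    (hx' : d' x = (((k + l : ℕ) : ℝ) + 1) • (σ * x')) :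
    d (((k + l).choose k : ℝ) • (E ^ l * x)) - d' (((k + l).choose k : ℝ) • (E ^ l * x)) =
      ((k + l).choose k : ℝ) • ((l : A) * E ^ (l - 1) * σ * x) -
      ((k + (l + 1)).choose k : ℝ) • (((l + 1 : ℕ) : A) * E ^ l * σ * x') := by
  have hb' : ((k + (l + 1)).choose k : ℝ) • (((l + 1 : ℕ) : A) * E ^ l * σ * x') =
      ((k + l).choose k : ℝ) • (E ^ l * ((((k + l : ℕ) : ℝ) + 1) • (σ * x'))) := by
    have hc : ((l + 1 : ℕ) : A) = algebraMap ℝ _ ((l : ℝ) + 1) := by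
      simp
    rw [mul_smul_comm, smul_smul, hc, ← Algebra.smul_def, smul_mul_assoc, smul_mul_assoc,
      smul_smul, choose_mul_succ, mul_assoc]
    push_cast
    rfl
  rw [hb', Derivation.map_smul, Derivation.map_smul, Derivation.leibniz, Derivation.leibniz, hx,
    hx', Derivation.leibniz_pow, Derivation.leibniz_pow, hE]
  simp only [smul_eq_mul, nsmul_eq_mul, mul_zero, zero_add]
  rw [← smul_sub, ← smul_sub]
  congr 1
  ring

theorem ahat_vf_X (s : TLs α w) (j : ℕ) :
    ahat (FinDep.vf s) (IsDer.vf s) (X (Sum.inl j) : PSplus α w) =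
      ((j : ℝ) + 1) • (incPS α w (s.1 0) * X (Sum.inl (j + 1))) := by
  rw [← incPS_X, ahat_incPS, vf_X_inl, mul_smul_comm, map_smul, map_mul, incPS_X]

theorem dhat_taylor {s : TLs α w} (hs : s ∈ LSym α w) (k : ℕ) :
    dhat (VS s) (taylor (Eser α w 0) k) =
      ahat (FinDep.vf s) (IsDer.vf s) (taylor (Eser α w 0) k) := by
  ext1 β
  obtain ⟨N, hN, h⟩ := coeff_ahat_taylor (FinDep.vf s) (IsDer.vf s) (Eser α w 0) k β
  rw [h, coeff_dhat, coeff_taylor _ k hN, map_sum, ← sub_eq_zero, ← Finset.sum_sub_distrib]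
  -- The telescoping sequence. It vanishes at $l=0$ through the factor $l$, and at $l=N$ because
  -- $z_{k+N}$ does not divide $z^\beta$.
  let a : ℕ → Tplus α w := fun l => coeff β (((k + l).choose k : ℝ) •
    ((l : PSplus α w) * Eser α w 0 ^ (l - 1) * incPS α w (s.1 0) * X (Sum.inl (k + l))))
  have h0 : a 0 = 0 := by
    simp [a]
  have hN' : a N = 0 := by
    change coeff β _ = 0
    rw [coeff_rsmul, coeff_mul_X_eq_zero (hN _ (Nat.le_add_left N k)), smul_zero]
  refine Eq.trans (Finset.sum_congr rfl fun l _ => ?_)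
    ((Finset.sum_range_sub' a N).trans (by rw [h0, hN', sub_zero]))
  rw [← coeff_dhat, ← map_sub, derivation_taylor_term (dhat_Eser hs 0) (dhat_X _ _) (ahat_vf_X s _),
    map_sub]
  rfl

/-- Moving the parameter along $V_D$ amounts to applying $D$ to the pulled-back series: the
infinitesimal form of the composition rule. Both sides are derivations along the pull-back, so the
variables suffice. -/
theorem dhat_upull {s : TLs α w} (hs : s ∈ LSym α w) (P : MvPolynomial Var ℝ) :
    dhat (VS s) (upull α w P) = ahat (FinDep.vf s) (IsDer.vf s) (upull α w P) := by
  refine derivation_gpull_ext (fun v => ?_) P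
  rcases v with k | n
  · rw [gpull_inl, dhat_taylor hs]
  · rw [gpull_inr, map_add, map_add, dhat_X, dhat_Eser hs, zero_add, ← incPS_X, ahat_incPS,
      vf_X_inr]

/-- The coefficient of `z^β` in the universal pull-back. -/
def cf (β : MIdx) (P : MvPolynomial Var ℝ) : Tplus α w := coeff β (upull α w P)

theorem mapA_epsP_upull (P : MvPolynomial Var ℝ) : mapA (epsP α w) (upull α w P) = P := by
  have h0 : (fun n => mapA (epsP α w) (Eser α w n)) = 0 := by
    funext n
    ext β
    exact epsP_Ehat n β
  rw [upull, mapA_gpull, h0, gpull_zero]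

/-- The differential equation `dhat_upull`, iterated over the factors of $u$; at the trivial
parameter the pull-back is the identity. The coefficients of the pull-back are thus the functions on
the group dual to the matrix of $\rho(u)$. -/
theorem BU_cf (u : U α w) (β : MIdx) (P : MvPolynomial Var ℝ) :
    BU u (cf β P) = coeff β (rhoh α w u (P : PS)) := by
  induction u using inU_induction generalizing β with
  | one =>
    rw [BU_one, map_one, cf, ← coeff_mapA, mapA_epsP_upull]
    rfl
  | mul D u hu =>
    rw [BU_inU_mul, rhoh_inU_mul, cf, ← coeff_dhat, dhat_upull (sg_mem D), coeff_ahat,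
      dual_act (FinDep.vf _)]
    congr 2
    ext γ
    exact hu γ
  | add u v hu hv => rw [map_add, map_add, LinearMap.add_apply, LinearMap.add_apply, map_add, hu, hv]
  | smul c u hu =>
    rw [map_smul, map_smul, LinearMap.smul_apply, LinearMap.smul_apply, hu, coeff_rsmul]

end UniversalPullback

end

end ShiftTilt

/-! ### Triangularity, and the pull-back of infinite series -/

namespace ShiftTilt

noncomputable section

open MvPowerSeries (coeff X)

/-! ### Triangularity and finiteness -/

/-- The additive functional `∑_k (k+1) γ(k)`. -/
def qd (γ : MIdx) : ℕ :=
  γ.sum fun v e => match v with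
    | Sum.inl k => (k + 1) * e
    | Sum.inr _ => 0

theorem qd_add (γ δ : MIdx) : qd (γ + δ) = qd γ + qd δ := by
  unfold qd
  refine Finsupp.sum_add_index' ?_ ?_
  · rintro (k | n) <;> simp
  · rintro (k | n) a b <;> simp
    ring

theorem qd_single_inl (k : ℕ) : qd (Finsupp.single (Sum.inl k) 1) = k + 1 := by
  unfold qd
  rw [Finsupp.sum_single_index] <;> simp

theorem br_le_qd (γ : MIdx) : br γ ≤ qd γ := by
  unfold br qd Finsupp.sum
  rw [Nat.cast_sum]
  refine Finset.sum_le_sum fun v _ => ?_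
  rcases v with k | n
  · push_cast
    nlinarith
  · simp

theorem finsupp_apply_le_sum {ι M : Type} [AddCommMonoid M] [PartialOrder M] [IsOrderedAddMonoid M]
    (f : ι → ℕ → M) (hf : ∀ v e, 0 ≤ f v e) (h0 : ∀ v, f v 0 = 0) (γ : ι →₀ ℕ) (v : ι) :
    f v (γ v) ≤ γ.sum f := by
  by_cases h : γ v = 0
  · rw [h, h0]
    exact Finset.sum_nonneg fun _ _ => hf _ _
  · exact Finset.single_le_sum (f := fun v => f v (γ v)) (fun _ _ => hf _ _)
      (Finsupp.mem_support_iff.2 h)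

theorem le_qd (γ : MIdx) (k : ℕ) : (k + 1) * γ (Sum.inl k) ≤ qd γ := by
  refine (le_of_eq ?_).trans
    (finsupp_apply_le_sum _ (fun _ _ => Nat.zero_le _) ?_ γ (Sum.inl k))
  · rfl
  · rintro (k | n) <;> simp

/-- A factor $z_0$ changes neither $[\gamma]$ nor $|\gamma|$, so these do not bound the
multi-indices below $\beta$. The weight $k+1$ of $z_k$ in `qd` counts $z_0$ as well, and $D^{(n)}$
does not decrease it. -/
theorem qd_le_of_coeff_Dtilt {n : N2} {γ β : MIdx} (h : coeff β (Dtilt n (zmon γ)) ≠ 0) :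
    qd γ ≤ qd β := by
  classical
  rcases exists_of_coeff_Dtilt h with ⟨hn, h1⟩ | ⟨k, δ, rfl, h1⟩
  · rw [coeff_zmon] at h1
    split_ifs at h1 with h2
    · rw [← h2, qd_add]
      unfold qd
      rw [Finsupp.sum_single_index] <;> simp
    · exact absurd rfl h1
  · rw [coeff_zmon] at h1
    split_ifs at h1 with h2
    · rw [← h2, qd_add, qd_add, qd_single_inl, qd_single_inl]
      omega
    · exact absurd rfl h1

theorem FinDep.exists_of_coeff {op : PS →ₗ[ℝ] PS} (h : FinDep op) {F : PS} {β : MIdx}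
    (hβ : coeff β (op F) ≠ 0) : ∃ γ, coeff β (op (zmon γ)) ≠ 0 ∧ coeff γ F ≠ 0 := by
  obtain ⟨S, -, hS⟩ := h.exists_sum β
  rw [hS] at hβ
  obtain ⟨γ, -, hγ⟩ := Finset.exists_ne_zero_of_sum_ne_zero hβ
  exact ⟨γ, left_ne_zero_of_mul hγ, right_ne_zero_of_mul hγ⟩

section Triangular

variable {α : ℝ} {w : N2 →+ ℝ}

/-- The strict triangular order on multi-indices. -/
def Below (α : ℝ) (w : N2 →+ ℝ) (γ β : MIdx) : Prop :=
  br γ ≤ br β ∧ homog α w γ < homog α w β ∧ qd γ ≤ qd β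

theorem Below.trans {γ β δ : MIdx} (h : Below α w γ β) (h' : Below α w β δ) : Below α w γ δ :=
  ⟨h.1.trans h'.1, h.2.1.trans h'.2.1, h.2.2.trans h'.2.2⟩

variable [Pos α w]

theorem below_of_coeff_vf (s : TLs α w) {γ β : MIdx} (h : coeff β (vf s (zmon γ)) ≠ 0) :
    Below α w γ β := by
  refine ⟨(exists_of_coeff_vf_zmon s h).1, (exists_of_coeff_vf_zmon s h).2, ?_⟩
  rw [coeff_vf s _ le_rfl] at h
  obtain ⟨n, -, h1⟩ := Finset.exists_ne_zero_of_sum_ne_zero h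
  obtain ⟨δ, β', rfl, -, h3⟩ := exists_of_coeff_mul h1
  have := qd_le_of_coeff_Dtilt h3
  rw [qd_add]
  omega

theorem below_of_coeff_rhoh (u : U α w) {γ β : MIdx} (h : coeff β (rhoh α w u (zmon γ)) ≠ 0) :
    γ = β ∨ Below α w γ β := by
  classical
  induction u using inU_induction generalizing β with
  | one =>
    rw [map_one, Module.End.one_apply, coeff_zmon] at h
    split_ifs at h with h1
    · exact Or.inl h1.symm
    · exact absurd rfl h
  | mul D u hu =>
    rw [rhoh_inU_mul] at h
    obtain ⟨δ, h1, h2⟩ := (FinDep.vf (sg D)).exists_of_coeff h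
    have h3 := below_of_coeff_vf _ h1
    rcases hu h2 with rfl | h4
    · exact Or.inr h3
    · exact Or.inr (h4.trans h3)
  | add u v hu hv =>
    rw [map_add, LinearMap.add_apply, map_add] at h
    by_cases h1 : coeff β (rhoh α w u (zmon γ)) = 0
    · rw [h1, zero_add] at h
      exact hv h
    · exact hu h1
  | smul c u hu =>
    rw [map_smul, LinearMap.smul_apply, MvPowerSeries.coeff_smul] at h
    exact hu (right_ne_zero_of_mul h)

theorem coeff_rhoh_self (u : U α w) (γ : MIdx) : coeff γ (rhoh α w u (zmon γ)) = counitU u := by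
  classical
  induction u using inU_induction with
  | one => rw [map_one, Module.End.one_apply, coeff_zmon, if_pos rfl, map_one]
  | mul D u hu =>
    rw [rhoh_inU_mul]
    refine Eq.trans ?_ (counitU_ι_mul D u).symm
    by_contra h
    obtain ⟨δ, h1, h2⟩ := (FinDep.vf (sg D)).exists_of_coeff h
    have h3 := (below_of_coeff_vf _ h1).2.1
    rcases below_of_coeff_rhoh u h2 with rfl | h4
    · exact lt_irrefl _ h3
    · exact lt_irrefl _ (h4.2.1.trans h3)
  | add u v hu hv => rw [map_add, LinearMap.add_apply, map_add, hu, hv, map_add]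
  | smul c u hu =>
    rw [map_smul, LinearMap.smul_apply, MvPowerSeries.coeff_smul, hu, map_smul, smul_eq_mul]

theorem finite_bounded (α : ℝ) (w : N2 →+ ℝ) [Pos α w] (N : ℤ) (c : ℝ) (Q : ℕ) :
    {γ : MIdx | N ≤ br γ ∧ homog α w γ ≤ c ∧ qd γ ≤ Q}.Finite := by
  classical
  -- Since $\alpha([\gamma]+1)\ge\alpha(N+1)$, what remains for $\sum_n|n|\gamma(n)$ is at most
  -- $c'$. It bounds the exponents of the $z_n$ and, up to the strict inequality of `finite_w_lt`,
  -- the occurring $n$; the $z_k$ are controlled by $Q$.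
  set c' : ℝ := c - α * (N + 1) with hc'
  let f : Var → ℕ := fun v => match v with
    | Sum.inl _ => Q
    | Sum.inr n => ⌈c' / w n.1⌉₊
  have hfin : {n : {n : N2 // n ≠ 0} | w n.1 < c' + 1}.Finite :=
    (finite_w_lt α w (c' + 1)).preimage Subtype.val_injective.injOn
  let S : Finset Var := (Finset.range Q).image Sum.inl ∪ hfin.toFinset.image Sum.inr
  let B : MIdx := Finsupp.indicator S fun v _ => f v
  refine (Set.finite_Iic B).subset fun γ hγ => ?_
  obtain ⟨h1, h2, h3⟩ := hγ
  intro v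
  by_cases hv : γ v = 0
  · rw [hv]
    exact Nat.zero_le _
  have hα := alpha_pos α w
  have hle : ∀ n : {n : N2 // n ≠ 0}, w n.1 * (γ (Sum.inr n) : ℝ) ≤ c' := by
    intro n
    have hb : (N : ℝ) ≤ br γ := by exact_mod_cast h1
    have h4 : w n.1 * (γ (Sum.inr n) : ℝ) ≤ homog α w γ - α * ((br γ : ℝ) + 1) := by
      unfold homog
      rw [add_sub_cancel_left]
      refine (le_of_eq ?_).trans (finsupp_apply_le_sum _ ?_ ?_ γ (Sum.inr n))
      · rfl
      · rintro (k | m) e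
        · exact le_rfl
        · exact mul_nonneg (w_nonneg α w _) (Nat.cast_nonneg _)
      · rintro (k | m) <;> simp
    nlinarith
  have hvS : v ∈ S ∧ γ v ≤ f v := by
    rcases v with k | n
    · have h5 := le_qd γ k
      have h6 : 1 ≤ γ (Sum.inl k) := Nat.one_le_iff_ne_zero.2 hv
      have h7 : k + 1 ≤ Q := by nlinarith
      have h8 : γ (Sum.inl k) ≤ Q := by nlinarith
      refine ⟨Finset.mem_union_left _ (Finset.mem_image_of_mem _ (Finset.mem_range.2 h7)), h8⟩
    · have h5 := hle n
      have h6 : (1 : ℝ) ≤ γ (Sum.inr n) := by exact_mod_cast Nat.one_le_iff_ne_zero.2 hv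
      have h7 := w_pos α w n.2
      refine ⟨Finset.mem_union_right _ (Finset.mem_image_of_mem _ (hfin.mem_toFinset.2 ?_)), ?_⟩
      · change w n.1 < c' + 1
        nlinarith
      · have : (γ (Sum.inr n) : ℝ) ≤ c' / w n.1 := by
          rw [le_div_iff₀ h7]
          linarith
        exact_mod_cast this.trans (Nat.le_ceil _)
  change γ v ≤ Finsupp.indicator S (fun v _ => f v) v
  rw [Finsupp.indicator_of_mem hvS.1]
  exact hvS.2

/-! ### The coefficients of the universal pull-back -/

/-- The coefficient of `z^β` in the universal pull-back of `z^γ`. -/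
def cfm (α : ℝ) (w : N2 →+ ℝ) (β γ : MIdx) : Tplus α w := cf β (MvPolynomial.monomial γ 1)

theorem BU_cfm (u : U α w) (β γ : MIdx) :
    BU u (cfm α w β γ) = coeff β (rhoh α w u (zmon γ)) := by
  rw [cfm, BU_cf, MvPolynomial.coe_monomial]

/-- Triangularity of all the matrices $\rho(u)$ passes to the universal matrix, since the pairing
separates points. -/
theorem below_of_cfm {β γ : MIdx} (h : cfm α w β γ ≠ 0) : γ = β ∨ Below α w γ β := by
  by_contra hc
  refine h (BU_ext_right fun u => ?_)
  rw [BU_cfm, map_zero]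
  by_contra h'
  exact hc (below_of_coeff_rhoh u h')

theorem cfm_self (γ : MIdx) : cfm α w γ γ = 1 :=
  BU_ext_right fun u => by rw [BU_cfm, coeff_rhoh_self, BU_apply_one]

theorem IsModelIdx.of_cfm {β γ : MIdx} (hγ : IsModelIdx γ) (h : cfm α w β γ ≠ 0) :
    IsModelIdx β := by
  by_contra hc
  refine h (BU_ext_right fun u => ?_)
  rw [BU_cfm, map_zero]
  by_contra h'
  have := coe_rho u ⟨zmon γ, zmon_mem_Tstar hγ⟩
  change (_ : PS) = rhoh α w u (zmon γ) at this
  rw [← this] at h'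
  exact hc ((rho α w u ⟨zmon γ, zmon_mem_Tstar hγ⟩).2 β h')

/-- The power series whose multi-indices have `[γ]` bounded below. -/
def BrBdd (N : ℤ) (F : PS) : Prop := ∀ γ, coeff γ F ≠ 0 → N ≤ br γ

theorem brBdd_of_mem_Tstar {F : PS} (hF : F ∈ Tstar) : BrBdd (-1) F :=
  fun γ hγ => (hF γ hγ).neg_one_le

theorem BrBdd.mul {N M : ℤ} {F G : PS} (hF : BrBdd N F) (hG : BrBdd M G) :
    BrBdd (N + M) (F * G) := by
  intro β hβ
  obtain ⟨γ, δ, rfl, h1, h2⟩ := exists_of_coeff_mul hβ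
  rw [br_add]
  exact add_le_add (hF γ h1) (hG δ h2)

/-- The universal pull-back of a power series. -/
def pullF (α : ℝ) (w : N2 →+ ℝ) (F : PS) : PSplus α w := fun β => ∑ᶠ γ, coeff γ F • cfm α w β γ

/-- The finite set of multi-indices that contribute to the coefficient of `z^β`. -/
def Bset (α : ℝ) (w : N2 →+ ℝ) [Pos α w] (N : ℤ) (β : MIdx) : Finset MIdx :=
  (finite_bounded α w N (homog α w β) (qd β)).toFinset

theorem mem_Bset {N : ℤ} {β γ : MIdx} :
    γ ∈ Bset α w N β ↔ N ≤ br γ ∧ homog α w γ ≤ homog α w β ∧ qd γ ≤ qd β := by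
  simp [Bset]

theorem mem_Bset_of_cfm {N : ℤ} {β γ : MIdx} (hN : N ≤ br γ) (h : cfm α w β γ ≠ 0) :
    γ ∈ Bset α w N β := by
  rw [mem_Bset]
  rcases below_of_cfm h with rfl | ⟨-, h2, h3⟩
  · exact ⟨hN, le_rfl, le_rfl⟩
  · exact ⟨hN, h2.le, h3⟩

theorem coeff_pullF {N : ℤ} {F : PS} (hF : BrBdd N F) (β : MIdx) :
    coeff β (pullF α w F) = ∑ γ ∈ Bset α w N β, coeff γ F • cfm α w β γ := by
  refine finsum_eq_sum_of_support_subset _ fun γ hγ => ?_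
  exact mem_Bset_of_cfm (hF γ (left_ne_zero_of_smul hγ)) (right_ne_zero_of_smul hγ)

theorem FinDep.coeff_eq_sum {op : PS →ₗ[ℝ] PS} (h : FinDep op) (F : PS) {β : MIdx} {S : Finset MIdx}
    (hS : ∀ γ, coeff β (op (zmon γ)) ≠ 0 → coeff γ F ≠ 0 → γ ∈ S) :
    coeff β (op F) = ∑ γ ∈ S, coeff γ F * coeff β (op (zmon γ)) := by
  classical
  obtain ⟨S', hS', h'⟩ := h.exists_sum β
  have key : ∀ γ, γ ∉ S → coeff γ F * coeff β (op (zmon γ)) = 0 := by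
    intro γ hγ
    by_contra hc
    exact hγ (hS γ (right_ne_zero_of_mul hc) (left_ne_zero_of_mul hc))
  rw [h']
  simp only [mul_comm (coeff β _)]
  rw [Finset.sum_subset (Finset.subset_union_left (s₁ := S') (s₂ := S)),
    Finset.sum_subset (Finset.subset_union_right (s₁ := S') (s₂ := S))]
  · exact fun γ _ hγ => key γ hγ
  · intro γ _ hγ
    rw [hS' γ hγ, mul_zero]

theorem BU_pullF {N : ℤ} {F : PS} (hF : BrBdd N F) (u : U α w) (β : MIdx) :
    BU u (coeff β (pullF α w F)) = coeff β (rhoh α w u F) := by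
  rw [coeff_pullF hF, map_sum, (FinDep.rhoh u).coeff_eq_sum F (S := Bset α w N β)]
  · simp only [map_smul, BU_cfm, smul_eq_mul]
  · intro γ h1 h2
    refine mem_Bset_of_cfm (hF γ h2) fun h0 => h1 ?_
    rw [← BU_cfm, h0, map_zero]

/-- A substitute for Sweedler notation: coproducts are written as explicit finite sums. -/
theorem exists_tensor {V W : Type} [AddCommGroup V] [Module ℝ V] [AddCommGroup W] [Module ℝ W]
    (x : V ⊗[ℝ] W) : ∃ (I : Type) (S : Finset I) (a : I → V) (b : I → W),
      x = ∑ i ∈ S, a i ⊗ₜ[ℝ] b i := by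
  induction x using TensorProduct.induction_on with
  | zero => exact ⟨Unit, ∅, 0, 0, by simp⟩
  | tmul a b => exact ⟨Unit, {()}, fun _ => a, fun _ => b, by simp⟩
  | add x y hx hy =>
    classical
    obtain ⟨I, S, a, b, rfl⟩ := hx
    obtain ⟨I', S', a', b', rfl⟩ := hy
    refine ⟨I ⊕ I', S.disjSum S', Sum.elim a a', Sum.elim b b', ?_⟩
    rw [Finset.sum_disjSum]
    rfl

/-- After pairing with $u$ both sides are governed by the coproduct of $u$: the left one by the
Leibniz rule for $\rho(u)$, the right one by the duality of product and coproduct. Lower bounds on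
$[\cdot]$ are the setting, because they survive products while $\mathsf T^*$ does not. -/
theorem pullF_mul {N M : ℤ} {F G : PS} (hF : BrBdd N F) (hG : BrBdd M G) :
    pullF α w (F * G) = pullF α w F * pullF α w G := by
  classical
  ext1 β
  refine BU_ext_right fun u => ?_
  rw [BU_pullF (hF.mul hG), rhoh_mul, MvPowerSeries.coeff_mul, map_sum]
  simp only [BU_mul_apply]
  obtain ⟨I, S, a, b, h⟩ := exists_tensor (cop u)
  simp only [h, map_sum, TensorProduct.map_tmul, LinearMap.mul'_apply, LinearMap.flip_apply,
    formTensor, LinearMap.comp_apply, BU_pullF hF, BU_pullF hG, MvPowerSeries.coeff_mul,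
    AlgHom.toLinearMap_apply]
  rw [Finset.sum_comm]

theorem pullF_coe {N : ℤ} {P : MvPolynomial Var ℝ} (hP : BrBdd N (P : PS)) :
    pullF α w (P : PS) = upull α w P := by
  ext1 β
  refine BU_ext_right fun u => ?_
  rw [BU_pullF hP]
  exact (BU_cf u β P).symm

theorem pullF_add {N : ℤ} {F G : PS} (hF : BrBdd N F) (hG : BrBdd N G) :
    pullF α w (F + G) = pullF α w F + pullF α w G := by
  have hFG : BrBdd N (F + G) := by
    intro γ hγ
    by_cases h : coeff γ F = 0
    · rw [map_add, h, zero_add] at hγ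
      exact hG γ hγ
    · exact hF γ h
  ext1 β
  rw [map_add, coeff_pullF hF, coeff_pullF hG, coeff_pullF hFG, ← Finset.sum_add_distrib]
  simp only [map_add, add_smul]

theorem pullF_smul {N : ℤ} {F : PS} (hF : BrBdd N F) (c : ℝ) :
    pullF α w (c • F) = c • pullF α w F := by
  have hcF : BrBdd N (c • F) := by
    intro γ hγ
    rw [MvPowerSeries.coeff_smul] at hγ
    exact hF γ (right_ne_zero_of_mul hγ)
  ext1 β
  rw [coeff_rsmul, coeff_pullF hF, coeff_pullF hcF, Finset.smul_sum]
  simp only [MvPowerSeries.coeff_smul, mul_smul]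

end Triangular

end

end ShiftTilt

/-! ### The comodule and the Hopf algebra obtained by duality -/

namespace ShiftTilt

noncomputable section

open MvPowerSeries (coeff X)

/-! ### Linear forms on tensor products -/

section Tensor

variable {V W V' W' : Type} [AddCommGroup V] [Module ℝ V] [AddCommGroup W] [Module ℝ W]
  [AddCommGroup V'] [Module ℝ V'] [AddCommGroup W'] [Module ℝ W']

/-- The contraction `f ⊗ id` of a tensor product. -/
def sl (f : V →ₗ[ℝ] ℝ) : V ⊗[ℝ] W →ₗ[ℝ] W := (TensorProduct.lid ℝ W).toLinearMap ∘ₗ f.rTensor W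

@[simp] theorem sl_tmul (f : V →ₗ[ℝ] ℝ) (v : V) (x : W) : sl f (v ⊗ₜ[ℝ] x) = f v • x := by
  simp [sl]

@[simp] theorem formTensor_tmul (f : V →ₗ[ℝ] ℝ) (g : W →ₗ[ℝ] ℝ) (v : V) (x : W) :
    formTensor f g (v ⊗ₜ[ℝ] x) = f v * g x := by
  simp [formTensor]

theorem formTensor_eq (f : V →ₗ[ℝ] ℝ) (g : W →ₗ[ℝ] ℝ) : formTensor f g = g ∘ₗ sl f := by
  refine TensorProduct.ext' fun v x => ?_
  simp

theorem formTensor_comp (f : V →ₗ[ℝ] ℝ) (g : W →ₗ[ℝ] ℝ) (p : V' →ₗ[ℝ] V) (q : W' →ₗ[ℝ] W)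
    (x : V' ⊗[ℝ] W') :
    formTensor f g (TensorProduct.map p q x) = formTensor (f ∘ₗ p) (g ∘ₗ q) x := by
  have : formTensor f g ∘ₗ TensorProduct.map p q = formTensor (f ∘ₗ p) (g ∘ₗ q) :=
    TensorProduct.ext' fun v x => by simp
  exact LinearMap.congr_fun this x

theorem formTensor_lTensor (f : V →ₗ[ℝ] ℝ) (g : W →ₗ[ℝ] ℝ) (q : W' →ₗ[ℝ] W) (x : V ⊗[ℝ] W') :
    formTensor f g (q.lTensor V x) = formTensor f (g ∘ₗ q) x := formTensor_comp f g LinearMap.id q x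

theorem formTensor_rTensor (f : V →ₗ[ℝ] ℝ) (g : W →ₗ[ℝ] ℝ) (p : V' →ₗ[ℝ] V) (x : V' ⊗[ℝ] W) :
    formTensor f g (p.rTensor W x) = formTensor (f ∘ₗ p) g x := formTensor_comp f g p LinearMap.id x

theorem formTensor_assoc {V₁ V₂ V₃ : Type} [AddCommGroup V₁] [Module ℝ V₁] [AddCommGroup V₂]
    [Module ℝ V₂] [AddCommGroup V₃] [Module ℝ V₃] (f : V₁ →ₗ[ℝ] ℝ) (g : V₂ →ₗ[ℝ] ℝ)
    (h : V₃ →ₗ[ℝ] ℝ) (x : (V₁ ⊗[ℝ] V₂) ⊗[ℝ] V₃) :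
    formTensor f (formTensor g h) (TensorProduct.assoc ℝ V₁ V₂ V₃ x) =
      formTensor (formTensor f g) h x := by
  have : formTensor f (formTensor g h) ∘ₗ (TensorProduct.assoc ℝ V₁ V₂ V₃).toLinearMap =
      formTensor (formTensor f g) h :=
    TensorProduct.ext_threefold fun a b c => by simp [mul_assoc]
  exact LinearMap.congr_fun this x

/-- A family of linear forms separates points. -/
def Separating {I : Type} (f : I → V →ₗ[ℝ] ℝ) : Prop := ∀ v w, (∀ i, f i v = f i w) → v = w

/-- Expanding in a basis of $W$, an element of the tensor product is a finite family of vectors of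
$V$, each of which is tested by the forms $f_i$. -/
theorem Separating.eq_of_sl {I : Type} {f : I → V →ₗ[ℝ] ℝ} (hf : Separating f) {x y : V ⊗[ℝ] W}
    (h : ∀ i, sl (f i) x = sl (f i) y) : x = y := by
  classical
  let b := Module.Basis.ofVectorSpace ℝ W
  have key : ∀ i k (z : V ⊗[ℝ] W),
      f i (TensorProduct.equivFinsuppOfBasisRight b z k) = b.repr (sl (f i) z) k := by
    intro i k z
    induction z using TensorProduct.induction_on with
    | zero => simp
    | tmul v x =>
      rw [TensorProduct.equivFinsuppOfBasisRight_apply_tmul_apply]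
      simp [mul_comm]
    | add x y hx hy => simp [hx, hy]
  refine (TensorProduct.equivFinsuppOfBasisRight b).injective (Finsupp.ext fun k => ?_)
  refine hf _ _ fun i => ?_
  rw [key, key, h]

theorem Separating.tensor {I I' : Type} {f : I → V →ₗ[ℝ] ℝ} {g : I' → W →ₗ[ℝ] ℝ}
    (hf : Separating f) (hg : Separating g) :
    Separating fun p : I × I' => formTensor (f p.1) (g p.2) := by
  intro x y h
  refine hf.eq_of_sl fun i => hg _ _ fun j => ?_
  have : formTensor (f i) (g j) x = formTensor (f i) (g j) y := h (i, j)
  rwa [formTensor_eq] at this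

end Tensor

/-! ### The pairing of `T^*` and `T` -/

theorem toDual_zT (F : Tstar) (γ : {γ : MIdx // IsModelIdx γ}) :
    toDual F (zT γ) = coeff γ.1 F.1 := by
  simp [toDual, zT]

theorem T_ext {M : Type} [AddCommGroup M] [Module ℝ M] {f g : T →ₗ[ℝ] M}
    (h : ∀ γ, f (zT γ) = g (zT γ)) : f = g :=
  Finsupp.lhom_ext' fun γ => LinearMap.ext_ring (h γ)

theorem Tstar_ext {F G : Tstar} (h : ∀ γ : {γ : MIdx // IsModelIdx γ}, coeff γ.1 F.1 = coeff γ.1 G.1) :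
    F = G := by
  refine Subtype.ext (MvPowerSeries.ext fun γ => ?_)
  by_cases hγ : IsModelIdx γ
  · exact h ⟨γ, hγ⟩
  · have h1 : coeff γ F.1 = 0 := by_contra fun h => hγ (F.2 γ h)
    have h2 : coeff γ G.1 = 0 := by_contra fun h => hγ (G.2 γ h)
    rw [h1, h2]

theorem separating_toDual : Separating fun F : Tstar => (toDual F : T →ₗ[ℝ] ℝ) := by
  classical
  intro τ τ' h
  ext γ
  have h1 : ∀ τ : T, toDual ⟨zmon γ.1, zmon_mem_Tstar γ.2⟩ τ = τ γ := by
    intro τ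
    have : (toDual ⟨zmon γ.1, zmon_mem_Tstar γ.2⟩ : T →ₗ[ℝ] ℝ) = Finsupp.lapply γ := by
      refine T_ext fun δ => ?_
      rw [toDual_zT, coeff_zmon, Finsupp.lapply_apply, Finsupp.single_apply]
      refine if_congr ?_ rfl rfl
      rw [Subtype.ext_iff]
    rw [this, Finsupp.lapply_apply]
  rw [← h1, ← h1, h]

/-- The element of `T^*` that represents a linear form on `T`. -/
def ofDual (f : T →ₗ[ℝ] ℝ) : Tstar := by
  classical
  exact ⟨series fun γ => if h : IsModelIdx γ then f (zT ⟨γ, h⟩) else 0, fun γ hγ => by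
    by_contra hc
    rw [coeff_series, dif_neg hc] at hγ
    exact hγ rfl⟩

theorem coeff_ofDual (f : T →ₗ[ℝ] ℝ) (γ : {γ : MIdx // IsModelIdx γ}) :
    coeff γ.1 (ofDual f).1 = f (zT γ) := by
  unfold ofDual
  exact dif_pos γ.2

theorem toDual_ofDual (f : T →ₗ[ℝ] ℝ) : toDual (ofDual f) = f :=
  T_ext fun γ => by rw [toDual_zT, coeff_ofDual]

theorem toDual_bijective : Function.Bijective toDual := by
  refine ⟨fun F G h => Tstar_ext fun γ => ?_, fun f => ⟨ofDual f, toDual_ofDual f⟩⟩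
  rw [← toDual_zT, ← toDual_zT, h]

/-! ### The comodule structure of `T` -/

section Comodule

variable {α : ℝ} {w : N2 →+ ℝ} [Pos α w]

open Classical in
/-- The value of the coaction on `z_β`. -/
def DeltaZ (α : ℝ) (w : N2 →+ ℝ) [Pos α w] (β : {γ : MIdx // IsModelIdx γ}) : Tplus α w ⊗[ℝ] T :=
  -- Row $\beta$ of the universal pull-back matrix. As $[\gamma]\ge-1$ for the multi-indices of
  -- $\mathsf T^*$, this finite set contains every nonzero entry.
  ∑ γ ∈ (Bset α w (-1) β.1).subtype IsModelIdx, cfm α w β.1 γ.1 ⊗ₜ[ℝ] zT γ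

/-- The coaction `T → T⁺ ⊗ T`. -/
def DeltaT (α : ℝ) (w : N2 →+ ℝ) [Pos α w] : T →ₗ[ℝ] Tplus α w ⊗[ℝ] T :=
  Finsupp.lsum ℝ fun β => LinearMap.toSpanSingleton ℝ _ (DeltaZ α w β)

theorem DeltaT_zT (β : {γ : MIdx // IsModelIdx γ}) : DeltaT α w (zT β) = DeltaZ α w β := by
  simp [DeltaT, zT]

/-- The linear form is arbitrary so that the formula serves both for the pairing with $u$, giving
the module, and for characters, giving $\Gamma_f$. -/
theorem formTensor_DeltaT (φ : Tplus α w →ₗ[ℝ] ℝ) (F : Tstar) (β : {γ : MIdx // IsModelIdx γ}) :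
    formTensor φ (toDual F) (DeltaT α w (zT β)) = φ (coeff β.1 (pullF α w F.1)) := by
  classical
  rw [DeltaT_zT, DeltaZ, map_sum, coeff_pullF (brBdd_of_mem_Tstar F.2), map_sum]
  simp only [formTensor_tmul, toDual_zT, map_smul, smul_eq_mul]
  rw [Finset.sum_subtype_eq_sum_filter (s := Bset α w (-1) β.1) (p := IsModelIdx)
    (f := fun γ => φ (cfm α w β.1 γ) * coeff γ F.1), Finset.sum_filter]
  refine Finset.sum_congr rfl fun γ _ => ?_
  split_ifs with h
  · rw [mul_comm]
  · have h1 : coeff γ F.1 = 0 := by_contra fun h' => h (F.2 γ h')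
    rw [h1, zero_mul]

theorem toDual_rho (u : U α w) (F : Tstar) (τ : T) :
    formTensor (BU u) (toDual F) (DeltaT α w τ) = toDual (rho α w u F) τ := by
  have : formTensor (BU u) (toDual F) ∘ₗ DeltaT α w = toDual (rho α w u F) := by
    refine T_ext fun β => ?_
    rw [LinearMap.comp_apply, formTensor_DeltaT, BU_pullF (brBdd_of_mem_Tstar F.2), toDual_zT,
      coe_rho]
  exact LinearMap.congr_fun this τ

/-- The universal extended tilt as a linear map on `T`. -/
def ET (α : ℝ) (w : N2 →+ ℝ) (n : N2) : T →ₗ[ℝ] Tplus α w :=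
  Finsupp.lsum ℝ fun γ => LinearMap.toSpanSingleton ℝ _ (Ehat α w n γ.1)

theorem ET_zT (n : N2) (γ : {γ : MIdx // IsModelIdx γ}) : ET α w n (zT γ) = Ehat α w n γ.1 := by
  simp [ET, zT]

/-- The pairing of an element of `U(L)` with the universal extended tilt. -/
def Bser (u : U α w) (n : N2) : PS := series fun γ => BU u (Ehat α w n γ)

theorem coeff_Bser (u : U α w) (n : N2) (γ : MIdx) :
    coeff γ (Bser u n) = BU u (Ehat α w n γ) := rfl

theorem Bser_mem (u : U α w) (n : N2) : Bser u n ∈ Tstar := by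
  intro γ hγ
  rw [coeff_Bser] at hγ
  exact (of_Ehat_ne_zero (α := α) (w := w) (n := n) fun h => hγ (by rw [h, map_zero])).1

theorem BU_comp_ET (u : U α w) (n : N2) : BU u ∘ₗ ET α w n = toDual ⟨Bser u n, Bser_mem u n⟩ := by
  refine T_ext fun γ => ?_
  rw [LinearMap.comp_apply, ET_zT, toDual_zT, coeff_Bser]

/-- The relation $V_D\hat\pi=s+D\hat\pi$ iterated over the factors of $u$. It is the composition
rule $\hat\pi+\Gamma^*\hat\pi'$ written on $\mathrm U(\mathsf L)$, and it dictates the coproduct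
`DeltaE`. -/
theorem BU_mul_Ehat (u u' : U α w) (n : N2) (γ : MIdx) :
    BU (u * u') (Ehat α w n γ) =
      counitU u' * BU u (Ehat α w n γ) + coeff γ (rhoh α w u (Bser u' n)) := by
  induction u using inU_induction generalizing γ with
  | one =>
    rw [one_mul, BU_one, epsP_Ehat, mul_zero, zero_add, map_one, Module.End.one_apply,
      coeff_Bser]
  | mul D u hu =>
    have hC : ∀ (v : U α w) (c : ℝ), BU v (MvPolynomial.C c) = c * counitU v := by
      intro v c
      rw [MvPolynomial.C_eq_smul_one, map_smul, BU_apply_one, smul_eq_mul]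
    have hs : (series fun δ => BU (u * u') (Ehat α w n δ)) =
        counitU u' • Bser u n + rhoh α w u (Bser u' n) := by
      ext δ
      rw [coeff_series, hu, map_add, MvPowerSeries.coeff_smul, coeff_Bser]
    rw [mul_assoc, BU_inU_mul, BU_inU_mul, VS_Ehat (sg_mem D), vdot, map_add, map_add, hC, hC,
      dual_act (FinDep.vf _), dual_act (FinDep.vf _), rhoh_inU_mul, hs, map_add, map_add, map_smul,
      MvPowerSeries.coeff_smul, map_mul]
    simp only [Bser]
    ring
  | add u v hu hv =>
    rw [add_mul, map_add, map_add, map_add, LinearMap.add_apply, LinearMap.add_apply,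
      LinearMap.add_apply, map_add, hu, hv]
    ring
  | smul c u hu =>
    rw [smul_mul_assoc, map_smul, map_smul, map_smul, LinearMap.smul_apply, LinearMap.smul_apply,
      LinearMap.smul_apply, MvPowerSeries.coeff_smul, hu, smul_eq_mul, smul_eq_mul]
    ring

/-! ### The coproduct of `T⁺` -/

theorem isModelIdx_posIdx (q : LIdx α w) : IsModelIdx (posIdx q).2 := by
  rcases q with q | i
  · exact Or.inl q.2.1
  · exact Or.inr ⟨_, rfl⟩

/-- The coproduct of a component of the universal extended tilt. -/
def DeltaE (α : ℝ) (w : N2 →+ ℝ) [Pos α w] (n : N2) (γ : {γ : MIdx // IsModelIdx γ}) :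
    Tplus α w ⊗[ℝ] Tplus α w :=
  Ehat α w n γ.1 ⊗ₜ[ℝ] 1 + (ET α w n).lTensor (Tplus α w) (DeltaT α w (zT γ))

theorem formTensor_DeltaE (u u' : U α w) (n : N2) (γ : {γ : MIdx // IsModelIdx γ}) :
    formTensor (BU u) (BU u') (DeltaE α w n γ) = BU (u * u') (Ehat α w n γ.1) := by
  rw [DeltaE, map_add, formTensor_tmul, formTensor_lTensor, BU_comp_ET, toDual_rho, toDual_zT,
    coe_rho, BU_mul_Ehat, BU_apply_one, mul_comm]

/-- The coproduct of `T⁺`. -/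
def DeltaP (α : ℝ) (w : N2 →+ ℝ) [Pos α w] : Tplus α w →ₐ[ℝ] Tplus α w ⊗[ℝ] Tplus α w :=
  MvPolynomial.aeval fun q => DeltaE α w (posIdx q).1 ⟨(posIdx q).2, isModelIdx_posIdx q⟩

theorem formTensor_mul (u u' : U α w) {I I' : Type} {S : Finset I} {S' : Finset I'}
    {a b : I → U α w} {a' b' : I' → U α w} (h : cop u = ∑ i ∈ S, a i ⊗ₜ[ℝ] b i)
    (h' : cop u' = ∑ i ∈ S', a' i ⊗ₜ[ℝ] b' i) (x y : Tplus α w ⊗[ℝ] Tplus α w) :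
    formTensor (BU u) (BU u') (x * y) = ∑ i ∈ S, ∑ j ∈ S',
      formTensor (BU (a i)) (BU (a' j)) x * formTensor (BU (b i)) (BU (b' j)) y := by
  induction x using TensorProduct.induction_on with
  | zero => simp
  | tmul Z Z' =>
    induction y using TensorProduct.induction_on with
    | zero => simp
    | tmul Y Y' =>
      rw [Algebra.TensorProduct.tmul_mul_tmul, formTensor_tmul, BU_mul_apply, BU_mul_apply, h, h',
        map_sum, map_sum, Finset.sum_mul_sum]
      refine Finset.sum_congr rfl fun i _ => Finset.sum_congr rfl fun j _ => ?_
      simp only [formTensor_tmul, LinearMap.flip_apply]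
      ring
    | add x y hx hy =>
      rw [mul_add, map_add, hx, hy, ← Finset.sum_add_distrib]
      simp only [map_add, mul_add, Finset.sum_add_distrib]
  | add x z hx hz =>
    rw [add_mul, map_add, hx, hz, ← Finset.sum_add_distrib]
    simp only [map_add, add_mul, Finset.sum_add_distrib]

/-- On variables this is the cocycle rule. It extends to products because the coproduct of $\mathrm
U(\mathsf L)$ is multiplicative and dual to the product of $\mathsf T^+$. -/
theorem formTensor_DeltaP (u u' : U α w) (Z : Tplus α w) :
    formTensor (BU u) (BU u') (DeltaP α w Z) = BU (u * u') Z := by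
  induction Z using MvPolynomial.induction_on generalizing u u' with
  | C c =>
    rw [← MvPolynomial.algebraMap_eq, AlgHom.commutes, Algebra.algebraMap_eq_smul_one,
      Algebra.algebraMap_eq_smul_one, map_smul, map_smul, Algebra.TensorProduct.one_def,
      formTensor_tmul, BU_apply_one, BU_apply_one, BU_apply_one, map_mul]
  | add p q hp hq => rw [map_add, map_add, map_add, hp, hq]
  | mul_X p q hp =>
    obtain ⟨I, S, a, b, h⟩ := exists_tensor (cop u)
    obtain ⟨I', S', a', b', h'⟩ := exists_tensor (cop u')
    have hX : ∀ v v' : U α w, formTensor (BU v) (BU v') (DeltaP α w (MvPolynomial.X q)) =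
        BU (v * v') (MvPolynomial.X q) := by
      intro v v'
      rw [DeltaP, MvPolynomial.aeval_X, formTensor_DeltaE, Ehat_posIdx]
    rw [map_mul, formTensor_mul u u' h h', BU_mul_apply, map_mul, h, h', Finset.sum_mul_sum, map_sum]
    refine Finset.sum_congr rfl fun i _ => ?_
    rw [map_sum]
    refine Finset.sum_congr rfl fun j _ => ?_
    rw [Algebra.TensorProduct.tmul_mul_tmul, formTensor_tmul, LinearMap.flip_apply,
      LinearMap.flip_apply, hp, hX]

theorem separating_BU : Separating fun u : U α w => BU u := fun _ _ h => BU_ext_right h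

/-- `DeltaP` is prescribed on the variables only; for the shift entries, which are polynomials in
$h$, the same formula is forced by the pairing. -/
theorem DeltaP_Ehat (n : N2) (γ : {γ : MIdx // IsModelIdx γ}) :
    DeltaP α w (Ehat α w n γ.1) = DeltaE α w n γ := by
  refine (separating_BU.tensor separating_BU) _ _ fun p => ?_
  rw [formTensor_DeltaP, formTensor_DeltaE]

theorem DeltaP_coassoc : (TensorProduct.assoc ℝ (Tplus α w) (Tplus α w) (Tplus α w)).toLinearMap ∘ₗ
    (DeltaP α w).toLinearMap.rTensor (Tplus α w) ∘ₗ (DeltaP α w).toLinearMap =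
    (DeltaP α w).toLinearMap.lTensor (Tplus α w) ∘ₗ (DeltaP α w).toLinearMap := by
  refine LinearMap.ext fun Z => ?_
  refine (separating_BU.tensor (separating_BU.tensor separating_BU)) _ _ fun p => ?_
  have h : ∀ u v : U α w, formTensor (BU u) (BU v) ∘ₗ (DeltaP α w).toLinearMap = BU (u * v) :=
    fun u v => LinearMap.ext fun Z => formTensor_DeltaP u v Z
  simp only [LinearMap.comp_apply, LinearEquiv.coe_coe, AlgHom.toLinearMap_apply]
  rw [formTensor_assoc, formTensor_rTensor, formTensor_lTensor, h, h, formTensor_DeltaP,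
    formTensor_DeltaP, mul_assoc]

theorem epsP_eq : (epsP α w).toLinearMap = BU (1 : U α w) :=
  LinearMap.ext fun Z => (BU_one Z).symm

theorem DeltaP_counit_left (Z : Tplus α w) : TensorProduct.lid ℝ (Tplus α w)
    ((epsP α w).toLinearMap.rTensor (Tplus α w) (DeltaP α w Z)) = Z := by
  refine BU_ext_right fun u => ?_
  have h := formTensor_DeltaP 1 u Z
  rw [one_mul, formTensor_eq] at h
  rw [epsP_eq]
  exact h

theorem formTensor_rid {V W : Type} [AddCommGroup V] [Module ℝ V] [AddCommGroup W] [Module ℝ W]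
    (f : V →ₗ[ℝ] ℝ) (g : W →ₗ[ℝ] ℝ) (x : V ⊗[ℝ] W) :
    f (TensorProduct.rid ℝ V (g.lTensor V x)) = formTensor f g x := by
  have : f ∘ₗ (TensorProduct.rid ℝ V).toLinearMap ∘ₗ g.lTensor V = formTensor f g :=
    TensorProduct.ext' fun v y => by simp [mul_comm]
  exact LinearMap.congr_fun this x

theorem DeltaP_counit_right (Z : Tplus α w) : TensorProduct.rid ℝ (Tplus α w)
    ((epsP α w).toLinearMap.lTensor (Tplus α w) (DeltaP α w Z)) = Z := by
  refine BU_ext_right fun u => ?_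
  rw [epsP_eq, formTensor_rid, formTensor_DeltaP, mul_one]

theorem isLeftComodule : IsLeftComodule (DeltaP α w) (epsP α w) (DeltaT α w) where
  coassoc := by
    refine LinearMap.ext fun τ => ?_
    refine (separating_BU.tensor (separating_BU.tensor separating_toDual)) _ _ fun p => ?_
    have h : ∀ u v : U α w, formTensor (BU u) (BU v) ∘ₗ (DeltaP α w).toLinearMap = BU (u * v) :=
      fun u v => LinearMap.ext fun Z => formTensor_DeltaP u v Z
    have h' : ∀ (u : U α w) F, formTensor (BU u) (toDual F) ∘ₗ DeltaT α w = toDual (rho α w u F) :=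
      fun u F => LinearMap.ext fun τ => toDual_rho u F τ
    simp only [LinearMap.comp_apply, LinearEquiv.coe_coe]
    rw [formTensor_assoc, formTensor_rTensor, formTensor_lTensor, h, h', toDual_rho, toDual_rho,
      map_mul]
    rfl
  counit τ := by
    refine separating_toDual _ _ fun F => ?_
    have h := toDual_rho (1 : U α w) F τ
    rw [map_one (rho α w), formTensor_eq] at h
    rw [epsP_eq]
    exact h

/-! ### The antipode of `T⁺` -/

theorem counitU_antipodeU {K : Type} [LieRing K] [LieAlgebra ℝ K]
    (v : UniversalEnvelopingAlgebra ℝ K) : counitU (antipodeU v) = counitU v := by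
  induction v using envelope_induction with
  | one => rw [antipodeU_one]
  | mul D v hv =>
    rw [antipodeU_mul, map_mul, map_mul, antipodeU_ι, map_neg, counitU_ι, neg_zero, mul_zero,
      zero_mul]
  | add v v' hv hv' => rw [map_add, map_add, map_add, hv, hv']
  | smul c v hv => rw [map_smul, map_smul, map_smul, hv]

/-- Duality alone would give the antipode as a functional on $\mathrm U(\mathsf L)$; it has to be
represented by a polynomial. The unitriangular matrix `cfm` allows solving the antipode axiom
recursively, and the cardinality of `Bset` decreases strictly along the triangular order. -/
theorem exists_antipode (n : N2) (γ : {γ : MIdx // IsModelIdx γ}) :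
    ∃ t : Tplus α w, ∀ u : U α w, BU u t = BU (antipodeU u) (Ehat α w n γ.1) := by
  classical
  induction hN : (Bset α w (-1) γ.1).card using Nat.strong_induction_on generalizing γ with
  | _ N ih =>
    have hlt : ∀ δ : {γ : MIdx // IsModelIdx γ}, δ ≠ γ → cfm α w γ.1 δ.1 ≠ 0 →
        (Bset α w (-1) δ.1).card < (Bset α w (-1) γ.1).card := by
      intro δ hδ h
      rcases below_of_cfm h with h1 | h1
      · exact absurd (Subtype.ext h1) hδ
      · refine Finset.card_lt_card (Finset.ssubset_iff_subset_ne.2 ⟨fun ε hε => ?_, fun he => ?_⟩)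
        · rw [mem_Bset] at hε ⊢
          exact ⟨hε.1, hε.2.1.trans h1.2.1.le, hε.2.2.trans h1.2.2⟩
        · have h2 : γ.1 ∈ Bset α w (-1) γ.1 := mem_Bset.2 ⟨γ.2.neg_one_le, le_rfl, le_rfl⟩
          rw [← he, mem_Bset] at h2
          exact absurd h1.2.1 (not_lt.2 h2.2.1)
    have hex : ∀ δ : {γ : MIdx // IsModelIdx γ}, ∃ t : Tplus α w, δ ≠ γ → cfm α w γ.1 δ.1 ≠ 0 →
        ∀ u : U α w, BU u t = BU (antipodeU u) (Ehat α w n δ.1) := by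
      intro δ
      by_cases h : δ ≠ γ ∧ cfm α w γ.1 δ.1 ≠ 0
      · obtain ⟨t, ht⟩ := ih _ (hN ▸ hlt δ h.1 h.2) δ rfl
        exact ⟨t, fun _ _ => ht⟩
      · exact ⟨0, fun h1 h2 => absurd ⟨h1, h2⟩ h⟩
    choose t ht using hex
    let M := (Bset α w (-1) γ.1).subtype IsModelIdx
    have hγM : γ ∈ M := Finset.mem_subtype.2 (mem_Bset.2 ⟨γ.2.neg_one_le, le_rfl, le_rfl⟩)
    -- The axiom $\sum a\,S(b)=\varepsilon(u)$, paired with the entry $\hat\pi_\gamma$ and expanded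
    -- by `BU_mul_Ehat`, reads $0=\hat\pi_\gamma+\sum_\delta c_{\gamma\delta}\,S\hat\pi_\delta$. The
    -- diagonal coefficient is $1$, so it is solved for $S\hat\pi_\gamma$.
    refine ⟨-Ehat α w n γ.1 - ∑ δ ∈ M.erase γ, cfm α w γ.1 δ.1 * t δ, fun u => ?_⟩
    obtain ⟨I, S, a, b, h⟩ := exists_tensor (cop u)
    have hop := (isHopf_envelope (K := L α w))
    have h1 := hop.antipode_right u
    have h2 := hop.counit_right u
    have h3 := hop.counit_left u
    simp only [h, map_sum, LinearMap.lTensor_tmul, LinearMap.rTensor_tmul, LinearMap.mul'_apply,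
      TensorProduct.lid_tmul, TensorProduct.rid_tmul, AlgHom.toLinearMap_apply] at h1 h2 h3
    have e1 := congrArg (fun v => BU v (Ehat α w n γ.1)) h1
    simp only [map_sum, LinearMap.sum_apply, BU_mul_Ehat, counitU_antipodeU, Algebra.algebraMap_eq_smul_one,
      map_smul, LinearMap.smul_apply, BU_one, epsP_Ehat, smul_zero, Finset.sum_add_distrib] at e1
    have e2 : ∑ i ∈ S, counitU (b i) * BU (a i) (Ehat α w n γ.1) = BU u (Ehat α w n γ.1) := by
      conv_rhs => rw [← h2]
      simp [LinearMap.sum_apply]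
    have e3 : ∑ i ∈ S, coeff γ.1 (rhoh α w (a i) (Bser (antipodeU (b i)) n)) =
        ∑ δ ∈ M, ∑ i ∈ S, BU (a i) (cfm α w γ.1 δ.1) * BU (antipodeU (b i)) (Ehat α w n δ.1) := by
      rw [Finset.sum_comm]
      refine Finset.sum_congr rfl fun i _ => ?_
      have := toDual_rho (a i) ⟨_, Bser_mem (antipodeU (b i)) n⟩ (zT γ)
      rw [toDual_zT, coe_rho] at this
      rw [← this, DeltaT_zT, DeltaZ, map_sum]
      refine Finset.sum_congr rfl fun δ _ => ?_
      rw [formTensor_tmul, toDual_zT, coeff_Bser]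
    have e4 : ∑ i ∈ S, BU (a i) (cfm α w γ.1 γ.1) * BU (antipodeU (b i)) (Ehat α w n γ.1) =
        BU (antipodeU u) (Ehat α w n γ.1) := by
      conv_rhs => rw [← h3]
      simp [LinearMap.sum_apply, cfm_self, BU_apply_one]
    have e5 : ∀ δ ∈ M.erase γ, ∑ i ∈ S, BU (a i) (cfm α w γ.1 δ.1) *
        BU (antipodeU (b i)) (Ehat α w n δ.1) = BU u (cfm α w γ.1 δ.1 * t δ) := by
      intro δ hδ
      by_cases h0 : cfm α w γ.1 δ.1 = 0
      · simp [h0]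
      · rw [BU_mul_apply, h, map_sum]
        refine Finset.sum_congr rfl fun i _ => ?_
        rw [formTensor_tmul, LinearMap.flip_apply, LinearMap.flip_apply,
          ht δ (Finset.ne_of_mem_erase hδ) h0]
    rw [e2, e3, ← Finset.add_sum_erase _ _ hγM, e4, Finset.sum_congr rfl e5] at e1
    rw [map_sub, map_neg, map_sum]
    linarith

/-- The antipode of `T⁺`. -/
def Santi (α : ℝ) (w : N2 →+ ℝ) [Pos α w] : Tplus α w →ₐ[ℝ] Tplus α w :=
  MvPolynomial.aeval fun q =>
    (exists_antipode (posIdx q).1 ⟨(posIdx q).2, isModelIdx_posIdx q⟩).choose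

/-- `Santi` is extended multiplicatively, which matches the dual of the antipode because the latter
is a coalgebra morphism in the cocommutative case (`cop_antipodeU`). -/
theorem BU_Santi (u : U α w) (Z : Tplus α w) : BU u (Santi α w Z) = BU (antipodeU u) Z := by
  induction Z using MvPolynomial.induction_on generalizing u with
  | C c =>
    rw [Santi, MvPolynomial.aeval_C, MvPolynomial.algebraMap_eq, MvPolynomial.C_eq_smul_one,
      map_smul, map_smul, BU_apply_one, BU_apply_one, counitU_antipodeU]
  | add p q hp hq => rw [map_add, map_add, map_add, hp, hq]
  | mul_X p q hp =>
    have hX : ∀ v : U α w, BU v (Santi α w (MvPolynomial.X q)) =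
        BU (antipodeU v) (MvPolynomial.X q) := by
      intro v
      rw [Santi, MvPolynomial.aeval_X, ← Ehat_posIdx]
      exact (exists_antipode (α := α) (w := w) (posIdx q).1
        ⟨(posIdx q).2, isModelIdx_posIdx q⟩).choose_spec v
    obtain ⟨I, S, a, b, h⟩ := exists_tensor (cop u)
    rw [map_mul, BU_mul_apply, BU_mul_apply, cop_antipodeU, h]
    simp only [map_sum, TensorProduct.map_tmul, formTensor_tmul, LinearMap.flip_apply, hp, hX]

theorem BU_mul' {u : U α w} {I : Type} {S : Finset I} {a b : I → U α w}
    (h : cop u = ∑ i ∈ S, a i ⊗ₜ[ℝ] b i) (x : Tplus α w ⊗[ℝ] Tplus α w) :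
    BU u (LinearMap.mul' ℝ (Tplus α w) x) = ∑ i ∈ S, formTensor (BU (a i)) (BU (b i)) x := by
  induction x using TensorProduct.induction_on with
  | zero => simp
  | tmul Z Z' =>
    rw [LinearMap.mul'_apply, BU_mul_apply, h, map_sum]
    simp only [formTensor_tmul, LinearMap.flip_apply]
  | add x y hx hy => simp only [map_add, hx, hy, Finset.sum_add_distrib]

theorem isHopf_Tplus : IsHopf (DeltaP α w) (epsP α w) (Santi α w).toLinearMap where
  coassoc := DeltaP_coassoc
  counit_left := DeltaP_counit_left
  counit_right := DeltaP_counit_right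
  antipode_left Z := by
    refine BU_ext_right fun u => ?_
    obtain ⟨I, S, a, b, h⟩ := exists_tensor (cop u)
    have h1 := (isHopf_envelope (K := L α w)).antipode_left u
    have hS : ∀ v : U α w, BU v ∘ₗ (Santi α w).toLinearMap = BU (antipodeU v) :=
      fun v => LinearMap.ext fun Z => BU_Santi v Z
    rw [BU_mul' h]
    simp only [formTensor_rTensor, hS, formTensor_DeltaP]
    rw [← LinearMap.sum_apply, ← map_sum]
    simp only [h, map_sum, LinearMap.rTensor_tmul, LinearMap.mul'_apply] at h1
    rw [h1, Algebra.algebraMap_eq_smul_one, Algebra.algebraMap_eq_smul_one, map_smul, map_smul,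
      LinearMap.smul_apply, BU_one, BU_apply_one, smul_eq_mul, smul_eq_mul, mul_comm]
  antipode_right Z := by
    refine BU_ext_right fun u => ?_
    obtain ⟨I, S, a, b, h⟩ := exists_tensor (cop u)
    have h1 := (isHopf_envelope (K := L α w)).antipode_right u
    have hS : ∀ v : U α w, BU v ∘ₗ (Santi α w).toLinearMap = BU (antipodeU v) :=
      fun v => LinearMap.ext fun Z => BU_Santi v Z
    rw [BU_mul' h]
    simp only [formTensor_lTensor, hS, formTensor_DeltaP]
    rw [← LinearMap.sum_apply, ← map_sum]
    simp only [h, map_sum, LinearMap.lTensor_tmul, LinearMap.mul'_apply] at h1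
    rw [h1, Algebra.algebraMap_eq_smul_one, Algebra.algebraMap_eq_smul_one, map_smul, map_smul,
      LinearMap.smul_apply, BU_one, BU_apply_one, smul_eq_mul, smul_eq_mul, mul_comm]

end Comodule

end

end ShiftTilt

/-! ### Re-centering maps and the two coproducts -/

namespace ShiftTilt

noncomputable section

open MvPowerSeries (coeff X)

section Intertwining

variable {α : ℝ} {w : N2 →+ ℝ} [Pos α w]

open Classical in
theorem cfm_eIdx (β : MIdx) (l : {n : N2 // n ≠ 0}) :
    cfm α w β (eIdx l) = (if β = eIdx l then 1 else 0) + Ehat α w l.1 β := by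
  have : upull α w (MvPolynomial.X (Sum.inr l)) = X (Sum.inr l) + Eser α w l.1 := gpull_inr _ _
  change coeff β (upull α w (MvPolynomial.X (Sum.inr l))) = _
  rw [this, map_add, coeff_Eser, MvPowerSeries.coeff_X]

theorem exists_eIdx {γ : MIdx} (h : IsModelIdx γ) (hb : br γ < 0) : ∃ l, γ = eIdx l := by
  rcases h with h | h
  · omega
  · exact h

/-- Contributions with $[\delta]=-1$ come from some $e_l$, and the entry at $l\neq\mathbf e_i$
contains $\binom{\mathbf e_i}{l}$. It vanishes because no nonzero $l$ lies strictly below $\mathbf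
e_i$. -/
theorem DeltaZ_unitVec (i : Fin 2) :
    DeltaZ α w ⟨eIdx ⟨unitVec i, unitVec_ne_zero i⟩, Or.inr ⟨_, rfl⟩⟩ =
      1 ⊗ₜ[ℝ] zT ⟨eIdx ⟨unitVec i, unitVec_ne_zero i⟩, Or.inr ⟨_, rfl⟩⟩ := by
  classical
  set γ : {γ : MIdx // IsModelIdx γ} := ⟨eIdx ⟨unitVec i, unitVec_ne_zero i⟩, Or.inr ⟨_, rfl⟩⟩
    with hγ
  rw [DeltaZ, Finset.sum_eq_single γ]
  · rw [cfm_self]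
  · intro δ _ hδ
    have : cfm α w γ.1 δ.1 = 0 := by
      by_contra h
      rcases below_of_cfm h with h1 | h1
      · exact hδ (Subtype.ext h1)
      · have hb := h1.1
        rw [hγ, br_single_inr] at hb
        obtain ⟨l, hl⟩ := exists_eIdx δ.2 (by omega)
        have hne : γ.1 ≠ eIdx l := fun h' => hδ (Subtype.ext (hl.trans h'.symm))
        rw [hl, cfm_eIdx, if_neg hne, zero_add] at h
        change Ehat α w l.1 (eIdx _) ≠ 0 at h
        rw [Ehat_eIdx] at h
        split_ifs at h with hl'
        · exact h rfl
        · refine h ?_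
          rw [hbin, choose2_eq_zero, Nat.cast_zero, zero_smul]
          intro hle
          obtain ⟨k, hk⟩ := exists_add_of_le hle
          have hd := congrArg Finsupp.degree hk
          simp only [map_add, Finsupp.degree_single] at hd
          have hl0 : Finsupp.degree l.1 ≠ 0 := fun h0 => l.2 ((Finsupp.degree_eq_zero_iff _).1 h0)
          have hk0 : k = 0 := (Finsupp.degree_eq_zero_iff _).1 (by omega)
          rw [hk0, add_zero] at hk
          exact hl' hk.symm
    rw [this, TensorProduct.zero_tmul]
  · intro h
    exact absurd (Finset.mem_subtype.2 (mem_Bset.2 ⟨γ.2.neg_one_le, le_rfl, le_rfl⟩)) h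

theorem DeltaP_X_inr (i : Fin 2) : DeltaP α w (MvPolynomial.X (Sum.inr i)) =
    MvPolynomial.X (Sum.inr i) ⊗ₜ[ℝ] 1 + 1 ⊗ₜ[ℝ] MvPolynomial.X (Sum.inr i) := by
  rw [DeltaP, MvPolynomial.aeval_X, DeltaE, Ehat_posIdx, DeltaT_zT]
  congr 1
  refine (congrArg _ (DeltaZ_unitVec i)).trans ?_
  rw [LinearMap.lTensor_tmul, ET_zT]
  exact congrArg _ (Ehat_unitVec i)

theorem DeltaP_Zb_unitVec (i : Fin 2) : DeltaP α w (Zb 0 (unitVec i)) =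
    Zb 0 (unitVec i) ⊗ₜ[ℝ] 1 + 1 ⊗ₜ[ℝ] Zb 0 (unitVec i) := by
  rw [Zb_zero, hmon_unitVec, DeltaP_X_inr]

/-! ### The intertwining of `Δ⁺` and `Δ` -/

theorem Jmap_zT (n : N2) (γ : {γ : MIdx // IsModelIdx γ}) (h : 0 ≤ br γ.1 ∧ w n < homog α w γ.1) :
    Jmap α w n (zT γ) = (fact2 n : ℝ) • Ehat α w n γ.1 := by
  have h1 := Ehat_adm (α := α) (w := w) ⟨(γ.1, n), h⟩
  have h2 : Zb (Finsupp.single (⟨(γ.1, n), h⟩ : TiltIdx α w) 1) 0 =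
      MvPolynomial.X (Sum.inl ⟨(γ.1, n), h⟩) := by
    rw [Zb_eq, Finsupp.prod_single_index (by simp), hmon_zero, mul_one, pow_one]
  rw [h1, ← h2]
  simp [Jmap, zT, h]

theorem Jmap_zT_eq_zero (n : N2) (γ : {γ : MIdx // IsModelIdx γ})
    (h : ¬ (0 ≤ br γ.1 ∧ w n < homog α w γ.1)) : Jmap α w n (zT γ) = 0 := by
  simp [Jmap, zT, h]

/-- The part of the universal extended tilt that belongs to the shift. -/
def EH (α : ℝ) (w : N2 →+ ℝ) (n : N2) : T →ₗ[ℝ] Tplus α w := by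
  classical
  exact Finsupp.lsum ℝ fun γ => LinearMap.toSpanSingleton ℝ _
    (if br γ.1 < 0 then Ehat α w n γ.1 else 0)

open Classical in
theorem EH_zT (n : N2) (γ : {γ : MIdx // IsModelIdx γ}) :
    EH α w n (zT γ) = if br γ.1 < 0 then Ehat α w n γ.1 else 0 := by
  simp [EH, zT]

theorem smul_ET (n : N2) : (fact2 n : ℝ) • ET α w n = Jmap α w n + (fact2 n : ℝ) • EH α w n := by
  refine T_ext fun γ => ?_
  simp only [LinearMap.smul_apply, LinearMap.add_apply, ET_zT, EH_zT]
  by_cases hb : br γ.1 < 0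
  · rw [if_pos hb, Jmap_zT_eq_zero n γ (fun h => by omega), zero_add]
  · rw [if_neg hb, smul_zero, add_zero]
    by_cases hw : w n < homog α w γ.1
    · rw [Jmap_zT n γ ⟨not_lt.1 hb, hw⟩]
    · rw [Jmap_zT_eq_zero n γ (fun h => hw h.2)]
      have : Ehat α w n γ.1 = 0 := by_contra fun h => hw (of_Ehat_ne_zero h).2
      rw [this, smul_zero]

theorem fact2_mul_choose2 (m n : N2) :
    fact2 n * choose2 (m + n) n * fact2 m = fact2 (m + n) := by
  unfold fact2 choose2
  rw [← Finset.prod_mul_distrib, ← Finset.prod_mul_distrib]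
  refine Finset.prod_congr rfl fun i _ => ?_
  rw [Finsupp.add_apply, ← Nat.add_choose_mul_factorial_mul_factorial (m i) (n i)]
  have : (m i + n i).choose (n i) = (m i + n i).choose (m i) := by
    rw [Nat.choose_symm_add]
  rw [this]
  ring

theorem fact2_ne_zero (m : N2) : (fact2 m : ℝ) ≠ 0 := by
  rw [Nat.cast_ne_zero]
  exact Finset.prod_ne_zero_iff.2 fun _ _ => Nat.factorial_ne_zero _

theorem finite_Jmap_zT (n : N2) (γ : {γ : MIdx // IsModelIdx γ}) :
    {m : N2 | Jmap α w (m + n) (zT γ) ≠ 0}.Finite := by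
  refine (finite_w_lt α w (homog α w γ.1)).subset fun m hm => ?_
  by_contra hc
  refine hm (Jmap_zT_eq_zero _ _ fun h => hc ?_)
  change w m < _
  refine lt_of_le_of_lt ?_ h.2
  rw [map_add]
  linarith [w_nonneg α w n]

/-- The summands of the intertwining formula. -/
def Jterm (n : N2) (τ : T) (m : N2) : Tplus α w ⊗[ℝ] Tplus α w :=
  Jmap α w (m + n) τ ⊗ₜ[ℝ] ((fact2 m : ℝ)⁻¹ • Zb (0 : TiltIdx α w →₀ ℕ) m)

/-- The shift part of the extended tilt lives on the $e_l$, and the coaction entry from $e_l$ to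
$\gamma$ is the entry $\hat\pi^{(l)}_\gamma$. Writing $l=m+n$, the binomial coefficient turns into
the factorials of the formula; $m=0$ accounts for the term $\hat\pi^{(n)}_\gamma\otimes1$. -/
theorem lTensor_EH (n : N2) (γ : {γ : MIdx // IsModelIdx γ}) (hb : 0 ≤ br γ.1)
    (hw : w n < homog α w γ.1) :
    (fact2 n : ℝ) • (Ehat α w n γ.1 ⊗ₜ[ℝ] 1 +
      (EH α w n).lTensor (Tplus α w) (DeltaT α w (zT γ))) = ∑ᶠ m : N2, Jterm n (zT γ) m := by
  classical
  have hK := finite_Jmap_zT (α := α) (w := w) n γ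
  set K : Finset N2 := insert 0 hK.toFinset with hKdef
  have h1 : ∑ᶠ m : N2, Jterm n (zT γ) m = ∑ m ∈ K, Jterm (α := α) (w := w) n (zT γ) m := by
    refine finsum_eq_sum_of_support_subset _ fun m hm => ?_
    refine Finset.mem_coe.2 (Finset.mem_insert_of_mem (hK.mem_toFinset.2 fun h0 => hm ?_))
    change Jmap α w (m + n) (zT γ) ⊗ₜ[ℝ] _ = 0
    rw [h0, TensorProduct.zero_tmul]
  -- The default value at $m+n=0$ is harmless: this can only happen for $m=0$, and that term is
  -- split off before $e$ is used.
  let e : N2 → {γ : MIdx // IsModelIdx γ} := fun m =>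
    if h : m + n ≠ 0 then ⟨eIdx ⟨m + n, h⟩, Or.inr ⟨_, rfl⟩⟩ else ⟨0, Or.inl br_zero.ge⟩
  have he : ∀ m, m ≠ 0 → ∃ h : m + n ≠ 0, e m = ⟨eIdx ⟨m + n, h⟩, Or.inr ⟨_, rfl⟩⟩ := by
    intro m hm
    have h : m + n ≠ 0 := fun h => hm (by simpa using (add_eq_zero.1 h).1)
    exact ⟨h, dif_pos h⟩
  have hinj : Set.InjOn e (K.erase 0 : Finset N2) := by
    intro m hm m' hm' h
    obtain ⟨h1, e1⟩ := he m (Finset.ne_of_mem_erase hm)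
    obtain ⟨h2, e2⟩ := he m' (Finset.ne_of_mem_erase hm')
    rw [e1, e2] at h
    have := eIdx_injective (congrArg Subtype.val h)
    simpa using this
  have hterm : ∀ m, m ≠ 0 → Jterm (α := α) (w := w) n (zT γ) m =
      (fact2 n : ℝ) • (cfm α w γ.1 (e m).1 ⊗ₜ[ℝ] EH α w n (zT (e m))) := by
    intro m hm
    obtain ⟨h, e1⟩ := he m hm
    rw [e1, cfm_eIdx, if_neg (fun h' => by rw [h', br_single_inr] at hb; omega), zero_add, EH_zT,
      if_pos (by rw [br_single_inr]; omega)]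
    change _ = (fact2 n : ℝ) • (_ ⊗ₜ[ℝ] Ehat α w n (eIdx _))
    rw [Ehat_eIdx, if_neg (fun h' => hm (by simpa using h')), hbin, Jterm, Zb_zero,
      add_tsub_cancel_right]
    by_cases hw' : w (m + n) < homog α w γ.1
    · rw [Jmap_zT _ _ ⟨hb, hw'⟩]
      simp only [TensorProduct.smul_tmul', TensorProduct.tmul_smul, smul_smul]
      congr 1
      rw [← fact2_mul_choose2]
      push_cast
      field_simp [fact2_ne_zero m]
    · have : Ehat α w (m + n) γ.1 = 0 := by_contra fun h => hw' (of_Ehat_ne_zero h).2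
      rw [Jmap_zT_eq_zero _ _ (fun h => hw' h.2), this, TensorProduct.zero_tmul,
        TensorProduct.zero_tmul, smul_zero]
  have h0 : Jterm (α := α) (w := w) n (zT γ) 0 = (fact2 n : ℝ) • (Ehat α w n γ.1 ⊗ₜ[ℝ] 1) := by
    rw [Jterm, zero_add, Jmap_zT _ _ ⟨hb, hw⟩, Zb_zero, hmon_zero]
    simp [fact2, TensorProduct.smul_tmul']
  rw [h1, ← Finset.add_sum_erase _ _ (Finset.mem_insert_self 0 _), h0, smul_add,
    Finset.sum_congr rfl fun m hm => hterm m (Finset.ne_of_mem_erase hm), ← Finset.smul_sum,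
    DeltaT_zT, DeltaZ, map_sum]
  congr 2
  simp only [LinearMap.lTensor_tmul]
  rw [← Finset.sum_image (f := fun δ => cfm α w γ.1 δ.1 ⊗ₜ[ℝ] EH α w n (zT δ)) hinj]
  symm
  refine Finset.sum_subset ?_ ?_
  · intro δ hδ
    obtain ⟨m, hm, rfl⟩ := Finset.mem_image.1 hδ
    have hm0 := Finset.ne_of_mem_erase hm
    obtain ⟨h, e1⟩ := he m hm0
    rw [e1, Finset.mem_subtype, mem_Bset]
    refine ⟨by rw [br_single_inr], ?_, ?_⟩
    · rw [homog_single_inr]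
      have hm1 := (Finset.mem_insert.1 (Finset.mem_of_mem_erase hm)).resolve_left hm0
      have hm2 := hK.mem_toFinset.1 hm1
      by_contra hc
      exact hm2 (Jmap_zT_eq_zero _ _ fun h' => hc h'.2.le)
    · change qd (eIdx _) ≤ _
      have : qd (eIdx ⟨m + n, h⟩) = 0 := by
        unfold qd
        rw [Finsupp.sum_single_index] <;> simp
      rw [this]
      exact Nat.zero_le _
  · intro δ hδ hδ'
    by_contra hc
    have hc1 : cfm α w γ.1 δ.1 ≠ 0 := fun h => hc (by rw [h, TensorProduct.zero_tmul])
    have hc2 : EH α w n (zT δ) ≠ 0 := fun h => hc (by rw [h, TensorProduct.tmul_zero])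
    rw [EH_zT] at hc2
    split_ifs at hc2 with hbδ
    · obtain ⟨l, hl⟩ := exists_eIdx δ.2 hbδ
      rw [hl] at hc1 hc2
      rw [cfm_eIdx, if_neg (fun h' => by rw [h', br_single_inr] at hb; omega), zero_add] at hc1
      rw [Ehat_eIdx] at hc2
      split_ifs at hc2 with hnl
      · exact hc2 rfl
      · have hle : n ≤ l.1 := by
          by_contra h
          exact hc2 (by rw [hbin, choose2_eq_zero h, Nat.cast_zero, zero_smul])
        obtain ⟨m, hm⟩ := exists_add_of_le hle
        rw [add_comm] at hm
        have hm0 : m ≠ 0 := by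
          rintro rfl
          rw [zero_add] at hm
          exact hnl hm.symm
        obtain ⟨h, e1⟩ := he m hm0
        refine hδ' (Finset.mem_image.2 ⟨m, Finset.mem_erase.2 ⟨hm0, ?_⟩, ?_⟩)
        · refine Finset.mem_insert_of_mem (hK.mem_toFinset.2 ?_)
          change Jmap α w (m + n) (zT γ) ≠ 0
          rw [← hm, Jmap_zT _ _ ⟨hb, (of_Ehat_ne_zero hc1).2⟩]
          exact smul_ne_zero (fact2_ne_zero _) hc1
        · rw [e1]
          refine Subtype.ext ?_
          have h3 : (⟨m + n, h⟩ : {n : N2 // n ≠ 0}) = l := Subtype.ext hm.symm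
          rw [hl, h3]
    · exact hc2 rfl

/-- For admissible $\gamma$, splitting the extended tilt into tilt and shift part turns
`DeltaP_Ehat` into the claim. Otherwise every term vanishes: triangularity prevents an inadmissible
$\gamma$ from receiving contributions of admissible $\delta$. -/
theorem DeltaP_Jmap_zT (n : N2) (γ : {γ : MIdx // IsModelIdx γ}) :
    DeltaP α w (Jmap α w n (zT γ)) = (Jmap α w n).lTensor (Tplus α w) (DeltaT α w (zT γ)) +
      ∑ᶠ m : N2, Jterm n (zT γ) m := by
  by_cases h : 0 ≤ br γ.1 ∧ w n < homog α w γ.1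
  · rw [← lTensor_EH n γ h.1 h.2, Jmap_zT n γ h, map_smul, DeltaP_Ehat, DeltaE, smul_add, smul_add,
      add_left_comm]
    congr 1
    have : ∀ f : T →ₗ[ℝ] Tplus α w, (fact2 n : ℝ) • f.lTensor (Tplus α w) (DeltaT α w (zT γ)) =
        ((fact2 n : ℝ) • f).lTensor (Tplus α w) (DeltaT α w (zT γ)) := by
      intro f
      rw [LinearMap.lTensor_smul, LinearMap.smul_apply]
    rw [this, this, smul_ET, LinearMap.lTensor_add, LinearMap.add_apply]
  · have h1 : ∀ m, Jterm (α := α) (w := w) n (zT γ) m = 0 := by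
      intro m
      rw [Jterm, Jmap_zT_eq_zero, TensorProduct.zero_tmul]
      rintro ⟨hb, hw⟩
      refine h ⟨hb, lt_of_le_of_lt ?_ hw⟩
      rw [map_add]
      linarith [w_nonneg α w m]
    rw [Jmap_zT_eq_zero n γ h, map_zero, DeltaT_zT, DeltaZ, map_sum]
    simp only [h1, finsum_zero, add_zero, LinearMap.lTensor_tmul]
    refine (Finset.sum_eq_zero fun δ _ => ?_).symm
    by_cases hc : cfm α w γ.1 δ.1 = 0
    · rw [hc, TensorProduct.zero_tmul]
    · rw [Jmap_zT_eq_zero n δ, TensorProduct.tmul_zero]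
      rcases below_of_cfm hc with h2 | h2
      · rw [h2]
        exact h
      · rintro ⟨hb, hw⟩
        exact h ⟨hb.trans h2.1, hw.trans h2.2.1⟩

theorem DeltaP_Jmap (n : N2) (τ : T) : {m : N2 | Jmap α w (m + n) τ ≠ 0}.Finite ∧
    DeltaP α w (Jmap α w n τ) = (Jmap α w n).lTensor (Tplus α w) (DeltaT α w τ) +
      ∑ᶠ m : N2, Jterm n τ m := by
  induction τ using Finsupp.induction_linear with
  | zero =>
    refine ⟨by simp, ?_⟩
    have : ∀ m, Jterm (α := α) (w := w) n 0 m = 0 := fun m => by simp [Jterm]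
    simp [this]
  | add f g hf hg =>
    have hfin : ∀ τ : T, {m : N2 | Jmap α w (m + n) τ ≠ 0}.Finite →
        (Function.support (Jterm (α := α) (w := w) n τ)).Finite := by
      intro τ h
      refine h.subset fun m hm h0 => hm ?_
      rw [Jterm, h0, TensorProduct.zero_tmul]
    refine ⟨(hf.1.union hg.1).subset fun m hm => ?_, ?_⟩
    · by_contra hc
      simp only [Set.mem_union, Set.mem_ofPred_eq, not_or, not_not] at hc
      refine hm ?_
      rw [map_add, hc.1, hc.2, add_zero]
    · have : ∀ m, Jterm (α := α) (w := w) n (f + g) m = Jterm n f m + Jterm n g m := by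
        intro m
        simp only [Jterm, map_add, TensorProduct.add_tmul]
      rw [finsum_congr this, finsum_add_distrib (hfin f hf.1) (hfin g hg.1), map_add, map_add,
        map_add, map_add, hf.2, hg.2]
      abel
  | single γ c =>
    have h0 : (Finsupp.single γ c : T) = c • zT γ := by simp [zT]
    rw [h0]
    refine ⟨(finite_Jmap_zT (α := α) (w := w) n γ).subset fun m hm h' => hm ?_, ?_⟩
    · rw [map_smul, h', smul_zero]
    · have : ∀ m, Jterm (α := α) (w := w) n (c • zT γ) m = c • Jterm n (zT γ) m := by
        intro m
        simp only [Jterm, map_smul, TensorProduct.smul_tmul']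
      have hs : ∑ᶠ m, c • Jterm (α := α) (w := w) n (zT γ) m = c • ∑ᶠ m, Jterm n (zT γ) m :=
        (smul_finsum' c ((finite_Jmap_zT (α := α) (w := w) n γ).subset fun m hm h0 => hm (by
          rw [Jterm, h0, TensorProduct.zero_tmul]))).symm
      rw [finsum_congr this, hs, map_smul, map_smul, map_smul, map_smul,
        DeltaP_Jmap_zT, smul_add]

end Intertwining

end

end ShiftTilt

/-! ### The structure group and its parameterization -/

namespace ShiftTilt

noncomputable section

open MvPowerSeries (coeff X)

/-! ### The structure group -/

section Contraction

variable {V W V' : Type} [AddCommGroup V] [Module ℝ V] [AddCommGroup W] [Module ℝ W]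
  [AddCommGroup V'] [Module ℝ V']

theorem sl_assoc {V₁ V₂ V₃ : Type} [AddCommGroup V₁] [Module ℝ V₁] [AddCommGroup V₂]
    [Module ℝ V₂] [AddCommGroup V₃] [Module ℝ V₃] (f : V₁ →ₗ[ℝ] ℝ) (g : V₂ →ₗ[ℝ] ℝ)
    (x : (V₁ ⊗[ℝ] V₂) ⊗[ℝ] V₃) :
    sl g (sl f (TensorProduct.assoc ℝ V₁ V₂ V₃ x)) = sl (formTensor f g) x := by
  have : sl g ∘ₗ sl f ∘ₗ (TensorProduct.assoc ℝ V₁ V₂ V₃).toLinearMap = sl (formTensor f g) :=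
    TensorProduct.ext_threefold fun a b c => by simp [mul_smul]
  exact LinearMap.congr_fun this x

theorem sl_rTensor (f : V →ₗ[ℝ] ℝ) (p : V' →ₗ[ℝ] V) (x : V' ⊗[ℝ] W) :
    sl f (p.rTensor W x) = sl (f ∘ₗ p) x := by
  have : sl f ∘ₗ p.rTensor W = sl (f ∘ₗ p) := TensorProduct.ext' fun v y => by simp
  exact LinearMap.congr_fun this x

theorem sl_lTensor (f : V →ₗ[ℝ] ℝ) (q : V' →ₗ[ℝ] W) (x : V ⊗[ℝ] V') :
    sl f (q.lTensor V x) = q (sl f x) := by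
  have : sl f ∘ₗ q.lTensor V = q ∘ₗ sl f := TensorProduct.ext' fun v y => by simp
  exact LinearMap.congr_fun this x

end Contraction

section StructureGroup

variable {α : ℝ} {w : N2 →+ ℝ}

theorem GammaOf_apply (Δ : T →ₗ[ℝ] Tplus α w ⊗[ℝ] T) (f : Tplus α w →ₐ[ℝ] ℝ) (τ : T) :
    GammaOf Δ f τ = sl f.toLinearMap (Δ τ) := rfl

theorem toLinearMap_conv (Δp : Tplus α w →ₐ[ℝ] Tplus α w ⊗[ℝ] Tplus α w)
    (f g : Tplus α w →ₐ[ℝ] ℝ) :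
    (conv Δp f g).toLinearMap = formTensor f.toLinearMap g.toLinearMap ∘ₗ Δp.toLinearMap := by
  have h : (Algebra.TensorProduct.lift f g fun _ _ => Commute.all _ _).toLinearMap =
      formTensor f.toLinearMap g.toLinearMap := TensorProduct.ext' fun x y => by simp
  rw [← h]
  rfl

theorem conv_apply (Δp : Tplus α w →ₐ[ℝ] Tplus α w ⊗[ℝ] Tplus α w) (f g : Tplus α w →ₐ[ℝ] ℝ)
    (Z : Tplus α w) : conv Δp f g Z = formTensor f.toLinearMap g.toLinearMap (Δp Z) :=
  LinearMap.congr_fun (toLinearMap_conv Δp f g) Z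

theorem GammaOf_conv {Δp : Tplus α w →ₐ[ℝ] Tplus α w ⊗[ℝ] Tplus α w} {ε : Tplus α w →ₐ[ℝ] ℝ}
    {Δ : T →ₗ[ℝ] Tplus α w ⊗[ℝ] T} (h : IsLeftComodule Δp ε Δ) (f g : Tplus α w →ₐ[ℝ] ℝ) :
    GammaOf Δ (conv Δp f g) = GammaOf Δ g ∘ₗ GammaOf Δ f := by
  refine LinearMap.ext fun τ => ?_
  have hc := LinearMap.congr_fun h.coassoc τ
  simp only [LinearMap.comp_apply, LinearEquiv.coe_coe] at hc
  rw [LinearMap.comp_apply, GammaOf_apply, GammaOf_apply, GammaOf_apply, ← sl_lTensor, hc, sl_assoc,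
    sl_rTensor, toLinearMap_conv]

theorem conv_antipode_left {Δp : Tplus α w →ₐ[ℝ] Tplus α w ⊗[ℝ] Tplus α w}
    {ε : Tplus α w →ₐ[ℝ] ℝ} {S : Tplus α w →ₐ[ℝ] Tplus α w} (h : IsHopf Δp ε S.toLinearMap)
    (f : Tplus α w →ₐ[ℝ] ℝ) : conv Δp (f.comp S) f = ε := by
  refine AlgHom.ext fun Z => ?_
  have h1 := congrArg f (h.antipode_left Z)
  rw [AlgHom.commutes] at h1
  have h2 : formTensor (f.comp S).toLinearMap f.toLinearMap =
      f.toLinearMap ∘ₗ LinearMap.mul' ℝ (Tplus α w) ∘ₗ S.toLinearMap.rTensor (Tplus α w) :=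
    TensorProduct.ext' fun x y => by simp
  rw [conv_apply, h2]
  exact h1

theorem conv_antipode_right {Δp : Tplus α w →ₐ[ℝ] Tplus α w ⊗[ℝ] Tplus α w}
    {ε : Tplus α w →ₐ[ℝ] ℝ} {S : Tplus α w →ₐ[ℝ] Tplus α w} (h : IsHopf Δp ε S.toLinearMap)
    (f : Tplus α w →ₐ[ℝ] ℝ) : conv Δp f (f.comp S) = ε := by
  refine AlgHom.ext fun Z => ?_
  have h1 := congrArg f (h.antipode_right Z)
  rw [AlgHom.commutes] at h1
  have h2 : formTensor f.toLinearMap (f.comp S).toLinearMap =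
      f.toLinearMap ∘ₗ LinearMap.mul' ℝ (Tplus α w) ∘ₗ S.toLinearMap.lTensor (Tplus α w) :=
    TensorProduct.ext' fun x y => by simp
  rw [conv_apply, h2]
  exact h1

/-! ### Parameters and characters -/

open Classical in
/-- The parameter of a multiplicative functional on `T⁺`. -/
def paramOf (f : Tplus α w →ₐ[ℝ] ℝ) : Param α w where
  h i := f (MvPolynomial.X (Sum.inr i))
  tilt n := series fun γ => if h : 0 ≤ br γ ∧ w n < homog α w γ then
    f (MvPolynomial.X (Sum.inl ⟨(γ, n), h⟩)) else 0
  adm n γ h := by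
    by_contra hc
    rw [coeff_series, dif_neg hc] at h
    exact h rfl

theorem char_X_inl (g : Param α w) (q : TiltIdx α w) :
    g.char (MvPolynomial.X (Sum.inl q)) = coeff q.1.1 (g.tilt q.1.2) := MvPolynomial.aeval_X _ _

theorem char_X_inr (g : Param α w) (i : Fin 2) :
    g.char (MvPolynomial.X (Sum.inr i)) = g.h i := MvPolynomial.aeval_X _ _

theorem char_paramOf (f : Tplus α w →ₐ[ℝ] ℝ) : (paramOf f).char = f := by
  refine MvPolynomial.algHom_ext fun v => ?_
  rcases v with q | i
  · rw [char_X_inl]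
    exact dif_pos q.2
  · rw [char_X_inr]
    rfl

theorem paramOf_char (g : Param α w) : paramOf g.char = g := by
  obtain ⟨h, t, ht⟩ := g
  have h1 : (paramOf (Param.char ⟨h, t, ht⟩)).h = h := funext fun i => char_X_inr _ i
  have h2 : (paramOf (Param.char ⟨h, t, ht⟩)).tilt = t := by
    funext n
    ext γ
    by_cases hγ : 0 ≤ br γ ∧ w n < homog α w γ
    · exact (dif_pos hγ).trans (char_X_inl ⟨h, t, ht⟩ ⟨(γ, n), hγ⟩)
    · refine (dif_neg hγ).trans (by_contra fun h' => hγ (ht n γ (Ne.symm h')))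
  cases hp : paramOf (Param.char ⟨h, t, ht⟩)
  rw [hp] at h1 h2
  subst h1 h2
  rfl

theorem char_bijective : Function.Bijective (Param.char (α := α) (w := w)) :=
  ⟨Function.LeftInverse.injective paramOf_char, fun f => ⟨paramOf f, char_paramOf f⟩⟩

theorem char_hmon (g : Param α w) (k : N2) : g.char (hmon α w k) = pow2 g.h k := by
  simp only [hmon, pow2, map_prod, map_pow, char_X_inr]

open Classical in
theorem coeff_eIdx_shiftSeries (h : Fin 2 → ℝ) (n : N2) (m : {n : N2 // n ≠ 0}) :
    coeff (eIdx m) (formalSum fun m : N2 =>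
      if n < m then ((choose2 m n : ℝ) * pow2 h (m - n)) • zp m else 0) =
      if n < m.1 then (choose2 m.1 n : ℝ) * pow2 h (m.1 - n) else 0 := by
  rw [coeff_formalSum, finsum_eq_single _ m.1]
  · split_ifs
    · rw [MvPowerSeries.coeff_smul, coeff_eIdx_zp, if_pos rfl, mul_one]
    · rw [map_zero]
  · intro l hl
    split_ifs
    · rw [MvPowerSeries.coeff_smul, coeff_eIdx_zp, if_neg hl, mul_zero]
    · rw [map_zero]

theorem coeff_zp_of_ne {γ : MIdx} (hγ : ¬ ∃ m, γ = eIdx m) (n : N2) : coeff γ (zp n) = 0 := by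
  classical
  unfold zp
  split_ifs with h
  · rw [MvPowerSeries.coeff_X, if_neg fun h' => hγ ⟨_, h'⟩]
  · rw [map_zero]

/-- A character of $\mathsf T^+$ specializes the universal extended tilt to that of its parameter;
this carries all universal identities to individual group elements. -/
theorem char_Ehat (g : Param α w) (n : N2) (γ : MIdx) :
    g.char (Ehat α w n γ) = coeff γ (g.etilt n) := by
  classical
  rw [Param.etilt, map_add]
  by_cases hm : ∃ m, γ = eIdx m
  · obtain ⟨m, rfl⟩ := hm
    have h0 : coeff (eIdx m) (g.tilt n) = 0 := by
      by_contra hc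
      have := (g.adm n _ hc).1
      rw [br_single_inr] at this
      omega
    rw [Ehat_eIdx, h0, zero_add]
    refine Eq.trans ?_ (coeff_eIdx_shiftSeries g.h n m).symm
    split_ifs with h1 h2 h2
    · exact absurd h2 (h1 ▸ lt_irrefl _)
    · rw [map_zero]
    · rw [hbin, map_smul, char_hmon, smul_eq_mul]
    · rw [hbin, choose2_eq_zero fun h3 => h2 (lt_of_le_of_ne h3 h1), Nat.cast_zero, zero_smul,
        map_zero]
  · have h0 : coeff γ (formalSum fun m : N2 =>
        if n < m then ((choose2 m n : ℝ) * pow2 g.h (m - n)) • zp m else 0) = 0 := by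
      rw [coeff_formalSum]
      refine finsum_eq_zero_of_forall_eq_zero fun m => ?_
      split_ifs
      · rw [MvPowerSeries.coeff_smul, coeff_zp_of_ne hm, mul_zero]
      · rw [map_zero]
    refine Eq.trans ?_ (congrArg _ h0).symm
    rw [add_zero]
    by_cases hq : 0 ≤ br γ ∧ w n < homog α w γ
    · exact (congrArg _ (Ehat_adm ⟨(γ, n), hq⟩)).trans (char_X_inl g ⟨(γ, n), hq⟩)
    · rw [Ehat, dif_neg hq, dif_neg hm, map_zero]
      exact by_contra fun h => hq (g.adm n γ (Ne.symm h))

theorem mapA_char_Eser (g : Param α w) (n : N2) : mapA g.char (Eser α w n) = g.etilt n := by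
  ext γ
  rw [coeff_mapA, coeff_Eser, char_Ehat]

theorem pullback_eq (g : Param α w) : g.pullback = gpull g.etilt := by
  refine MvPolynomial.algHom_ext fun v => ?_
  rcases v with k | n
  · rw [gpull_inl]
    exact MvPolynomial.aeval_X _ _
  · rw [gpull_inr]
    exact MvPolynomial.aeval_X _ _

variable [Pos α w]

theorem etilt_TLs (g : Param α w) : g.etilt ∈ TLs α w := by
  intro n γ h
  rw [← char_Ehat] at h
  exact of_Ehat_ne_zero fun h0 => h (by rw [h0, map_zero])

theorem etilt_mem (g : Param α w) (n : N2) : g.etilt n ∈ Tstar :=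
  fun γ h => (etilt_TLs g n γ h).1

/-! ### The maps `Γ` and `Γ^*` -/

theorem mapA_pullF_mem (f : Tplus α w →ₐ[ℝ] ℝ) (F : Tstar) : mapA f (pullF α w F.1) ∈ Tstar := by
  intro β hβ
  rw [coeff_mapA, coeff_pullF (brBdd_of_mem_Tstar F.2), map_sum] at hβ
  obtain ⟨γ, -, hγ⟩ := Finset.exists_ne_zero_of_sum_ne_zero hβ
  rw [map_smul] at hγ
  refine IsModelIdx.of_cfm (α := α) (w := w) (F.2 γ (left_ne_zero_of_smul hγ)) fun h => ?_
  rw [h, map_zero] at hγ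
  exact hγ (smul_zero _)

/-- The endomorphism `Γ_f^*` of `T^*`. -/
def GamS (f : Tplus α w →ₐ[ℝ] ℝ) : Tstar →ₗ[ℝ] Tstar where
  toFun F := ⟨mapA f (pullF α w F.1), mapA_pullF_mem f F⟩
  map_add' F G := Subtype.ext (by
    change mapA f (pullF α w (F.1 + G.1)) = _
    rw [pullF_add (brBdd_of_mem_Tstar F.2) (brBdd_of_mem_Tstar G.2), map_add]
    rfl)
  map_smul' c F := Subtype.ext (by
    change mapA f (pullF α w (c • F.1)) = _
    rw [pullF_smul (brBdd_of_mem_Tstar F.2), map_smul]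
    rfl)

theorem coe_GamS (f : Tplus α w →ₐ[ℝ] ℝ) (F : Tstar) : (GamS f F : PS) = mapA f (pullF α w F.1) := rfl

theorem isDual_GamS (f : Tplus α w →ₐ[ℝ] ℝ) : IsDual (GamS f) (GammaOf (DeltaT α w) f) := by
  intro F τ
  have : toDual (GamS f F) = toDual F ∘ₗ GammaOf (DeltaT α w) f := by
    refine T_ext fun β => ?_
    rw [LinearMap.comp_apply, GammaOf_apply, toDual_zT, coe_GamS, coeff_mapA]
    have h := formTensor_DeltaT f.toLinearMap F β
    rw [formTensor_eq] at h
    exact h.symm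
  exact LinearMap.congr_fun this τ

theorem IsDual.unique {Ψs Ψs' : Tstar →ₗ[ℝ] Tstar} {Ψ : T →ₗ[ℝ] T} (h : IsDual Ψs Ψ)
    (h' : IsDual Ψs' Ψ) : Ψs = Ψs' :=
  LinearMap.ext fun F => toDual_bijective.1 (LinearMap.ext fun τ => (h F τ).trans (h' F τ).symm)

theorem GammaOf_epsP : GammaOf (DeltaT α w) (epsP α w) = LinearMap.id :=
  LinearMap.ext fun τ => isLeftComodule.counit τ

theorem GammaOf_antipode (f : Tplus α w →ₐ[ℝ] ℝ) :
    GammaOf (DeltaT α w) (f.comp (Santi α w)) ∘ₗ GammaOf (DeltaT α w) f = LinearMap.id ∧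
      GammaOf (DeltaT α w) f ∘ₗ GammaOf (DeltaT α w) (f.comp (Santi α w)) = LinearMap.id := by
  rw [← GammaOf_conv isLeftComodule, ← GammaOf_conv isLeftComodule,
    conv_antipode_left isHopf_Tplus, conv_antipode_right isHopf_Tplus, GammaOf_epsP]
  exact ⟨rfl, rfl⟩

theorem GamS_epsP : GamS (epsP α w) = LinearMap.id := by
  have h := isDual_GamS (epsP α w)
  rw [GammaOf_epsP] at h
  exact h.unique fun _ _ => rfl

theorem GamS_conv (f g : Tplus α w →ₐ[ℝ] ℝ) : GamS (conv (DeltaP α w) f g) = GamS f ∘ₗ GamS g := by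
  have h := isDual_GamS (conv (DeltaP α w) f g)
  rw [GammaOf_conv isLeftComodule] at h
  refine h.unique fun F τ => ?_
  rw [LinearMap.comp_apply, isDual_GamS f, isDual_GamS g]
  rfl

/-- The automorphism `Γ_f` of `T`. -/
def GamE (f : Tplus α w →ₐ[ℝ] ℝ) : T ≃ₗ[ℝ] T :=
  LinearEquiv.ofLinearMap (GammaOf (DeltaT α w) f) (GammaOf (DeltaT α w) (f.comp (Santi α w)))
    (GammaOf_antipode f).2 (GammaOf_antipode f).1

/-- The automorphism `Γ_f^*` of `T^*`. -/
def GamSE (f : Tplus α w →ₐ[ℝ] ℝ) : Tstar ≃ₗ[ℝ] Tstar :=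
  LinearEquiv.ofLinearMap (GamS f) (GamS (f.comp (Santi α w)))
    (by rw [← GamS_conv, conv_antipode_right isHopf_Tplus, GamS_epsP])
    (by rw [← GamS_conv, conv_antipode_left isHopf_Tplus, GamS_epsP])

theorem GamE_conv (f g : Tplus α w →ₐ[ℝ] ℝ) : GamE (conv (DeltaP α w) f g) = GamE g * GamE f :=
  LinearEquiv.toLinearMap_injective (GammaOf_conv isLeftComodule f g)

theorem GamSE_conv (f g : Tplus α w →ₐ[ℝ] ℝ) : GamSE (conv (DeltaP α w) f g) = GamSE f * GamSE g :=
  LinearEquiv.toLinearMap_injective (GamS_conv f g)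

theorem GamE_epsP : GamE (epsP α w) = 1 := LinearEquiv.toLinearMap_injective GammaOf_epsP

theorem GamSE_epsP : GamSE (epsP α w) = 1 := LinearEquiv.toLinearMap_injective GamS_epsP

/-- The group `G ⊂ End(T)`. -/
def grpG (α : ℝ) (w : N2 →+ ℝ) [Pos α w] : Subgroup (T ≃ₗ[ℝ] T) where
  carrier := Set.range (GamE (α := α) (w := w))
  one_mem' := ⟨epsP α w, GamE_epsP⟩
  mul_mem' := by
    rintro _ _ ⟨f, rfl⟩ ⟨g, rfl⟩
    exact ⟨_, GamE_conv g f⟩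
  inv_mem' := by
    rintro _ ⟨f, rfl⟩
    refine ⟨f.comp (Santi α w), ?_⟩
    rw [← mul_eq_one_iff_eq_inv, ← GamE_conv, conv_antipode_right isHopf_Tplus, GamE_epsP]

/-- The group `G^* ⊂ End(T^*)`. -/
def grpGs (α : ℝ) (w : N2 →+ ℝ) [Pos α w] : Subgroup (Tstar ≃ₗ[ℝ] Tstar) where
  carrier := Set.range (GamSE (α := α) (w := w))
  one_mem' := ⟨epsP α w, GamSE_epsP⟩
  mul_mem' := by
    rintro _ _ ⟨f, rfl⟩ ⟨g, rfl⟩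
    exact ⟨_, GamSE_conv f g⟩
  inv_mem' := by
    rintro _ ⟨f, rfl⟩
    refine ⟨f.comp (Santi α w), ?_⟩
    rw [← mul_eq_one_iff_eq_inv, ← GamSE_conv, conv_antipode_left isHopf_Tplus, GamSE_epsP]

theorem range_char {β : Type} (φ : (Tplus α w →ₐ[ℝ] ℝ) → β) :
    Set.range (fun g : Param α w => φ g.char) = Set.range φ :=
  char_bijective.2.range_comp φ

/-! ### Properties of the pull-back -/

theorem GamS_coe (g : Param α w) {P : MvPolynomial Var ℝ} (hP : (P : PS) ∈ Tstar) :
    (GamS g.char ⟨P, hP⟩ : PS) = gpull g.etilt P := by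
  rw [coe_GamS, pullF_coe (brBdd_of_mem_Tstar hP), upull, mapA_gpull]
  simp only [mapA_char_Eser]

theorem extends_GamS (g : Param α w) : Extends g (GamS g.char) := by
  intro P hP
  rw [GamS_coe, pullback_eq]

/-- An operator dual to one on $\mathsf T$ has its matrix determined by the images of monomials, and
monomials are polynomials. Polynomials alone do not determine a linear map on infinite series, so
duality is essential. -/
theorem Extends.unique {g : Param α w} {Ψs Ψs' : Tstar →ₗ[ℝ] Tstar} {Ψ Ψ' : T →ₗ[ℝ] T}
    (hd : IsDual Ψs Ψ) (hd' : IsDual Ψs' Ψ') (h : Extends g Ψs) (h' : Extends g Ψs') : Ψs = Ψs' := by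
  have hΨ : Ψ = Ψ' := by
    refine T_ext fun β => ?_
    ext γ
    have e : ((MvPolynomial.monomial γ.1 1 : MvPolynomial Var ℝ) : PS) ∈ Tstar := by
      rw [MvPolynomial.coe_monomial]
      exact zmon_mem_Tstar γ.2
    have key : ∀ τ : T, toDual ⟨_, e⟩ τ = τ γ := by
      intro τ
      classical
      have : toDual ⟨_, e⟩ = Finsupp.lapply γ := by
        refine T_ext fun δ => ?_
        rw [toDual_zT, Finsupp.lapply_apply, zT, Finsupp.single_apply, MvPolynomial.coeff_coe,
          MvPolynomial.coeff_monomial]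
        simp only [Subtype.ext_iff, eq_comm]
      rw [this, Finsupp.lapply_apply]
    have h1 := hd ⟨_, e⟩ (zT β)
    have h2 := hd' ⟨_, e⟩ (zT β)
    rw [key] at h1 h2
    rw [← h1, ← h2, toDual_zT, toDual_zT, h _ e, h' _ e]
  subst hΨ
  exact hd.unique hd'

/-- Partial products may leave $\mathsf T^*$ even when the full product lies in it; the lower bound
on $[\cdot]$ is carried along to keep the pull-back multiplicative. -/
theorem pullF_prod {k : ℕ} (F : Fin k → Tstar) :
    (∃ N, BrBdd N (∏ i, (F i : PS))) ∧
      pullF α w (∏ i, (F i : PS)) = ∏ i, pullF α w (F i : PS) := by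
  classical
  induction k with
  | zero =>
    simp only [Finset.univ_eq_empty, Finset.prod_empty]
    have h1 : BrBdd 0 ((1 : MvPolynomial Var ℝ) : PS) := by
      intro γ hγ
      rw [MvPolynomial.coe_one, MvPowerSeries.coeff_one] at hγ
      split_ifs at hγ with h
      · rw [h, br_zero]
      · exact absurd rfl hγ
    have h2 := pullF_coe (α := α) (w := w) h1
    rw [map_one, MvPolynomial.coe_one] at h2
    rw [MvPolynomial.coe_one] at h1
    exact ⟨⟨0, h1⟩, h2⟩
  | succ k ih =>
    obtain ⟨⟨N, hN⟩, h⟩ := ih fun i => F i.succ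
    rw [Fin.prod_univ_succ, Fin.prod_univ_succ, ← h]
    exact ⟨⟨_, (brBdd_of_mem_Tstar (F 0).2).mul hN⟩, pullF_mul (brBdd_of_mem_Tstar (F 0).2) hN⟩

theorem GamS_prod (f : Tplus α w →ₐ[ℝ] ℝ) {k : ℕ} (F : Fin k → Tstar)
    (hF : ∏ i, (F i : PS) ∈ Tstar) :
    (GamS f ⟨∏ i, (F i : PS), hF⟩ : PS) = ∏ i, (GamS f (F i) : PS) := by
  simp only [coe_GamS]
  rw [(pullF_prod F).2, map_prod]

theorem etilt_conv (g g' : Param α w) (n : N2) :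
    (paramOf (conv (DeltaP α w) g.char g'.char)).etilt n =
      g.etilt n + (GamS g.char ⟨g'.etilt n, etilt_mem g' n⟩ : PS) := by
  ext γ
  rw [map_add, ← char_Ehat, char_paramOf]
  by_cases hγ : IsModelIdx γ
  · have h1 : g'.char.toLinearMap ∘ₗ ET α w n = toDual ⟨g'.etilt n, etilt_mem g' n⟩ := by
      refine T_ext fun δ => ?_
      rw [LinearMap.comp_apply, ET_zT, toDual_zT]
      exact char_Ehat g' n δ.1
    rw [conv_apply, DeltaP_Ehat n ⟨γ, hγ⟩, DeltaE, map_add, formTensor_tmul, formTensor_lTensor, h1,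
      formTensor_DeltaT, coe_GamS, coeff_mapA, ← char_Ehat]
    simp
  · have h1 : coeff γ (GamS g.char ⟨g'.etilt n, etilt_mem g' n⟩ : PS) = 0 :=
      by_contra fun h => hγ ((GamS g.char ⟨g'.etilt n, etilt_mem g' n⟩).2 γ h)
    rw [h1, ← char_Ehat, Ehat_eq_zero_of_not_model hγ, map_zero, map_zero, add_zero]

theorem h_conv (g g' : Param α w) :
    (paramOf (conv (DeltaP α w) g.char g'.char)).h = g.h + g'.h := by
  funext i
  change conv (DeltaP α w) g.char g'.char (MvPolynomial.X (Sum.inr i)) = g.h i + g'.h i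
  rw [conv_apply, DeltaP_X_inr, map_add, formTensor_tmul, formTensor_tmul]
  simp [char_X_inr]

theorem grpGs_eq_closure : grpGs α w = Subgroup.closure
    ({Ψ | ∃ g : Param α w, g.tilt = 0 ∧ GamSE g.char = Ψ} ∪
      {Ψ | ∃ g : Param α w, g.h = 0 ∧ GamSE g.char = Ψ}) := by
  refine le_antisymm ?_ ?_
  · rintro _ ⟨f, rfl⟩
    let g := paramOf f
    -- Shifts add under composition, so composing with the opposite pure shift leaves a pure tilt.
    -- Every element is thus a tilt times the inverse of a shift.
    let s : Param α w := ⟨-g.h, 0, fun n γ h => absurd (by simp) h⟩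
    let g' := paramOf (conv (DeltaP α w) g.char s.char)
    have hg' : g'.h = 0 := by
      rw [h_conv]
      exact add_neg_cancel g.h
    have h1 : GamSE f = GamSE g'.char * (GamSE s.char)⁻¹ := by
      rw [char_paramOf, GamSE_conv, mul_inv_cancel_right, char_paramOf]
    rw [h1]
    exact Subgroup.mul_mem _ (Subgroup.subset_closure (Or.inr ⟨g', hg', rfl⟩))
      (Subgroup.inv_mem _ (Subgroup.subset_closure (Or.inl ⟨s, rfl, rfl⟩)))
  · rw [Subgroup.closure_le]
    rintro _ (⟨g, -, rfl⟩ | ⟨g, -, rfl⟩) <;> exact ⟨g.char, rfl⟩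

/-! ### Injectivity of the parameterization -/

theorem coeff_mul_congr {R : Type} [CommRing R] {F Q Q' : MvPowerSeries Var R} {β : MIdx}
    (h : ∀ δ ≤ β, coeff δ Q = coeff δ Q') : coeff β (F * Q) = coeff β (F * Q') := by
  classical
  rw [MvPowerSeries.coeff_mul, MvPowerSeries.coeff_mul]
  refine Finset.sum_congr rfl fun p hp => ?_
  rw [h p.2 ((Finset.HasAntidiagonal.mem_antidiagonal.1 hp) ▸ le_add_self)]

/-- The divided difference of the Taylor series. -/
def divDiff (e e' : PS) : PS := series fun β =>
  ∑ᶠ l : ℕ, coeff β ((∑ i ∈ Finset.range l, e ^ i * e' ^ (l - 1 - i)) * X (Sum.inl l))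

theorem coeff_divDiff (e e' : PS) {β : MIdx} {N : ℕ} (hN : ∀ j, N ≤ j → β (Sum.inl j) = 0) :
    coeff β (divDiff e e') = coeff β (∑ l ∈ Finset.range N,
      (∑ i ∈ Finset.range l, e ^ i * e' ^ (l - 1 - i)) * X (Sum.inl l)) := by
  rw [map_sum]
  refine finsum_eq_sum_of_support_subset _ fun l hl => ?_
  by_contra hc
  exact hl (coeff_mul_X_eq_zero (hN l (by simpa using hc)) _)

theorem taylor_sub_taylor (e e' : PS) : taylor e 0 - taylor e' 0 = (e - e') * divDiff e e' := by
  ext β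
  obtain ⟨N, hN⟩ := exists_bound {β}
  have hN := hN β (Finset.mem_singleton_self _)
  rw [map_sub, coeff_taylor e 0 hN, coeff_taylor e' 0 hN,
    coeff_mul_congr fun δ hδ => coeff_divDiff e e' fun j hj => Nat.le_zero.1 ((hδ _).trans_eq (hN j hj)),
    ← Finset.sum_sub_distrib, Finset.mul_sum, map_sum]
  refine Finset.sum_congr rfl fun l _ => ?_
  rw [← map_sub, ← smul_sub, ← sub_mul, ← mul_assoc, Commute.mul_geom_sum₂ (Commute.all e e')]
  simp

theorem divDiff_ne_zero (e e' : PS) : divDiff e e' ≠ 0 := by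
  intro h
  -- The coefficient of $z_1$ is $1$: the term $l=0$ is an empty sum and $l=1$ contributes $z_1$
  -- itself.
  have h1 := coeff_divDiff e e' (β := Finsupp.single (Sum.inl 1) 1) (N := 2) (by
    intro j hj
    rw [Finsupp.single_apply, if_neg (by simp; omega)])
  rw [h, Finset.sum_range_succ, Finset.sum_range_one] at h1
  simp [MvPowerSeries.X, MvPowerSeries.coeff_monomial_same] at h1

/-- The image $\sum_le^lz_l$ of $z_0$ determines $e$: the difference of two images is $e-e'$ times a
nonzero divided difference in a domain. This recovers $\hat\pi^{(0)}$, which is not directly the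
image of a variable. -/
theorem taylor_injective {e e' : PS} (h : taylor e 0 = taylor e' 0) : e = e' := by
  have h1 := taylor_sub_taylor e e'
  rw [h, sub_self] at h1
  exact sub_eq_zero.1 ((mul_eq_zero.1 h1.symm).resolve_right (divDiff_ne_zero e e'))

theorem etilt_injective {g g' : Param α w} (h : g.etilt = g'.etilt) : g = g' := by
  rw [← paramOf_char g, ← paramOf_char g']
  congr 1
  refine MvPolynomial.algHom_ext fun q => ?_
  rw [← Ehat_posIdx, char_Ehat, char_Ehat, h]

theorem GamS_char_injective {g g' : Param α w} (h : GamS g.char = GamS g'.char) : g = g' := by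
  refine etilt_injective (funext fun n => ?_)
  by_cases hn : n = 0
  · have hP : ((MvPolynomial.X (Sum.inl 0) : MvPolynomial Var ℝ) : PS) ∈ Tstar := by
      rw [MvPolynomial.coe_X]
      exact zmon_mem_Tstar (Or.inl (by rw [br_single_inl]; simp))
    have h1 := congrArg Subtype.val (LinearMap.congr_fun h ⟨_, hP⟩)
    rw [GamS_coe, GamS_coe, gpull_inl, gpull_inl] at h1
    rw [hn]
    exact taylor_injective h1
  · have hP : ((MvPolynomial.X (Sum.inr ⟨n, hn⟩) : MvPolynomial Var ℝ) : PS) ∈ Tstar := by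
      rw [MvPolynomial.coe_X]
      exact zmon_mem_Tstar (Or.inr ⟨⟨n, hn⟩, rfl⟩)
    have h1 := congrArg Subtype.val (LinearMap.congr_fun h ⟨_, hP⟩)
    rw [GamS_coe, GamS_coe, gpull_inr, gpull_inr] at h1
    exact add_left_cancel h1

theorem GamSE_char_injective : Function.Injective fun g : Param α w => GamSE g.char :=
  fun _ _ h => GamS_char_injective (congrArg LinearEquiv.toLinearMap h)

/-! ### Expansion in the basis of `U(L)` -/

/-- Each coefficient of the universal pull-back is a polynomial in $\mathsf T^+$ whose monomial
coefficients are pairings with the dual basis. Applying $f$ to its finite monomial expansion gives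
the formula. -/
theorem isFormalSum_Dbas (f : Tplus α w →ₐ[ℝ] ℝ) (F : Tstar) : IsFormalSum
    (fun M : (TiltIdx α w →₀ ℕ) × N2 => f (Zb M.1 M.2) • (rho α w (Dbas M.1 M.2) F : PS))
    (GamS f F) := by
  classical
  intro β
  set y := coeff β (pullF α w F.1) with hy
  let e := Finsupp.sumFinsuppEquivProdFinsupp (α := TiltIdx α w) (β := Fin 2) (γ := ℕ)
  have hterm : ∀ M : (TiltIdx α w →₀ ℕ) × N2,
      coeff β (f (Zb M.1 M.2) • (rho α w (Dbas M.1 M.2) F : PS)) =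
        f (MvPolynomial.monomial (e.symm M) 1) * MvPolynomial.coeff (e.symm M) y := by
    intro M
    rw [MvPowerSeries.coeff_smul, coe_rho, ← BU_pullF (brBdd_of_mem_Tstar F.2), BU_Dbas_apply]
    rfl
  have hsub : {M : (TiltIdx α w →₀ ℕ) × N2 | coeff β (f (Zb M.1 M.2) • (rho α w (Dbas M.1 M.2) F : PS)) ≠ 0} ⊆
      (y.support.image e : Finset _) := by
    intro M hM
    rw [Set.mem_ofPred_eq, hterm] at hM
    rw [Finset.coe_image]
    exact ⟨e.symm M, MvPolynomial.mem_support_iff.2 (right_ne_zero_of_mul hM), by simp⟩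
  refine ⟨(Finset.finite_toSet _).subset hsub, ?_⟩
  rw [finsum_eq_sum_of_support_subset _ hsub, Finset.sum_image e.injective.injOn, coe_GamS, coeff_mapA,
    ← hy]
  conv_lhs => rw [y.as_sum, map_sum]
  refine Finset.sum_congr rfl fun k _ => ?_
  rw [hterm, Equiv.symm_apply_apply, mul_comm, ← smul_eq_mul, ← map_smul, MvPolynomial.smul_monomial,
    smul_eq_mul, mul_one]

end StructureGroup

end

end ShiftTilt

/-! ### Evaluation at pairs of polynomials -/

namespace ShiftTilt

noncomputable section

open MvPowerSeries (coeff X)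

/-! ### Evaluation of power series -/

section Values

/-- The monomial `x^γ`. -/
def monVal (x : Var → ℝ) (γ : MIdx) : ℝ := γ.prod fun i e => x i ^ e

theorem monVal_add (x : Var → ℝ) (γ δ : MIdx) : monVal x (γ + δ) = monVal x γ * monVal x δ :=
  Finsupp.prod_add_index' (fun _ => pow_zero _) fun _ _ _ => pow_add _ _ _

theorem monVal_single (x : Var → ℝ) (v : Var) : monVal x (Finsupp.single v 1) = x v := by
  simp [monVal]

theorem monVal_eq_zero {x : Var → ℝ} {γ : MIdx} {v : Var} (hv : γ v ≠ 0) (hx : x v = 0) :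
    monVal x γ = 0 :=
  Finset.prod_eq_zero (Finsupp.mem_support_iff.2 hv) (by simp [hx, hv])

variable {a : Polynomial ℝ} {p : MvPolynomial (Fin 2) ℝ} {F G : PS} {u v : ℝ}

theorem hasValue_iff : HasValue F a p v ↔ HasSum (fun γ => coeff γ F * monVal (coords a p) γ) v :=
  Iff.rfl

theorem HasValue.add (hF : HasValue F a p u) (hG : HasValue G a p v) :
    HasValue (F + G) a p (u + v) := by
  rw [hasValue_iff] at *
  refine (HasSum.add hF hG).congr_fun ?_
  intro γ
  rw [map_add, add_mul]

theorem HasValue.smul (c : ℝ) (hF : HasValue F a p u) : HasValue (c • F) a p (c * u) := by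
  rw [hasValue_iff] at *
  refine (HasSum.mul_left c hF).congr_fun ?_
  intro γ
  rw [MvPowerSeries.coeff_smul, mul_assoc]

theorem hasSum_antidiagonal {A : Type} [AddCommMonoid A] [Finset.HasAntidiagonal A] {f g : A → ℝ}
    {u v : ℝ} (hf : HasSum f u) (hg : HasSum g v) :
    HasSum (fun n => ∑ q ∈ Finset.HasAntidiagonal.antidiagonal n, f q.1 * g q.2) (u * v) := by
  have hs := summable_mul_of_summable_norm hf.summable.norm hg.summable.norm
  have h1 := Summable.tsum_mul_tsum_eq_tsum_sum_antidiagonal hf.summable hg.summable hs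
  rw [← hf.tsum_eq, ← hg.tsum_eq, h1]
  exact (summable_sum_mul_antidiagonal_of_summable_mul hs).hasSum

/-- The Cauchy product over antidiagonals; unconditional convergence of real series is absolute
convergence. -/
theorem HasValue.mul (hF : HasValue F a p u) (hG : HasValue G a p v) :
    HasValue (F * G) a p (u * v) := by
  classical
  rw [hasValue_iff] at *
  have h2 := hasSum_antidiagonal hF hG
  have h3 : (fun γ => coeff γ (F * G) * monVal (coords a p) γ) = fun γ =>
      ∑ q ∈ Finset.HasAntidiagonal.antidiagonal γ, coeff q.1 F * monVal (coords a p) q.1 *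
        (coeff q.2 G * monVal (coords a p) q.2) := by
    funext γ
    rw [MvPowerSeries.coeff_mul, Finset.sum_mul]
    refine Finset.sum_congr rfl fun q hq => ?_
    rw [← Finset.HasAntidiagonal.mem_antidiagonal.1 hq, monVal_add]
    ring
  rw [h3]
  exact h2

theorem hasValue_C (c : ℝ) : HasValue (MvPowerSeries.C c) a p c := by
  classical
  rw [hasValue_iff]
  have h := hasSum_single (f := fun γ => coeff γ (MvPowerSeries.C c : PS) * monVal (coords a p) γ) 0
    (fun γ hγ => by rw [MvPowerSeries.coeff_C, if_neg hγ, zero_mul])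
  simpa [monVal] using h

theorem hasValue_X (i : Var) : HasValue (X i) a p (coords a p i) := by
  classical
  rw [hasValue_iff]
  have h := hasSum_single (f := fun γ => coeff γ (X i : PS) * monVal (coords a p) γ)
    (Finsupp.single i 1) (fun γ hγ => by rw [MvPowerSeries.coeff_X, if_neg hγ, zero_mul])
  simpa [monVal_single, MvPowerSeries.coeff_X] using h

theorem HasValue.pow (hF : HasValue F a p u) (k : ℕ) : HasValue (F ^ k) a p (u ^ k) := by
  induction k with
  | zero =>
    rw [pow_zero, pow_zero]
    exact hasValue_C 1
  | succ k ih =>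
    rw [pow_succ, pow_succ]
    exact ih.mul hF

theorem HasValue.sum {ι : Type} {S : Finset ι} {F : ι → PS} {u : ι → ℝ}
    (h : ∀ i ∈ S, HasValue (F i) a p (u i)) : HasValue (∑ i ∈ S, F i) a p (∑ i ∈ S, u i) := by
  rw [hasValue_iff]
  refine (hasSum_sum fun i hi => hasValue_iff.1 (h i hi)).congr_fun ?_
  intro γ
  rw [map_sum, Finset.sum_mul]

theorem coeff_translate (a : Polynomial ℝ) (c : ℝ) (k : ℕ) {N : ℕ} (hN : a.natDegree < N) :
    (translate a c).coeff k =
      ∑ l ∈ Finset.range N, ((k + l).choose k : ℝ) * (c ^ l * a.coeff (k + l)) := by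
  rw [translate, ← Polynomial.taylor_apply, Polynomial.taylor_coeff, Polynomial.hasseDeriv_apply,
    a.sum_over_range' (by simp) (k + N) (by omega), Polynomial.eval_finsetSum,
    Finset.sum_range_add, Finset.sum_eq_zero, zero_add]
  · refine Finset.sum_congr rfl fun l _ => ?_
    rw [Polynomial.eval_monomial, add_tsub_cancel_left]
    ring
  · intro i hi
    rw [Nat.choose_eq_zero_of_lt (Finset.mem_range.1 hi)]
    simp

/-- As $a$ is a polynomial, every monomial containing some $z_j$ with $j>\deg a$ evaluates to zero.
The infinite Taylor series may therefore be replaced by a finite sum. -/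
theorem HasValue.taylor (hF : HasValue F a p u) (k : ℕ) :
    HasValue (taylor F k) a p ((translate a u).coeff k) := by
  set N := a.natDegree + 1 with hN
  rw [coeff_translate a u k (Nat.lt_succ_self _)]
  have h : HasValue (∑ l ∈ Finset.range N, ((k + l).choose k : ℝ) • (F ^ l * X (Sum.inl (k + l))))
      a p (∑ l ∈ Finset.range N, ((k + l).choose k : ℝ) * (u ^ l * a.coeff (k + l))) :=
    HasValue.sum fun l _ => ((hF.pow l).mul (hasValue_X (Sum.inl (k + l)))).smul _
  rw [hasValue_iff] at h ⊢
  refine h.congr_fun ?_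
  intro γ
  by_cases hγ : ∀ j, N ≤ j → γ (Sum.inl j) = 0
  · rw [coeff_taylor F k hγ, map_sum]
  · push Not at hγ
    obtain ⟨j, hj, hγj⟩ := hγ
    have h0 : monVal (coords a p) γ = 0 :=
      monVal_eq_zero hγj (Polynomial.coeff_eq_zero_of_natDegree_lt (by omega))
    rw [h0, mul_zero, mul_zero]

theorem hasValue_gpull {E : N2 → PS} {y : Var → ℝ}
    (h : ∀ i, HasValue (gpull E (MvPolynomial.X i)) a p (y i)) (P : MvPolynomial Var ℝ) :
    HasValue (gpull E P) a p (MvPolynomial.eval y P) := by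
  induction P using MvPolynomial.induction_on with
  | C c =>
    rw [MvPolynomial.eval_C, ← MvPolynomial.algebraMap_eq, AlgHom.commutes]
    exact hasValue_C c
  | add P Q hP hQ =>
    rw [map_add, map_add]
    exact hP.add hQ
  | mul_X P i hP =>
    rw [map_mul, map_mul, MvPolynomial.eval_X]
    exact hP.mul (h i)

theorem coeff_tiltPoly (v : N2 →₀ ℝ) {n : N2} (hn : n ≠ 0) : (tiltPoly v).coeff n = v n := by
  classical
  rw [tiltPoly, MvPolynomial.coeff_sum]
  simp only [MvPolynomial.coeff_monomial]
  rw [Finset.sum_ite_eq']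
  split_ifs with h
  · rfl
  · by_contra hc
    exact h (Finset.mem_erase.2 ⟨hn, Finsupp.mem_support_iff.2 (Ne.symm hc)⟩)

theorem hasValue_gpull_tilt {E : N2 → PS} {v : N2 →₀ ℝ} (h : ∀ n, HasValue (E n) a p (v n))
    (P : MvPolynomial Var ℝ) : HasValue (gpull E P) a p
      (MvPolynomial.eval (coords (translate a (v 0)) (p + tiltPoly v)) P) := by
  refine hasValue_gpull (fun i => ?_) P
  rcases i with k | n
  · rw [gpull_inl]
    exact (h 0).taylor k
  · rw [gpull_inr]
    change HasValue _ _ _ ((p + tiltPoly v).coeff n.1)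
    rw [MvPolynomial.coeff_add, coeff_tiltPoly v n.2]
    exact (hasValue_X (Sum.inr n)).add (h n.1)

/-! ### Translation of polynomials -/

theorem coeff_translate2_monomial (h : Fin 2 → ℝ) (m n : N2) (c : ℝ) :
    (translate2 (MvPolynomial.monomial m c) h).coeff n =
      c * ((choose2 m n : ℝ) * pow2 h (m - n)) := by
  classical
  have hX : ∀ i, (MvPolynomial.X i + MvPolynomial.C (h i) : MvPolynomial (Fin 2) ℝ) ^ m i =
      ∑ j ∈ Finset.range (m i + 1), MvPolynomial.monomial (Finsupp.single i j)
        (((m i).choose j : ℝ) * h i ^ (m i - j)) := by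
    intro i
    rw [add_pow]
    refine Finset.sum_congr rfl fun j _ => ?_
    rw [MvPolynomial.X_pow_eq_monomial, ← map_pow, ← map_natCast MvPolynomial.C, mul_assoc,
      ← map_mul, mul_comm, MvPolynomial.C_mul_monomial, mul_one, mul_comm]
  have hn : ∀ j l : ℕ, (Finsupp.single 0 j + Finsupp.single 1 l : N2) = n ↔ j = n 0 ∧ l = n 1 := by
    intro j l
    refine ⟨fun h => by simp [← h], ?_⟩
    rintro ⟨rfl, rfl⟩
    ext i
    fin_cases i <;> simp
  rw [translate2, MvPolynomial.aeval_monomial, Finsupp.prod_fintype _ _ (fun _ => pow_zero _),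
    Fin.prod_univ_two, hX, hX, Finset.sum_mul_sum, MvPolynomial.algebraMap_eq,
    MvPolynomial.coeff_C_mul, MvPolynomial.coeff_sum]
  simp only [MvPolynomial.coeff_sum, MvPolynomial.monomial_mul, MvPolynomial.coeff_monomial, hn]
  congr 1
  by_cases hle : n 0 ≤ m 0 ∧ n 1 ≤ m 1
  · rw [Finset.sum_eq_single (n 0), Finset.sum_eq_single (n 1)]
    · simp only [choose2, pow2, Fin.prod_univ_two, and_self, if_true, Finsupp.tsub_apply]
      push_cast
      ring
    · intro l _ hl
      rw [if_neg fun h => hl h.2]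
    · intro hc
      exact absurd (Finset.mem_range.2 (by omega)) hc
    · intro j _ hj
      exact Finset.sum_eq_zero fun l _ => if_neg fun h => hj h.1
    · intro hc
      exact absurd (Finset.mem_range.2 (by omega)) hc
  · rw [choose2_eq_zero fun h => hle ⟨h 0, h 1⟩, Nat.cast_zero, zero_mul]
    refine Finset.sum_eq_zero fun j hj => Finset.sum_eq_zero fun l hl => if_neg fun h => hle ?_
    rw [Finset.mem_range] at hj hl
    omega

theorem coeff_translate2 (p : MvPolynomial (Fin 2) ℝ) (h : Fin 2 → ℝ) (n : N2) :
    (translate2 p h).coeff n =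
      ∑ m ∈ p.support, p.coeff m * ((choose2 m n : ℝ) * pow2 h (m - n)) := by
  have : translate2 p h = ∑ m ∈ p.support, translate2 (MvPolynomial.monomial m (p.coeff m)) h := by
    conv_lhs => rw [p.as_sum]
    exact map_sum (MvPolynomial.aeval _) _ _
  rw [this, MvPolynomial.coeff_sum]
  exact Finset.sum_congr rfl fun m _ => coeff_translate2_monomial h m n _

theorem coeff_zero_translate2 (p : MvPolynomial (Fin 2) ℝ) (h : Fin 2 → ℝ) :
    (translate2 p h).coeff 0 = MvPolynomial.eval h p := by
  rw [coeff_translate2, MvPolynomial.eval_eq']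
  refine Finset.sum_congr rfl fun m _ => ?_
  rw [choose2_zero_right, Nat.cast_one, one_mul, tsub_zero, pow2]

variable {α : ℝ} {w : N2 →+ ℝ}

theorem coeff_etilt_eIdx (g : Param α w) (n : N2) (m : {n : N2 // n ≠ 0}) :
    coeff (eIdx m) (g.etilt n) =
      if n = m.1 then 0 else (choose2 m.1 n : ℝ) * pow2 g.h (m.1 - n) := by
  rw [← char_Ehat, Ehat_eIdx]
  split_ifs
  · rw [map_zero]
  · rw [hbin, map_smul, char_hmon, smul_eq_mul]

theorem coeff_etilt_of_shift {g : Param α w} (hg : g.tilt = 0) (n : N2) {γ : MIdx}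
    (hγ : ¬ ∃ m, γ = eIdx m) : coeff γ (g.etilt n) = 0 := by
  rw [← char_Ehat]
  by_cases hq : 0 ≤ br γ ∧ w n < homog α w γ
  · refine (congrArg _ (Ehat_adm ⟨(γ, n), hq⟩)).trans ((char_X_inl g ⟨(γ, n), hq⟩).trans ?_)
    rw [hg]
    simp
  · rw [Ehat, dif_neg hq, dif_neg hγ, map_zero]

/-- Without tilt the extended tilt is linear in the $z_m$, and its value is the binomial expansion
of $p(\cdot+h)-p$ over the finite support of $p$. The condition $p(0)=0$ is needed because there is
no variable $z_m$ with $m=0$. -/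
theorem hasValue_etilt_shift {g : Param α w} (hg : g.tilt = 0) (a : Polynomial ℝ)
    {p : MvPolynomial (Fin 2) ℝ} (hp : p.coeff 0 = 0) (n : N2) :
    HasValue (g.etilt n) a p ((translate2 p g.h).coeff n - p.coeff n) := by
  classical
  rw [hasValue_iff]
  let S : Finset {n : N2 // n ≠ 0} := p.support.subtype _
  have h := hasSum_sum_of_ne_finset_zero (s := S.image eIdx)
    (f := fun γ => coeff γ (g.etilt n) * monVal (coords a p) γ) (L := .unconditional _) (by
      intro γ hγ
      by_cases hm : ∃ m, γ = eIdx m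
      · obtain ⟨m, rfl⟩ := hm
        have h0 : p.coeff m.1 = 0 := by
          by_contra hc
          exact hγ (Finset.mem_image_of_mem _
            (Finset.mem_subtype.2 (MvPolynomial.mem_support_iff.2 hc)))
        rw [monVal_single]
        change _ * p.coeff m.1 = 0
        rw [h0, mul_zero]
      · rw [coeff_etilt_of_shift hg n hm, zero_mul])
  convert h using 1
  rw [Finset.sum_image eIdx_injective.injOn]
  simp only [coeff_etilt_eIdx, monVal_single]
  have h1 := Finset.sum_subtype_eq_sum_filter (s := p.support) (p := fun n : N2 => n ≠ 0)
    (f := fun m => (if n = m then 0 else (choose2 m n : ℝ) * pow2 g.h (m - n)) * p.coeff m)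
  refine Eq.trans ?_ h1.symm
  have h2 : p.support.filter (fun n : N2 => n ≠ 0) = p.support := by
    refine Finset.filter_true_of_mem fun m hm h0 => ?_
    rw [h0, MvPolynomial.mem_support_iff] at hm
    exact hm hp
  rw [h2, coeff_translate2]
  have h3 : p.coeff n = ∑ m ∈ p.support, if n = m then p.coeff m else 0 := by
    rw [Finset.sum_ite_eq]
    split_ifs with h
    · rfl
    · simpa using h
  conv_lhs => rw [h3]
  rw [← Finset.sum_sub_distrib]
  refine Finset.sum_congr rfl fun m _ => ?_
  split_ifs with h
  · subst h
    rw [choose2_self, tsub_self]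
    simp [pow2]
  · ring

theorem hasValue_gpull_shift {g : Param α w} (hg : g.tilt = 0) (a : Polynomial ℝ)
    {p : MvPolynomial (Fin 2) ℝ} (hp : p.coeff 0 = 0) (P : MvPolynomial Var ℝ) :
    HasValue (gpull g.etilt P) a p (MvPolynomial.eval (coords (translate a (MvPolynomial.eval g.h p))
      (translate2 p g.h - MvPolynomial.C (MvPolynomial.eval g.h p))) P) := by
  classical
  refine hasValue_gpull (fun i => ?_) P
  rcases i with k | n
  · rw [gpull_inl]
    have h := hasValue_etilt_shift hg a hp 0
    rw [coeff_zero_translate2, hp, sub_zero] at h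
    exact h.taylor k
  · rw [gpull_inr]
    change HasValue _ _ _ ((translate2 p g.h - MvPolynomial.C (MvPolynomial.eval g.h p)).coeff n.1)
    have h := (hasValue_X (a := a) (p := p) (Sum.inr n)).add (hasValue_etilt_shift hg a hp n.1)
    have e : coords a p (Sum.inr n) = p.coeff n.1 := rfl
    rw [e, add_sub_cancel] at h
    rw [MvPolynomial.coeff_sub, MvPolynomial.coeff_C, if_neg (Ne.symm n.2), sub_zero]
    exact h

end Values

end

end ShiftTilt

/-! ### Exponential formula by scaling the extended tilt -/

namespace ShiftTilt

noncomputable section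

open MvPowerSeries (coeff X)

/-! ### The exponential formula -/

section Exponential

open Classical in
/-- The derivation `D^{(n)}` of the polynomial algebra. -/
def Dpoly (n : N2) : Derivation ℝ (MvPolynomial Var ℝ) (MvPolynomial Var ℝ) :=
  MvPolynomial.mkDerivation ℝ fun v => match v with
    | Sum.inl k => if n = 0 then ((k : ℝ) + 1) • MvPolynomial.X (Sum.inl (k + 1)) else 0
    | Sum.inr m => if n = m.1 then 1 else 0

open Classical in
theorem Dpoly_X_inl (n : N2) (k : ℕ) : Dpoly n (MvPolynomial.X (Sum.inl k)) =
    if n = 0 then ((k : ℝ) + 1) • MvPolynomial.X (Sum.inl (k + 1)) else 0 :=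
  MvPolynomial.mkDerivation_X _ _ _

open Classical in
theorem Dpoly_X_inr (n : N2) (m : {n : N2 // n ≠ 0}) :
    Dpoly n (MvPolynomial.X (Sum.inr m)) = if n = m.1 then 1 else 0 :=
  MvPolynomial.mkDerivation_X _ _ _

theorem coe_Dpoly (n : N2) (P : MvPolynomial Var ℝ) : (Dpoly n P : PS) = Dtilt n (P : PS) := by
  classical
  induction P using MvPolynomial.induction_on with
  | C c =>
    have h1 : Dpoly n (MvPolynomial.C c) = 0 := (Dpoly n).map_algebraMap c
    have h2 : ((MvPolynomial.C c : MvPolynomial Var ℝ) : PS) = c • (1 : PS) := by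
      rw [MvPolynomial.C_eq_smul_one, MvPolynomial.coe_smul, MvPolynomial.coe_one]
    rw [h1, h2, map_smul, (IsDer.Dtilt n).one, smul_zero, MvPolynomial.coe_zero]
  | add P Q hP hQ => rw [map_add, MvPolynomial.coe_add, MvPolynomial.coe_add, map_add, hP, hQ]
  | mul_X P v hP =>
    have hX : (Dpoly n (MvPolynomial.X v) : PS) = Dtilt n (X v) := by
      rcases v with k | m
      · rw [Dpoly_X_inl, Dtilt_X_inl]
        split_ifs
        · rw [MvPolynomial.coe_smul, MvPolynomial.coe_X]
        · rw [MvPolynomial.coe_zero]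
      · rw [Dpoly_X_inr, Dtilt_X_inr]
        split_ifs
        · rw [MvPolynomial.coe_one]
        · rw [MvPolynomial.coe_zero]
    rw [Derivation.leibniz, smul_eq_mul, smul_eq_mul, MvPolynomial.coe_add, MvPolynomial.coe_mul,
      MvPolynomial.coe_mul, MvPolynomial.coe_mul, hP, hX, MvPolynomial.coe_X, IsDer.Dtilt n,
      mul_comm (X v)]

/-- The composition `D^{(n_k)} ⋯ D^{(n_1)}`. -/
def Dlist : List N2 → PS →ₗ[ℝ] PS
  | [] => LinearMap.id
  | n :: l => Dlist l ∘ₗ Dtilt n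

theorem foldl_Dtilt (l : List N2) (F : PS) : l.foldl (fun G n => Dtilt n G) F = Dlist l F := by
  induction l generalizing F with
  | nil => rfl
  | cons n l ih => exact ih _

theorem FinDep.Dlist (l : List N2) : FinDep (Dlist l) := by
  induction l with
  | nil => exact FinDep.id
  | cons n l ih => exact ih.comp (FinDep.Dtilt n)

theorem coe_foldl_Dpoly (l : List N2) (P : MvPolynomial Var ℝ) :
    ((l.foldl (fun G n => Dpoly n G) P : MvPolynomial Var ℝ) : PS) = Dlist l (P : PS) := by
  induction l generalizing P with
  | nil => rfl
  | cons n l ih =>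
    refine (ih _).trans ?_
    rw [coe_Dpoly]
    rfl

theorem br_of_coeff_Dtilt {n : N2} {F : PS} {N : ℤ} (hF : BrBdd N F) : BrBdd (N + 1) (Dtilt n F) := by
  intro β h
  rcases exists_of_coeff_Dtilt h with ⟨hn, h1⟩ | ⟨k, δ, rfl, h1⟩
  · have := hF _ h1
    rw [br_add, br_single_inr] at this
    omega
  · have := hF _ h1
    rw [br_add, br_single_inl] at this ⊢
    push_cast
    omega

theorem brBdd_Dlist (l : List N2) {F : PS} {N : ℤ} (hF : BrBdd N F) :
    BrBdd (N + l.length) (Dlist l F) := by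
  induction l generalizing F N with
  | nil =>
    rw [List.length_nil, Nat.cast_zero, add_zero]
    exact hF
  | cons n l ih =>
    have := ih (br_of_coeff_Dtilt (n := n) hF)
    rw [List.length_cons]
    push_cast
    rw [add_comm (l.length : ℤ), ← add_assoc]
    exact this

/-- The family `t π^{(n)}` of power series with polynomial coefficients in `t`. -/
def tE (s : N2 → PS) (n : N2) : MvPowerSeries Var (Polynomial ℝ) :=
  fun γ => Polynomial.C (coeff γ (s n)) * Polynomial.X

theorem coeff_tE (s : N2 → PS) (n : N2) (γ : MIdx) :
    coeff γ (tE s n) = Polynomial.C (coeff γ (s n)) * Polynomial.X := rfl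

/-- Real power series as power series with polynomial coefficients in `t`. -/
def incR : PS →ₐ[ℝ] MvPowerSeries Var (Polynomial ℝ) := mapA (Algebra.ofId ℝ (Polynomial ℝ))

/-- The coefficientwise derivative with respect to `t`. -/
abbrev dt : Derivation ℝ (MvPowerSeries Var (Polynomial ℝ)) (MvPowerSeries Var (Polynomial ℝ)) :=
  dhat Polynomial.derivative'

theorem coeff_incR (F : PS) (γ : MIdx) : coeff γ (incR F) = Polynomial.C (coeff γ F) := rfl

theorem dt_incR (F : PS) : dt (incR F) = 0 := by
  ext1 γ
  rw [coeff_dhat, coeff_incR]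
  exact Polynomial.derivative_C

theorem dt_tE (s : N2 → PS) (n : N2) : dt (tE s n) = incR (s n) := by
  ext1 γ
  rw [coeff_dhat, coeff_incR, coeff_tE]
  exact Polynomial.derivative_C_mul_X _

theorem mapA_eval_incR (t : ℝ) (F : PS) : mapA (Polynomial.aeval t) (incR F) = F := by
  ext γ
  rw [coeff_mapA, coeff_incR, Polynomial.aeval_C]
  rfl

theorem mapA_eval_tE (t : ℝ) (s : N2 → PS) (n : N2) : mapA (Polynomial.aeval t) (tE s n) = t • s n := by
  ext γ
  rw [coeff_mapA, MvPowerSeries.coeff_smul, coeff_tE, map_mul, Polynomial.aeval_C, Polynomial.aeval_X,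
    mul_comm]
  rfl

/-- Agreement of the coefficients up to `β`. -/
def TruncEq {R : Type} [CommRing R] (β : MIdx) (F G : MvPowerSeries Var R) : Prop :=
  ∀ δ ≤ β, coeff δ F = coeff δ G

theorem TruncEq.mul_left {R : Type} [CommRing R] {β : MIdx} {F G : MvPowerSeries Var R}
    (h : TruncEq β F G) (A : MvPowerSeries Var R) : TruncEq β (A * F) (A * G) :=
  fun _ hδ => coeff_mul_congr fun ε hε => h ε (hε.trans hδ)

theorem TruncEq.add {R : Type} [CommRing R] {β : MIdx} {F G F' G' : MvPowerSeries Var R}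
    (h : TruncEq β F G) (h' : TruncEq β F' G') : TruncEq β (F + F') (G + G') := fun δ hδ => by
  rw [map_add, map_add, h δ hδ, h' δ hδ]

theorem truncEq_taylor {R : Type} [CommRing R] [Algebra ℝ R] (E : MvPowerSeries Var R) (k : ℕ)
    {β : MIdx} {N : ℕ} (hN : ∀ j, N ≤ j → β (Sum.inl j) = 0) :
    TruncEq β (taylor E k)
      (∑ l ∈ Finset.range N, ((k + l).choose k : ℝ) • (E ^ l * X (Sum.inl (k + l)))) := by
  intro δ hδ
  rw [coeff_taylor E k fun j hj => Nat.le_zero.1 ((hδ _).trans_eq (hN j hj)), map_sum]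

theorem dt_taylor (s : N2 → PS) (k : ℕ) : dt (taylor (tE s 0) k) =
    incR (s 0) * (((k : ℝ) + 1) • taylor (tE s 0) (k + 1)) := by
  ext1 β
  obtain ⟨N, hN⟩ := exists_bound {β}
  have hN := hN β (Finset.mem_singleton_self _)
  rw [mul_smul_comm, coeff_rsmul, (truncEq_taylor (tE s 0) (k + 1) hN).mul_left _ β le_rfl, coeff_dhat,
    coeff_taylor (tE s 0) k (N := N + 1) (fun j hj => hN j (by omega)), Finset.sum_range_succ', map_add,
    map_sum, Finset.mul_sum, map_sum, Finset.smul_sum]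
  -- The term $l=0$ does not depend on $t$. Differentiation therefore shifts the index by one, which
  -- explains the $N+1$ terms on this side against $N$ on the other.
  have h0 : Polynomial.derivative' (coeff β (((k + 0).choose k : ℝ) •
      (tE s 0 ^ 0 * X (Sum.inl (k + 0))))) = 0 := by
    rw [← coeff_dhat, Derivation.map_smul, pow_zero, one_mul, dhat_X, smul_zero, map_zero]
  rw [h0, add_zero]
  refine Finset.sum_congr rfl fun l _ => ?_
  have e1 : k + 1 + l = k + (l + 1) := by omega
  have hc : ((k + (l + 1)).choose k : ℝ) * ((l : ℝ) + 1) =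
      ((k : ℝ) + 1) * ((k + 1 + l).choose (k + 1) : ℝ) := by
    have h := Nat.add_one_mul_choose_eq (k + l) k
    have h' := choose_mul_succ k l
    rw [h', e1]
    have : ((k + l + 1) * (k + l).choose k : ℝ) = (k + (l + 1)).choose (k + 1) * (k + 1) := by
      exact_mod_cast h
    linarith
  rw [← coeff_dhat, Derivation.map_smul, Derivation.leibniz, Derivation.leibniz_pow, dhat_X, smul_zero,
    zero_add, dt_tE, Nat.add_sub_cancel, ← coeff_rsmul, mul_smul_comm, smul_smul, ← hc, e1, mul_smul]
  congr 2
  simp only [smul_eq_mul, nsmul_eq_mul, Nat.cast_add, Nat.cast_one]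
  have h2 : ((l : ℝ) + 1) • (incR (s 0) * (tE s 0 ^ l * X (Sum.inl (k + (l + 1))))) =
      (((l : MvPowerSeries Var (Polynomial ℝ)) + 1) *
        (incR (s 0) * (tE s 0 ^ l * X (Sum.inl (k + (l + 1)))))) := by
    rw [Algebra.smul_def, map_add, map_natCast, map_one]
  rw [h2]
  ring

variable {α : ℝ} {w : N2 →+ ℝ} [Pos α w]

theorem zero_mem_Nset (β : MIdx) : (0 : N2) ∈ Nset α w β :=
  (mem_Nset α w).2 ⟨0, zero_le, by
    rw [map_zero, homog_zero]
    exact Pos.alpha_pos w⟩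

/-- The flow equation $\frac{d}{dt}\Gamma_t^*P=\sum_n\pi^{(n)}\Gamma_t^*D^{(n)}P$ for the pull-back
under $t\pi$. Both sides obey the Leibniz rule along the pull-back. Comparing all coefficients up to
$\beta$, rather than at $\beta$ alone, makes the truncated sum over $n$ stable under products. -/
theorem truncEq_dt_gpull (s : TLs α w) (β : MIdx) (P : MvPolynomial Var ℝ) :
    TruncEq β (dt (gpull (tE s.1) P))
      (∑ n ∈ Nset α w β, incR (s.1 n) * gpull (tE s.1) (Dpoly n P)) := by
  classical
  induction P using MvPolynomial.induction_on with
  | C c =>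
    intro δ _
    have h1 : ∀ n, Dpoly n (MvPolynomial.C c) = 0 := fun n => (Dpoly n).map_algebraMap c
    have h2 : dt (gpull (tE s.1) (MvPolynomial.C c)) = 0 := by
      rw [← MvPolynomial.algebraMap_eq, AlgHom.commutes]
      exact dt.map_algebraMap c
    rw [h2]
    simp [h1]
  | add P Q hP hQ =>
    have := hP.add hQ
    simp only [map_add, mul_add, Finset.sum_add_distrib]
    exact this
  | mul_X P v hP =>
    have hX : TruncEq β (dt (gpull (tE s.1) (MvPolynomial.X v)))
        (∑ n ∈ Nset α w β, incR (s.1 n) * gpull (tE s.1) (Dpoly n (MvPolynomial.X v))) := by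
      intro δ hδ
      rcases v with k | m
      · rw [gpull_inl, dt_taylor, Finset.sum_eq_single 0]
        · rw [Dpoly_X_inl, if_pos rfl, map_smul, gpull_inl]
        · intro n _ hn
          rw [Dpoly_X_inl, if_neg hn, map_zero, mul_zero]
        · intro h
          exact absurd (zero_mem_Nset β) h
      · rw [gpull_inr, map_add, dhat_X, zero_add, dt_tE]
        simp only [Dpoly_X_inr]
        by_cases hm : m.1 ∈ Nset α w β
        · rw [Finset.sum_eq_single m.1]
          · rw [if_pos rfl, map_one, mul_one]
          · intro n _ hn
            rw [if_neg hn, map_zero, mul_zero]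
          · intro h
            exact absurd hm h
        · rw [Finset.sum_eq_zero]
          · have h0 : coeff δ (s.1 m.1) = 0 := by
              by_contra hc
              exact hm (mem_Nset_of_coeff s (G := 1) hδ (by rwa [mul_one]))
            rw [coeff_incR, h0, map_zero, map_zero]
          · intro n hn
            rw [if_neg (fun h : n = m.1 => hm (h ▸ hn)), map_zero, mul_zero]
    have h := (hX.mul_left (gpull (tE s.1) P)).add (hP.mul_left (gpull (tE s.1) (MvPolynomial.X v)))
    rw [map_mul, Derivation.leibniz, smul_eq_mul, smul_eq_mul]
    intro δ hδ
    rw [h δ hδ, Finset.mul_sum, Finset.mul_sum, ← Finset.sum_add_distrib]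
    congr 1
    refine Finset.sum_congr rfl fun n _ => ?_
    rw [Derivation.leibniz, smul_eq_mul, smul_eq_mul, map_add, map_mul, map_mul]
    ring

theorem sum_piFinset_succ {ι M : Type} [AddCommMonoid M] {k : ℕ} (S : Finset ι)
    (f : (Fin (k + 1) → ι) → M) :
    ∑ ns ∈ Fintype.piFinset (fun _ : Fin (k + 1) => S), f ns =
      ∑ n ∈ S, ∑ ns ∈ Fintype.piFinset (fun _ : Fin k => S), f (Fin.cons n ns) := by
  rw [← Finset.sum_product']
  refine Finset.sum_nbij' (fun ns => (ns 0, Fin.tail ns)) (fun q => Fin.cons q.1 q.2) ?_ ?_ ?_ ?_ ?_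
  · intro ns h
    rw [Fintype.mem_piFinset] at h
    exact Finset.mem_product.2 ⟨h 0, Fintype.mem_piFinset.2 fun i => h i.succ⟩
  · intro q h
    rw [Finset.mem_product, Fintype.mem_piFinset] at h
    rw [Fintype.mem_piFinset]
    exact Fin.cases h.1 h.2
  · intro ns _
    exact Fin.cons_self_tail ns
  · intro q _
    simp
  · intro ns _
    rw [Fin.cons_self_tail]

theorem iterate_derivative_gpull (s : TLs α w) (β : MIdx) (k : ℕ) (A : PS)
    (P : MvPolynomial Var ℝ) :
    Polynomial.derivative^[k] (coeff β (incR A * gpull (tE s.1) P)) =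
      ∑ ns ∈ Fintype.piFinset (fun _ : Fin k => Nset α w β),
        coeff β (incR (A * ∏ i, s.1 (ns i)) *
          gpull (tE s.1) ((List.ofFn ns).foldl (fun G n => Dpoly n G) P)) := by
  induction k generalizing A P with
  | zero =>
    rw [Fintype.piFinset_of_isEmpty, Finset.sum_congr Finset.univ_unique (fun _ _ => rfl),
      Finset.sum_singleton]
    simp
  | succ k ih =>
    have h1 : Polynomial.derivative (coeff β (incR A * gpull (tE s.1) P)) =
        ∑ n ∈ Nset α w β, coeff β (incR (A * s.1 n) * gpull (tE s.1) (Dpoly n P)) := by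
      have h2 : Polynomial.derivative (coeff β (incR A * gpull (tE s.1) P)) =
          coeff β (dt (incR A * gpull (tE s.1) P)) := rfl
      rw [h2, Derivation.leibniz, dt_incR, smul_zero, add_zero, smul_eq_mul,
        (truncEq_dt_gpull s β P).mul_left _ β le_rfl, Finset.mul_sum, map_sum]
      simp only [← mul_assoc, map_mul]
    rw [Function.iterate_succ_apply, h1, Polynomial.iterate_derivative_sum, sum_piFinset_succ]
    refine Finset.sum_congr rfl fun n _ => ?_
    rw [ih]
    refine Finset.sum_congr rfl fun ns _ => ?_
    rw [Fin.prod_univ_succ, List.ofFn_succ, List.foldl_cons, ← mul_assoc]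
    simp only [Fin.cons_zero, Fin.cons_succ]

theorem factorial_mul_coeff (c : Polynomial ℝ) (k : ℕ) :
    (k.factorial : ℝ) * c.coeff k = Polynomial.aeval (0 : ℝ) (Polynomial.derivative^[k] c) := by
  rw [Polynomial.aeval_def, Polynomial.eval₂_eq_eval_map, Algebra.algebraMap_self, Polynomial.map_id,
    ← Polynomial.coeff_zero_eq_eval_zero, Polynomial.coeff_iterate_derivative, zero_add,
    Nat.descFactorial_self, nsmul_eq_mul]

theorem coeff_gpull_eq_sum (s : TLs α w) (β : MIdx) (P : MvPolynomial Var ℝ) :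
    ∃ M : ℕ, ∀ N, M ≤ N → coeff β (gpull s.1 P) = ∑ k ∈ Finset.range N,
      ∑ ns ∈ Fintype.piFinset (fun _ : Fin k => Nset α w β),
        (k.factorial : ℝ)⁻¹ * coeff β ((∏ i, s.1 (ns i)) * Dlist (List.ofFn ns) (P : PS)) := by
  set c := coeff β (gpull (tE s.1) P) with hc
  -- The coefficient at $\beta$ is a polynomial in $t$, so its Taylor expansion at $t=0$, evaluated
  -- at $t=1$, is finite. The $k$-th derivative at $0$ comes from iterating the flow equation.
  refine ⟨c.natDegree + 1, fun N hN => ?_⟩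
  have h1 : coeff β (gpull s.1 P) = Polynomial.aeval (1 : ℝ) c := by
    rw [hc, ← coeff_mapA, mapA_gpull]
    simp only [mapA_eval_tE, one_smul]
  have h0 : ∀ Q : MvPolynomial Var ℝ, mapA (Polynomial.aeval (0 : ℝ)) (gpull (tE s.1) Q) = Q := by
    intro Q
    rw [mapA_gpull]
    simp only [mapA_eval_tE, zero_smul]
    exact gpull_zero Q
  have h2 : Polynomial.aeval (1 : ℝ) c = ∑ k ∈ Finset.range N, c.coeff k := by
    rw [Polynomial.aeval_def, Polynomial.eval₂_eq_eval_map, Algebra.algebraMap_self, Polynomial.map_id,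
      Polynomial.eval_eq_sum_range' (by omega : c.natDegree < N)]
    simp
  rw [h1, h2]
  refine Finset.sum_congr rfl fun k _ => ?_
  have h3 := factorial_mul_coeff c k
  have h4 := iterate_derivative_gpull s β k 1 P
  rw [map_one, one_mul] at h4
  rw [h4, map_sum] at h3
  rw [← Finset.mul_sum, eq_inv_mul_iff_mul_eq₀ (Nat.cast_ne_zero.2 k.factorial_ne_zero), h3]
  refine Finset.sum_congr rfl fun ns _ => ?_
  rw [← coeff_mapA, map_mul, mapA_eval_incR, h0, one_mul, coe_foldl_Dpoly]

theorem support_expTerm (g : Param α w) {F : PS} (hF : F ∈ Tstar) (β : MIdx) {N : ℕ}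
    (hN : qd β + 2 ≤ N) : {q | coeff β (g.expTerm F q) ≠ 0} ⊆
      ((Finset.range N).sigma fun k => Fintype.piFinset fun _ : Fin k => Nset α w β :
        Finset (Σ k : ℕ, Fin k → N2)) := by
  rintro ⟨k, ns⟩ h
  have h' : coeff β ((∏ i, g.etilt (ns i)) * Dlist (List.ofFn ns) F) ≠ 0 := by
    intro h0
    refine h ?_
    rw [Param.expTerm, MvPowerSeries.coeff_smul, foldl_Dtilt, h0, mul_zero]
  rw [Finset.mem_coe, Finset.mem_sigma, Fintype.mem_piFinset, Finset.mem_range]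
  refine ⟨?_, fun i => ?_⟩
  · obtain ⟨γ, δ, hβ, -, hδ⟩ := exists_of_coeff_mul h'
    -- Each $D^{(n)}$ raises $[\cdot]$ by one, starting from at least $-1$, so $k-1\le[\delta]$.
    -- Since $[\delta]\le$ `qd δ` $\le$ `qd β`, at most `qd β + 1` factors occur.
    have h1 := brBdd_Dlist (List.ofFn ns) (brBdd_of_mem_Tstar hF) δ hδ
    rw [List.length_ofFn] at h1
    have h2 := br_le_qd δ
    have h3 : qd δ ≤ qd β := by
      rw [hβ, qd_add]
      omega
    change k < N
    omega
  · rw [← Finset.mul_prod_erase _ _ (Finset.mem_univ i), mul_assoc] at h'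
    exact mem_Nset_of_coeff ⟨g.etilt, etilt_TLs g⟩ le_rfl h'

/-- The restriction of a power series to a finite set of multi-indices. -/
def truncTo (S : Finset MIdx) (F : PS) : MvPolynomial Var ℝ :=
  ∑ γ ∈ S, MvPolynomial.monomial γ (coeff γ F)

open Classical in
theorem coeff_truncTo (S : Finset MIdx) (F : PS) (γ : MIdx) :
    coeff γ (truncTo S F : PS) = if γ ∈ S then coeff γ F else 0 := by
  rw [MvPolynomial.coeff_coe, truncTo, MvPolynomial.coeff_sum]
  simp only [MvPolynomial.coeff_monomial]
  rw [Finset.sum_ite_eq']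

theorem truncTo_mem (S : Finset MIdx) {F : PS} (hF : F ∈ Tstar) : (truncTo S F : PS) ∈ Tstar := by
  classical
  intro γ hγ
  rw [coeff_truncTo] at hγ
  split_ifs at hγ
  · exact hF γ hγ
  · exact absurd rfl hγ

theorem isFormalSum_expTerm (g : Param α w) (F : Tstar) :
    IsFormalSum (g.expTerm F) (GamS g.char F) := by
  classical
  intro β
  have hfin : {q | coeff β (g.expTerm F q) ≠ 0}.Finite :=
    (Finset.finite_toSet _).subset (support_expTerm g F.2 β le_rfl)
  refine ⟨hfin, ?_⟩
  let Q : Finset (Σ k : ℕ, Fin k → N2) := (Finset.range (qd β + 2)).sigma fun k =>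
    Fintype.piFinset fun _ : Fin k => Nset α w β
  have hdep : ∀ q : Σ k : ℕ, Fin k → N2, ∃ S : Finset MIdx, ∀ G : PS, (∀ γ ∈ S, coeff γ G = 0) →
      coeff β (g.expTerm G q) = 0 := by
    intro q
    obtain ⟨S, hS⟩ := ((FinDep.mulLeft (∏ i, g.etilt (q.2 i))).comp (FinDep.Dlist (List.ofFn q.2))) β
    refine ⟨S, fun G hG => ?_⟩
    rw [Param.expTerm, MvPowerSeries.coeff_smul, foldl_Dtilt]
    refine (congrArg _ (hS G hG)).trans (mul_zero _)
  choose S hS using hdep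
  -- At $\beta$ both sides depend on finitely many coefficients of $F$ only. Truncating $F$ to these
  -- reduces the formula to polynomials, where the flow argument applies.
  let B := Bset α w (-1) β ∪ Q.biUnion S
  let P := truncTo B F.1
  have hP : (P : PS) ∈ Tstar := truncTo_mem B F.2
  have hsub : ∀ q, g.expTerm (F.1 - P) q = g.expTerm F.1 q - g.expTerm P q := by
    intro q
    simp only [Param.expTerm, foldl_Dtilt, map_sub, mul_sub, smul_sub]
  have hterm : ∀ q, coeff β (g.expTerm F.1 q) = coeff β (g.expTerm P q) := by
    intro q
    by_cases hq : q ∈ Q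
    · have h := hS q (F.1 - P) fun γ hγ => by
        rw [map_sub, coeff_truncTo, if_pos, sub_self]
        exact Finset.mem_union_right _ (Finset.mem_biUnion.2 ⟨q, hq, hγ⟩)
      rw [hsub, map_sub, sub_eq_zero] at h
      exact h
    · have h1 : coeff β (g.expTerm F.1 q) = 0 :=
        by_contra fun h => hq (support_expTerm g F.2 β le_rfl h)
      have h2 : coeff β (g.expTerm P q) = 0 :=
        by_contra fun h => hq (support_expTerm g hP β le_rfl h)
      rw [h1, h2]
  have hΓ : coeff β (GamS g.char F : PS) = coeff β (gpull g.etilt P) := by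
    rw [← GamS_coe g hP, coe_GamS, coe_GamS, coeff_mapA, coeff_mapA,
      coeff_pullF (brBdd_of_mem_Tstar F.2), coeff_pullF (brBdd_of_mem_Tstar hP)]
    congr 1
    refine Finset.sum_congr rfl fun γ hγ => ?_
    rw [coeff_truncTo, if_pos (Finset.mem_union_left _ hγ)]
  obtain ⟨M, hM⟩ := coeff_gpull_eq_sum ⟨g.etilt, etilt_TLs g⟩ β P
  have h1 := hM (max M (qd β + 2)) (le_max_left _ _)
  rw [hΓ, finsum_eq_sum_of_support_subset _ (support_expTerm g F.2 β (le_max_right M _)),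
    Finset.sum_sigma]
  refine h1.trans (Finset.sum_congr rfl fun k _ => Finset.sum_congr rfl fun ns _ => ?_)
  rw [hterm, Param.expTerm, MvPowerSeries.coeff_smul, foldl_Dtilt]

end Exponential

end

end ShiftTilt

/-! ### Grading of the model space and triangular group action -/

namespace ShiftTilt

noncomputable section

open MvPowerSeries (coeff X)

/-! ### The regularity structure -/

section RegularityStructure

variable {α : ℝ} {w : N2 →+ ℝ} [Pos α w]

theorem exists_homog_eq (γ : MIdx) : ∃ n : N2, homog α w γ = α * ((br γ : ℝ) + 1) + w n := by
  refine ⟨∑ v ∈ γ.support, (match v with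
      | Sum.inl _ => 0
      | Sum.inr n => γ v • n.1), ?_⟩
  unfold homog
  congr 1
  rw [map_sum]
  refine Finset.sum_congr rfl fun v _ => ?_
  rcases v with k | n
  · exact (map_zero w).symm
  · change w n.1 * _ = w (_ • n.1)
    rw [map_nsmul, nsmul_eq_mul, mul_comm]

/-- The only negative value of $[\cdot]$ occurs at $e_n$, where the part with $\alpha$ vanishes and
$|n|>0$ remains. Otherwise the integer is $[\gamma]+1\ge1$. -/
theorem homog_model {γ : MIdx} (hγ : IsModelIdx γ) :
    0 < homog α w γ ∧ ∃ (k : ℕ) (n : N2), homog α w γ = α * k + w n := by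
  have hα := Pos.alpha_pos (α := α) w
  rcases hγ with h | ⟨n, rfl⟩
  · obtain ⟨n, e⟩ := exists_homog_eq (α := α) (w := w) γ
    have hb : ((br γ).toNat : ℝ) = (br γ : ℝ) := by
      have : ((br γ).toNat : ℤ) = br γ := Int.toNat_of_nonneg h
      exact_mod_cast this
    refine ⟨?_, (br γ).toNat + 1, n, ?_⟩
    · rw [e, ← hb]
      have := w_nonneg α w n
      positivity
    · rw [e, Nat.cast_add, hb, Nat.cast_one]
  · rw [homog_single_inr]
    exact ⟨w_pos α w n.2, 0, n.1, by simp⟩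

theorem iSup_Tgraded (A : Set ℝ) : ⨆ κ ∈ A, Tgraded α w κ =
    Finsupp.supported ℝ ℝ {γ : {γ : MIdx // IsModelIdx γ} | homog α w γ.1 ∈ A} := by
  rw [iSup_subtype']
  simp only [Tgraded]
  rw [← Finsupp.supported_iUnion]
  congr 1
  ext γ
  simp

theorem isInternal_Tgraded {A : Set ℝ} (hA : ∀ γ, IsModelIdx γ → homog α w γ ∈ A) :
    DirectSum.IsInternal fun κ : A => Tgraded α w κ := by
  classical
  rw [DirectSum.isInternal_submodule_iff_iSupIndep_and_iSup_eq_top]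
  constructor
  · intro κ
    rw [iSup_subtype']
    simp only [Tgraded]
    rw [← Finsupp.supported_iUnion]
    refine Finsupp.disjoint_supported_supported (Set.disjoint_left.2 fun γ h1 h2 => ?_)
    obtain ⟨κ', h2⟩ := Set.mem_iUnion.1 h2
    exact κ'.2 (Subtype.ext (Eq.trans (Eq.symm h2) h1))
  · simp only [Tgraded]
    rw [← Finsupp.supported_iUnion, eq_top_iff, ← Finsupp.supported_univ]
    refine Finsupp.supported_mono fun γ _ => ?_
    rw [Set.mem_iUnion]
    exact ⟨⟨_, hA γ.1 γ.2⟩, rfl⟩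

theorem GamE_zT_sub (f : Tplus α w →ₐ[ℝ] ℝ) (β : {γ : MIdx // IsModelIdx γ}) :
    GamE f (zT β) - zT β ∈ Finsupp.supported ℝ ℝ
      {γ : {γ : MIdx // IsModelIdx γ} | homog α w γ.1 < homog α w β.1} := by
  classical
  have hβ : β ∈ (Bset α w (-1) β.1).subtype IsModelIdx :=
    Finset.mem_subtype.2 (mem_Bset.2 ⟨β.2.neg_one_le, le_rfl, le_rfl⟩)
  have h : GamE f (zT β) = GammaOf (DeltaT α w) f (zT β) := rfl
  rw [h, GammaOf_apply, DeltaT_zT, DeltaZ, map_sum, ← Finset.add_sum_erase _ _ hβ, sl_tmul, cfm_self,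
    AlgHom.toLinearMap_apply, map_one, one_smul, add_sub_cancel_left]
  refine Submodule.sum_mem _ fun γ hγ => ?_
  rw [sl_tmul]
  by_cases hc : cfm α w β.1 γ.1 = 0
  · rw [hc, map_zero, zero_smul]
    exact Submodule.zero_mem _
  · rcases below_of_cfm hc with h1 | h1
    · exact absurd (Subtype.ext h1) (Finset.ne_of_mem_erase hγ)
    · exact Submodule.smul_mem _ _ (Finsupp.single_mem_supported ℝ _ h1.2.1)

theorem GamE_sub (f : Tplus α w →ₐ[ℝ] ℝ) {κ : ℝ} {τ : T} (hτ : τ ∈ Tgraded α w κ) :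
    GamE f τ - τ ∈ Finsupp.supported ℝ ℝ
      {γ : {γ : MIdx // IsModelIdx γ} | homog α w γ.1 < κ} := by
  have hle : Tgraded α w κ ≤ (Finsupp.supported ℝ ℝ
      {γ : {γ : MIdx // IsModelIdx γ} | homog α w γ.1 < κ}).comap
        ((GamE f).toLinearMap - LinearMap.id) := by
    rw [Tgraded, Finsupp.supported_eq_span_single, Submodule.span_le]
    rintro _ ⟨β, hβ, rfl⟩
    have h := GamE_zT_sub f β
    have hβ' : homog α w β.1 = κ := hβ
    rw [hβ'] at h
    exact h
  exact hle hτ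

theorem isRegularityStructure {A : Set ℝ} (h0 : BddBelow A) (hf : ∀ c : ℝ, (A ∩ Set.Iic c).Finite)
    (hA : ∀ γ, IsModelIdx γ → homog α w γ ∈ A) :
    IsRegularityStructure A (Tgraded α w) (grpG α w) where
  bddBelow := h0
  locallyFinite := hf
  graded := isInternal_Tgraded hA
  triangular := by
    rintro _ ⟨f, rfl⟩ κ _ τ hτ
    have hle : Finsupp.supported ℝ ℝ {γ : {γ : MIdx // IsModelIdx γ} | homog α w γ.1 < κ} ≤
        ⨆ κ' ∈ A ∩ Set.Iio κ, Tgraded α w κ' := by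
      rw [iSup_Tgraded]
      exact Finsupp.supported_mono fun γ hγ => ⟨hA γ.1 γ.2, hγ⟩
    exact hle (GamE_sub f hτ)

theorem finite_mul_add {ι : Type} {α : ℝ} (hα : 0 < α) (v : ι → ℝ) (hv : ∀ i, 0 ≤ v i)
    (hfin : ∀ c, {i | v i ≤ c}.Finite) (c : ℝ) :
    ({κ : ℝ | ∃ (k : ℕ) (i : ι), κ = α * k + v i} ∩ Set.Iic c).Finite := by
  refine ((Finset.finite_toSet (Finset.range (⌊c / α⌋₊ + 1))).image2
    (fun (k : ℕ) (i : ι) => α * k + v i) (hfin c)).subset ?_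
  rintro _ ⟨⟨k, i, rfl⟩, hκ⟩
  have hκ' : α * k + v i ≤ c := hκ
  have h1 := hv i
  have h2 : 0 ≤ α * k := by positivity
  refine ⟨k, ?_, i, ?_, rfl⟩
  · rw [Finset.mem_coe, Finset.mem_range, Nat.lt_add_one_iff]
    refine Nat.le_floor ?_
    rw [le_div_iff₀ hα]
    linarith
  · change v i ≤ c
    linarith

theorem isRegularityStructure_weights :
    IsRegularityStructure ({κ | ∃ (k : ℕ) (n : N2), κ = α * k + w n} \ {0}) (Tgraded α w)
      (grpG α w) := by
  have hα := Pos.alpha_pos (α := α) w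
  refine isRegularityStructure ⟨0, ?_⟩ (fun c => ?_) fun γ hγ => ?_
  · rintro _ ⟨⟨k, n, rfl⟩, -⟩
    have := w_nonneg α w n
    positivity
  · refine (finite_mul_add hα w (w_nonneg α w) (fun c => ?_) c).subset
      (Set.inter_subset_inter_left _ Set.sdiff_subset)
    refine (finite_w_lt α w (c + 1)).subset fun n hn => ?_
    change w n < c + 1
    have : w n ≤ c := hn
    linarith
  · obtain ⟨h1, h2⟩ := homog_model (α := α) (w := w) hγ
    exact ⟨h2, h1.ne'⟩

theorem isRegularityStructure_integers (hw : ∀ i, ∃ k : ℕ, w (unitVec i) = k) :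
    IsRegularityStructure ({κ | ∃ k l : ℕ, κ = α * k + l} \ {0}) (Tgraded α w) (grpG α w) := by
  have hα := Pos.alpha_pos (α := α) w
  refine isRegularityStructure ⟨0, ?_⟩ (fun c => ?_) fun γ hγ => ?_
  · rintro _ ⟨⟨k, n, rfl⟩, -⟩
    positivity
  · refine (finite_mul_add hα (fun l : ℕ => (l : ℝ)) (fun l => l.cast_nonneg) (fun c => ?_) c).subset
      (Set.inter_subset_inter_left _ Set.sdiff_subset)
    exact (Finset.finite_toSet (Finset.range (⌊c⌋₊ + 1))).subset fun l hl => by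
      rw [Finset.mem_coe, Finset.mem_range, Nat.lt_add_one_iff]
      exact Nat.le_floor hl
  · obtain ⟨h1, k, n, h2⟩ := homog_model (α := α) (w := w) hγ
    choose m hm using hw
    refine ⟨⟨k, n 0 * m 0 + n 1 * m 1, ?_⟩, h1.ne'⟩
    rw [h2, w_eq, hm, hm]
    push_cast
    rfl

end RegularityStructure

end

end ShiftTilt

/-! ### Assembly of the theorem -/

theorem mainTheorem1 (α : ℝ) (hα : 0 < α) (w : N2 →+ ℝ) (hw : ∀ i, 0 < w (unitVec i)) :
    -- `T^*` is the algebraic dual of `T`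
    Function.Bijective toDual ∧
    ∃ (Γs : Param α w → (Tstar ≃ₗ[ℝ] Tstar)) (Γ : Param α w → (T ≃ₗ[ℝ] T))
      (Gs : Subgroup (Tstar ≃ₗ[ℝ] Tstar)) (G : Subgroup (T ≃ₗ[ℝ] T)),
    -- (i) the pull-backs extend to automorphisms of `T^*`, which are dual to automorphisms of `T`
    (∀ g, Extends g (Γs g).toLinearMap) ∧
    (∀ g, IsDual (Γs g).toLinearMap (Γ g).toLinearMap) ∧
    (∀ g Ψs Ψ, IsDual Ψs Ψ → Extends g Ψs → Ψs = (Γs g).toLinearMap) ∧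
    -- as functions on `(a,p)`-space: variable tilt, wherever the tilt can be evaluated ...
    (∀ (g : Param α w) (a : Polynomial ℝ) (p : MvPolynomial (Fin 2) ℝ) (v : N2 →₀ ℝ),
      p.coeff 0 = 0 → (∀ n, HasValue (g.etilt n) a p (v n)) →
      ∀ (P : MvPolynomial Var ℝ) (hP : (P : PS) ∈ Tstar),
        HasValue (Γs g ⟨P, hP⟩) a p
          (MvPolynomial.eval (coords (translate a (v 0)) (p + tiltPoly v)) P)) ∧
    -- ... and shift
    (∀ g : Param α w, g.tilt = 0 → ∀ (a : Polynomial ℝ) (p : MvPolynomial (Fin 2) ℝ),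
      p.coeff 0 = 0 → ∀ (P : MvPolynomial Var ℝ) (hP : (P : PS) ∈ Tstar),
        HasValue (Γs g ⟨P, hP⟩) a p
          (MvPolynomial.eval (coords (translate a (MvPolynomial.eval g.h p))
            (translate2 p g.h - MvPolynomial.C (MvPolynomial.eval g.h p))) P)) ∧
    -- they respect the products of the ambient algebra
    (∀ (g : Param α w) (k : ℕ) (F : Fin k → Tstar) (hF : ∏ i, (F i : PS) ∈ Tstar),
      (Γs g ⟨∏ i, (F i : PS), hF⟩ : PS) = ∏ i, (Γs g (F i) : PS)) ∧
    -- shifts and tilts generate the group `G^*`, parameterized by `(h, {π^{(n)}}_n)`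
    Gs = Subgroup.closure ({Ψ | ∃ g, g.tilt = 0 ∧ Γs g = Ψ} ∪ {Ψ | ∃ g, g.h = 0 ∧ Γs g = Ψ}) ∧
    (Gs : Set (Tstar ≃ₗ[ℝ] Tstar)) = Set.range Γs ∧
    Function.Injective Γs ∧
    -- composition rule
    (∀ g g' : Param α w, ∃ g'' : Param α w, Γs g'' = Γs g * Γs g' ∧ g''.h = g.h + g'.h ∧
      ∀ n, ∃ F : Tstar, (F : PS) = g'.etilt n ∧ g''.etilt n = g.etilt n + (Γs g F : PS)) ∧
    -- exponential formula
    (∀ (g : Param α w) (F : Tstar), IsFormalSum (g.expTerm F) (Γs g F)) ∧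
    -- (ii) regularity structure
    (G : Set (T ≃ₗ[ℝ] T)) = Set.range Γ ∧
    IsRegularityStructure ({κ | ∃ (k : ℕ) (n : N2), κ = α * k + w n} \ {0}) (Tgraded α w) G ∧
    ((∀ i, ∃ k : ℕ, w (unitVec i) = k) →
      IsRegularityStructure ({κ | ∃ k l : ℕ, κ = α * k + l} \ {0}) (Tgraded α w) G) ∧
    -- (iii) the Lie algebra `L` and the Hopf algebra `U(L)`
    (L α w).toSubmodule = Submodule.span ℝ (Set.range (gen α w)) ∧
    LinearIndependent ℝ (gen α w) ∧
    IsHopf (cop (K := L α w)) counitU antipodeU ∧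
    -- the partial pre-Lie product
    ∃ tri : L α w →ₗ[ℝ] Ltilde α w →ₗ[ℝ] Ltilde α w,
    IsPreLieProduct tri ∧
    (∀ tri', IsPreLieProduct tri' → tri' = tri) ∧
    (∀ X Y : Ltilde α w, ⁅(X : L α w), (Y : L α w)⁆ = (tri X Y : L α w) - (tri Y X : L α w)) ∧
    (∀ (D D' : L α w) (X : Ltilde α w),
      tri ⁅D, D'⁆ X = tri D (tri D' X) - tri D' (tri D X)) ∧
    (∀ (q : TiltIdx α w) (i : Fin 2) (F : Tstar),
      ((⁅genL α w (Sum.inl q), genL α w (Sum.inr i)⁆ : L α w) : Module.End ℝ Tstar) F =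
        (q.1.2 i : ℝ) • (zmon q.1.1 * Dtilt (q.1.2 - unitVec i) (F : PS)) -
        (((tri (genL α w (Sum.inr i)) (genLt α w q) : L α w) : Module.End ℝ Tstar) F : PS)) ∧
    -- the basis of `U(L)` built from it
    ∃ graft : Ltilde α w →ₗ[ℝ] U α w →ₗ[ℝ] U α w,
    IsGraft tri graft ∧
    (∀ graft', IsGraft tri graft' → graft' = graft) ∧
    (∀ X Y u, graft X (graft Y u) = graft Y (graft X u)) ∧
    ∃ Dbas : (TiltIdx α w →₀ ℕ) → N2 → U α w,
    IsBasisFamily graft Dbas ∧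
    LinearIndependent ℝ (fun M : (TiltIdx α w →₀ ℕ) × N2 => Dbas M.1 M.2) ∧
    Submodule.span ℝ (Set.range fun M : (TiltIdx α w →₀ ℕ) × N2 => Dbas M.1 M.2) = ⊤ ∧
    -- the non-degenerate pairing with `T⁺` determined by this basis
    ∃ B : U α w →ₗ[ℝ] Tplus α w →ₗ[ℝ] ℝ,
    (∀ J m, B (Dbas J m) (Zb J m) = 1) ∧
    (∀ J m J' m', (J, m) ≠ (J', m') → B (Dbas J m) (Zb J' m') = 0) ∧
    B.Nondegenerate ∧
    -- the dual Hopf algebra structure of `T⁺`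
    ∃ (Δp : Tplus α w →ₐ[ℝ] Tplus α w ⊗[ℝ] Tplus α w) (εp : Tplus α w →ₐ[ℝ] ℝ)
      (Sp : Tplus α w →ₐ[ℝ] Tplus α w),
    IsHopf Δp εp Sp.toLinearMap ∧
    (∀ u Z Z', B u (Z * Z') = formTensor (B.flip Z) (B.flip Z') (cop u)) ∧
    (∀ u, B u 1 = counitU u) ∧
    (∀ u u' Z, formTensor (B u) (B u') (Δp Z) = B (u * u') Z) ∧
    (∀ Z, εp Z = B 1 Z) ∧
    (∀ u Z, B u (Sp Z) = B (antipodeU u) Z) ∧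
    -- the comodule dual to the module `T^*` over `U(L)`
    ∃ Δ : T →ₗ[ℝ] Tplus α w ⊗[ℝ] T,
    IsLeftComodule Δp εp Δ ∧
    (∀ u (F : Tstar) τ, formTensor (B u) (toDual F) (Δ τ) = toDual (rho α w u F) τ) ∧
    -- `G` arises from `T⁺` and `Δ`
    Function.Bijective (Param.char (α := α) (w := w)) ∧
    (∀ g : Param α w, (Γ g).toLinearMap = GammaOf Δ g.char) ∧
    GammaOf Δ εp = LinearMap.id ∧
    (∀ f f', GammaOf Δ (conv Δp f f') = GammaOf Δ f' ∘ₗ GammaOf Δ f) ∧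
    (∀ f, GammaOf Δ (f.comp Sp) ∘ₗ GammaOf Δ f = LinearMap.id ∧
      GammaOf Δ f ∘ₗ GammaOf Δ (f.comp Sp) = LinearMap.id) ∧
    -- the elements of `G^*` in terms of the basis
    (∀ (g : Param α w) (F : Tstar), IsFormalSum
      (fun M : (TiltIdx α w →₀ ℕ) × N2 =>
        (g.char (Zb M.1 M.2)) • (rho α w (Dbas M.1 M.2) F : PS)) (Γs g F)) ∧
    -- intertwining of `Δ⁺` and `Δ`
    (∀ (n : N2) (τ : T), {m : N2 | Jmap α w (m + n) τ ≠ 0}.Finite ∧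
      Δp (Jmap α w n τ) = (Jmap α w n).lTensor (Tplus α w) (Δ τ) +
        ∑ᶠ m : N2, Jmap α w (m + n) τ ⊗ₜ[ℝ] ((fact2 m : ℝ)⁻¹ • Zb (0 : TiltIdx α w →₀ ℕ) m)) ∧
    (∀ i : Fin 2, Δp (Zb 0 (unitVec i)) =
      Zb 0 (unitVec i) ⊗ₜ[ℝ] 1 + 1 ⊗ₜ[ℝ] Zb 0 (unitVec i)) := by
  have : Pos α w := ⟨hα, hw⟩
  refine ⟨toDual_bijective, fun g => GamSE g.char, fun g => GamE g.char, grpGs α w, grpG α w,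
    extends_GamS, fun g => isDual_GamS g.char,
    fun g Ψs Ψ hd he => Extends.unique hd (isDual_GamS g.char) he (extends_GamS g), ?_, ?_,
    fun g k F hF => GamS_prod g.char F hF, grpGs_eq_closure, (range_char GamSE).symm,
    GamSE_char_injective, fun g g' => ?_, isFormalSum_expTerm, (range_char GamE).symm,
    isRegularityStructure_weights, isRegularityStructure_integers, L_toSubmodule,
    linearIndependent_gen, isHopf_envelope, triL, isPreLieProduct_triL, fun _ => triL_unique,
    lie_eq_triL, triL_lie, lie_inl_inr_apply, graft, isGraft_graft, fun _ => graft_unique, graft_comm, Dbas,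
    isBasisFamily_Dbas, linearIndependent_Dbas, span_Dbas, BU, fun J m => ?_, fun J m J' m' h => ?_,
    nondegenerate_BU, DeltaP α w, epsP α w, Santi α w, isHopf_Tplus, BU_mul_apply, BU_apply_one,
    formTensor_DeltaP, fun Z => (BU_one Z).symm, BU_Santi, DeltaT α w, isLeftComodule, toDual_rho,
    char_bijective, fun g => rfl, GammaOf_epsP, GammaOf_conv isLeftComodule, GammaOf_antipode,
    fun g => isFormalSum_Dbas g.char, DeltaP_Jmap, DeltaP_Zb_unitVec⟩
  · intro g a p v _ hv P hP
    have h := hasValue_gpull_tilt hv P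
    rwa [← GamS_coe g hP] at h
  · intro g hg a p hp P hP
    have h := hasValue_gpull_shift hg a hp P
    rwa [← GamS_coe g hP] at h
  · refine ⟨paramOf (conv (DeltaP α w) g.char g'.char), ?_, h_conv g g',
      fun n => ⟨⟨g'.etilt n, etilt_mem g' n⟩, rfl, etilt_conv g g' n⟩⟩
    exact (congrArg GamSE (char_paramOf _)).trans (GamSE_conv _ _)
  · rw [BU_Dbas_Zb, if_pos ⟨rfl, rfl⟩]
  · rw [BU_Dbas_Zb, if_neg fun h' => h (Prod.ext h'.1 h'.2)]
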